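/- Let $F$ be a number field with ring of integers $\mathfrak o$ and different ideal $\mathfrak d$. For a finite place $v$ with prime ideal $\mathfrak p_v$, put $N_v=N(\mathfrak p_v)$, let $\varpi_v$ be a uniformizer of $F_v$, and let $d^\times y$ be the Haar measure on $F_v^\times$ with $\mathrm{vol}(\mathfrak o_v^\times)=1$. Let $\psi_v$ be an additive character of $F_v$ whose largest fractional ideal of triviality is the local inverse different, as is the case for the standard character. Let $\pi_0=(\pi_{0,v})_v$ and $\pi=(\pi_v)_v$ be families, indexed by the finite places $v$ of $F$, of generic irreducible smooth unitary representations of $\mathrm{PGL}_2(F_v)$, realised in their Whittaker models $\mathcal W(\pi_{0,v},\psi_v)$ and $\mathcal W(\pi_v,\psi_v)$, with $\pi_{0,v}$ unramified for all $v$. (For example, $\pi_0$ may come from a cuspidal automorphic representation of $\mathrm{PGL}_2(\mathbb A_F)$ that is unramified everywhere, and $\pi$ from any generic unitary automorphic representation.) Let $\mathfrak q=\prod_v\mathfrak p_v^{r_v}$ be a non-zero integral ideal coprime to $\mathfrak d$. For $v\mid\mathfrak q$ let $W_{0,v}\in\mathcal W(\pi_{0,v},\psi_v)$ be the spherical vector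 with $W_{0,v}(1)=1$, let $x_v=\mathrm{diag}(\varpi_v^{-r_v},1)$, and for $\Phi\in\mathcal S(F_v^2)$ put $$f_{\Phi,s}(g)=|\det g|^s\int_{F_v^\times}\Phi\big(t\,(0\ 1)\,g\big)|t|^{2s}\,d^\times t .$$ Let $f_{s,v}=f_{\Phi_v,s}$ with $\Phi_v(x_1,x_2)=\mathbf 1_{\mathfrak o_v}(x_1)\mathbf 1_{\mathfrak o_v^\times}(x_2)$. For functions $f,W,W'$ put $$\Psi_v(f,W,\overline{W'})=\int_{F_v^\times}\int_{K_v} (W\,\overline{W'}\,f)\Big(\begin{pmatrix}y&\\&1\end{pmatrix}k\Big)\,dk\,\frac{d^\times y}{|y|},$$ where $K_v$ is the maximal compact subgroup $\mathrm{PGL}_2(\mathfrak o_v)$ with its Haar probability measure. Let $L_v(s,\sigma\otimes\tilde\tau)=P(N_v^{-s})^{-1}$, with $P$ a polynomial and $P(0)=1$, be the Rankin--Selberg factor, that is, the generator of the fractional $\mathbb C[N_v^{s},N_v^{-s}]$-ideal spanned by all $\Psi_v(f_{\Phi,s},W,\overline{W'})$ with $\Phi\in\mathcal S(F_v^2)$,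 $W\in\mathcal W(\sigma,\psi_v)$, $W'\in\mathcal W(\tau,\psi_v)$. Put $\zeta_v(s)=(1-N_v^{-s})^{-1}$, $\zeta_{\mathfrak q}=\prod_{v\mid\mathfrak q}\zeta_v$, let $\mathcal B(\pi_v)$ be an orthonormal basis of $\mathcal W(\pi_v,\psi_v)$ for $$\langle W,W'\rangle=\frac{\zeta_v(2)}{L_v(1,\pi_v\otimes\tilde\pi_v)}\int_{F_v^\times}W\begin{pmatrix}y&\\&1\end{pmatrix}\overline{W'}\begin{pmatrix}y&\\&1\end{pmatrix}d^\times y ,$$ and define the spectral weight $$J_{\mathfrak q}(\pi)=N(\mathfrak q)\frac{\zeta_{\mathfrak q}(1)^3}{\zeta_{\mathfrak q}(2)}\prod_{v\mid\mathfrak q}\ \sum_{W\in\mathcal B(\pi_v)}\left|\frac{\Psi_v(f_{s,v}(\cdot\,x_v),W_{0,v},\overline W)}{L_v(s,\pi_{0,v}\otimes\tilde\pi_v)}\right|^2_{s=1/2}\in[0,\infty],$$ where the quotient, defined for $\mathrm{Re}\,s$ large, is evaluated at $s=1/2$ by analytic continuation (it is entire in $s$). Then for every $0<\varepsilon<1$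 there is a constant $c>0$, depending only on $F$ and $\varepsilon$, such that $$J_{\mathfrak q}(\pi)\ \ge\ c\,(1-\varepsilon)^{\omega_F(\mathfrak q)}$$ for all such $\psi$, $\pi_0$ and $\mathfrak q$, and all such $\pi$ whose conductor ideal divides $\mathfrak q$ (that is, the conductor exponent of $\pi_v$ is at most $r_v$ for every finite $v$). Here $\omega_F(\mathfrak q)$ is the number of distinct prime ideals dividing $\mathfrak q$. -/

import Mathlib

open IsDedekindDomain NumberField MeasureTheory Filter Polynomial
open scoped Matrix WithZero ENNReal

noncomputable section

namespace SpectralWeight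

variable {F : Type*} [Field F] [NumberField F]

/-! ### The local field at a finite place, and its Haar measures -/

section LocalField

variable (v : HeightOneSpectrum (𝓞 F))

/-- The absolute norm `N(𝔭_v)` of the prime ideal attached to `v`. -/
def residueCard : ℕ := Ideal.absNorm v.asIdeal

/-- The group `GL₂(F_v)`. Functions on `PGL₂(F_v)` are treated as functions on this group that
are invariant under the centre. -/
abbrev LocalGL : Type _ := GL (Fin 2) (v.adicCompletion F)

/-- The group `GL₂(𝔬_v)`. -/
abbrev IntegralGL : Type _ := GL (Fin 2) (v.adicCompletionIntegers F)

/-- The inclusion of `GL₂(𝔬_v)` into `GL₂(F_v)`. -/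
def integralIncl : IntegralGL v →* LocalGL v :=
  Matrix.GeneralLinearGroup.map (v.adicCompletionIntegers F).subtype

theorem finite_residueField :
    Finite (IsLocalRing.ResidueField (v.adicCompletionIntegers F)) := by
  have hfin : Finite (𝓞 F ⧸ v.asIdeal) := v.asIdeal.finiteQuotientOfFreeOfNeBot v.ne_bot
  let φ : 𝓞 F →+* IsLocalRing.ResidueField (v.adicCompletionIntegers F) :=
    (IsLocalRing.residue _).comp (algebraMap (𝓞 F) (v.adicCompletionIntegers F))
  have hlt : ∀ x : v.adicCompletionIntegers F, Valued.v (x : v.adicCompletion F) < 1 →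
      IsLocalRing.residue _ x = 0 := fun x hx =>
    (IsLocalRing.residue_eq_zero_iff x).2
      ((Valuation.mem_maximalIdeal_iff (v := (Valued.v : Valuation (v.adicCompletion F) _)) (a := x)).2 hx)
  have hker : ∀ a ∈ v.asIdeal, φ a = 0 := by
    intro a ha
    refine hlt _ ?_
    rw [HeightOneSpectrum.algebraMap_adicCompletionIntegers_apply,
      HeightOneSpectrum.valuedAdicCompletion_eq_valuation']
    exact (v.valuation_lt_one_iff_mem a).2 ha
  refine Finite.of_surjective (Ideal.Quotient.lift v.asIdeal φ hker)
    (Ideal.Quotient.lift_surjective_of_surjective _ _ ?_)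
  intro y
  obtain ⟨x, rfl⟩ := IsLocalRing.residue_surjective y
  have hopen : IsOpen {z : v.adicCompletion F | Valued.v (z - x) < 1} := by
    have h1 : IsOpen {z : v.adicCompletion F | Valued.v z < 1} := by
      simpa [Valuation.restrict_lt_one_iff] using Valued.isOpen_ball (v.adicCompletion F) 1
    exact h1.preimage (continuous_id.sub continuous_const)
  obtain ⟨k, hk⟩ := (HeightOneSpectrum.denseRange_algebraMap (R := 𝓞 F) (K := F) v).exists_mem_open hopen
    ⟨x, by simp⟩
  have hk' : Valued.v ((k : v.adicCompletion F) - x) < 1 := hk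
  have hkle : v.valuation F k ≤ 1 := by
    rw [← HeightOneSpectrum.valuedAdicCompletion_eq_valuation']
    have := Valued.v.map_add ((k : v.adicCompletion F) - x) x
    rw [sub_add_cancel] at this
    exact this.trans (max_le hk'.le x.2)
  obtain ⟨a, ha⟩ := v.exists_valuation_sub_lt_of_integer hkle 1
  refine ⟨a, ?_⟩
  change IsLocalRing.residue _ _ = _
  rw [← sub_eq_zero, ← map_sub]
  refine hlt _ ?_
  have e : ((algebraMap (𝓞 F) (v.adicCompletionIntegers F) a - x :
      v.adicCompletionIntegers F) : v.adicCompletion F) =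
      ((algebraMap (𝓞 F) F a - k : F) : v.adicCompletion F) + ((k : v.adicCompletion F) - x) := by
    have : ((algebraMap (𝓞 F) F a - k : F) : v.adicCompletion F) =
      (algebraMap (𝓞 F) F a : v.adicCompletion F) - (k : v.adicCompletion F) :=
      map_sub (algebraMap F (v.adicCompletion F)) _ _
    rw [this]
    simp
  rw [e]
  refine Valued.v.map_add_lt ?_ hk'
  rw [HeightOneSpectrum.valuedAdicCompletion_eq_valuation']
  simpa using ha

instance compactSpace_integers : CompactSpace (v.adicCompletionIntegers F) := by
  have := finite_residueField v
  refine (Valued.integer.compactSpace_iff_completeSpace_and_isDiscreteValuationRing_and_finite_residueField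
    (K := v.adicCompletion F)).2 ⟨?_, inferInstanceAs (IsDiscreteValuationRing (v.adicCompletionIntegers F)), this⟩
  exact (Valued.isClosed_integer _).completeSpace_coe

instance compactSpace_integralGL : CompactSpace (IntegralGL v) := by
  have : CompactSpace (Matrix (Fin 2) (Fin 2) (v.adicCompletionIntegers F)) :=
    inferInstanceAs (CompactSpace (Fin 2 → Fin 2 → v.adicCompletionIntegers F))
  have : T1Space (Matrix (Fin 2) (Fin 2) (v.adicCompletionIntegers F)) :=
    inferInstanceAs (T1Space (Fin 2 → Fin 2 → v.adicCompletionIntegers F))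
  infer_instance

/-- The unit group `𝔬_v^×` as a compact subset of `F_v^×` with non-empty interior. -/
def unitCompacts : TopologicalSpace.PositiveCompacts (v.adicCompletion F)ˣ where
  carrier := {u | Valued.v (u : v.adicCompletion F) = 1}
  isCompact' := by
    have hc : IsCompact (v.adicCompletionIntegers F : Set (v.adicCompletion F)) :=
      isCompact_iff_compactSpace.2 (compactSpace_integers v)
    have := Submonoid.units_isCompact (S := (v.adicCompletionIntegers F).toSubring.toSubmonoid) hc
    convert this using 1
    ext u
    exact (HeightOneSpectrum.adicCompletionIntegers.mem_units_iff_valued_eq_one ..).symm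
  interior_nonempty' := by
    have ho : IsOpen {u : (v.adicCompletion F)ˣ | Valued.v (u : v.adicCompletion F) = 1} := by
      simpa [Valuation.restrict_eq_one_iff] using
        (Valued.isOpen_sphere (v.adicCompletion F) one_ne_zero).preimage Units.continuous_val
    rw [ho.interior_eq]
    exact ⟨1, by simp⟩

/-- Integration over `F_v^×` against the Haar measure `d^×y` for which `𝔬_v^×` has volume `1`. -/
def integralUnits (H : (v.adicCompletion F)ˣ → ℂ) : ℂ :=
  letI : MeasurableSpace (v.adicCompletion F)ˣ := borel _
  haveI : BorelSpace (v.adicCompletion F)ˣ := ⟨rfl⟩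
  ∫ y, H y ∂(Measure.haarMeasure (unitCompacts v))

/-- Integration over the maximal compact subgroup against its Haar probability measure. -/
def integralCompact (H : LocalGL v → ℂ) : ℂ :=
  letI : MeasurableSpace (IntegralGL v) := borel _
  haveI : BorelSpace (IntegralGL v) := ⟨rfl⟩
  ∫ k, H (integralIncl v k) ∂(Measure.haarMeasure (⊤ : TopologicalSpace.PositiveCompacts _))

end LocalField

/-! ### Whittaker models of generic unitary representations -/

section Whittaker

variable {v : HeightOneSpectrum (𝓞 F)}

/-- The matrix `diag(y, 1)`. -/
def diagOne (y : (v.adicCompletion F)ˣ) : LocalGL v :=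
  Matrix.GeneralLinearGroup.mkOfDetNeZero !![(y : v.adicCompletion F), 0; 0, 1] (by simp)

/-- The right translate `h ↦ W (h g)`. -/
def rightTranslate (g : LocalGL v) (W : LocalGL v → ℂ) : LocalGL v → ℂ := fun h => W (h * g)

/-- The additive character `ψ` of `F_v` has conductor `𝔭_v^{-d}`: this is the largest fractional
ideal on which it is trivial. -/
def HasConductor (ψ : AddChar (v.adicCompletion F) Circle) (d : ℕ) : Prop :=
  (∀ x : v.adicCompletion F, Valued.v x ≤ WithZero.exp (d : ℤ) → ψ x = 1) ∧
    ∃ x : v.adicCompletion F, Valued.v x ≤ WithZero.exp ((d : ℤ) + 1) ∧ ψ x ≠ 1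

/-- `V` is the `ψ`-Whittaker model `𝒲(π, ψ)` of a generic irreducible smooth unitary
representation `π` of `PGL₂(F_v)`; the group acts on `V` by right translation. -/
structure IsUnitaryGeneric (ψ : AddChar (v.adicCompletion F) Circle)
    (V : Submodule ℂ (LocalGL v → ℂ)) : Prop where
  whittaker : ∀ W ∈ V, ∀ (x : v.adicCompletion F) (g : LocalGL v),
    W (Matrix.GeneralLinearGroup.upperRightHom x * g) = (ψ x : ℂ) * W g
  central : ∀ W ∈ V, ∀ (z : (v.adicCompletion F)ˣ) (g : LocalGL v),
    W (Matrix.GeneralLinearGroup.scalar (Fin 2) z * g) = W g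
  smooth : ∀ W ∈ V, ∃ U : Subgroup (LocalGL v), IsOpen (U : Set (LocalGL v)) ∧
    ∀ u ∈ U, rightTranslate u W = W
  stable : ∀ W ∈ V, ∀ g : LocalGL v, rightTranslate g W ∈ V
  nonzero : V ≠ ⊥
  irreducible : ∀ U : Submodule ℂ (LocalGL v → ℂ), U ≤ V →
    (∀ W ∈ U, ∀ g : LocalGL v, rightTranslate g W ∈ U) → U = ⊥ ∨ U = V
  unitary : ∃ B : V →ₗ⋆[ℂ] V →ₗ[ℂ] ℂ,
    (∀ W W' : V, B W' W = starRingEnd ℂ (B W W')) ∧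
    (∀ W : V, W ≠ 0 → 0 < (B W W).re) ∧
    (∀ (g : LocalGL v) (W W' : V),
      B ⟨rightTranslate g W, stable W W.2 g⟩ ⟨rightTranslate g W', stable W' W'.2 g⟩ = B W W')

/-- The function `W` is invariant under the Hecke congruence subgroup of level `𝔭_v^n` (for
`n = 0` this is the maximal compact subgroup). -/
def IsInvariantLevel (n : ℕ) (W : LocalGL v → ℂ) : Prop :=
  ∀ k : IntegralGL v, Valued.v (k 1 0 : v.adicCompletion F) ≤ WithZero.exp (-(n : ℤ)) →
    rightTranslate (integralIncl v k) W = W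

/-- The exponent of the conductor ideal `ℭ(π) = 𝔭_v^c` of the representation with Whittaker
model `V`: the least level at which there is a non-zero invariant vector. -/
def conductorExponent (V : Submodule ℂ (LocalGL v → ℂ)) : ℕ∞ :=
  ⨅ n ∈ {n : ℕ | ∃ W ∈ V, W ≠ 0 ∧ IsInvariantLevel n W}, (n : ℕ∞)

end Whittaker

/-! ### Local zeta integrals and Rankin–Selberg factors -/

section Zeta

variable {v : HeightOneSpectrum (𝓞 F)}

/-- Schwartz–Bruhat functions on `F_v²`. -/
def IsSchwartzBruhat (Φ : v.adicCompletion F × v.adicCompletion F → ℂ) : Prop :=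
  IsLocallyConstant Φ ∧ HasCompactSupport Φ

/-- The principal series vector
`f_{Φ,s}(g) = |det g|^s ∫_{F_v^×} Φ(t (0 1) g) |t|^{2s} d^×t`. -/
def principalVector (Φ : v.adicCompletion F × v.adicCompletion F → ℂ) (s : ℂ) (g : LocalGL v) :
    ℂ :=
  ((‖(g : Matrix (Fin 2) (Fin 2) (v.adicCompletion F)).det‖ : ℝ) : ℂ) ^ s *
    integralUnits v fun t =>
      Φ ((t : v.adicCompletion F) * g 1 0, (t : v.adicCompletion F) * g 1 1) *
        ((‖(t : v.adicCompletion F)‖ : ℝ) : ℂ) ^ (2 * s)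

/-- The local zeta integral `Ψ_v(f, W, W̄') = ∫_{N(F_v)\PGL₂(F_v)} W(g) \overline{W'(g)} f(g) dg`,
the invariant measure on the quotient being given by the Iwasawa decomposition. -/
def zetaIntegral (f W W' : LocalGL v → ℂ) : ℂ :=
  integralUnits v fun y =>
    (integralCompact v fun k =>
      W (diagOne y * k) * starRingEnd ℂ (W' (diagOne y * k)) * f (diagOne y * k)) /
      ((‖(y : v.adicCompletion F)‖ : ℝ) : ℂ)

/-- "For `s` of sufficiently large real part." -/
def farRight : Filter ℂ := comap Complex.re atTop

variable (v) in
/-- The function `s ↦ N(𝔭_v)^{ms} Q(N(𝔭_v)^{-s})`. -/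
def laurentIn (m : ℕ) (Q : ℂ[X]) (s : ℂ) : ℂ :=
  (residueCard v : ℂ) ^ (m * s) * Q.eval ((residueCard v : ℂ) ^ (-s))

/-- `L_v(s, π₁ ⊗ π̃₂) = P(N(𝔭_v)^{-s})⁻¹`, where `π₁`, `π₂` have Whittaker models `V₁`, `V₂`
(so that the complex conjugates of the functions in `V₂` form a Whittaker model of `π̃₂`):
the polynomial `P` has constant term `1`, and `P(N(𝔭_v)^{-s})⁻¹` generates the fractional ideal
of `ℂ[N(𝔭_v)^s, N(𝔭_v)^{-s}]` that is spanned by the local zeta integrals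
`Ψ_v(f_{Φ,s}, W₁, W̄₂)`. -/
def IsRankinSelbergPolynomial (V₁ V₂ : Submodule ℂ (LocalGL v → ℂ)) (P : ℂ[X]) : Prop :=
  P.coeff 0 = 1 ∧
  (∀ (Φ : v.adicCompletion F × v.adicCompletion F → ℂ), IsSchwartzBruhat Φ →
    ∀ W₁ ∈ V₁, ∀ W₂ ∈ V₂, ∃ (m : ℕ) (Q : ℂ[X]), ∀ᶠ s in farRight,
      zetaIntegral (principalVector Φ s) W₁ W₂ * P.eval ((residueCard v : ℂ) ^ (-s)) =
        laurentIn v m Q s) ∧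
  (∃ (n : ℕ) (Φ : Fin n → v.adicCompletion F × v.adicCompletion F → ℂ)
      (W₁ W₂ : Fin n → LocalGL v → ℂ) (m : Fin n → ℕ) (Q : Fin n → ℂ[X]),
    (∀ i, IsSchwartzBruhat (Φ i)) ∧ (∀ i, W₁ i ∈ V₁) ∧ (∀ i, W₂ i ∈ V₂) ∧
    ∀ᶠ s in farRight,
      ∑ i, laurentIn v (m i) (Q i) s * zetaIntegral (principalVector (Φ i) s) (W₁ i) (W₂ i) *
        P.eval ((residueCard v : ℂ) ^ (-s)) = 1)

open Classical in
/-- The local Rankin–Selberg factor `L_v(s, π₁ ⊗ π̃₂)`. -/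
def rankinSelbergL (V₁ V₂ : Submodule ℂ (LocalGL v → ℂ)) (s : ℂ) : ℂ :=
  if h : ∃ P, IsRankinSelbergPolynomial V₁ V₂ P then
    (h.choose.eval ((residueCard v : ℂ) ^ (-s)))⁻¹
  else 1

open Classical in
/-- The entire function `E(s)` with `Ψ(s) = L(s) E(s)` for `Re s` sufficiently large (unique by
the identity theorem), that is, the analytic continuation of the normalised zeta integral. -/
def entireQuotient (Ψ L : ℂ → ℂ) : ℂ → ℂ :=
  if h : ∃ E : ℂ → ℂ, Differentiable ℂ E ∧ ∀ᶠ s in farRight, Ψ s = L s * E s then h.choose else 0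

end Zeta

/-! ### The spectral weight -/

section Weight

variable {v : HeightOneSpectrum (𝓞 F)}

variable (v) in
/-- The Euler factor `ζ_v(s) = (1 - N(𝔭_v)^{-s})⁻¹` at real `s`, for `v` prime to the
different. -/
def eulerFactor (s : ℝ) : ℝ := (1 - (residueCard v : ℝ) ^ (-s))⁻¹

/-- The normalised inner product
`⟨W, W'⟩ = ζ_v(2) / L_v(1, π ⊗ π̃) ∫_{F_v^×} W(diag(y,1)) \overline{W'(diag(y,1))} d^×y` on the
Whittaker model `V` of `π`. -/
def whittakerInner (V : Submodule ℂ (LocalGL v → ℂ)) (W W' : LocalGL v → ℂ) : ℂ :=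
  (eulerFactor v 2 : ℂ) / rankinSelbergL V V 1 *
    integralUnits v fun y => W (diagOne y) * starRingEnd ℂ (W' (diagOne y))

open Classical in
/-- `B` is an orthonormal basis of `V` for the normalised inner product. -/
structure IsOrthonormalBasis (V : Submodule ℂ (LocalGL v → ℂ)) (B : Set (LocalGL v → ℂ)) :
    Prop where
  span_eq : Submodule.span ℂ B = V
  orthonormal : ∀ W ∈ B, ∀ W' ∈ B, whittakerInner V W W' = if W = W' then 1 else 0

/-- `W₀` is the spherical vector with `W₀(1) = 1` in the Whittaker model `V₀`. -/
def IsNormalizedSpherical (V₀ : Submodule ℂ (LocalGL v → ℂ)) (W₀ : LocalGL v → ℂ) : Prop :=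
  W₀ ∈ V₀ ∧ IsInvariantLevel 0 W₀ ∧ W₀ 1 = 1

open Classical in
variable (v) in
/-- The function `𝟏_{𝔬_v}(x₁) 𝟏_{𝔬_v^×}(x₂)`. -/
def testFunction (x : v.adicCompletion F × v.adicCompletion F) : ℂ :=
  if Valued.v x.1 ≤ 1 ∧ Valued.v x.2 = 1 then 1 else 0

/-- The translate `g ↦ f_{s,v}(g x_v)` of the principal series vector attached to the test
function, where `x_v = diag(ϖ^{-r}, 1)`. -/
def testVector (ϖ : (v.adicCompletion F)ˣ) (r : ℕ) (s : ℂ) : LocalGL v → ℂ :=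
  rightTranslate (diagOne (ϖ ^ r)⁻¹) (principalVector (testFunction v) s)

/-- The local weight
`J(f_{s,v}(· x_v), W₀, π) = |L_v(s, π̃ ⊗ π₀)|⁻² ∑_{W ∈ B} |Ψ_v(f_{s,v}(· x_v), W₀, W̄)|²` at
`s = 1/2`, each quotient `Ψ_v / L_v` being continued analytically from large `Re s`. Here `B` is
an orthonormal basis of the Whittaker model `V` of `π`, and `V₀` is that of `π₀`. -/
def localWeight (ϖ : (v.adicCompletion F)ˣ) (r : ℕ) (V₀ : Submodule ℂ (LocalGL v → ℂ))
    (W₀ : LocalGL v → ℂ) (V : Submodule ℂ (LocalGL v → ℂ)) (B : Set (LocalGL v → ℂ)) : ℝ≥0∞ :=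
  ∑' W : B, ‖entireQuotient (fun s => zetaIntegral (testVector ϖ r s) W₀ W)
    (rankinSelbergL V₀ V) (1 / 2)‖ₑ ^ 2

/-- The exponent of `v` in the factorisation of a non-zero ideal. -/
def idealExponent (v : HeightOneSpectrum (𝓞 F)) (𝔮 : Ideal (𝓞 F)) : ℕ := multiplicity v.asIdeal 𝔮

/-- `ω_F(𝔮)`, the number of prime ideals dividing a non-zero ideal `𝔮`. -/
def primeOmega (𝔮 : Ideal (𝓞 F)) : ℕ :=
  {v : HeightOneSpectrum (𝓞 F) | v.asIdeal ∣ 𝔮}.ncard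

/-- The spectral weight
`J_𝔮(π) = N(𝔮) ζ_𝔮(1)³ / ζ_𝔮(2) ∏_{v ∣ 𝔮} J(f_{1/2,v}(· x_v), W₀_v, π_v)`. -/
def spectralWeight (𝔮 : Ideal (𝓞 F))
    (ϖ : ∀ v : HeightOneSpectrum (𝓞 F), (v.adicCompletion F)ˣ)
    (π₀ : ∀ v : HeightOneSpectrum (𝓞 F), Submodule ℂ (LocalGL v → ℂ))
    (W₀ : ∀ v : HeightOneSpectrum (𝓞 F), LocalGL v → ℂ)
    (π : ∀ v : HeightOneSpectrum (𝓞 F), Submodule ℂ (LocalGL v → ℂ))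
    (B : ∀ v : HeightOneSpectrum (𝓞 F), Set (LocalGL v → ℂ)) : ℝ≥0∞ :=
  ENNReal.ofReal ((Ideal.absNorm 𝔮 : ℝ) *
      ((∏ᶠ v ∈ {v : HeightOneSpectrum (𝓞 F) | v.asIdeal ∣ 𝔮}, eulerFactor v 1) ^ 3 /
        ∏ᶠ v ∈ {v : HeightOneSpectrum (𝓞 F) | v.asIdeal ∣ 𝔮}, eulerFactor v 2)) *
    ∏ᶠ v ∈ {v : HeightOneSpectrum (𝓞 F) | v.asIdeal ∣ 𝔮},
      localWeight (ϖ v) (idealExponent v 𝔮) (π₀ v) (W₀ v) (π v) (B v)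

end Weight

end SpectralWeight

end

noncomputable section

namespace SpectralWeight

variable {F : Type*} [Field F] [NumberField F] {v : HeightOneSpectrum (𝓞 F)}

/-! ### Balls, uniformizers and residues -/

/-! The weight is a product over the primes dividing `𝔮`. With `q = residueCard v`, each local
factor is shown to be at least `(1 - q^(-1/2))^18`. This tends to `1`, so all primes of `F` outside
a finite set depending only on `F` and `ε` contribute at least `1 - ε`, and the exceptional ones are
absorbed in `c` (`exists_le_prod_of_tendsto_one`).

Fix `v ∣ 𝔮`; then `ψ_v` is trivial on `𝔬_v` and on no larger fractional ideal. The basis spans the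
Whittaker model algebraically, so Cauchy–Schwarz bounds the local weight below by `|ℓ(W)|² / ⟨W, W⟩`
for any single `W`, where `ℓ` is the normalised zeta functional at `s = 1/2`
(`sq_norm_le_localWeight`). A good `W` is one of level `𝔭^r` with `W 1 = 1` whose values on the
torus are known. Restricted to `GL₂(𝔬_v)` the test vector is `q^(rs)` times the indicator of the
Hecke congruence subgroup of level `𝔭^r`, so the zeta integral is `q^(rs)` times the volume of that
subgroup times a Mellin transform on the torus (`zetaIntegral_levelTest`).

The Rankin–Selberg factors are never computed exactly. Write `X = q^(-s)` and let the Mellin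
transform be `N(qX) / M(X)`. Integrality of this one zeta integral gives `M ∣ P · N(qX)`. Conversely
`(1 - X²) M` clears the denominators of all zeta integrals, where `1 - X²` comes from the Tate
integral defining `f_{Φ,s}`; hence `P ∣ (1 - X²) M`. So `P · N(qX) = M · G` with `G ∣ (1 - X²)²`
(`exists_dvd_sq`): the normalised zeta integral is explicit up to at most four factors `1 ± X`.
These have absolute value at least `1 - q^(-1/2)` at `s = 1/2`, and at most `1 + q⁻¹` at `s = 1`,
where the same argument for `π × π̃` bounds `⟨W, W⟩` above.

The values on the torus are found in three cases. With a spherical vector, the Hecke operator acts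
by a scalar and gives a quadratic recurrence with roots `α`, `β`, `αβ = q⁻¹` (`exists_satake`). With
a vector of level `𝔭` but no spherical one, an Atkin–Lehner eigenvector gives a recurrence of order
one (`exists_satake_of_level_one`). With no vector of level `𝔭`, there is a vector of level `𝔭^r`
whose restriction to the torus is the indicator of the units (`exists_newvector`), and the zeta
integrals against `π₀` have no poles coming from the torus.

In the last case the factor of `π × π̃` can still have poles, and the asymptotics of all Whittaker
functions near `0` are needed. The Jacquet module has a torus-equivariant functional, which embeds
the representation in a principal series; an argument on the big cell produces at most two exponents
with product `q⁻¹` (`IsUnitaryGeneric.exists_exponents`). Square integrability on the torus removes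
exponents that are too large (`mem_zeroGerm`), and this bounds the polynomial at `q⁻¹`. -/

theorem one_lt_residueCard : 1 < residueCard v := HeightOneSpectrum.one_lt_absNorm v

theorem residueCard_pos : (0 : ℝ) < residueCard v := by
  exact_mod_cast zero_lt_one.trans one_lt_residueCard

theorem norm_eq_zpow {x : v.adicCompletion F} {n : ℤ} (h : Valued.v x = WithZero.exp n) :
    ‖x‖ = (residueCard v : ℝ) ^ n := by
  rw [FinitePlace.norm_def, h, WithZeroMulInt.toNNReal_neg_apply _ (by simp), NNReal.coe_zpow]
  rfl

theorem norm_eq_one {x : v.adicCompletion F} (h : Valued.v x = 1) : ‖x‖ = 1 := by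
  simpa using norm_eq_zpow (n := 0) (by simpa using h)

variable (v) in
/-- The fractional ideal `𝔭_v^n`. -/
def ball (n : ℤ) : AddSubgroup (v.adicCompletion F) where
  carrier := {x | Valued.v x ≤ WithZero.exp (-n)}
  zero_mem' := by simp
  add_mem' {a b} ha hb := (Valued.v.map_add a b).trans (max_le ha hb)
  neg_mem' {a} ha := by simpa [Valuation.map_neg] using ha

theorem mem_ball {n : ℤ} {x : v.adicCompletion F} :
    x ∈ ball v n ↔ Valued.v x ≤ WithZero.exp (-n) := Iff.rfl

theorem mem_ball_zero {x : v.adicCompletion F} : x ∈ ball v 0 ↔ Valued.v x ≤ 1 := by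
  simp [mem_ball]

theorem ball_mono {m n : ℤ} (h : m ≤ n) {x : v.adicCompletion F} (hx : x ∈ ball v n) :
    x ∈ ball v m :=
  (mem_ball.1 hx).trans (WithZero.exp_le_exp.2 (neg_le_neg h))

theorem mul_mem_ball {m n : ℤ} {x y : v.adicCompletion F} (hx : x ∈ ball v m)
    (hy : y ∈ ball v n) : x * y ∈ ball v (m + n) := by
  rw [mem_ball] at *
  rw [map_mul, neg_add, WithZero.exp_add]
  exact mul_le_mul' hx hy

theorem one_mem_ball : (1 : v.adicCompletion F) ∈ ball v 0 := by simp [mem_ball]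

theorem mem_ball_one {x : v.adicCompletion F} : x ∈ ball v 1 ↔ Valued.v x < 1 := by
  rw [mem_ball]
  by_cases h : x = 0
  · simp [h]
  · obtain ⟨n, hn⟩ : ∃ n : ℤ, Valued.v x = WithZero.exp n :=
      ⟨_, (WithZero.exp_log ((Valuation.ne_zero_iff _).2 h)).symm⟩
    rw [hn, ← WithZero.exp_zero, WithZero.exp_lt_exp, WithZero.exp_le_exp]
    omega

theorem val_eq_one_or_mem {x : v.adicCompletion F} (hx : x ∈ ball v 0) :
    Valued.v x = 1 ∨ x ∈ ball v 1 := by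
  rw [mem_ball_one]
  exact (mem_ball_zero.1 hx).eq_or_lt

theorem exists_val_eq_exp {x : v.adicCompletion F} (hx : x ≠ 0) :
    ∃ n : ℤ, Valued.v x = WithZero.exp n :=
  ⟨_, (WithZero.exp_log ((Valuation.ne_zero_iff _).2 hx)).symm⟩

theorem exists_mem_ball (x : v.adicCompletion F) : ∃ n : ℕ, x ∈ ball v (-n) := by
  by_cases hx : x = 0
  · exact ⟨0, by simp [hx, (ball v _).zero_mem]⟩
  · obtain ⟨n, hn⟩ := exists_val_eq_exp hx
    refine ⟨n.toNat, ?_⟩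
    rw [mem_ball, hn, WithZero.exp_le_exp]
    omega

theorem val_add_eq_one {x y : v.adicCompletion F} (hx : Valued.v x = 1) (hy : y ∈ ball v 1) :
    Valued.v (x + y) = 1 := by
  rw [Valuation.map_add_eq_of_lt_left _ (by rw [hx]; exact mem_ball_one.1 hy), hx]

theorem unit_mul_mem_ball {n : ℤ} {u x : v.adicCompletion F} (hu : Valued.v u = 1) :
    u * x ∈ ball v n ↔ x ∈ ball v n := by simp [mem_ball, hu]

theorem isOpen_ball (n : ℤ) : IsOpen (ball v n : Set (v.adicCompletion F)) := by
  obtain ⟨r, hr⟩ := HeightOneSpectrum.valuedAdicCompletion_surjective F v (WithZero.exp (-n))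
  have hr0 : r ≠ 0 := by
    rintro rfl
    rw [map_zero] at hr
    exact WithZero.exp_ne_zero hr.symm
  convert Valued.isOpen_closedBall (v.adicCompletion F) (r := Valued.v.restrict r)
    (by simpa using hr0) using 1
  ext x
  simp only [SetLike.mem_coe, mem_ball, Set.mem_ofPred_eq, Valuation.restrict_le_iff, hr]

theorem exists_ball_subset {s : Set (v.adicCompletion F)} (hs : s ∈ nhds 0) :
    ∃ n : ℕ, ∀ x ∈ ball v n, x ∈ s := by
  rw [Metric.mem_nhds_iff] at hs
  obtain ⟨ε, hε, h⟩ := hs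
  have hq : (1 : ℝ) < residueCard v := by exact_mod_cast one_lt_residueCard
  obtain ⟨n, hn⟩ := exists_pow_lt_of_lt_one hε (inv_lt_one_of_one_lt₀ hq)
  refine ⟨n, fun x hx => h ?_⟩
  rw [mem_ball_zero_iff]
  refine lt_of_le_of_lt ?_ hn
  by_cases h0 : x = 0
  · simp [h0]
  · obtain ⟨m, hm⟩ := exists_val_eq_exp h0
    rw [mem_ball, hm, WithZero.exp_le_exp] at hx
    rw [norm_eq_zpow hm, inv_pow, ← zpow_natCast, ← zpow_neg]
    exact zpow_le_zpow_right₀ hq.le hx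

/-- Representatives in `𝓞 F` of the finite ring `𝓞 F ⧸ 𝔭^j` serve: two elements of `𝓞 F` are
congruent modulo `𝔭_v^j` exactly when they are congruent modulo `𝔭^j`, and density of `F` together
with integral approximation gives completeness. -/
theorem exists_residues (j : ℕ) : ∃ S : Finset (v.adicCompletion F),
    S.card = residueCard v ^ j ∧ (∀ s ∈ S, s ∈ ball v 0) ∧
    (∀ x ∈ ball v 0, ∃ s ∈ S, x - s ∈ ball v j) ∧
    ∀ s ∈ S, ∀ t ∈ S, s - t ∈ ball v j → s = t := by
  classical
  have hfin : Finite (𝓞 F ⧸ v.asIdeal ^ j) :=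
    (v.asIdeal ^ j).finiteQuotientOfFreeOfNeBot (pow_ne_zero _ v.ne_bot)
  have := Fintype.ofFinite (𝓞 F ⧸ v.asIdeal ^ j)
  have key : ∀ a b : 𝓞 F, (algebraMap F (v.adicCompletion F) (algebraMap (𝓞 F) F a)) -
      algebraMap F (v.adicCompletion F) (algebraMap (𝓞 F) F b) ∈ ball v j ↔
      a - b ∈ v.asIdeal ^ j := by
    intro a b
    rw [← map_sub, ← map_sub, mem_ball]
    have := HeightOneSpectrum.valuedAdicCompletion_eq_valuation' v (algebraMap (𝓞 F) F (a - b))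
    rw [← HeightOneSpectrum.intValuation_le_pow_iff_mem, ← v.valuation_of_algebraMap (K := F),
      ← this]
    rfl
  let f : (𝓞 F ⧸ v.asIdeal ^ j) → v.adicCompletion F := fun c =>
    algebraMap F (v.adicCompletion F) (algebraMap (𝓞 F) F c.out)
  have hf : ∀ c d, f c - f d ∈ ball v j → c = d := by
    intro c d h
    rw [key] at h
    rw [← Ideal.Quotient.mk_out c, ← Ideal.Quotient.mk_out d]
    exact (Ideal.Quotient.mk_eq_mk_iff_sub_mem _ _).2 h
  have hinj : Function.Injective f := fun c d h => hf c d (by rw [h, sub_self]; exact zero_mem _)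
  refine ⟨Finset.univ.image f, ?_, ?_, ?_, ?_⟩
  · rw [Finset.card_image_of_injective _ hinj, Finset.card_univ, residueCard, ← map_pow,
      Ideal.absNorm_apply, Submodule.cardQuot_apply, Nat.card_eq_fintype_card]
  · simp only [Finset.mem_image, Finset.mem_univ, true_and, forall_exists_index,
      forall_apply_eq_imp_iff]
    intro c
    rw [mem_ball_zero]
    have := HeightOneSpectrum.valuedAdicCompletion_eq_valuation' v (algebraMap (𝓞 F) F c.out)
    exact this.le.trans (v.valuation_le_one _)
  · intro x hx
    have hopen : IsOpen {z : v.adicCompletion F | z - x ∈ ball v (j + 1)} :=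
      (isOpen_ball (j + 1)).preimage (continuous_id.sub continuous_const)
    obtain ⟨k, hk⟩ := (HeightOneSpectrum.denseRange_algebraMap (R := 𝓞 F) (K := F) v).exists_mem_open
      hopen ⟨x, by simp [(ball v _).zero_mem]⟩
    have hk' : algebraMap F (v.adicCompletion F) k - x ∈ ball v (j + 1) := hk
    have hkle : v.valuation F k ≤ 1 := by
      rw [← HeightOneSpectrum.valuedAdicCompletion_eq_valuation', ← mem_ball_zero]
      have := (ball v 0).add_mem (ball_mono (by omega) hk') hx
      rwa [sub_add_cancel] at this
    obtain ⟨a, ha⟩ := v.exists_valuation_sub_lt_of_integer hkle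
      (Units.mk0 (WithZero.exp (-(j : ℤ))) (by simp))
    refine ⟨f (Ideal.Quotient.mk _ a), by simp, ?_⟩
    have h1 : algebraMap F (v.adicCompletion F) (algebraMap (𝓞 F) F a) -
        algebraMap F (v.adicCompletion F) k ∈ ball v j := by
      rw [← map_sub, mem_ball]
      have := HeightOneSpectrum.valuedAdicCompletion_eq_valuation' v (algebraMap (𝓞 F) F a - k)
      exact this.le.trans ha.le
    have h2 : f (Ideal.Quotient.mk _ a) - algebraMap F (v.adicCompletion F) (algebraMap (𝓞 F) F a)
        ∈ ball v j := by
      rw [key, ← Ideal.Quotient.mk_eq_mk_iff_sub_mem]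
      exact Ideal.Quotient.mk_out _
    have h3 := (ball v j).add_mem (ball_mono (by omega) hk') ((ball v j).add_mem h1 h2)
    have := (ball v j).neg_mem h3
    convert this using 1
    ring
  · simp only [Finset.mem_image, Finset.mem_univ, true_and, forall_exists_index,
      forall_apply_eq_imp_iff]
    intro c d h
    rw [hf c d h]

theorem exists_zpow_mul_unit {ϖ : (v.adicCompletion F)ˣ}
    (hϖ : Valued.v (ϖ : v.adicCompletion F) = WithZero.exp (-1 : ℤ)) (y : (v.adicCompletion F)ˣ) :
    ∃ (n : ℤ) (u : (v.adicCompletion F)ˣ), Valued.v (u : v.adicCompletion F) = 1 ∧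
      y = ϖ ^ n * u := by
  obtain ⟨n, hn⟩ := exists_val_eq_exp y.ne_zero
  refine ⟨-n, ϖ ^ n * y, ?_, by simp⟩
  rw [Units.val_mul, map_mul, hn, Units.val_zpow_eq_zpow_val, map_zpow₀, hϖ, ← WithZero.exp_zsmul,
    ← WithZero.exp_add]
  simp

theorem val_zpow {ϖ : (v.adicCompletion F)ˣ}
    (hϖ : Valued.v (ϖ : v.adicCompletion F) = WithZero.exp (-1 : ℤ)) (n : ℤ) :
    Valued.v ((ϖ ^ n : (v.adicCompletion F)ˣ) : v.adicCompletion F) = WithZero.exp (-n) := by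
  rw [Units.val_zpow_eq_zpow_val, map_zpow₀, hϖ, ← WithZero.exp_zsmul]
  simp

theorem zpow_mem_ball {ϖ : (v.adicCompletion F)ˣ}
    (hϖ : Valued.v (ϖ : v.adicCompletion F) = WithZero.exp (-1 : ℤ)) (n : ℤ) :
    ((ϖ ^ n : (v.adicCompletion F)ˣ) : v.adicCompletion F) ∈ ball v n := (val_zpow hϖ n).le

theorem zpow_mul_mem_ball {ϖ : (v.adicCompletion F)ˣ}
    (hϖ : Valued.v (ϖ : v.adicCompletion F) = WithZero.exp (-1 : ℤ)) (m n : ℤ)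
    {x : v.adicCompletion F} :
    ((ϖ ^ n : (v.adicCompletion F)ˣ) : v.adicCompletion F) * x ∈ ball v (n + m) ↔ x ∈ ball v m := by
  refine ⟨fun h => ?_, fun h => mul_mem_ball (zpow_mem_ball hϖ n) h⟩
  have := mul_mem_ball (zpow_mem_ball hϖ (-n)) h
  rwa [← mul_assoc, ← Units.val_mul, ← zpow_add, neg_add_cancel, zpow_zero, Units.val_one, one_mul,
    neg_add_cancel_left] at this

/-! ### Matrices in `GL₂(F_v)` -/

/-- The upper triangular unipotent matrix `(1 x; 0 1)`. -/
abbrev upper (x : v.adicCompletion F) : LocalGL v := Matrix.GeneralLinearGroup.upperRightHom x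

/-- The lower triangular unipotent matrix `(1 0; x 1)`. -/
def lower (x : v.adicCompletion F) : LocalGL v :=
  ⟨!![1, 0; x, 1], !![1, 0; -x, 1], by simp [Matrix.one_fin_two], by simp [Matrix.one_fin_two]⟩

variable (v) in
/-- The Weyl element `(0 1; 1 0)`. -/
def weyl : LocalGL v :=
  ⟨!![0, 1; 1, 0], !![0, 1; 1, 0], by simp [Matrix.one_fin_two], by simp [Matrix.one_fin_two]⟩

/-- The scalar matrix with entry `z`. -/
abbrev centre (z : (v.adicCompletion F)ˣ) : LocalGL v :=
  Matrix.GeneralLinearGroup.scalar (Fin 2) z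

theorem coe_upper (x : v.adicCompletion F) :
    ((upper x : LocalGL v) : Matrix (Fin 2) (Fin 2) (v.adicCompletion F)) = !![1, x; 0, 1] := rfl

theorem coe_lower (x : v.adicCompletion F) :
    ((lower x : LocalGL v) : Matrix (Fin 2) (Fin 2) (v.adicCompletion F)) = !![1, 0; x, 1] := rfl

theorem coe_weyl :
    ((weyl v : LocalGL v) : Matrix (Fin 2) (Fin 2) (v.adicCompletion F)) = !![0, 1; 1, 0] := rfl

theorem coe_diagOne (y : (v.adicCompletion F)ˣ) :
    ((diagOne y : LocalGL v) : Matrix (Fin 2) (Fin 2) (v.adicCompletion F)) =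
      !![(y : v.adicCompletion F), 0; 0, 1] := rfl

theorem coe_centre (z : (v.adicCompletion F)ˣ) :
    ((centre z : LocalGL v) : Matrix (Fin 2) (Fin 2) (v.adicCompletion F)) =
      !![(z : v.adicCompletion F), 0; 0, (z : v.adicCompletion F)] := by
  rw [Matrix.GeneralLinearGroup.coe_scalar]
  refine Matrix.ext fun i j => ?_
  fin_cases i <;> fin_cases j <;> simp

theorem LocalGL.ext' {g h : LocalGL v}
    (H : (g : Matrix (Fin 2) (Fin 2) (v.adicCompletion F)) = h) : g = h := Units.ext H

theorem det_eq (g : LocalGL v) : ((Matrix.GeneralLinearGroup.det g : (v.adicCompletion F)ˣ) :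
    v.adicCompletion F) = g 0 0 * g 1 1 - g 0 1 * g 1 0 := Matrix.det_fin_two _

theorem diagOne_mul (x y : (v.adicCompletion F)ˣ) :
    (diagOne (x * y) : LocalGL v) = diagOne x * diagOne y :=
  LocalGL.ext' (by simp [coe_diagOne])

theorem diagOne_one : (diagOne 1 : LocalGL v) = 1 :=
  LocalGL.ext' (by simp [coe_diagOne, Matrix.one_fin_two])

theorem lower_add (x y : v.adicCompletion F) : lower (x + y) = lower x * lower y :=
  LocalGL.ext' (by simp [coe_lower])

theorem lower_zero : lower (0 : v.adicCompletion F) = 1 :=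
  LocalGL.ext' (by simp [coe_lower, Matrix.one_fin_two])

theorem upper_add (x y : v.adicCompletion F) : (upper (x + y) : LocalGL v) = upper x * upper y :=
  AddChar.map_add_eq_mul _ _ _

theorem upper_zero : (upper 0 : LocalGL v) = 1 := AddChar.map_zero_eq_one _

theorem diagOne_mul_upper (y : (v.adicCompletion F)ˣ) (x : v.adicCompletion F) :
    (diagOne y * upper x : LocalGL v) = upper ((y : v.adicCompletion F) * x) * diagOne y :=
  LocalGL.ext' (by simp [coe_diagOne, -Matrix.GeneralLinearGroup.upperRightHom_apply, coe_upper])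

theorem lower_mul_diagOne (y : (v.adicCompletion F)ˣ) (x : v.adicCompletion F) :
    (lower x * diagOne y : LocalGL v) = diagOne y * lower (x * (y : v.adicCompletion F)) :=
  LocalGL.ext' (by simp [coe_diagOne, coe_lower])

theorem centre_comm (z : (v.adicCompletion F)ˣ) (g : LocalGL v) :
    g * centre z = centre z * g := (Matrix.GeneralLinearGroup.scalar_commute _ _).symm

/-- With `eq_mul_weyl` this covers the whole group, since the bottom row is non-zero. On the left
stand unipotent, scalar and diagonal matrices, under which Whittaker functions and Jacquet
functionals behave explicitly, so only a lower unipotent or `w` times an upper unipotent remains to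
be studied. -/
theorem eq_mul_lower (g : LocalGL v) (d : (v.adicCompletion F)ˣ) (hd : (d : v.adicCompletion F) = g 1 1) :
    g = upper (g 0 1 / (d : v.adicCompletion F)) * (centre d *
      (diagOne (Matrix.GeneralLinearGroup.det g * (d ^ 2)⁻¹) * lower (g 1 0 / (d : v.adicCompletion F)))) := by
  have h0 : (d : v.adicCompletion F) ≠ 0 := d.ne_zero
  refine LocalGL.ext' ?_
  simp only [Units.val_mul, coe_upper, coe_lower, coe_diagOne, coe_centre, det_eq,
    Units.val_inv_eq_inv_val, Units.val_pow_eq_pow_val]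
  refine Matrix.ext fun i j => ?_
  fin_cases i <;> fin_cases j <;> simp [← hd] <;> field_simp
  ring

theorem eq_mul_weyl (g : LocalGL v) (c : (v.adicCompletion F)ˣ) (hc : (c : v.adicCompletion F) = g 1 0) :
    g = upper (g 0 0 / (c : v.adicCompletion F)) * (centre c *
      (diagOne (-(Matrix.GeneralLinearGroup.det g) * (c ^ 2)⁻¹) *
        (weyl v * upper (g 1 1 / (c : v.adicCompletion F))))) := by
  have h0 : (c : v.adicCompletion F) ≠ 0 := c.ne_zero
  refine LocalGL.ext' ?_
  simp only [Units.val_mul, coe_upper, coe_weyl, coe_diagOne, coe_centre, det_eq,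
    Units.val_inv_eq_inv_val, Units.val_pow_eq_pow_val, Units.val_neg]
  refine Matrix.ext fun i j => ?_
  fin_cases i <;> fin_cases j <;> simp [← hc] <;> field_simp
  ring

theorem continuous_diagOne : Continuous (diagOne : (v.adicCompletion F)ˣ → LocalGL v) := by
  rw [Units.continuous_iff]
  constructor
  · refine continuous_matrix fun i j => ?_
    fin_cases i <;> fin_cases j <;> simp [coe_diagOne, continuous_const, Units.continuous_val]
  · have : ∀ y : (v.adicCompletion F)ˣ, ((diagOne y : LocalGL v)⁻¹) = diagOne y⁻¹ := fun y =>
      inv_eq_of_mul_eq_one_left (by rw [← diagOne_mul, inv_mul_cancel, diagOne_one])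
    simp only [this]
    refine continuous_matrix fun i j => ?_
    fin_cases i <;> fin_cases j <;> simp [coe_diagOne, continuous_const]
    exact Units.continuous_val.inv₀ fun y => y.ne_zero

theorem continuous_lower : Continuous (lower : v.adicCompletion F → LocalGL v) := by
  rw [Units.continuous_iff]
  constructor
  · refine continuous_matrix fun i j => ?_
    fin_cases i <;> fin_cases j <;> simp [coe_lower, continuous_const, continuous_id']
  · have : ∀ y : v.adicCompletion F, ((lower y : LocalGL v)⁻¹) = lower (-y) := fun y =>
      inv_eq_of_mul_eq_one_left (by rw [← lower_add, neg_add_cancel, lower_zero])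
    simp only [this]
    refine continuous_matrix fun i j => ?_
    fin_cases i <;> fin_cases j <;> simp [coe_lower, continuous_const, continuous_neg]

theorem continuous_integralIncl : Continuous (integralIncl v) :=
  Continuous.generalLinearGroup_map continuous_subtype_val

theorem integralIncl_apply (k : IntegralGL v) (i j : Fin 2) :
    integralIncl v k i j = (k i j : v.adicCompletion F) := rfl

theorem coe_mem_ball (x : v.adicCompletionIntegers F) : (x : v.adicCompletion F) ∈ ball v 0 :=
  mem_ball_zero.2 x.2

theorem val_det_integralIncl (k : IntegralGL v) :
    Valued.v ((Matrix.GeneralLinearGroup.det (integralIncl v k) : (v.adicCompletion F)ˣ) :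
      v.adicCompletion F) = 1 := by
  have h : IsUnit ((Matrix.GeneralLinearGroup.det k : (v.adicCompletionIntegers F)ˣ) :
    v.adicCompletionIntegers F) := Units.isUnit _
  rw [HeightOneSpectrum.adicCompletionIntegers.isUnit_iff_valued_eq_one] at h
  rw [← h, det_eq]
  congr 1
  have := congrArg (Subtype.val) (Matrix.det_fin_two (k : Matrix (Fin 2) (Fin 2) (v.adicCompletionIntegers F)))
  exact this.symm

theorem exists_integralIncl_eq (g : LocalGL v) (hg : ∀ i j, g i j ∈ ball v 0)
    (hdet : Valued.v ((Matrix.GeneralLinearGroup.det g : (v.adicCompletion F)ˣ) :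
      v.adicCompletion F) = 1) : ∃ k : IntegralGL v, integralIncl v k = g := by
  let M : Matrix (Fin 2) (Fin 2) (v.adicCompletionIntegers F) :=
    fun i j => ⟨g i j, mem_ball_zero.1 (hg i j)⟩
  have hM : IsUnit M.det := by
    rw [HeightOneSpectrum.adicCompletionIntegers.isUnit_iff_valued_eq_one, ← hdet, det_eq,
      Matrix.det_fin_two]
    rfl
  exact ⟨Matrix.GeneralLinearGroup.mk'' M hM, LocalGL.ext' rfl⟩

/-! ### Whittaker functions on the torus -/

/-- The function `W` is a `ψ`-Whittaker function that is invariant under the centre. -/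
structure IsWhittakerFunction (ψ : AddChar (v.adicCompletion F) Circle) (W : LocalGL v → ℂ) :
    Prop where
  upper_mul : ∀ (x : v.adicCompletion F) (g : LocalGL v), W (upper x * g) = (ψ x : ℂ) * W g
  centre_mul : ∀ (z : (v.adicCompletion F)ˣ) (g : LocalGL v), W (centre z * g) = W g

theorem IsUnitaryGeneric.isWhittakerFunction {ψ : AddChar (v.adicCompletion F) Circle}
    {V : Submodule ℂ (LocalGL v → ℂ)} (hV : IsUnitaryGeneric ψ V) {W : LocalGL v → ℂ}
    (hW : W ∈ V) : IsWhittakerFunction ψ W := ⟨hV.whittaker W hW, hV.central W hW⟩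

theorem rightTranslate_mul (g h : LocalGL v) (W : LocalGL v → ℂ) :
    rightTranslate (g * h) W = rightTranslate g (rightTranslate h W) := by
  funext x
  simp [rightTranslate, mul_assoc]

theorem rightTranslate_one (W : LocalGL v → ℂ) : rightTranslate 1 W = W := by
  funext x
  simp [rightTranslate]

theorem rightTranslate_add (g : LocalGL v) (W W' : LocalGL v → ℂ) :
    rightTranslate g (W + W') = rightTranslate g W + rightTranslate g W' := rfl

theorem rightTranslate_smul (g : LocalGL v) (c : ℂ) (W : LocalGL v → ℂ) :
    rightTranslate g (c • W) = c • rightTranslate g W := rfl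

theorem rightTranslate_sum {ι : Type*} (g : LocalGL v) (s : Finset ι) (W : ι → LocalGL v → ℂ) :
    rightTranslate g (∑ i ∈ s, W i) = ∑ i ∈ s, rightTranslate g (W i) := by
  funext x
  simp [rightTranslate]

namespace IsWhittakerFunction

variable {ψ : AddChar (v.adicCompletion F) Circle} {W : LocalGL v → ℂ}

theorem translate (hW : IsWhittakerFunction ψ W) (g : LocalGL v) :
    IsWhittakerFunction ψ (rightTranslate g W) :=
  ⟨fun x h => by simp only [rightTranslate, mul_assoc, hW.upper_mul],
    fun z h => by simp only [rightTranslate, mul_assoc, hW.centre_mul]⟩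

theorem diagOne_upper_mul (hW : IsWhittakerFunction ψ W) (y : (v.adicCompletion F)ˣ)
    (x : v.adicCompletion F) (g : LocalGL v) :
    W (diagOne y * (upper x * g)) = (ψ ((y : v.adicCompletion F) * x) : ℂ) * W (diagOne y * g) := by
  rw [← mul_assoc, diagOne_mul_upper, mul_assoc, hW.upper_mul]

theorem diagOne_centre_mul (hW : IsWhittakerFunction ψ W) (y z : (v.adicCompletion F)ˣ)
    (g : LocalGL v) : W (diagOne y * (centre z * g)) = W (diagOne y * g) := by
  rw [← mul_assoc, centre_comm, mul_assoc, hW.centre_mul]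

theorem diagOne_mul_eq_lower (hW : IsWhittakerFunction ψ W) (y : (v.adicCompletion F)ˣ)
    (g : LocalGL v) (d : (v.adicCompletion F)ˣ) (hd : (d : v.adicCompletion F) = g 1 1) :
    W (diagOne y * g) = (ψ ((y : v.adicCompletion F) * (g 0 1 / (d : v.adicCompletion F))) : ℂ) *
      W (diagOne (y * (Matrix.GeneralLinearGroup.det g * (d ^ 2)⁻¹)) * lower (g 1 0 / (d : v.adicCompletion F))) := by
  conv_lhs => rw [eq_mul_lower g d hd]
  rw [hW.diagOne_upper_mul, hW.diagOne_centre_mul, ← mul_assoc, ← diagOne_mul]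

end IsWhittakerFunction

/-! ### Smoothness -/

theorem IsUnitaryGeneric.exists_isOpen_integral {ψ : AddChar (v.adicCompletion F) Circle}
    {V : Submodule ℂ (LocalGL v → ℂ)} (hV : IsUnitaryGeneric ψ V) {W : LocalGL v → ℂ}
    (hW : W ∈ V) : ∃ U : Subgroup (IntegralGL v), IsOpen (U : Set (IntegralGL v)) ∧
      ∀ u ∈ U, rightTranslate (integralIncl v u) W = W := by
  obtain ⟨U, hU, h⟩ := hV.smooth W hW
  exact ⟨U.comap (integralIncl v), hU.preimage continuous_integralIncl, fun u hu => h _ hu⟩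

theorem IsUnitaryGeneric.exists_level {ψ : AddChar (v.adicCompletion F) Circle}
    {V : Submodule ℂ (LocalGL v → ℂ)} (hV : IsUnitaryGeneric ψ V) {W : LocalGL v → ℂ}
    (hW : W ∈ V) : ∃ m : ℕ, 1 ≤ m ∧
      (∀ x ∈ ball v m, rightTranslate (upper x) W = W) ∧
      (∀ x ∈ ball v m, rightTranslate (lower x) W = W) ∧
      ∀ u : (v.adicCompletion F)ˣ, (u : v.adicCompletion F) - 1 ∈ ball v m →
        rightTranslate (diagOne u) W = W := by
  obtain ⟨U, hU, h⟩ := hV.smooth W hW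
  obtain ⟨m₁, h₁⟩ := exists_ball_subset (v := v) (s := upper ⁻¹' (U : Set (LocalGL v)))
    ((Matrix.GeneralLinearGroup.continuous_upperRightHom.continuousAt).preimage_mem_nhds
      (hU.mem_nhds (by rw [AddChar.map_zero_eq_one]; exact U.one_mem)))
  obtain ⟨m₂, h₂⟩ := exists_ball_subset (v := v) (s := lower ⁻¹' (U : Set (LocalGL v)))
    ((continuous_lower.continuousAt).preimage_mem_nhds
      (hU.mem_nhds (by rw [lower_zero]; exact U.one_mem)))
  have h3 : ∃ m : ℕ, ∀ u : (v.adicCompletion F)ˣ, (u : v.adicCompletion F) - 1 ∈ ball v m →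
      diagOne u ∈ U := by
    have hn : diagOne ⁻¹' (U : Set (LocalGL v)) ∈ nhds (1 : (v.adicCompletion F)ˣ) :=
      (continuous_diagOne.continuousAt).preimage_mem_nhds
        (hU.mem_nhds (by rw [diagOne_one]; exact U.one_mem))
    rw [Units.isEmbedding_val₀.nhds_eq_comap, Filter.mem_comap] at hn
    obtain ⟨t, ht, hs⟩ := hn
    have ht' : (fun x => x + 1) ⁻¹' t ∈ nhds (0 : v.adicCompletion F) :=
      (continuous_add_const 1).continuousAt.preimage_mem_nhds (by simpa using ht)
    obtain ⟨m, hm⟩ := exists_ball_subset ht'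
    refine ⟨m, fun u hu => hs ?_⟩
    have := hm _ hu
    simpa using this
  obtain ⟨m₃, h₃⟩ := h3
  refine ⟨m₁ + m₂ + m₃ + 1, by omega, fun x hx => h _ (h₁ x (ball_mono (by omega) hx)),
    fun x hx => h _ (h₂ x (ball_mono (by omega) hx)),
    fun u hu => h _ (h₃ u (ball_mono (by omega) hu))⟩

/-! ### Integration over the maximal compact subgroup -/

instance : MeasurableSpace (IntegralGL v) := borel _

instance : BorelSpace (IntegralGL v) := ⟨rfl⟩

variable (v) in
/-- The Haar probability measure on `GL₂(𝔬_v)`. -/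
def haarCompact : Measure (IntegralGL v) :=
  Measure.haarMeasure (⊤ : TopologicalSpace.PositiveCompacts _)

instance : IsProbabilityMeasure (haarCompact v) :=
  ⟨by simpa [haarCompact] using Measure.haarMeasure_self (K₀ := (⊤ : TopologicalSpace.PositiveCompacts (IntegralGL v)))⟩

instance : (haarCompact v).IsHaarMeasure := inferInstanceAs (Measure.haarMeasure _).IsHaarMeasure

theorem integralCompact_eq (H : LocalGL v → ℂ) :
    integralCompact v H = ∫ k, H (integralIncl v k) ∂(haarCompact v) := rfl

theorem integralCompact_mul_left (H : LocalGL v → ℂ) (k₀ : IntegralGL v) :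
    integralCompact v (fun g => H (integralIncl v k₀ * g)) = integralCompact v H := by
  simp only [integralCompact_eq, ← map_mul]
  exact integral_mul_left_eq_self (μ := haarCompact v) (fun k => H (integralIncl v k)) k₀

/-- Conjugation is an automorphism of a compact group and so preserves the Haar probability measure;
right invariance follows from left invariance. -/
theorem integralCompact_mul_right (H : LocalGL v → ℂ) (k₀ : IntegralGL v) :
    integralCompact v (fun g => H (g * integralIncl v k₀)) = integralCompact v H := by
  have hc : Continuous (MulAut.conj k₀⁻¹ : IntegralGL v →* IntegralGL v) := by
    change Continuous fun k => k₀⁻¹ * k * k₀⁻¹⁻¹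
    fun_prop
  have hp : MeasurePreserving (MulAut.conj k₀⁻¹ : IntegralGL v →* IntegralGL v) (haarCompact v)
      (haarCompact v) :=
    MonoidHom.measurePreserving hc (MulAut.conj k₀⁻¹).surjective rfl
  have he : MeasurableEmbedding (MulAut.conj k₀⁻¹ : IntegralGL v →* IntegralGL v) := by
    convert ((Homeomorph.mulLeft k₀⁻¹).trans (Homeomorph.mulRight k₀)).measurableEmbedding using 1
    funext k
    simp
  have h1 := hp.integral_comp he fun k => H (integralIncl v (k₀ * k))
  rw [← integralCompact_mul_left H k₀, integralCompact_eq, integralCompact_eq]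
  simp only [← map_mul]
  rw [← h1]
  refine integral_congr_ae (Eventually.of_forall fun k => ?_)
  simp [mul_assoc]

theorem isOpen_entry (i j : Fin 2) (n : ℤ) :
    IsOpen {k : IntegralGL v | (k i j : v.adicCompletion F) ∈ ball v n} := by
  refine (isOpen_ball n).preimage (continuous_subtype_val.comp ?_)
  exact Matrix.GeneralLinearGroup.continuous_apply _ continuous_id i |>.comp continuous_id |> fun h => (continuous_apply j).comp h

/-- The cosets of an open subgroup are finite in number and have equal mass, and the common mass is
found by integrating `1`. By smoothness every integral over `GL₂(𝔬_v)` met below is such a finite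
average, so no interchange of infinite integrals is needed. -/
theorem exists_average (U : Subgroup (IntegralGL v)) (hU : IsOpen (U : Set (IntegralGL v))) :
    ∃ (n : ℕ) (k : Fin n → IntegralGL v), 0 < n ∧ ∀ H : LocalGL v → ℂ,
      (∀ k₁, ∀ u ∈ U, H (integralIncl v (k₁ * u)) = H (integralIncl v k₁)) →
      integralCompact v H = (n : ℂ)⁻¹ * ∑ i, H (integralIncl v (k i)) := by
  have hfin : Finite (IntegralGL v ⧸ U) := U.quotient_finite_of_isOpen hU
  let e := (Finite.equivFin (IntegralGL v ⧸ U)).symm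
  let k : Fin (Nat.card (IntegralGL v ⧸ U)) → IntegralGL v := fun i => (e i).out
  have hmeas : ∀ i, MeasurableSet {g : IntegralGL v | (g : IntegralGL v ⧸ U) = e i} := by
    intro i
    have : {g : IntegralGL v | (g : IntegralGL v ⧸ U) = e i} =
        (fun g => (k i)⁻¹ * g) ⁻¹' (U : Set (IntegralGL v)) := by
      ext g
      simp only [Set.mem_ofPred_eq, Set.mem_preimage, SetLike.mem_coe, ← QuotientGroup.eq, k,
        QuotientGroup.out_eq']
      exact eq_comm
    rw [this]
    exact (hU.preimage (continuous_const_mul _)).measurableSet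
  have hm : ∀ i, (haarCompact v).real {g : IntegralGL v | (g : IntegralGL v ⧸ U) = e i} =
      (haarCompact v).real U := by
    intro i
    have : {g : IntegralGL v | (g : IntegralGL v ⧸ U) = e i} =
        (fun g => (k i)⁻¹ * g) ⁻¹' (U : Set (IntegralGL v)) := by
      ext g
      simp only [Set.mem_ofPred_eq, Set.mem_preimage, SetLike.mem_coe, ← QuotientGroup.eq, k,
        QuotientGroup.out_eq']
      exact eq_comm
    rw [this, measureReal_def, measure_preimage_mul, measureReal_def]
  have key : ∀ H : LocalGL v → ℂ,
      (∀ k₁, ∀ u ∈ U, H (integralIncl v (k₁ * u)) = H (integralIncl v k₁)) →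
      integralCompact v H = ((haarCompact v).real U : ℂ) * ∑ i, H (integralIncl v (k i)) := by
    intro H hH
    have h1 : ∀ g, H (integralIncl v g) = ∑ i, Set.indicator
        {g : IntegralGL v | (g : IntegralGL v ⧸ U) = e i}
        (fun _ => H (integralIncl v (k i))) g := by
      intro g
      rw [Finset.sum_eq_single (e.symm g)]
      · rw [Set.indicator_of_mem (by simp)]
        have : (k (e.symm g))⁻¹ * g ∈ U := by
          rw [← QuotientGroup.eq]; simp [k]
        rw [← hH (k (e.symm g)) _ this, mul_inv_cancel_left]
      · intro i _ hi
        refine Set.indicator_of_notMem ?_ _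
        intro h
        apply hi
        simp only [Set.mem_ofPred_eq] at h
        rw [h, Equiv.symm_apply_apply]
      · simp
    rw [integralCompact_eq, integral_congr_ae (Eventually.of_forall h1), integral_finsetSum]
    · rw [Finset.mul_sum]
      refine Finset.sum_congr rfl fun i _ => ?_
      rw [integral_indicator_const _ (hmeas i), hm i, Complex.real_smul]
    · intro i _
      exact (integrable_const _).indicator (hmeas i)
  have h1 := key (fun _ => 1) (fun _ _ _ => rfl)
  rw [integralCompact_eq] at h1
  rw [integral_const, probReal_univ, one_smul, Finset.sum_const, Finset.card_univ,
    Fintype.card_fin, nsmul_eq_mul, mul_one] at h1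
  have hn : ((Nat.card (IntegralGL v ⧸ U) : ℕ) : ℂ) ≠ 0 := by
    intro h0
    rw [h0, mul_zero] at h1
    exact one_ne_zero h1
  refine ⟨_, k, Nat.pos_of_ne_zero (by exact_mod_cast hn), fun H hH => ?_⟩
  rw [key H hH]
  congr 1
  exact eq_inv_of_mul_eq_one_left h1.symm

theorem exists_integral_upper {x : v.adicCompletion F} (hx : x ∈ ball v 0) :
    ∃ k : IntegralGL v, integralIncl v k = upper x := by
  refine exists_integralIncl_eq _ (fun i j => ?_) ?_
  · rw [coe_upper]
    fin_cases i <;> fin_cases j <;> simp [hx, one_mem_ball, zero_mem]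
  · rw [det_eq, coe_upper]
    simp

theorem exists_integral_lower {x : v.adicCompletion F} (hx : x ∈ ball v 0) :
    ∃ k : IntegralGL v, integralIncl v k = lower x := by
  refine exists_integralIncl_eq _ (fun i j => ?_) ?_
  · rw [coe_lower]
    fin_cases i <;> fin_cases j <;> simp [hx, one_mem_ball, zero_mem]
  · rw [det_eq, coe_lower]
    simp

variable (v) in
theorem exists_integral_weyl : ∃ k : IntegralGL v, integralIncl v k = weyl v := by
  refine exists_integralIncl_eq _ (fun i j => ?_) ?_
  · rw [coe_weyl]
    fin_cases i <;> fin_cases j <;> simp [one_mem_ball, zero_mem]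
  · rw [det_eq, coe_weyl]
    simp

theorem exists_integral_diagOne {u : (v.adicCompletion F)ˣ}
    (hu : Valued.v (u : v.adicCompletion F) = 1) :
    ∃ k : IntegralGL v, integralIncl v k = diagOne u := by
  refine exists_integralIncl_eq _ (fun i j => ?_) ?_
  · rw [coe_diagOne]
    fin_cases i <;> fin_cases j <;> simp [zero_mem, mem_ball_zero, hu]
  · rw [det_eq, coe_diagOne]
    simpa using hu

theorem not_mem_ball_one_of_det {k : IntegralGL v}
    (h : (k 0 0 * k 1 1 : v.adicCompletion F) ∈ ball v 1)
    (h' : (k 0 1 * k 1 0 : v.adicCompletion F) ∈ ball v 1) : False := by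
  have hd := val_det_integralIncl k
  rw [det_eq] at hd
  have : (k 0 0 * k 1 1 - k 0 1 * k 1 0 : v.adicCompletion F) ∈ ball v 1 := sub_mem h h'
  rw [mem_ball_one] at this
  exact this.ne hd

theorem mul_mem_ball_one {x y : v.adicCompletion F} (hx : x ∈ ball v 1) (hy : y ∈ ball v 0) :
    x * y ∈ ball v 1 := mul_mem_ball hx hy

theorem mul_mem_ball_one' {x y : v.adicCompletion F} (hx : x ∈ ball v 0) (hy : y ∈ ball v 1) :
    x * y ∈ ball v 1 := by
  rw [mul_comm]
  exact mul_mem_ball hy hx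

theorem val_entry_one_one {k : IntegralGL v}
    (h : (k 1 0 : v.adicCompletion F) ∈ ball v 1 ∨ (k 0 1 : v.adicCompletion F) ∈ ball v 1) :
    Valued.v (k 1 1 : v.adicCompletion F) = 1 := by
  refine (val_eq_one_or_mem (coe_mem_ball _)).resolve_right fun h' => ?_
  refine not_mem_ball_one_of_det (mul_mem_ball_one' (coe_mem_ball _) h') ?_
  rcases h with h | h
  · exact mul_mem_ball_one' (coe_mem_ball _) h
  · exact mul_mem_ball_one h (coe_mem_ball _)

theorem val_entry_one_zero {k : IntegralGL v}
    (h : (k 1 1 : v.adicCompletion F) ∈ ball v 1 ∨ (k 0 0 : v.adicCompletion F) ∈ ball v 1) :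
    Valued.v (k 1 0 : v.adicCompletion F) = 1 := by
  refine (val_eq_one_or_mem (coe_mem_ball _)).resolve_right fun h' => ?_
  refine not_mem_ball_one_of_det ?_ (mul_mem_ball_one' (coe_mem_ball _) h')
  rcases h with h | h
  · exact mul_mem_ball_one' (coe_mem_ball _) h
  · exact mul_mem_ball_one h (coe_mem_ball _)

/-- The second column of `k` modulo `𝔭` is a point of the projective line over the residue field.
The `q + 1` fibres are left translates of `{k | k 0 1 ∈ 𝔭}`, hence have equal mass. All Hecke sums
are evaluated through this decomposition. -/
theorem integralCompact_partition {S : Finset (v.adicCompletion F)}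
    (hcard : S.card = residueCard v ^ 1) (hS : ∀ s ∈ S, s ∈ ball v 0)
    (hcov : ∀ x ∈ ball v 0, ∃ s ∈ S, x - s ∈ ball v 1)
    (hinj : ∀ s ∈ S, ∀ t ∈ S, s - t ∈ ball v 1 → s = t)
    (H : LocalGL v → ℂ) (A : ℂ) (B : v.adicCompletion F → ℂ)
    (hA : ∀ k : IntegralGL v, (k 1 1 : v.adicCompletion F) ∈ ball v 1 → H (integralIncl v k) = A)
    (hB : ∀ k : IntegralGL v, Valued.v (k 1 1 : v.adicCompletion F) = 1 → ∀ x ∈ S,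
      (k 0 1 - x * k 1 1 : v.adicCompletion F) ∈ ball v 1 → H (integralIncl v k) = B x) :
    integralCompact v H = ((residueCard v : ℂ) + 1)⁻¹ * (A + ∑ x ∈ S, B x) := by
  let I : Set (IntegralGL v) := {k | (k 0 1 : v.adicCompletion F) ∈ ball v 1}
  let D : Set (IntegralGL v) := {k | (k 1 1 : v.adicCompletion F) ∈ ball v 1}
  let C : v.adicCompletion F → Set (IntegralGL v) := fun x =>
    {k | (k 0 1 - x * k 1 1 : v.adicCompletion F) ∈ ball v 1}
  obtain ⟨w, hw⟩ := exists_integral_weyl v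
  have hI : MeasurableSet I := (isOpen_entry 0 1 1).measurableSet
  have hD : MeasurableSet D := (isOpen_entry 1 1 1).measurableSet
  have hDI : D = (fun k => w * k) ⁻¹' I := by
    ext k
    have : ((w * k) 0 1 : v.adicCompletion F) = k 1 1 := by
      rw [← integralIncl_apply, map_mul, hw, Units.val_mul, coe_weyl, Matrix.mul_apply]
      simp [integralIncl_apply]
    simp only [D, I, Set.mem_ofPred_eq, Set.mem_preimage, this]
  have hDm : (haarCompact v).real D = (haarCompact v).real I := by
    rw [hDI, measureReal_def, measure_preimage_mul, measureReal_def]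
  have hCI : ∀ x ∈ S, ∃ g : IntegralGL v, C x = (fun k => g * k) ⁻¹' I := by
    intro x hx
    obtain ⟨g, hg⟩ := exists_integral_upper (neg_mem (hS x hx))
    refine ⟨g, ?_⟩
    ext k
    have : ((g * k) 0 1 : v.adicCompletion F) = k 0 1 - x * k 1 1 := by
      rw [← integralIncl_apply, map_mul, hg, Units.val_mul, coe_upper, Matrix.mul_apply]
      simp [integralIncl_apply, sub_eq_add_neg]
    simp only [C, I, Set.mem_ofPred_eq, Set.mem_preimage, this]
  have hC : ∀ x ∈ S, MeasurableSet (C x) := by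
    intro x hx
    obtain ⟨g, hg⟩ := hCI x hx
    rw [hg]
    exact (continuous_const_mul g).measurable hI
  have hCm : ∀ x ∈ S, (haarCompact v).real (C x) = (haarCompact v).real I := by
    intro x hx
    obtain ⟨g, hg⟩ := hCI x hx
    rw [hg, measureReal_def, measure_preimage_mul, measureReal_def]
  have hsplit : ∀ (A : ℂ) (B : v.adicCompletion F → ℂ) (H : LocalGL v → ℂ),
      (∀ k : IntegralGL v, (k 1 1 : v.adicCompletion F) ∈ ball v 1 → H (integralIncl v k) = A) →
      (∀ k : IntegralGL v, Valued.v (k 1 1 : v.adicCompletion F) = 1 → ∀ x ∈ S,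
        (k 0 1 - x * k 1 1 : v.adicCompletion F) ∈ ball v 1 → H (integralIncl v k) = B x) →
      integralCompact v H = ((haarCompact v).real I : ℂ) * (A + ∑ x ∈ S, B x) := by
    intro A B H hA hB
    have h1 : ∀ k, H (integralIncl v k) = D.indicator (fun _ => A) k +
        ∑ x ∈ S, (C x).indicator (fun _ => B x) k := by
      intro k
      by_cases hk : k ∈ D
      · rw [Set.indicator_of_mem hk, hA k hk, Finset.sum_eq_zero, add_zero]
        intro x hx
        refine Set.indicator_of_notMem (fun h => ?_) _
        have h01 : (k 0 1 : v.adicCompletion F) ∈ ball v 1 := by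
          have := add_mem h (mul_mem_ball_one' (hS x hx) hk)
          simpa using this
        have := val_entry_one_one (Or.inr h01)
        exact (mem_ball_one.1 hk).ne this
      · have hu : Valued.v (k 1 1 : v.adicCompletion F) = 1 :=
          (val_eq_one_or_mem (coe_mem_ball _)).resolve_right hk
        have hne : (k 1 1 : v.adicCompletion F) ≠ 0 := by
          intro h0
          rw [h0, map_zero] at hu
          exact zero_ne_one hu
        have hmem : ∀ x, k ∈ C x ↔ (k 0 1 / k 1 1 - x : v.adicCompletion F) ∈ ball v 1 := by
          intro x
          rw [← unit_mul_mem_ball hu]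
          simp only [C, Set.mem_ofPred_eq]
          rw [mul_sub, mul_div_cancel₀ _ hne, mul_comm x]
        obtain ⟨x, hx, hxk⟩ := hcov (k 0 1 / k 1 1 : v.adicCompletion F) (by
          rw [mem_ball_zero, map_div₀, hu, div_one]
          exact (k 0 1).2)
        rw [Set.indicator_of_notMem hk, zero_add, Finset.sum_eq_single x,
          Set.indicator_of_mem ((hmem x).2 hxk), hB k hu x hx ((hmem x).2 hxk)]
        · intro y hy hyx
          refine Set.indicator_of_notMem (fun h => hyx ?_) _
          refine hinj y hy x hx ?_
          have := sub_mem hxk ((hmem y).1 h)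
          simpa using this
        · exact fun h => absurd hx h
    rw [integralCompact_eq]
    simp only [h1]
    rw [integral_add ((integrable_const _).indicator hD)
      (integrable_finsetSum _ fun x hx => (integrable_const _).indicator (hC x hx)),
      integral_finsetSum _ fun x hx => (integrable_const _).indicator (hC x hx),
      integral_indicator_const _ hD, hDm, mul_add, Complex.real_smul, Finset.mul_sum]
    congr 1
    refine Finset.sum_congr rfl fun x hx => ?_
    rw [integral_indicator_const _ (hC x hx), hCm x hx, Complex.real_smul]
  -- The constant function `1` determines the common mass of the fibres.
  have h1 := hsplit 1 (fun _ => 1) (fun _ => 1) (fun _ _ => rfl) (fun _ _ _ _ _ => rfl)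
  rw [integralCompact_eq, integral_const, probReal_univ, one_smul, Finset.sum_const, hcard, pow_one,
    nsmul_eq_mul, mul_one, add_comm (1 : ℂ)] at h1
  rw [hsplit A B H hA hB]
  congr 1
  exact eq_inv_of_mul_eq_one_left h1.symm

variable (v) in
/-- The volume of the Hecke congruence subgroup of level `𝔭_v^r`. -/
def levelVolume (r : ℕ) : ℝ :=
  (haarCompact v).real {k : IntegralGL v | (k 1 0 : v.adicCompletion F) ∈ ball v r}

theorem integralCompact_level (r : ℕ) (H : LocalGL v → ℂ) (c : ℂ)
    (h₁ : ∀ k : IntegralGL v, (k 1 0 : v.adicCompletion F) ∈ ball v r → H (integralIncl v k) = c)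
    (h₂ : ∀ k : IntegralGL v, (k 1 0 : v.adicCompletion F) ∉ ball v r →
      H (integralIncl v k) = 0) :
    integralCompact v H = levelVolume v r * c := by
  have : ∀ k, H (integralIncl v k) =
      Set.indicator {k : IntegralGL v | (k 1 0 : v.adicCompletion F) ∈ ball v r} (fun _ => c) k := by
    intro k
    by_cases hk : (k 1 0 : v.adicCompletion F) ∈ ball v r
    · rw [h₁ k hk]
      exact (Set.indicator_of_mem (s := {k : IntegralGL v | (k 1 0 : v.adicCompletion F) ∈ ball v r})
        hk (fun _ => c)).symm
    · rw [h₂ k hk]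
      exact (Set.indicator_of_notMem
        (s := {k : IntegralGL v | (k 1 0 : v.adicCompletion F) ∈ ball v r}) hk (fun _ => c)).symm
  rw [integralCompact_eq]
  simp only [this]
  rw [integral_indicator_const _ (isOpen_entry 1 0 r).measurableSet, Complex.real_smul]
  rfl

/-- The compact group is covered by `q^(r+1) + q^r` left translates of the congruence subgroup of
level `𝔭^(r+1)`, indexed by the projective line over `𝔬 / 𝔭^(r+1)`: the ratio `k 1 0 / k 0 0` modulo
`𝔭^(r+1)` if `k 0 0` is a unit, and otherwise `k 0 0 / k 1 0`, which lies in `𝔭` and leaves `q^r`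
classes. A lower bound for the volume needs no disjointness. -/
theorem one_le_levelVolume {ϖ : (v.adicCompletion F)ˣ}
    (hϖ : Valued.v (ϖ : v.adicCompletion F) = WithZero.exp (-1 : ℤ)) (r : ℕ) :
    1 ≤ ((residueCard v : ℝ) ^ (r + 1) + (residueCard v : ℝ) ^ r) * levelVolume v (r + 1) := by
  let I : Set (IntegralGL v) := {k | (k 1 0 : v.adicCompletion F) ∈ ball v (r + 1 : ℕ)}
  obtain ⟨S, hScard, hS, hScov, -⟩ := exists_residues (v := v) (r + 1)
  obtain ⟨T, hTcard, hT, hTcov, -⟩ := exists_residues (v := v) r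
  obtain ⟨w, hw⟩ := exists_integral_weyl v
  have hlow : ∀ x : v.adicCompletion F, ∃ g : IntegralGL v, x ∈ ball v 0 →
      integralIncl v g = lower (-x) := by
    intro x
    by_cases hx : x ∈ ball v 0
    · obtain ⟨g, hg⟩ := exists_integral_lower (neg_mem hx)
      exact ⟨g, fun _ => hg⟩
    · exact ⟨1, fun h => absurd h hx⟩
  have hup : ∀ x : v.adicCompletion F, ∃ g : IntegralGL v, x ∈ ball v 0 →
      integralIncl v g = upper (-((ϖ : v.adicCompletion F) * x)) := by
    intro x
    by_cases hx : x ∈ ball v 0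
    · obtain ⟨g, hg⟩ := exists_integral_upper (x := -((ϖ : v.adicCompletion F) * x)) (neg_mem (mul_mem_ball (m := 0)
        (ball_mono (n := 1) (by omega) (by simpa using zpow_mem_ball hϖ 1)) hx))
      exact ⟨g, fun _ => hg⟩
    · exact ⟨1, fun h => absurd h hx⟩
  choose a ha using hlow
  choose b hb using hup
  have hcover : (Set.univ : Set (IntegralGL v)) ⊆
      (⋃ x ∈ S, (fun k => a x * k) ⁻¹' I) ∪ ⋃ x ∈ T, (fun k => (w * b x) * k) ⁻¹' I := by
    intro k _
    rcases val_eq_one_or_mem (coe_mem_ball (k 0 0)) with hu | hp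
    · left
      have hne : (k 0 0 : v.adicCompletion F) ≠ 0 := by
        intro h0
        rw [h0, map_zero] at hu
        exact zero_ne_one hu
      obtain ⟨x, hx, hxk⟩ := hScov (k 1 0 / k 0 0 : v.adicCompletion F) (by
        rw [mem_ball_zero, map_div₀, hu, div_one]
        exact (k 1 0).2)
      refine Set.mem_biUnion hx ?_
      have : ((a x * k) 1 0 : v.adicCompletion F) = k 0 0 * (k 1 0 / k 0 0 - x) := by
        rw [← integralIncl_apply, map_mul, ha x (hS x hx), Units.val_mul, coe_lower,
          Matrix.mul_apply, mul_sub, mul_div_cancel₀ _ hne]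
        simp [integralIncl_apply]
        ring
      simp only [I, Set.mem_preimage, Set.mem_ofPred_eq, this]
      exact (unit_mul_mem_ball hu).2 hxk
    · right
      have hu := val_entry_one_zero (Or.inr hp)
      have hne : (k 1 0 : v.adicCompletion F) ≠ 0 := by
        intro h0
        rw [h0, map_zero] at hu
        exact zero_ne_one hu
      have h1 : ((ϖ ^ (-1 : ℤ) : (v.adicCompletion F)ˣ) : v.adicCompletion F) *
          (k 0 0 / k 1 0) ∈ ball v 0 := by
        have : (k 0 0 / k 1 0 : v.adicCompletion F) ∈ ball v 1 := by
          rw [mem_ball, map_div₀, hu, div_one]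
          exact hp
        simpa using (zpow_mul_mem_ball hϖ 1 (-1)).2 this
      obtain ⟨x, hx, hxk⟩ := hTcov _ h1
      refine Set.mem_biUnion hx ?_
      have : (((w * b x) * k) 1 0 : v.adicCompletion F) =
          k 1 0 * ((ϖ : v.adicCompletion F) * (((ϖ ^ (-1 : ℤ) : (v.adicCompletion F)ˣ) : v.adicCompletion F) *
          (k 0 0 / k 1 0) - x)) := by
        rw [← integralIncl_apply, map_mul, map_mul, hb x (hT x hx), hw, Units.val_mul,
          Units.val_mul, coe_upper, coe_weyl]
        simp only [Matrix.mul_apply, Fin.sum_univ_two, integralIncl_apply]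
        have h0 : (ϖ : v.adicCompletion F) ≠ 0 := ϖ.ne_zero
        simp
        field_simp
        ring
      simp only [I, Set.mem_preimage, Set.mem_ofPred_eq, this]
      refine (unit_mul_mem_ball hu).2 ?_
      have := (zpow_mul_mem_ball hϖ r 1).2 hxk
      rwa [zpow_one, add_comm] at this
  have hle : ∀ (X : Finset (v.adicCompletion F)) (g : v.adicCompletion F → IntegralGL v),
      (haarCompact v).real (⋃ x ∈ X, (fun k => g x * k) ⁻¹' I) ≤ X.card * levelVolume v (r + 1) := by
    intro X g
    refine (measureReal_biUnion_finset_le _ _).trans ?_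
    rw [← nsmul_eq_mul, ← Finset.sum_const]
    refine Finset.sum_le_sum fun x _ => ?_
    rw [measureReal_def, measure_preimage_mul]
    rfl
  calc (1 : ℝ) = (haarCompact v).real Set.univ := by simp
    _ ≤ _ := measureReal_mono hcover
    _ ≤ _ := measureReal_union_le _ _
    _ ≤ S.card * levelVolume v (r + 1) + T.card * levelVolume v (r + 1) :=
        add_le_add (hle S a) (hle T fun x => w * b x)
    _ = _ := by rw [hScard, hTcard]; push_cast; ring

/-! ### Integration over the multiplicative group -/

instance : MeasurableSpace (v.adicCompletion F)ˣ := borel _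

instance : BorelSpace (v.adicCompletion F)ˣ := ⟨rfl⟩

variable (v) in
/-- The Haar measure on `F_v^×` for which `𝔬_v^×` has volume `1`. -/
def haarUnits : Measure (v.adicCompletion F)ˣ := Measure.haarMeasure (unitCompacts v)

instance : (haarUnits v).IsHaarMeasure := inferInstanceAs (Measure.haarMeasure _).IsHaarMeasure

theorem integralUnits_eq (H : (v.adicCompletion F)ˣ → ℂ) :
    integralUnits v H = ∫ y, H y ∂(haarUnits v) := rfl

variable (v) in
/-- The group `𝔬_v^×` as a subset of `F_v^×`. -/
def unitSet : Set (v.adicCompletion F)ˣ := {u | Valued.v (u : v.adicCompletion F) = 1}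

theorem mem_unitSet {u : (v.adicCompletion F)ˣ} :
    u ∈ unitSet v ↔ Valued.v (u : v.adicCompletion F) = 1 := Iff.rfl

theorem isCompact_unitSet : IsCompact (unitSet v) := (unitCompacts v).isCompact

theorem isOpen_unitSet : IsOpen (unitSet v) := by
  have : unitSet v = ⋃ w ∈ unitSet v,
      {u : (v.adicCompletion F)ˣ | (u : v.adicCompletion F) - w ∈ ball v 1} := by
    ext u
    simp only [Set.mem_iUnion, Set.mem_ofPred_eq, mem_unitSet, exists_prop]
    constructor
    · exact fun h => ⟨u, h, by simp [zero_mem]⟩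
    · rintro ⟨w, hw, h⟩
      simpa using val_add_eq_one hw h
  rw [this]
  have ho : ∀ w : v.adicCompletion F,
      IsOpen {u : (v.adicCompletion F)ˣ | (u : v.adicCompletion F) - w ∈ ball v 1} := fun w =>
    (isOpen_ball 1).preimage (Units.continuous_val.sub continuous_const)
  exact isOpen_biUnion fun w _ => ho w

theorem measurableSet_unitSet : MeasurableSet (unitSet v) := isOpen_unitSet.measurableSet

theorem haarUnits_unitSet : haarUnits v (unitSet v) = 1 :=
  Measure.haarMeasure_self (K₀ := unitCompacts v)

variable (v) in
/-- Integration over `𝔬_v^×`. -/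
def unitIntegral (H : (v.adicCompletion F)ˣ → ℂ) : ℂ := ∫ u in unitSet v, H u ∂(haarUnits v)

theorem integrableOn_unitSet {H : (v.adicCompletion F)ˣ → ℂ} (hH : Continuous H) :
    IntegrableOn H (unitSet v) (haarUnits v) :=
  hH.continuousOn.integrableOn_compact isCompact_unitSet

theorem unitIntegral_congr {H H' : (v.adicCompletion F)ˣ → ℂ}
    (h : ∀ u : (v.adicCompletion F)ˣ, Valued.v (u : v.adicCompletion F) = 1 → H u = H' u) :
    unitIntegral v H = unitIntegral v H' := setIntegral_congr_fun measurableSet_unitSet h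

theorem unitIntegral_const (c : ℂ) : unitIntegral v (fun _ => c) = c := by
  simp [unitIntegral, measureReal_def, haarUnits_unitSet]

theorem unitIntegral_mul_left {u₀ : (v.adicCompletion F)ˣ}
    (hu : Valued.v (u₀ : v.adicCompletion F) = 1) (H : (v.adicCompletion F)ˣ → ℂ) :
    unitIntegral v (fun u => H (u₀ * u)) = unitIntegral v H := by
  have h := (measurePreserving_mul_left (haarUnits v) u₀).setIntegral_preimage_emb
    (measurableEmbedding_mulLeft u₀) H (unitSet v)
  have hs : (fun x => u₀ * x) ⁻¹' (unitSet v) = unitSet v := by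
    ext u
    simp [mem_unitSet, hu]
  rw [hs] at h
  exact h

/-- The set of elements of `F_v^×` of normalised valuation `n`. -/
def shell (ϖ : (v.adicCompletion F)ˣ) (n : ℤ) : Set (v.adicCompletion F)ˣ :=
  (fun x => (ϖ ^ n)⁻¹ * x) ⁻¹' (unitSet v)

theorem measurableSet_shell (ϖ : (v.adicCompletion F)ˣ) (n : ℤ) : MeasurableSet (shell ϖ n) :=
  (isOpen_unitSet.preimage (continuous_const_mul _)).measurableSet

theorem setIntegral_shell {E : Type*} [NormedAddCommGroup E] [NormedSpace ℝ E]
    (ϖ : (v.adicCompletion F)ˣ) (n : ℤ) (H : (v.adicCompletion F)ˣ → E) :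
    ∫ y in shell ϖ n, H y ∂(haarUnits v) = ∫ u in unitSet v, H (ϖ ^ n * u) ∂(haarUnits v) := by
  have h := (measurePreserving_mul_left (haarUnits v) (ϖ ^ n)).setIntegral_preimage_emb
    (measurableEmbedding_mulLeft (ϖ ^ n)) H (shell ϖ n)
  rw [← h]
  congr 2
  ext u
  simp [shell]

theorem integrableOn_shell (ϖ : (v.adicCompletion F)ˣ) (n : ℤ) {H : (v.adicCompletion F)ˣ → ℂ}
    (hH : Continuous H) : IntegrableOn H (shell ϖ n) (haarUnits v) := by
  refine hH.continuousOn.integrableOn_compact ?_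
  have : shell ϖ n = (fun x => ϖ ^ n * x) '' (unitSet v) := by
    ext u
    simp only [shell, Set.mem_preimage, Set.mem_image]
    exact ⟨fun h => ⟨_, h, by simp⟩, by rintro ⟨x, hx, rfl⟩; simpa using hx⟩
  rw [this]
  exact isCompact_unitSet.image (continuous_const_mul _)

section

variable {ϖ : (v.adicCompletion F)ˣ}

theorem iUnion_shell (hϖ : Valued.v (ϖ : v.adicCompletion F) = WithZero.exp (-1 : ℤ)) :
    ⋃ n, shell ϖ n = Set.univ := by
  refine Set.eq_univ_of_forall fun y => ?_
  obtain ⟨n, u, hu, rfl⟩ := exists_zpow_mul_unit hϖ y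
  exact Set.mem_iUnion.2 ⟨n, by simpa [shell, mem_unitSet] using hu⟩

theorem pairwise_disjoint_shell (hϖ : Valued.v (ϖ : v.adicCompletion F) = WithZero.exp (-1 : ℤ)) :
    Pairwise (Function.onFun Disjoint (shell ϖ)) := by
  intro m n hmn
  rw [Function.onFun, Set.disjoint_left]
  intro y hm hn
  apply hmn
  have key : ∀ n, y ∈ shell ϖ n → Valued.v (y : v.adicCompletion F) = WithZero.exp (-n) := by
    intro n hn
    have : y = ϖ ^ n * ((ϖ ^ n)⁻¹ * y) := by simp
    have h1 : Valued.v (((ϖ ^ n)⁻¹ * y : (v.adicCompletion F)ˣ) : v.adicCompletion F) = 1 := hn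
    rw [this, Units.val_mul, map_mul, val_zpow hϖ, h1, mul_one]
  have := (key m hm).symm.trans (key n hn)
  rw [WithZero.exp_inj] at this
  omega

theorem hasSum_unitIntegral (hϖ : Valued.v (ϖ : v.adicCompletion F) = WithZero.exp (-1 : ℤ))
    {H : (v.adicCompletion F)ˣ → ℂ} (hH : Integrable H (haarUnits v)) :
    HasSum (fun n : ℤ => unitIntegral v fun u => H (ϖ ^ n * u)) (integralUnits v H) := by
  have h := hasSum_integral_iUnion (measurableSet_shell ϖ) (pairwise_disjoint_shell hϖ)
    (f := H) (μ := haarUnits v) (hH.integrableOn)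
  rw [iUnion_shell hϖ, Measure.restrict_univ] at h
  simp only [setIntegral_shell] at h
  exact h

theorem integrable_of_summable (hϖ : Valued.v (ϖ : v.adicCompletion F) = WithZero.exp (-1 : ℤ))
    {H : (v.adicCompletion F)ˣ → ℂ} (hH : Continuous H) {g : ℤ → ℝ} (hg : Summable g)
    (hb : ∀ n (u : (v.adicCompletion F)ˣ), Valued.v (u : v.adicCompletion F) = 1 →
      ‖H (ϖ ^ n * u)‖ ≤ g n) : Integrable H (haarUnits v) := by
  rw [← integrableOn_univ, ← iUnion_shell hϖ]
  refine integrableOn_iUnion_of_summable_integral_norm (fun n => integrableOn_shell ϖ n hH) ?_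
  refine Summable.of_nonneg_of_le (fun n => integral_nonneg fun _ => norm_nonneg _) (fun n => ?_) hg
  rw [setIntegral_shell ϖ n fun y => ‖H y‖]
  have h1 : ∫ u in unitSet v, ‖H (ϖ ^ n * u)‖ ∂(haarUnits v) ≤
      ∫ u in unitSet v, g n ∂(haarUnits v) := by
    refine setIntegral_mono_on ?_ ?_ measurableSet_unitSet (fun u hu => hb n u hu)
    · exact ((hH.comp (continuous_const_mul _)).norm).continuousOn.integrableOn_compact
        isCompact_unitSet
    · exact continuousOn_const.integrableOn_compact isCompact_unitSet
  simpa [measureReal_def, haarUnits_unitSet] using h1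

theorem norm_zpow_mul (hϖ : Valued.v (ϖ : v.adicCompletion F) = WithZero.exp (-1 : ℤ)) (n : ℤ)
    {u : (v.adicCompletion F)ˣ} (hu : Valued.v (u : v.adicCompletion F) = 1) :
    ‖((ϖ ^ n * u : (v.adicCompletion F)ˣ) : v.adicCompletion F)‖ = (residueCard v : ℝ) ^ (-n) := by
  refine norm_eq_zpow ?_
  rw [Units.val_mul, map_mul, val_zpow hϖ, hu, mul_one]

theorem norm_cpow_zpow_mul (hϖ : Valued.v (ϖ : v.adicCompletion F) = WithZero.exp (-1 : ℤ)) (n : ℤ)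
    {u : (v.adicCompletion F)ˣ} (hu : Valued.v (u : v.adicCompletion F) = 1) (z : ℂ) :
    ((‖((ϖ ^ n * u : (v.adicCompletion F)ˣ) : v.adicCompletion F)‖ : ℝ) : ℂ) ^ z =
      ((residueCard v : ℂ) ^ (-z)) ^ n := by
  have hq := residueCard_pos (v := v)
  rw [norm_zpow_mul hϖ n hu, Complex.cpow_def_of_ne_zero
    (by exact_mod_cast (zpow_pos hq _).ne'), Complex.cpow_def_of_ne_zero (by exact_mod_cast hq.ne'),
    ← Complex.ofReal_log (zpow_pos hq _).le, Real.log_zpow, ← Complex.exp_int_mul]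
  congr 1
  rw [← Complex.natCast_log]
  push_cast
  ring

/-- The Mellin transform of a function on `F_v^×` as a power series. -/
theorem integralUnits_mul_cpow
    (hϖ : Valued.v (ϖ : v.adicCompletion F) = WithZero.exp (-1 : ℤ))
    {H : (v.adicCompletion F)ˣ → ℂ} (hH : Continuous H) (A : ℕ)
    (hA : ∀ (n : ℤ) (u : (v.adicCompletion F)ˣ), Valued.v (u : v.adicCompletion F) = 1 → n < -A →
      H (ϖ ^ n * u) = 0) {C R : ℝ} (hR : 0 ≤ R)
    (hb : ∀ (n : ℕ) (u : (v.adicCompletion F)ˣ), Valued.v (u : v.adicCompletion F) = 1 →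
      ‖H (ϖ ^ ((n : ℤ) - A) * u)‖ ≤ C * R ^ n) {z : ℂ}
    (hz : ‖(residueCard v : ℂ) ^ (-z)‖ * R < 1) :
    Integrable (fun y => H y * ((‖(y : v.adicCompletion F)‖ : ℝ) : ℂ) ^ z) (haarUnits v) ∧
    Summable (fun n : ℕ => ‖(unitIntegral v fun u => H (ϖ ^ ((n : ℤ) - A) * u)) *
      ((residueCard v : ℂ) ^ (-z)) ^ n‖) ∧
    (integralUnits v fun y => H y * ((‖(y : v.adicCompletion F)‖ : ℝ) : ℂ) ^ z) =
      ((residueCard v : ℂ) ^ z) ^ A * ∑' n : ℕ,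
        (unitIntegral v fun u => H (ϖ ^ ((n : ℤ) - A) * u)) * ((residueCard v : ℂ) ^ (-z)) ^ n := by
  have hq := residueCard_pos (v := v)
  set Y := (residueCard v : ℂ) ^ (-z) with hY
  have hY0 : Y ≠ 0 := by
    rw [hY, Ne, Complex.cpow_eq_zero_iff]
    exact fun h => hq.ne' (by exact_mod_cast h.1)
  have hYinv : ((residueCard v : ℂ) ^ z) = Y⁻¹ := by rw [hY, Complex.cpow_neg, inv_inv]
  have hinj : Function.Injective (fun n : ℕ => (n : ℤ) - A) := fun a b h => by
    simp only at h; omega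
  have hrange : ∀ n : ℤ, n ∉ Set.range (fun n : ℕ => (n : ℤ) - A) → n < -A := by
    intro n hn
    by_contra h
    exact hn ⟨(n + A).toNat, by simp only; omega⟩
  have hcont : Continuous fun y : (v.adicCompletion F)ˣ =>
      H y * ((‖(y : v.adicCompletion F)‖ : ℝ) : ℂ) ^ z := by
    refine hH.mul ?_
    refine Continuous.cpow (by fun_prop) continuous_const fun y => ?_
    exact Or.inl (by simp)
  have hgeo : Summable fun n : ℕ => C * R ^ n * ‖Y‖ ^ n := by
    have : ∀ n : ℕ, C * R ^ n * ‖Y‖ ^ n = C * (‖Y‖ * R) ^ n := fun n => by rw [mul_pow]; ring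
    simp only [this]
    exact (summable_geometric_of_lt_one (by positivity) hz).mul_left C
  have hint : Integrable (fun y => H y * ((‖(y : v.adicCompletion F)‖ : ℝ) : ℂ) ^ z)
      (haarUnits v) := by
    let g : ℤ → ℝ := fun n => if -(A : ℤ) ≤ n then C * R ^ (n + A).toNat * ‖Y‖ ^ n else 0
    have hg : Summable g := by
      -- The shells with `n < -A` contribute nothing, so summability over `ℤ` is that of a geometric
      -- series indexed by `n + A`.
      rw [← hinj.summable_iff (f := g)]
      · have : g ∘ (fun n : ℕ => (n : ℤ) - A) =
            fun n : ℕ => (C * R ^ n * ‖Y‖ ^ n) * ‖Y‖ ^ (-(A : ℤ)) := by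
          funext n
          simp only [g, Function.comp]
          rw [if_pos (by omega), show ((n : ℤ) - A + A).toNat = n by omega, sub_eq_add_neg,
            zpow_add₀ (by simpa using hY0), zpow_natCast]
          ring
        rw [this]
        exact hgeo.mul_right _
      · intro n hn
        have := hrange n hn
        simp only [g]
        rw [if_neg (by omega)]
    refine integrable_of_summable hϖ hcont hg fun n u hu => ?_
    rw [norm_cpow_zpow_mul hϖ n hu, norm_mul, norm_zpow]
    simp only [g]
    split_ifs with h
    · have := hb (n + A).toNat u hu
      rw [show (((n + A).toNat : ℕ) : ℤ) - A = n by omega] at this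
      exact mul_le_mul_of_nonneg_right this (zpow_nonneg (norm_nonneg _) _)
    · rw [hA n u hu (by omega)]
      simp
  refine ⟨hint, ?_, ?_⟩
  · refine Summable.of_nonneg_of_le (fun _ => norm_nonneg _) (fun n => ?_) hgeo
    rw [norm_mul, norm_pow]
    refine mul_le_mul_of_nonneg_right ?_ (by positivity)
    have h1 := norm_setIntegral_le_of_norm_le_const (μ := haarUnits v) (s := unitSet v)
      (f := fun u => H (ϖ ^ ((n : ℤ) - A) * u)) (C := C * R ^ n)
      (by rw [haarUnits_unitSet]; exact ENNReal.one_lt_top) (fun u hu => hb n u hu)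
    simpa [measureReal_def, haarUnits_unitSet, unitIntegral] using h1
  · have hs := hasSum_unitIntegral hϖ hint
    have hterm : ∀ n : ℤ, (unitIntegral v fun u => H (ϖ ^ n * u) *
        ((‖((ϖ ^ n * u : (v.adicCompletion F)ˣ) : v.adicCompletion F)‖ : ℝ) : ℂ) ^ z) =
        (unitIntegral v fun u => H (ϖ ^ n * u)) * Y ^ n := by
      intro n
      rw [unitIntegral_congr (H' := fun u => H (ϖ ^ n * u) * Y ^ n)
        fun u hu => congrArg (fun t => H (ϖ ^ n * u) * t) (norm_cpow_zpow_mul hϖ n hu z)]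
      exact integral_mul_const _ _
    simp only [hterm] at hs
    rw [← hinj.hasSum_iff] at hs
    · rw [← hs.tsum_eq, ← tsum_mul_left]
      refine tsum_congr fun n => ?_
      simp only [Function.comp]
      rw [hYinv, sub_eq_add_neg, zpow_add₀ hY0, zpow_natCast, zpow_neg, zpow_natCast, inv_pow]
      ring
    · intro n hn
      rw [unitIntegral_congr (H' := fun _ => 0) fun u hu => hA n u hu (hrange n hn),
        unitIntegral_const, zero_mul]

end

/-! ### Linear recurrences and Euler polynomials -/

/-- The operator `∏_{γ ∈ l} (E - γ)` on sequences, where `E` is the shift. -/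
def recOp : List ℂ → (ℕ → ℂ) → ℕ → ℂ
  | [], c => c
  | γ :: l, c => recOp l fun n => c (n + 1) - γ * c n

/-- The polynomial `∏_{γ ∈ l} (1 - γ X)`. -/
def eulerPoly (l : List ℂ) : ℂ[X] := (l.map fun γ => 1 - C γ * X).prod

@[simp] theorem eulerPoly_nil : eulerPoly [] = 1 := rfl

@[simp] theorem eulerPoly_cons (γ : ℂ) (l : List ℂ) :
    eulerPoly (γ :: l) = (1 - C γ * X) * eulerPoly l := by simp [eulerPoly]

theorem eulerPoly_append (l l' : List ℂ) :
    eulerPoly (l ++ l') = eulerPoly l * eulerPoly l' := by simp [eulerPoly]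

@[simp] theorem eulerPoly_coeff_zero (l : List ℂ) : (eulerPoly l).coeff 0 = 1 := by
  induction l with
  | nil => simp
  | cons γ l ih => rw [eulerPoly_cons, mul_coeff_zero, ih]; simp

theorem eulerPoly_ne_zero (l : List ℂ) : eulerPoly l ≠ 0 := fun h => by
  have := eulerPoly_coeff_zero l
  simp [h] at this

theorem eval_eulerPoly_map_mul (l : List ℂ) (a x : ℂ) :
    (eulerPoly (l.map fun γ => γ * a)).eval x = (eulerPoly l).eval (a * x) := by
  induction l with
  | nil => simp
  | cons γ l ih =>
    rw [List.map_cons, eulerPoly_cons, eulerPoly_cons, eval_mul, eval_mul, ih]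
    simp [mul_assoc]

/-- Multiplying a power series by `1 - γX` applies `E - γ` to its coefficients, up to a shift of the
index and the constant term. Hence an eventual recurrence means rationality with the corresponding
denominator. -/
theorem exists_eulerPoly_mul_eq (l : List ℂ) : ∀ c : ℕ → ℂ,
    (∃ N, ∀ n ≥ N, recOp l c n = 0) →
    ∃ Q : ℂ[X], (eulerPoly l : PowerSeries ℂ) * PowerSeries.mk c = Q := by
  induction l with
  | nil =>
    rintro c ⟨N, hN⟩
    refine ⟨PowerSeries.trunc N (PowerSeries.mk c), ?_⟩
    ext n
    rw [Polynomial.coeff_coe, PowerSeries.coeff_trunc]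
    simp only [eulerPoly_nil, Polynomial.coe_one, one_mul, PowerSeries.coeff_mk]
    split_ifs with h
    · rfl
    · exact hN n (not_lt.1 h)
  | cons γ l ih =>
    rintro c h
    obtain ⟨Q, hQ⟩ := ih _ h
    refine ⟨X * Q + C (c 0) * eulerPoly l, ?_⟩
    have h1 : ((1 - C γ * X : ℂ[X]) : PowerSeries ℂ) * PowerSeries.mk c =
        PowerSeries.X * PowerSeries.mk (fun n => c (n + 1) - γ * c n) + PowerSeries.C (c 0) := by
      ext n
      rw [Polynomial.coe_sub, Polynomial.coe_mul, Polynomial.coe_one, Polynomial.coe_C,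
        Polynomial.coe_X, sub_mul, one_mul, mul_assoc]
      cases n with
      | zero => simp
      | succ n => simp [PowerSeries.coeff_succ_X_mul]
    rw [eulerPoly_cons, Polynomial.coe_mul, mul_right_comm, h1, Polynomial.coe_add,
      Polynomial.coe_mul, Polynomial.coe_mul, ← hQ, Polynomial.coe_X, Polynomial.coe_C]
    ring

theorem eval_mul_tsum_eq {M Q : ℂ[X]} {c : ℕ → ℂ}
    (h : (M : PowerSeries ℂ) * PowerSeries.mk c = Q) {x : ℂ}
    (hs : Summable fun n => ‖c n * x ^ n‖) : M.eval x * ∑' n, c n * x ^ n = Q.eval x := by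
  have hM : ∀ P : ℂ[X], HasSum (fun n => P.coeff n * x ^ n) (P.eval x) := by
    intro P
    rw [Polynomial.eval_eq_sum_range]
    refine hasSum_sum_of_ne_finset_zero fun n hn => ?_
    rw [Polynomial.coeff_eq_zero_of_natDegree_lt, zero_mul]
    simpa using hn
  have hMs : Summable fun n => ‖M.coeff n * x ^ n‖ := by
    refine summable_of_ne_finset_zero (s := Finset.range (M.natDegree + 1)) fun n hn => ?_
    rw [Polynomial.coeff_eq_zero_of_natDegree_lt, zero_mul, norm_zero]
    simpa using hn
  rw [← (hM M).tsum_eq, tsum_mul_tsum_eq_tsum_sum_antidiagonal_of_summable_norm hMs hs,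
    ← (hM Q).tsum_eq]
  refine tsum_congr fun n => ?_
  rw [← Polynomial.coeff_coe, ← h, PowerSeries.coeff_mul, Finset.sum_mul]
  refine Finset.sum_congr rfl fun p hp => ?_
  rw [Polynomial.coeff_coe, PowerSeries.coeff_mk, ← Finset.HasAntidiagonal.mem_antidiagonal.1 hp, pow_add]
  ring

/-- The list of pairwise products of the roots of two quadratic recurrences. -/
def productList (α β γ δ : ℂ) : List ℂ := [α * γ, α * δ, β * γ, β * δ]

/-- For distinct roots the product of the two sequences is a combination of powers of the four
products of roots. Reducing everything to the initial values by the recurrences gives a polynomial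
identity, so repeated roots need no separate treatment. -/
theorem recOp_productList {α β γ δ : ℂ} {a b : ℕ → ℂ} {n : ℕ}
    (ha : ∀ m ≥ n, a (m + 2) - (α + β) * a (m + 1) + α * β * a m = 0)
    (hb : ∀ m ≥ n, b (m + 2) - (γ + δ) * b (m + 1) + γ * δ * b m = 0) :
    recOp (productList α β γ δ) (fun m => a m * b m) n = 0 := by
  have ha' : ∀ m ≥ n, a (m + 2) = (α + β) * a (m + 1) - α * β * a m := fun m hm => by
    linear_combination ha m hm
  have hb' : ∀ m ≥ n, b (m + 2) = (γ + δ) * b (m + 1) - γ * δ * b m := fun m hm => by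
    linear_combination hb m hm
  simp only [productList, recOp]
  rw [ha' (n + 2) (by omega), hb' (n + 2) (by omega), ha' (n + 1) (by omega),
    hb' (n + 1) (by omega), ha' n le_rfl, hb' n le_rfl]
  ring

/-- The classical Rankin–Selberg identity. Coefficients of degree at least four vanish by the
recurrences, and the remaining ones are computed from the initial values. -/
theorem eulerPoly_productList_mul {α β γ δ : ℂ} {a b : ℕ → ℂ}
    (ha : ∀ m, a (m + 2) - (α + β) * a (m + 1) + α * β * a m = 0)
    (hb : ∀ m, b (m + 2) - (γ + δ) * b (m + 1) + γ * δ * b m = 0)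
    (ha0 : a 0 = 1) (ha1 : a 1 = α + β) (hb0 : b 0 = 1) (hb1 : b 1 = γ + δ) :
    (eulerPoly (productList α β γ δ) : PowerSeries ℂ) * PowerSeries.mk (fun m => a m * b m) =
      ((1 - C (α * β * γ * δ) * X ^ 2 : ℂ[X]) : PowerSeries ℂ) := by
  have ha' : ∀ m, a (m + 2) = (α + β) * a (m + 1) - α * β * a m := fun m => by
    linear_combination ha m
  have hb' : ∀ m, b (m + 2) = (γ + δ) * b (m + 1) - γ * δ * b m := fun m => by
    linear_combination hb m
  have h1 : ∀ (γ : ℂ) (c : ℕ → ℂ), ((1 - C γ * X : ℂ[X]) : PowerSeries ℂ) * PowerSeries.mk c =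
      PowerSeries.mk (fun n => match n with | 0 => c 0 | n + 1 => c (n + 1) - γ * c n) := by
    intro γ c
    ext n
    rw [Polynomial.coe_sub, Polynomial.coe_mul, Polynomial.coe_one, Polynomial.coe_C,
      Polynomial.coe_X, sub_mul, one_mul, mul_assoc]
    cases n with
    | zero => simp
    | succ n => simp [PowerSeries.coeff_succ_X_mul]
  rw [productList, eulerPoly_cons, eulerPoly_cons, eulerPoly_cons, eulerPoly_cons, eulerPoly_nil,
    mul_one, Polynomial.coe_mul, Polynomial.coe_mul, Polynomial.coe_mul, mul_assoc, mul_assoc,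
    mul_assoc, h1, h1, h1, h1]
  ext n
  rw [PowerSeries.coeff_mk, Polynomial.coeff_coe, coeff_sub, coeff_C_mul, coeff_X_pow, coeff_one]
  match n with
  | 0 => simp [ha0, hb0]
  | 1 => simp [ha0, hb0, ha1, hb1]; ring
  | 2 => simp [ha0, hb0, ha1, hb1, ha', hb']; ring
  | 3 => simp [ha0, hb0, ha1, hb1, ha', hb']; ring
  | n + 4 => simp [ha', hb']; ring

/-- Unique factorisation, the constant term `1` excluding scalars. It turns a divisibility by a
known product into bounds for the value of an otherwise unknown polynomial. -/
theorem exists_sublist_of_dvd_eulerPoly (l : List ℂ) : ∀ G : ℂ[X], G ∣ eulerPoly l →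
    G.coeff 0 = 1 → ∃ l' : List ℂ, l'.Sublist l ∧ G = eulerPoly l' := by
  induction l with
  | nil =>
    intro G hG h0
    refine ⟨[], List.Sublist.refl _, ?_⟩
    obtain ⟨c, hc⟩ := Polynomial.isUnit_iff.1 (isUnit_of_dvd_one hG)
    rw [← hc.2] at h0 ⊢
    simp at h0
    simp [h0]
  | cons γ l ih =>
    intro G hG h0
    by_cases hγ : γ = 0
    · obtain ⟨l', hl', h⟩ := ih G (by simpa [hγ] using hG) h0
      exact ⟨l', hl'.cons γ, h⟩
    · have hirr : Irreducible (1 - C γ * X : ℂ[X]) := by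
        refine Polynomial.irreducible_of_degree_eq_one ?_
        have : (1 - C γ * X : ℂ[X]) = C (-γ) * X + C 1 := by simp; ring
        rw [this, Polynomial.degree_linear (neg_ne_zero.2 hγ)]
      by_cases hd : (1 - C γ * X : ℂ[X]) ∣ G
      · obtain ⟨G', rfl⟩ := hd
        rw [eulerPoly_cons] at hG
        obtain ⟨l', hl', h⟩ := ih G' ((mul_dvd_mul_iff_left hirr.ne_zero).1 hG)
          (by simpa [mul_coeff_zero] using h0)
        exact ⟨γ :: l', hl'.cons_cons γ, by rw [eulerPoly_cons, h]⟩
      · have hcop : IsCoprime (1 - C γ * X : ℂ[X]) G := (hirr.coprime_iff_not_dvd).2 hd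
        rw [eulerPoly_cons] at hG
        obtain ⟨l', hl', h⟩ := ih G (hcop.symm.dvd_of_dvd_mul_left hG) h0
        exact ⟨l', hl'.cons γ, h⟩

theorem norm_eval_eulerPoly_le {x : ℂ} {B : ℝ} (hB : 1 ≤ B) (l : List ℂ)
    (h : ∀ γ ∈ l, ‖1 - γ * x‖ ≤ B) {l' : List ℂ} (hl : l'.Sublist l) :
    ‖(eulerPoly l').eval x‖ ≤ B ^ l.length := by
  have h1 : ∀ l'' : List ℂ, (∀ γ ∈ l'', ‖1 - γ * x‖ ≤ B) →
      ‖(eulerPoly l'').eval x‖ ≤ B ^ l''.length := by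
    intro l''
    induction l'' with
    | nil => simp
    | cons γ l'' ih =>
      intro h
      rw [eulerPoly_cons, eval_mul, norm_mul, List.length_cons, pow_succ']
      refine mul_le_mul ?_ (ih fun δ hδ => h δ (List.mem_cons_of_mem _ hδ)) (norm_nonneg _)
        (by linarith)
      simpa using h γ (List.mem_cons_self)
  exact (h1 l' fun γ hγ => h γ (hl.subset hγ)).trans (pow_le_pow_right₀ hB hl.length_le)

theorem le_norm_eval_eulerPoly {x : ℂ} {b : ℝ} (hb0 : 0 ≤ b) (hb : b ≤ 1) (l : List ℂ)
    (h : ∀ γ ∈ l, b ≤ ‖1 - γ * x‖) {l' : List ℂ} (hl : l'.Sublist l) :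
    b ^ l.length ≤ ‖(eulerPoly l').eval x‖ := by
  have h1 : ∀ l'' : List ℂ, (∀ γ ∈ l'', b ≤ ‖1 - γ * x‖) →
      b ^ l''.length ≤ ‖(eulerPoly l'').eval x‖ := by
    intro l''
    induction l'' with
    | nil => simp
    | cons γ l'' ih =>
      intro h
      rw [eulerPoly_cons, eval_mul, norm_mul, List.length_cons, pow_succ']
      refine mul_le_mul ?_ (ih fun δ hδ => h δ (List.mem_cons_of_mem _ hδ)) (by positivity)
        (norm_nonneg _)
      simpa using h γ (List.mem_cons_self)
  exact (pow_le_pow_of_le_one hb0 hb hl.length_le).trans (h1 l' fun γ hγ => h γ (hl.subset hγ))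

/-- A crude exponential bound is enough: it serves only to make Mellin transforms converge for `Re
s` large. -/
theorem norm_le_of_recurrence {α β : ℂ} {a : ℕ → ℂ} {N : ℕ} {D R : ℝ} (hD : 0 ≤ D)
    (hR : ‖α + β‖ + ‖α * β‖ + 1 ≤ R) (hbase : ∀ n < N + 2, ‖a n‖ ≤ D)
    (ha : ∀ m ≥ N, a (m + 2) - (α + β) * a (m + 1) + α * β * a m = 0) (n : ℕ) :
    ‖a n‖ ≤ D * R ^ n := by
  have hR1 : 1 ≤ R := by linarith [norm_nonneg (α + β), norm_nonneg (α * β)]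
  induction n using Nat.strong_induction_on with
  | _ n ih =>
    by_cases hn : n < N + 2
    · exact (hbase n hn).trans (le_mul_of_one_le_right hD (one_le_pow₀ hR1))
    · obtain ⟨m, rfl⟩ : ∃ m, n = m + 2 := ⟨n - 2, by omega⟩
      have h0 := ih m (by omega)
      have h1 := ih (m + 1) (by omega)
      have h2 : a (m + 2) = (α + β) * a (m + 1) - α * β * a m := by
        linear_combination ha m (by omega)
      have h3 : D * R ^ m ≤ D * R ^ (m + 1) :=
        mul_le_mul_of_nonneg_left (pow_le_pow_right₀ hR1 (Nat.le_succ m)) hD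
      have h4 : 0 ≤ D * R ^ (m + 1) := by positivity
      rw [h2]
      calc ‖(α + β) * a (m + 1) - α * β * a m‖
          ≤ ‖α + β‖ * ‖a (m + 1)‖ + ‖α * β‖ * ‖a m‖ := by
            refine (norm_sub_le _ _).trans ?_
            rw [norm_mul, norm_mul (α * β)]
        _ ≤ ‖α + β‖ * (D * R ^ (m + 1)) + ‖α * β‖ * (D * R ^ (m + 1)) := by
            gcongr
            exact h0.trans h3
        _ ≤ R * (D * R ^ (m + 1)) := by nlinarith
        _ = D * R ^ (m + 2) := by ring

/-! ### Whittaker functions on the torus -/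

theorem HasConductor.eq_one {ψ : AddChar (v.adicCompletion F) Circle} (hψ : HasConductor ψ 0)
    {x : v.adicCompletion F} (hx : x ∈ ball v 0) : ψ x = 1 :=
  hψ.1 x (by simpa using mem_ball_zero.1 hx)

theorem HasConductor.exists_ne_one {ψ : AddChar (v.adicCompletion F) Circle}
    (hψ : HasConductor ψ 0) : ∃ x ∈ ball v (-1), ψ x ≠ 1 := by
  obtain ⟨x, hx, h⟩ := hψ.2
  exact ⟨x, by simpa [mem_ball] using hx, h⟩

/-- For such `y` there is `x ∈ 𝔭^m` with `ψ(yx) ≠ 1`, while invariance under `upper x` and the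
Whittaker property give `W(diag(y,1)) = ψ(yx) W(diag(y,1))`. -/
theorem IsWhittakerFunction.eq_zero_of_notMem {ψ : AddChar (v.adicCompletion F) Circle}
    (hψ : HasConductor ψ 0) {W : LocalGL v → ℂ} (hW : IsWhittakerFunction ψ W) {m : ℤ}
    (hm : ∀ x ∈ ball v m, rightTranslate (upper x) W = W) {y : (v.adicCompletion F)ˣ}
    (hy : (y : v.adicCompletion F) ∉ ball v (-m)) : W (diagOne y) = 0 := by
  obtain ⟨x₀, hx₀, hne⟩ := hψ.exists_ne_one
  obtain ⟨n, hn⟩ := exists_val_eq_exp y.ne_zero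
  have hnm : m < n := by
    by_contra h
    exact hy (by rw [mem_ball, hn, WithZero.exp_le_exp]; omega)
  have hx : x₀ / (y : v.adicCompletion F) ∈ ball v m := by
    rw [mem_ball] at hx₀ ⊢
    rw [map_div₀, hn, div_le_iff₀ (by simp), ← WithZero.exp_add]
    exact hx₀.trans (WithZero.exp_le_exp.2 (by omega))
  have h1 := congrFun (hm _ hx) (diagOne y)
  have h2 := hW.diagOne_upper_mul y (x₀ / (y : v.adicCompletion F)) 1
  rw [mul_one, mul_one, mul_div_cancel₀ _ y.ne_zero] at h2
  rw [rightTranslate, h2] at h1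
  by_contra h0
  apply hne
  have := mul_right_cancel₀ h0 (h1.trans (one_mul _).symm)
  exact Circle.ext (by simpa using this)

theorem continuous_torus {ψ : AddChar (v.adicCompletion F) Circle}
    {V : Submodule ℂ (LocalGL v → ℂ)} (hV : IsUnitaryGeneric ψ V) {W : LocalGL v → ℂ}
    (hW : W ∈ V) : Continuous fun y : (v.adicCompletion F)ˣ => W (diagOne y) := by
  obtain ⟨m, -, -, -, hm⟩ := hV.exists_level hW
  refine IsLocallyConstant.continuous ((IsLocallyConstant.iff_eventually_eq _).2 fun y₀ => ?_)
  have hopen : IsOpen {y : (v.adicCompletion F)ˣ |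
      ((y₀⁻¹ * y : (v.adicCompletion F)ˣ) : v.adicCompletion F) - 1 ∈ ball v m} :=
    (isOpen_ball m).preimage
      ((Units.continuous_val.comp (continuous_const_mul _)).sub continuous_const)
  filter_upwards [hopen.mem_nhds (by simp [zero_mem])] with y hy
  have := congrFun (hm _ hy) (diagOne y₀)
  rw [rightTranslate, ← diagOne_mul, mul_inv_cancel_left] at this
  exact this

/-- The function `φ` on `F_v^×` is continuous, vanishes far from `0`, and grows at most
exponentially near `0`. -/
def HasMellin (ϖ : (v.adicCompletion F)ˣ) (φ : (v.adicCompletion F)ˣ → ℂ) : Prop :=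
  Continuous φ ∧ ∃ (A : ℕ) (D R : ℝ), 0 ≤ D ∧ 1 ≤ R ∧
    (∀ (n : ℤ) (u : (v.adicCompletion F)ˣ), Valued.v (u : v.adicCompletion F) = 1 → n < -A →
      φ (ϖ ^ n * u) = 0) ∧
    ∀ (n : ℕ) (u : (v.adicCompletion F)ˣ), Valued.v (u : v.adicCompletion F) = 1 →
      ‖φ (ϖ ^ ((n : ℤ) - A) * u)‖ ≤ D * R ^ n

section

variable {ϖ : (v.adicCompletion F)ˣ}

theorem bound_mono {φ : (v.adicCompletion F)ˣ → ℂ} {A A' : ℕ} (hA : A ≤ A') {D R : ℝ} (hD : 0 ≤ D)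
    (hR : 1 ≤ R)
    (h0 : ∀ (n : ℤ) (u : (v.adicCompletion F)ˣ), Valued.v (u : v.adicCompletion F) = 1 → n < -A →
      φ (ϖ ^ n * u) = 0)
    (hb : ∀ (n : ℕ) (u : (v.adicCompletion F)ˣ), Valued.v (u : v.adicCompletion F) = 1 →
      ‖φ (ϖ ^ ((n : ℤ) - A) * u)‖ ≤ D * R ^ n) (n : ℕ) (u : (v.adicCompletion F)ˣ)
    (hu : Valued.v (u : v.adicCompletion F) = 1) :
    ‖φ (ϖ ^ ((n : ℤ) - A') * u)‖ ≤ D * R ^ n := by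
  by_cases hn : (n : ℤ) - A' < -A
  · rw [h0 _ u hu hn, norm_zero]
    positivity
  · have := hb (n - (A' - A)) u hu
    rw [show ((n - (A' - A) : ℕ) : ℤ) - A = (n : ℤ) - A' by omega] at this
    exact this.trans (mul_le_mul_of_nonneg_left (pow_le_pow_right₀ hR (by omega)) hD)

theorem HasMellin.mul {φ φ' : (v.adicCompletion F)ˣ → ℂ} (h : HasMellin ϖ φ)
    (h' : HasMellin ϖ φ') : HasMellin ϖ fun y => φ y * φ' y := by
  obtain ⟨hc, A, D, R, hD, hR, h0, hb⟩ := h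
  obtain ⟨hc', A', D', R', hD', hR', h0', hb'⟩ := h'
  refine ⟨hc.mul hc', A + A', D * D', R * R', by positivity,
    one_le_mul_of_one_le_of_one_le hR hR', fun n u hu hn => ?_, fun n u hu => ?_⟩
  · simp only [h0 n u hu (by push_cast at hn; omega), zero_mul]
  · rw [norm_mul]
    have h1 := bound_mono (A' := A + A') (by omega) hD hR h0 hb n u hu
    have h2 := bound_mono (A' := A + A') (by omega) hD' hR' h0' hb' n u hu
    calc _ ≤ (D * R ^ n) * (D' * R' ^ n) := mul_le_mul h1 h2 (norm_nonneg _) (by positivity)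
      _ = _ := by rw [mul_pow]; ring

theorem HasMellin.conj {φ : (v.adicCompletion F)ˣ → ℂ} (h : HasMellin ϖ φ) :
    HasMellin ϖ fun y => starRingEnd ℂ (φ y) := by
  obtain ⟨hc, A, D, R, hD, hR, h0, hb⟩ := h
  exact ⟨Complex.continuous_conj.comp hc, A, D, R, hD, hR,
    fun n u hu hn => by simp only [h0 n u hu hn, map_zero],
    fun n u hu => by rw [RCLike.norm_conj]; exact hb n u hu⟩

theorem exists_bound_of_continuous {φ : (v.adicCompletion F)ˣ → ℂ} (hc : Continuous φ) (A N : ℕ) :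
    ∃ D : ℝ, 0 ≤ D ∧ ∀ n < N, ∀ u : (v.adicCompletion F)ˣ, Valued.v (u : v.adicCompletion F) = 1 →
      ‖φ (ϖ ^ ((n : ℤ) - A) * u)‖ ≤ D := by
  induction N with
  | zero => exact ⟨0, le_rfl, by simp⟩
  | succ N ih =>
    obtain ⟨D, hD, h⟩ := ih
    obtain ⟨D', h'⟩ := isCompact_unitSet.exists_bound_of_continuousOn (s := unitSet v)
      (f := fun u => φ (ϖ ^ ((N : ℤ) - A) * u)) (hc.comp (continuous_const_mul _)).continuousOn
    refine ⟨max D D', le_max_of_le_left hD, fun n hn u hu => ?_⟩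
    rcases Nat.lt_succ_iff_lt_or_eq.1 hn with h1 | rfl
    · exact (h n h1 u hu).trans (le_max_left _ _)
    · exact (h' u hu).trans (le_max_right _ _)

/-- The germs at `0` of the functions in `V` on the torus are annihilated by `(E - α)(E - β)`,
where `E` is the translation by `ϖ`. -/
def HasExponents (ϖ : (v.adicCompletion F)ˣ) (V : Submodule ℂ (LocalGL v → ℂ)) (α β : ℂ) : Prop :=
  ∀ W ∈ V, ∃ N : ℕ, ∀ y : (v.adicCompletion F)ˣ, (y : v.adicCompletion F) ∈ ball v N →
    W (diagOne (ϖ ^ 2 * y)) - (α + β) * W (diagOne (ϖ * y)) + α * β * W (diagOne y) = 0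

theorem HasExponents.recurrence
    (hϖ : Valued.v (ϖ : v.adicCompletion F) = WithZero.exp (-1 : ℤ))
    {V : Submodule ℂ (LocalGL v → ℂ)} {α β : ℂ} (h : HasExponents ϖ V α β) {W : LocalGL v → ℂ}
    (hW : W ∈ V) : ∃ N : ℕ, ∀ n : ℤ, N ≤ n → ∀ u : (v.adicCompletion F)ˣ,
      Valued.v (u : v.adicCompletion F) = 1 →
      W (diagOne (ϖ ^ (n + 2) * u)) - (α + β) * W (diagOne (ϖ ^ (n + 1) * u)) +
        α * β * W (diagOne (ϖ ^ n * u)) = 0 := by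
  obtain ⟨N, hN⟩ := h W hW
  refine ⟨N, fun n hn u hu => ?_⟩
  have := hN (ϖ ^ n * u) (by
    rw [Units.val_mul]
    refine ball_mono hn ?_
    rw [mul_comm, unit_mul_mem_ball hu]
    exact zpow_mem_ball hϖ n)
  rw [← mul_assoc, ← mul_assoc, ← zpow_natCast ϖ 2, ← zpow_add, ← zpow_one_add, add_comm _ n,
    add_comm 1 n] at this
  exact_mod_cast this

/-- Three ranges: far from `0` the function vanishes, on finitely many shells it is bounded by
compactness, and near `0` the recurrence controls its growth. -/
theorem HasExponents.hasMellin {ψ : AddChar (v.adicCompletion F) Circle}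
    (hψ : HasConductor ψ 0)
    (hϖ : Valued.v (ϖ : v.adicCompletion F) = WithZero.exp (-1 : ℤ))
    {V : Submodule ℂ (LocalGL v → ℂ)} (hV : IsUnitaryGeneric ψ V) {α β : ℂ}
    (h : HasExponents ϖ V α β) {W : LocalGL v → ℂ} (hW : W ∈ V) :
    HasMellin ϖ fun y => W (diagOne y) := by
  have hc := continuous_torus hV hW
  obtain ⟨A, -, hA, -, -⟩ := hV.exists_level hW
  obtain ⟨N, hN⟩ := h.recurrence hϖ hW
  obtain ⟨D, hD, hb⟩ := exists_bound_of_continuous (ϖ := ϖ) hc A (N + A + 2)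
  refine ⟨hc, A, D, ‖α + β‖ + ‖α * β‖ + 1, hD,
    by linarith [norm_nonneg (α + β), norm_nonneg (α * β)], fun n u hu hn => ?_, fun n u hu => ?_⟩
  · refine (hV.isWhittakerFunction hW).eq_zero_of_notMem hψ hA fun hmem => ?_
    rw [mem_ball, Units.val_mul, map_mul, val_zpow hϖ, hu, mul_one, WithZero.exp_le_exp] at hmem
    omega
  · refine norm_le_of_recurrence (a := fun n : ℕ => W (diagOne (ϖ ^ ((n : ℤ) - A) * u)))
      (N := N + A) hD le_rfl (fun n hn => hb n hn u hu) (fun m hm => ?_) n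
    have := hN ((m : ℤ) - A) (by omega) u hu
    rw [show ((m + 2 : ℕ) : ℤ) - A = (m : ℤ) - A + 2 by push_cast; ring,
      show ((m + 1 : ℕ) : ℤ) - A = (m : ℤ) - A + 1 by push_cast; ring]
    exact this

/-! ### Mellin transforms as Laurent polynomials -/

theorem recOp_shift (l : List ℂ) : ∀ (c : ℕ → ℂ) (k n : ℕ),
    recOp l (fun m => c (m + k)) n = recOp l c (n + k) := by
  induction l with
  | nil => intro c k n; rfl
  | cons γ l ih =>
    intro c k n
    simp only [recOp]
    rw [← ih]
    congr 1
    funext m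
    rw [add_right_comm]

theorem recOp_unitIntegral (l : List ℂ) : ∀ φ : ℕ → (v.adicCompletion F)ˣ → ℂ,
    (∀ n, Continuous (φ n)) → ∀ n, recOp l (fun m => unitIntegral v (φ m)) n =
      unitIntegral v fun u => recOp l (fun m => φ m u) n := by
  induction l with
  | nil => intro φ _ n; rfl
  | cons γ l ih =>
    intro φ hφ n
    simp only [recOp]
    rw [← ih (fun n u => φ (n + 1) u - γ * φ n u)
      (fun n => (hφ _).sub (continuous_const.mul (hφ _)))]
    congr 1
    funext m
    unfold unitIntegral
    rw [integral_sub (integrableOn_unitSet (hφ _))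
      ((integrableOn_unitSet (hφ m)).const_mul γ), integral_const_mul]

/-- The Mellin transform is `q^(zA)` times a power series in `q^(-z)` whose coefficients are the
averages over shells. A recurrence for these averages near `0` makes it rational, with denominator
the Euler polynomial of the recurrence. -/
theorem exists_mellin_eq (hϖ : Valued.v (ϖ : v.adicCompletion F) = WithZero.exp (-1 : ℤ))
    {φ : (v.adicCompletion F)ˣ → ℂ} (hφ : HasMellin ϖ φ) (l : List ℂ)
    (hl : ∃ N, ∀ n ≥ N, recOp l (fun m : ℕ => unitIntegral v fun u => φ (ϖ ^ m * u)) n = 0) :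
    ∃ (A : ℕ) (Q : ℂ[X]) (R : ℝ), 1 ≤ R ∧ ∀ z : ℂ, ‖(residueCard v : ℂ) ^ (-z)‖ * R < 1 →
      Integrable (fun y => φ y * ((‖(y : v.adicCompletion F)‖ : ℝ) : ℂ) ^ z) (haarUnits v) ∧
      (eulerPoly l).eval ((residueCard v : ℂ) ^ (-z)) *
        (integralUnits v fun y => φ y * ((‖(y : v.adicCompletion F)‖ : ℝ) : ℂ) ^ z) =
        ((residueCard v : ℂ) ^ z) ^ A * Q.eval ((residueCard v : ℂ) ^ (-z)) := by
  obtain ⟨hc, A, D, R, hD, hR, h0, hb⟩ := hφ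
  obtain ⟨N, hN⟩ := hl
  set c : ℕ → ℂ := fun n => unitIntegral v fun u => φ (ϖ ^ ((n : ℤ) - A) * u) with hc_def
  have hshift : (fun m : ℕ => unitIntegral v fun u => φ (ϖ ^ m * u)) = fun m => c (m + A) := by
    funext m
    simp only [hc_def]
    rw [show ((m + A : ℕ) : ℤ) - A = m by push_cast; ring]
    simp only [zpow_natCast]
  rw [hshift] at hN
  obtain ⟨Q, hQ⟩ := exists_eulerPoly_mul_eq l c ⟨N + A, fun n hn => by
    have := hN (n - A) (by omega)
    rwa [recOp_shift, Nat.sub_add_cancel (by omega)] at this⟩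
  refine ⟨A, Q, R, hR, fun z hz => ?_⟩
  obtain ⟨h1, h2, h3⟩ := integralUnits_mul_cpow hϖ hc A h0 (by linarith) hb hz
  refine ⟨h1, ?_⟩
  rw [h3, mul_left_comm, eval_mul_tsum_eq hQ h2]

variable (v) in
/-- The function `z` agrees with a Laurent polynomial in `N(𝔭_v)^{-s}` for `Re s` large. -/
def IsLaurent (z : ℂ → ℂ) : Prop :=
  ∃ (m : ℕ) (Q : ℂ[X]), ∀ᶠ s in farRight, z s = laurentIn v m Q s

instance : farRight.NeBot := by
  refine comap_neBot fun t ht => ?_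
  obtain ⟨x, hx⟩ := (Filter.nonempty_of_mem ht)
  exact ⟨(x : ℂ), by simpa using hx⟩

theorem residueCard_ne_zero : (residueCard v : ℂ) ≠ 0 := by
  exact_mod_cast (residueCard_pos (v := v)).ne'

theorem laurentIn_eq (m : ℕ) (Q : ℂ[X]) (s : ℂ) :
    laurentIn v m Q s = ((residueCard v : ℂ) ^ (-s)) ^ (-(m : ℤ)) *
      Q.eval ((residueCard v : ℂ) ^ (-s)) := by
  rw [laurentIn, zpow_neg, zpow_natCast, Complex.cpow_neg, inv_pow, inv_inv, Complex.cpow_nat_mul]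

theorem residueCard_cpow_ne_zero (s : ℂ) : (residueCard v : ℂ) ^ s ≠ 0 := by
  rw [Ne, Complex.cpow_eq_zero_iff]
  exact fun h => residueCard_ne_zero h.1

theorem norm_residueCard_cpow (s : ℂ) :
    ‖(residueCard v : ℂ) ^ (-s)‖ = (residueCard v : ℝ) ^ (-s.re) := by
  rw [Complex.norm_natCast_cpow_of_pos (zero_lt_one.trans one_lt_residueCard), Complex.neg_re]

theorem tendsto_norm_residueCard_cpow :
    Tendsto (fun s : ℂ => ‖(residueCard v : ℂ) ^ (-s)‖) farRight (nhds 0) := by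
  simp only [norm_residueCard_cpow]
  have hq : (1 : ℝ) < residueCard v := by exact_mod_cast one_lt_residueCard
  have h1 : Tendsto (fun x : ℝ => (residueCard v : ℝ) ^ (-x)) atTop (nhds 0) := by
    have := tendsto_rpow_atTop_of_base_lt_one (residueCard v : ℝ)⁻¹
      (by linarith [inv_pos.2 (residueCard_pos (v := v))]) (inv_lt_one_of_one_lt₀ hq)
    refine this.congr fun x => ?_
    rw [Real.inv_rpow residueCard_pos.le, Real.rpow_neg residueCard_pos.le]
  exact h1.comp tendsto_comap

theorem eventually_farRight_of_norm_lt {ε : ℝ} (hε : 0 < ε) :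
    ∀ᶠ s : ℂ in farRight, ‖(residueCard v : ℂ) ^ (-s)‖ < ε :=
  (tendsto_norm_residueCard_cpow).eventually_lt_const hε

theorem IsLaurent.mul {z z' : ℂ → ℂ} (h : IsLaurent v z) (h' : IsLaurent v z') :
    IsLaurent v fun s => z s * z' s := by
  obtain ⟨m, Q, h⟩ := h
  obtain ⟨m', Q', h'⟩ := h'
  refine ⟨m + m', Q * Q', ?_⟩
  filter_upwards [h, h'] with s hs hs'
  rw [hs, hs', laurentIn_eq, laurentIn_eq, laurentIn_eq, eval_mul, Nat.cast_add, neg_add,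
    zpow_add₀ (residueCard_cpow_ne_zero _)]
  ring

theorem IsLaurent.add {z z' : ℂ → ℂ} (h : IsLaurent v z) (h' : IsLaurent v z') :
    IsLaurent v fun s => z s + z' s := by
  obtain ⟨m, Q, h⟩ := h
  obtain ⟨m', Q', h'⟩ := h'
  refine ⟨m + m', X ^ m' * Q + X ^ m * Q', ?_⟩
  filter_upwards [h, h'] with s hs hs'
  have h0 := residueCard_cpow_ne_zero (v := v) (-s)
  rw [hs, hs', laurentIn_eq, laurentIn_eq, laurentIn_eq, eval_add, eval_mul, eval_mul, eval_pow,
    eval_pow, eval_X, Nat.cast_add, neg_add, zpow_add₀ h0, zpow_neg, zpow_neg, zpow_natCast,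
    zpow_natCast]
  field_simp

theorem IsLaurent.eval (Q : ℂ[X]) :
    IsLaurent v fun s => Q.eval ((residueCard v : ℂ) ^ (-s)) :=
  ⟨0, Q, Eventually.of_forall fun s => by simp [laurentIn_eq]⟩

theorem IsLaurent.laurentIn (m : ℕ) (Q : ℂ[X]) : IsLaurent v (laurentIn v m Q) :=
  ⟨m, Q, Eventually.of_forall fun _ => rfl⟩

theorem IsLaurent.const (c : ℂ) : IsLaurent v fun _ => c := by
  simpa using IsLaurent.eval (v := v) (C c)

theorem IsLaurent.congr {z z' : ℂ → ℂ} (h : IsLaurent v z) (hz : ∀ᶠ s in farRight, z s = z' s) :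
    IsLaurent v z' := by
  obtain ⟨m, Q, h⟩ := h
  exact ⟨m, Q, by filter_upwards [h, hz] with s h1 h2; rw [← h2, h1]⟩

theorem IsLaurent.sum {ι : Type*} (t : Finset ι) {z : ι → ℂ → ℂ} (h : ∀ i ∈ t, IsLaurent v (z i)) :
    IsLaurent v fun s => ∑ i ∈ t, z i s := by
  classical
  induction t using Finset.induction_on with
  | empty => simpa using IsLaurent.const (v := v) 0
  | insert i t hi ih =>
    simp only [Finset.sum_insert hi]
    exact (h i (Finset.mem_insert_self _ _)).add
      (ih fun j hj => h j (Finset.mem_insert_of_mem hj))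

end

/-! ### Principal series vectors -/

/-- The action of `GL₂(𝔬_v)` on row vectors. -/
def rowAct (x : v.adicCompletion F × v.adicCompletion F) (k : IntegralGL v) :
    v.adicCompletion F × v.adicCompletion F :=
  (x.1 * k 0 0 + x.2 * k 1 0, x.1 * k 0 1 + x.2 * k 1 1)

theorem rowAct_mul (x : v.adicCompletion F × v.adicCompletion F) (k k' : IntegralGL v) :
    rowAct x (k * k') = rowAct (rowAct x k) k' := by
  have h : ∀ i j, ((k * k') i j : v.adicCompletion F) = k i 0 * k' 0 j + k i 1 * k' 1 j := by
    intro i j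
    rw [Units.val_mul, Matrix.mul_apply, Fin.sum_univ_two]
    rfl
  ext1 <;> simp only [rowAct, h] <;> ring

theorem rowAct_one (x : v.adicCompletion F × v.adicCompletion F) : rowAct x 1 = x := by
  ext1 <;> simp [rowAct]

theorem continuous_rowAct : Continuous fun p : IntegralGL v × (v.adicCompletion F × v.adicCompletion F) =>
    rowAct p.2 p.1 := by
  have h : ∀ i j, Continuous fun k : IntegralGL v => (k i j : v.adicCompletion F) := fun i j =>
    continuous_subtype_val.comp
      ((continuous_apply j).comp (Matrix.GeneralLinearGroup.continuous_apply _ continuous_id i))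
  have h' : ∀ i j, Continuous fun p : IntegralGL v × (v.adicCompletion F × v.adicCompletion F) =>
      (p.1 i j : v.adicCompletion F) := fun i j => (h i j).comp continuous_fst
  have h1 : Continuous fun p : IntegralGL v × (v.adicCompletion F × v.adicCompletion F) => p.2.1 :=
    continuous_fst.comp continuous_snd
  have h2 : Continuous fun p : IntegralGL v × (v.adicCompletion F × v.adicCompletion F) => p.2.2 :=
    continuous_snd.comp continuous_snd
  exact (((h1.mul (h' 0 0)).add (h2.mul (h' 1 0))).prodMk
    ((h1.mul (h' 0 1)).add (h2.mul (h' 1 1))))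

/-- Local constancy gives an open stabilising neighbourhood at each point, and compactness of the
support makes it uniform through the tube lemma. -/
theorem IsSchwartzBruhat.exists_isOpen {Φ : v.adicCompletion F × v.adicCompletion F → ℂ}
    (hΦ : IsSchwartzBruhat Φ) : ∃ U : Subgroup (IntegralGL v), IsOpen (U : Set (IntegralGL v)) ∧
      ∀ u ∈ U, ∀ x, Φ (rowAct x u) = Φ x := by
  let U : Subgroup (IntegralGL v) :=
    { carrier := {u | ∀ x, Φ (rowAct x u) = Φ x}
      one_mem' := fun x => by rw [rowAct_one]
      mul_mem' := fun {a b} ha hb x => by rw [rowAct_mul, hb, ha]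
      inv_mem' := fun {a} ha x => by
        rw [← ha (rowAct x a⁻¹), ← rowAct_mul, inv_mul_cancel, rowAct_one] }
  refine ⟨U, ?_, fun u hu => hu⟩
  -- `S` is the saturation of the support under the compact group, so `Φ` vanishes on the whole
  -- orbit of a point outside `S`.
  obtain ⟨S, hS, hSmem⟩ : ∃ S : Set (v.adicCompletion F × v.adicCompletion F), IsCompact S ∧
      ∀ (k : IntegralGL v), ∀ x ∈ tsupport Φ, rowAct x k ∈ S :=
    ⟨_, (isCompact_univ.prod hΦ.2).image continuous_rowAct,
      fun k x hx => ⟨(k, x), ⟨trivial, hx⟩, rfl⟩⟩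
  obtain ⟨O, hO, hOmem⟩ : ∃ O : Set (IntegralGL v × (v.adicCompletion F × v.adicCompletion F)),
      IsOpen O ∧ ∀ k x, (k, x) ∈ O ↔ Φ (rowAct x k) - Φ x = 0 :=
    ⟨_, ((hΦ.1.comp_continuous continuous_rowAct).sub
      (hΦ.1.comp_continuous continuous_snd)).isOpen_fiber 0, fun k x => Iff.rfl⟩
  obtain ⟨u, w, hu, -, h1u, hSw, huw⟩ :=
    generalized_tube_lemma (isCompact_singleton (x := (1 : IntegralGL v))) hS hO
    (by
      rintro ⟨a, x⟩ ⟨ha, -⟩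
      obtain rfl : a = 1 := ha
      rw [hOmem, rowAct_one, sub_self])
  refine Subgroup.isOpen_of_mem_nhds U (g := 1)
    (mem_of_superset (hu.mem_nhds (h1u rfl)) fun a ha x => ?_)
  by_cases hx : x ∈ S
  · exact sub_eq_zero.1 ((hOmem a x).1 (huw ⟨ha, hSw hx⟩))
  · have h1 : x ∉ tsupport Φ := fun h => hx (by simpa only [rowAct_one] using hSmem 1 x h)
    have h2 : rowAct x a ∉ tsupport Φ := fun h => hx (by
      simpa only [← rowAct_mul, mul_inv_cancel, rowAct_one] using hSmem a⁻¹ _ h)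
    rw [image_eq_zero_of_notMem_tsupport h1, image_eq_zero_of_notMem_tsupport h2]

theorem norm_det_integralIncl (k : IntegralGL v) :
    ‖((integralIncl v k : LocalGL v) : Matrix (Fin 2) (Fin 2) (v.adicCompletion F)).det‖ = 1 :=
  norm_eq_one (val_det_integralIncl k)

theorem principalVector_diagOne_mul (Φ : v.adicCompletion F × v.adicCompletion F → ℂ) (s : ℂ)
    (y : (v.adicCompletion F)ˣ) (g : LocalGL v) :
    principalVector Φ s (diagOne y * g) =
      ((‖(y : v.adicCompletion F)‖ : ℝ) : ℂ) ^ s * principalVector Φ s g := by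
  have h1 : ((diagOne y * g : LocalGL v) : Matrix (Fin 2) (Fin 2) (v.adicCompletion F)).det =
      y * (g : Matrix (Fin 2) (Fin 2) (v.adicCompletion F)).det := by
    rw [Units.val_mul, Matrix.det_mul, coe_diagOne]
    simp
  have h2 : ∀ j, (diagOne y * g : LocalGL v) 1 j = g 1 j := by
    intro j
    rw [Units.val_mul, coe_diagOne, Matrix.mul_apply, Fin.sum_univ_two]
    simp
  unfold principalVector
  rw [h1, norm_mul, Complex.ofReal_mul, Complex.mul_cpow_ofReal_nonneg (norm_nonneg _)
    (norm_nonneg _), h2, h2, mul_assoc]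

theorem principalVector_integral (Φ : v.adicCompletion F × v.adicCompletion F → ℂ) (s : ℂ)
    (k : IntegralGL v) : principalVector Φ s (integralIncl v k) =
      integralUnits v fun t => Φ ((t : v.adicCompletion F) * k 1 0, (t : v.adicCompletion F) * k 1 1) *
        ((‖(t : v.adicCompletion F)‖ : ℝ) : ℂ) ^ (2 * s) := by
  unfold principalVector
  rw [norm_det_integralIncl, Complex.ofReal_one, Complex.one_cpow, one_mul]
  rfl

theorem principalVector_mul_right {Φ : v.adicCompletion F × v.adicCompletion F → ℂ}
    {u : IntegralGL v} (hu : ∀ x, Φ (rowAct x u) = Φ x) (s : ℂ) (k : IntegralGL v) :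
    principalVector Φ s (integralIncl v (k * u)) = principalVector Φ s (integralIncl v k) := by
  rw [principalVector_integral, principalVector_integral]
  congr 1
  funext t
  congr 1
  refine Eq.trans (congrArg Φ ?_) (hu _)
  have h : ∀ i j, ((k * u) i j : v.adicCompletion F) = k i 0 * u 0 j + k i 1 * u 1 j := by
    intro i j
    rw [Units.val_mul, Matrix.mul_apply, Fin.sum_univ_two]
    rfl
  ext1 <;> simp only [rowAct, h] <;> ring

theorem exists_mem_ball_of_isCompact {S : Set (v.adicCompletion F × v.adicCompletion F)}
    (hS : IsCompact S) : ∃ A : ℕ, ∀ x ∈ S, x.1 ∈ ball v (-A) ∧ x.2 ∈ ball v (-A) := by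
  obtain ⟨D, hD⟩ := hS.isBounded.exists_norm_le
  have hq : (1 : ℝ) < residueCard v := by exact_mod_cast one_lt_residueCard
  obtain ⟨A, hA⟩ := pow_unbounded_of_one_lt D hq
  have key : ∀ y : v.adicCompletion F, ‖y‖ ≤ D → y ∈ ball v (-A) := by
    intro y hy
    by_cases h0 : y = 0
    · rw [h0]; exact zero_mem _
    · obtain ⟨n, hn⟩ := exists_val_eq_exp h0
      rw [mem_ball, hn, WithZero.exp_le_exp, neg_neg]
      rw [norm_eq_zpow hn] at hy
      have := hy.trans_lt hA
      rw [← zpow_natCast] at this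
      exact ((zpow_lt_zpow_iff_right₀ hq).1 this).le
  exact ⟨A, fun x hx => ⟨key _ ((norm_fst_le x).trans (hD x hx)),
    key _ ((norm_snd_le x).trans (hD x hx))⟩⟩

section

variable {ϖ : (v.adicCompletion F)ˣ}

/-- The bottom row of an integral invertible matrix contains a unit, so `Φ` vanishes at large
multiples of it; at small multiples `Φ` is the constant `Φ 0`, which is annihilated by `E - 1`. -/
theorem row_hasMellin (hϖ : Valued.v (ϖ : v.adicCompletion F) = WithZero.exp (-1 : ℤ))
    {Φ : v.adicCompletion F × v.adicCompletion F → ℂ} (hΦ : IsSchwartzBruhat Φ) (k : IntegralGL v) :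
    HasMellin ϖ (fun t => Φ ((t : v.adicCompletion F) * k 1 0, (t : v.adicCompletion F) * k 1 1)) ∧
    ∃ N, ∀ n ≥ N, recOp [1] (fun m : ℕ => unitIntegral v fun u =>
      Φ (((ϖ ^ m * u : (v.adicCompletion F)ˣ) : v.adicCompletion F) * k 1 0,
        ((ϖ ^ m * u : (v.adicCompletion F)ˣ) : v.adicCompletion F) * k 1 1)) n = 0 := by
  have hc : Continuous Φ := hΦ.1.continuous
  obtain ⟨A, hA⟩ := exists_mem_ball_of_isCompact hΦ.2
  obtain ⟨D, hD⟩ := hc.bounded_above_of_compact_support hΦ.2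
  refine ⟨⟨hc.comp ((Units.continuous_val.mul continuous_const).prodMk
    (Units.continuous_val.mul continuous_const)), A, D, 1, (norm_nonneg _).trans (hD 0), le_rfl,
    fun n u hu hn => ?_, fun n u _ => by simpa using hD _⟩, ?_⟩
  · by_contra hne
    have h1 := hA _ (subset_tsupport _ hne)
    have key : ∀ c : v.adicCompletion F, Valued.v c = 1 →
        ((ϖ ^ n * u : (v.adicCompletion F)ˣ) : v.adicCompletion F) * c ∉ ball v (-A) := by
      intro c hc' hmem
      rw [mul_comm, unit_mul_mem_ball hc', mem_ball, Units.val_mul, map_mul, val_zpow hϖ, hu,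
        mul_one, WithZero.exp_le_exp] at hmem
      omega
    rcases val_eq_one_or_mem (coe_mem_ball (k 1 1)) with h | h
    · exact key _ h h1.2
    · exact key _ (val_entry_one_zero (Or.inl h)) h1.1
  · have hn0 : {x | Φ x = Φ 0} ∈ nhds (0 : v.adicCompletion F × v.adicCompletion F) :=
      (hΦ.1.isOpen_fiber _).mem_nhds rfl
    rw [show (0 : v.adicCompletion F × v.adicCompletion F) = (0, 0) from rfl,
      mem_nhds_prod_iff] at hn0
    obtain ⟨s, hs, t, ht, hst⟩ := hn0
    obtain ⟨N₁, h₁⟩ := exists_ball_subset hs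
    obtain ⟨N₂, h₂⟩ := exists_ball_subset ht
    have key : ∀ n : ℕ, n ≥ N₁ + N₂ → (unitIntegral v fun u =>
        Φ (((ϖ ^ n * u : (v.adicCompletion F)ˣ) : v.adicCompletion F) * k 1 0,
        ((ϖ ^ n * u : (v.adicCompletion F)ˣ) : v.adicCompletion F) * k 1 1)) = Φ 0 := by
      intro n hn
      rw [unitIntegral_congr (H' := fun _ => Φ 0), unitIntegral_const]
      intro u hu
      have hmem : ∀ c : v.adicCompletionIntegers F, ((ϖ ^ n * u : (v.adicCompletion F)ˣ) :
          v.adicCompletion F) * c ∈ ball v n := by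
        intro c
        have h1 : ((ϖ ^ n * u : (v.adicCompletion F)ˣ) : v.adicCompletion F) ∈ ball v n := by
          rw [mem_ball, Units.val_mul, map_mul, hu, mul_one, ← zpow_natCast, val_zpow hϖ]
        simpa using mul_mem_ball h1 (coe_mem_ball c)
      exact hst (Set.mk_mem_prod (h₁ _ (ball_mono (by omega) (hmem _)))
        (h₂ _ (ball_mono (by omega) (hmem _))))
    refine ⟨N₁ + N₂, fun n hn => ?_⟩
    simp only [recOp]
    rw [key n hn, key (n + 1) (by omega)]
    ring

/-- On the compact group `f_{Φ,s}` is a Tate integral at `2s`, so its only denominator is `1 -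
q^(-2s) = (1 - X)(1 + X)` with `X = q^(-s)`. -/
theorem isLaurent_principalVector
    (hϖ : Valued.v (ϖ : v.adicCompletion F) = WithZero.exp (-1 : ℤ))
    {Φ : v.adicCompletion F × v.adicCompletion F → ℂ} (hΦ : IsSchwartzBruhat Φ) (k : IntegralGL v) :
    IsLaurent v fun s => (eulerPoly [1, -1]).eval ((residueCard v : ℂ) ^ (-s)) *
      principalVector Φ s (integralIncl v k) := by
  obtain ⟨h1, h2⟩ := row_hasMellin hϖ hΦ k
  obtain ⟨A, Q, R, hR, h⟩ := exists_mellin_eq hϖ h1 [1] h2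
  refine ⟨2 * A, Q.comp (X ^ 2), ?_⟩
  have hR0 : 0 < R := by linarith
  filter_upwards [eventually_farRight_of_norm_lt (v := v) (ε := min 1 R⁻¹)
    (lt_min one_pos (inv_pos.2 hR0))] with s hs
  have hsq : (residueCard v : ℂ) ^ (-(2 * s)) = ((residueCard v : ℂ) ^ (-s)) ^ 2 := by
    rw [← Complex.cpow_nat_mul]
    congr 1
    push_cast
    ring
  have hsq' : (residueCard v : ℂ) ^ (2 * s) = (((residueCard v : ℂ) ^ (-s)) ^ 2)⁻¹ := by
    rw [← hsq, Complex.cpow_neg, inv_inv]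
  obtain ⟨-, h3⟩ := h (2 * s) (by
    rw [hsq, norm_pow]
    have h4 := hs.trans_le (min_le_left _ _)
    have h5 := hs.trans_le (min_le_right _ _)
    have h6 : ‖(residueCard v : ℂ) ^ (-s)‖ ^ 2 ≤ ‖(residueCard v : ℂ) ^ (-s)‖ := by
      rw [sq]
      exact mul_le_of_le_one_left (norm_nonneg _) h4.le
    calc _ ≤ ‖(residueCard v : ℂ) ^ (-s)‖ * R := by gcongr
      _ < R⁻¹ * R := by gcongr
      _ = 1 := inv_mul_cancel₀ hR0.ne')
  have hE : (eulerPoly [1, -1]).eval ((residueCard v : ℂ) ^ (-s)) =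
      (eulerPoly [1]).eval ((residueCard v : ℂ) ^ (-(2 * s))) := by
    rw [hsq]
    simp
    ring
  rw [principalVector_integral, hE, h3, laurentIn_eq, hsq, hsq', eval_comp, eval_pow, eval_X]
  congr 1
  rw [zpow_neg, zpow_natCast, pow_mul, inv_pow]

end

/-! ### Rankin–Selberg integrals -/

/-- The integral of `W W̄' |y|^{s-1}` over the torus. -/
def torusIntegral (W W' : LocalGL v → ℂ) (s : ℂ) : ℂ :=
  integralUnits v fun y => W (diagOne y) * starRingEnd ℂ (W' (diagOne y)) *
    ((‖(y : v.adicCompletion F)‖ : ℝ) : ℂ) ^ (s - 1)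

/-- The sequence of averages of `W W̄'` over the shells of the torus. -/
def shellSeq (ϖ : (v.adicCompletion F)ˣ) (W W' : LocalGL v → ℂ) (n : ℕ) : ℂ :=
  unitIntegral v fun u => W (diagOne (ϖ ^ n * u)) * starRingEnd ℂ (W' (diagOne (ϖ ^ n * u)))

theorem cpow_sub_one_eq (s : ℂ) :
    (residueCard v : ℂ) ^ (-(s - 1)) = residueCard v * (residueCard v : ℂ) ^ (-s) := by
  rw [show -(s - 1) = 1 + -s by ring, Complex.cpow_add _ _ residueCard_ne_zero, Complex.cpow_one]

/-- The weight `|y|^(s-1)` evaluates the power series at `q · q^(-s)`; this is the source of the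
factor `residueCard v` attached to each root here and later. -/
theorem isLaurent_torusIntegral {ϖ : (v.adicCompletion F)ˣ}
    (hϖ : Valued.v (ϖ : v.adicCompletion F) = WithZero.exp (-1 : ℤ)) {W W' : LocalGL v → ℂ}
    (hW : HasMellin ϖ fun y => W (diagOne y)) (hW' : HasMellin ϖ fun y => W' (diagOne y))
    (l : List ℂ) (hl : ∃ N, ∀ n ≥ N, recOp l (shellSeq ϖ W W') n = 0) :
    (∀ᶠ s in farRight, Integrable (fun y => W (diagOne y) * starRingEnd ℂ (W' (diagOne y)) *
      ((‖(y : v.adicCompletion F)‖ : ℝ) : ℂ) ^ (s - 1)) (haarUnits v)) ∧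
    IsLaurent v fun s => (eulerPoly (l.map fun γ => γ * residueCard v)).eval
      ((residueCard v : ℂ) ^ (-s)) * torusIntegral W W' s := by
  obtain ⟨A, Q, R, hR, h⟩ := exists_mellin_eq hϖ (hW.mul hW'.conj) l hl
  have hR0 : 0 < R := by linarith
  have hq := residueCard_pos (v := v)
  have hs : ∀ᶠ s : ℂ in farRight, ‖(residueCard v : ℂ) ^ (-(s - 1))‖ * R < 1 := by
    filter_upwards [eventually_farRight_of_norm_lt (v := v) (ε := (residueCard v * R)⁻¹)
      (by positivity)] with s hs
    rw [cpow_sub_one_eq, norm_mul, Complex.norm_natCast]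
    calc _ = ‖(residueCard v : ℂ) ^ (-s)‖ * (residueCard v * R) := by ring
      _ < (residueCard v * R)⁻¹ * (residueCard v * R) := by gcongr
      _ = 1 := inv_mul_cancel₀ (by positivity)
  refine ⟨by filter_upwards [hs] with s hs using (h _ hs).1, A,
    C ((residueCard v : ℂ) ^ A)⁻¹ * Q.comp (C (residueCard v : ℂ) * X), ?_⟩
  filter_upwards [hs] with s hs
  have h2 := (h _ hs).2
  have h3 : (residueCard v : ℂ) ^ (s - 1) =
      (residueCard v : ℂ)⁻¹ * ((residueCard v : ℂ) ^ (-s))⁻¹ := by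
    rw [← mul_inv, ← cpow_sub_one_eq, Complex.cpow_neg, inv_inv]
  rw [eval_eulerPoly_map_mul, ← cpow_sub_one_eq, torusIntegral, h2, laurentIn_eq, h3, eval_mul,
    eval_C, eval_comp, eval_mul, eval_C, eval_X, cpow_sub_one_eq, mul_pow, zpow_neg, zpow_natCast,
    inv_pow, inv_pow]
  ring

/-- All three functions are invariant under one open subgroup, so the inner integral is a finite
average, and the homogeneity `f(diag(y,1)k) = |y|^s f(k)` separates the variables. -/
theorem zetaIntegral_eq_sum {U : Subgroup (IntegralGL v)} {n : ℕ} {k : Fin n → IntegralGL v}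
    (havg : ∀ H : LocalGL v → ℂ,
      (∀ k₁, ∀ u ∈ U, H (integralIncl v (k₁ * u)) = H (integralIncl v k₁)) →
      integralCompact v H = (n : ℂ)⁻¹ * ∑ i, H (integralIncl v (k i)))
    {W W' : LocalGL v → ℂ} (hW : ∀ u ∈ U, rightTranslate (integralIncl v u) W = W)
    (hW' : ∀ u ∈ U, rightTranslate (integralIncl v u) W' = W')
    {Φ : v.adicCompletion F × v.adicCompletion F → ℂ} (hΦ : ∀ u ∈ U, ∀ x, Φ (rowAct x u) = Φ x)
    (s : ℂ) : zetaIntegral (principalVector Φ s) W W' = integralUnits v fun y =>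
      ∑ i, ((n : ℂ)⁻¹ * principalVector Φ s (integralIncl v (k i))) *
        (rightTranslate (integralIncl v (k i)) W (diagOne y) *
          starRingEnd ℂ (rightTranslate (integralIncl v (k i)) W' (diagOne y)) *
          ((‖(y : v.adicCompletion F)‖ : ℝ) : ℂ) ^ (s - 1)) := by
  unfold zetaIntegral
  congr 1
  funext y
  have hy : ((‖(y : v.adicCompletion F)‖ : ℝ) : ℂ) ≠ 0 := by simp
  rw [havg, Finset.mul_sum, Finset.sum_div]
  · refine Finset.sum_congr rfl fun i _ => ?_
    rw [principalVector_diagOne_mul, Complex.cpow_sub _ _ hy, Complex.cpow_one]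
    simp only [rightTranslate]
    ring
  · intro k₁ u hu
    have h1 : ∀ W : LocalGL v → ℂ, rightTranslate (integralIncl v u) W = W →
        W (diagOne y * integralIncl v (k₁ * u)) = W (diagOne y * integralIncl v k₁) := by
      intro W hW
      have := congrFun hW (diagOne y * integralIncl v k₁)
      rwa [rightTranslate, mul_assoc, ← map_mul] at this
    rw [h1 W (hW u hu), h1 W' (hW' u hu), principalVector_diagOne_mul,
      principalVector_mul_right (hΦ u hu), ← principalVector_diagOne_mul]

/-- A common denominator for all zeta integrals: the roots `1`, `-1` come from the principal series
vector and the others from the torus integrals. It need not be minimal; it bounds the Rankin–Selberg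
polynomial from above in the sense of divisibility. -/
theorem isLaurent_zetaIntegral {ϖ : (v.adicCompletion F)ˣ}
    (hϖ : Valued.v (ϖ : v.adicCompletion F) = WithZero.exp (-1 : ℤ))
    {ψ₁ ψ₂ : AddChar (v.adicCompletion F) Circle} {V₁ V₂ : Submodule ℂ (LocalGL v → ℂ)}
    (hV₁ : IsUnitaryGeneric ψ₁ V₁) (hV₂ : IsUnitaryGeneric ψ₂ V₂)
    (hm₁ : ∀ W ∈ V₁, HasMellin ϖ fun y => W (diagOne y))
    (hm₂ : ∀ W ∈ V₂, HasMellin ϖ fun y => W (diagOne y)) (l : List ℂ)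
    (hl : ∀ W₁ ∈ V₁, ∀ W₂ ∈ V₂, ∃ N, ∀ n ≥ N, recOp l (shellSeq ϖ W₁ W₂) n = 0)
    {Φ : v.adicCompletion F × v.adicCompletion F → ℂ} (hΦ : IsSchwartzBruhat Φ)
    {W₁ W₂ : LocalGL v → ℂ} (hW₁ : W₁ ∈ V₁) (hW₂ : W₂ ∈ V₂) :
    IsLaurent v fun s => (eulerPoly (1 :: -1 :: l.map fun γ => γ * residueCard v)).eval
      ((residueCard v : ℂ) ^ (-s)) * zetaIntegral (principalVector Φ s) W₁ W₂ := by
  obtain ⟨U₁, hU₁, h₁⟩ := hV₁.exists_isOpen_integral hW₁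
  obtain ⟨U₂, hU₂, h₂⟩ := hV₂.exists_isOpen_integral hW₂
  obtain ⟨U₃, hU₃, h₃⟩ := hΦ.exists_isOpen
  obtain ⟨n, k, -, havg⟩ := exists_average (U₁ ⊓ U₂ ⊓ U₃) ((hU₁.inter hU₂).inter hU₃)
  have key := fun i => isLaurent_torusIntegral hϖ
    (hm₁ _ (hV₁.stable W₁ hW₁ (integralIncl v (k i))))
    (hm₂ _ (hV₂.stable W₂ hW₂ (integralIncl v (k i)))) l
    (hl _ (hV₁.stable W₁ hW₁ _) _ (hV₂.stable W₂ hW₂ _))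
  have hL : IsLaurent v fun s => ∑ i, (n : ℂ)⁻¹ *
      (((eulerPoly [1, -1]).eval ((residueCard v : ℂ) ^ (-s)) *
        principalVector Φ s (integralIncl v (k i))) *
      ((eulerPoly (l.map fun γ => γ * residueCard v)).eval ((residueCard v : ℂ) ^ (-s)) *
        torusIntegral (rightTranslate (integralIncl v (k i)) W₁)
          (rightTranslate (integralIncl v (k i)) W₂) s)) :=
    IsLaurent.sum _ fun i _ => (IsLaurent.const _).mul
      ((isLaurent_principalVector hϖ hΦ (k i)).mul (key i).2)
  refine hL.congr ?_
  filter_upwards [eventually_all.2 fun i => (key i).1] with s hs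
  rw [zetaIntegral_eq_sum havg (fun u hu => h₁ u hu.1.1) (fun u hu => h₂ u hu.1.2)
    (fun u hu => h₃ u hu.2), integralUnits_eq, integral_finsetSum _ fun i _ => (hs i).const_mul _,
    Finset.mul_sum]
  refine Finset.sum_congr rfl fun i _ => ?_
  rw [integral_const_mul, show (1 :: -1 :: l.map fun γ => γ * (residueCard v : ℂ)) =
    [1, -1] ++ l.map fun γ => γ * (residueCard v : ℂ) from rfl, eulerPoly_append, eval_mul,
    torusIntegral, integralUnits_eq]
  ring

/-! ### Analytic continuation -/

theorem eventually_eval_ne_zero {P : ℂ[X]} (hP : P.coeff 0 = 1) :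
    ∀ᶠ s in farRight, P.eval ((residueCard v : ℂ) ^ (-s)) ≠ 0 := by
  have h1 : Tendsto (fun s : ℂ => P.eval ((residueCard v : ℂ) ^ (-s))) farRight (nhds 1) := by
    have h2 := (P.continuous.tendsto 0).comp
      (tendsto_zero_iff_norm_tendsto_zero.2 (tendsto_norm_residueCard_cpow (v := v)))
    rwa [← Polynomial.coeff_zero_eq_eval_zero, hP] at h2
  exact h1.eventually_ne one_ne_zero

variable (v) in
-- The points `q^(-s)` are non-zero and tend to `0` far to the right, so they cannot all lie in the
-- finite agreement set of two distinct polynomials.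
theorem eq_of_eventually_eval_eq {A B : ℂ[X]} (h : ∀ᶠ s in farRight,
    A.eval ((residueCard v : ℂ) ^ (-s)) = B.eval ((residueCard v : ℂ) ^ (-s))) : A = B := by
  refine Polynomial.eq_of_infinite_eval_eq A B fun hfin => ?_
  have h1 : ({x | A.eval x = B.eval x} \ {0})ᶜ ∈ nhds (0 : ℂ) :=
    (hfin.sdiff).isClosed.isOpen_compl.mem_nhds (by simp)
  have h2 := (tendsto_zero_iff_norm_tendsto_zero.2
    (tendsto_norm_residueCard_cpow (v := v))).eventually h1
  obtain ⟨s, hs, hs'⟩ := (h2.and h).exists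
  exact hs ⟨hs', residueCard_cpow_ne_zero _⟩

theorem eq_of_eventually_eq {E E' : ℂ → ℂ} (hE : Differentiable ℂ E) (hE' : Differentiable ℂ E')
    (h : ∀ᶠ s in farRight, E s = E' s) : E = E' := by
  obtain ⟨R, hR⟩ := Filter.eventually_atTop.1 (Filter.eventually_comap.1 h)
  refine AnalyticOnNhd.eq_of_eventuallyEq (𝕜 := ℂ) (z₀ := ((R + 1 : ℝ) : ℂ))
    (fun z _ => hE.analyticAt z) (fun z _ => hE'.analyticAt z) ?_
  have h1 : IsOpen {s : ℂ | R < s.re} := isOpen_lt continuous_const Complex.continuous_re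
  filter_upwards [h1.mem_nhds (show R < (((R + 1 : ℝ) : ℂ)).re by simp)] with s hs
  exact hR _ (le_of_lt hs) s rfl

/-- Since `P(0) = 1`, the factor `P(q^(-s))` is non-zero far to the right, and the identity theorem
identifies the chosen continuation with any entire candidate. -/
theorem entireQuotient_eq {Ψ E : ℂ → ℂ} {P : ℂ[X]} (hP : P.coeff 0 = 1)
    (hE : Differentiable ℂ E)
    (h : ∀ᶠ s in farRight, Ψ s * P.eval ((residueCard v : ℂ) ^ (-s)) = E s) :
    entireQuotient Ψ (fun s => (P.eval ((residueCard v : ℂ) ^ (-s)))⁻¹) = E := by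
  have hex : ∃ E : ℂ → ℂ, Differentiable ℂ E ∧ ∀ᶠ s in farRight,
      Ψ s = (P.eval ((residueCard v : ℂ) ^ (-s)))⁻¹ * E s := by
    refine ⟨E, hE, ?_⟩
    filter_upwards [h, eventually_eval_ne_zero (v := v) hP] with s hs h0
    rw [← hs]
    field_simp
  rw [entireQuotient, dif_pos hex]
  refine eq_of_eventually_eq hex.choose_spec.1 hE ?_
  filter_upwards [h, eventually_eval_ne_zero (v := v) hP, hex.choose_spec.2] with s hs h0 h1
  rw [← hs, h1]
  field_simp

theorem differentiable_residueCard_cpow :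
    Differentiable ℂ fun s : ℂ => (residueCard v : ℂ) ^ s := fun _ =>
  (differentiableAt_id).const_cpow (Or.inl residueCard_ne_zero)

theorem differentiable_laurentIn (m : ℕ) (Q : ℂ[X]) : Differentiable ℂ (laurentIn v m Q) := by
  have h1 := differentiable_residueCard_cpow (v := v)
  exact (h1.comp (differentiable_id.const_mul (m : ℂ))).mul
    (Q.differentiable.comp (h1.comp differentiable_neg))

/-! ### Rankin–Selberg polynomials -/

/-- A polynomial with constant term `1` is prime to `X`, so divisibility among Laurent polynomials
already holds among polynomials. -/
theorem dvd_of_X_pow_mul_eq {P D Q : ℂ[X]} {m : ℕ} (hP : P.coeff 0 = 1)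
    (h : X ^ m * D = P * Q) : P ∣ D := by
  refine IsCoprime.dvd_of_dvd_mul_left (IsCoprime.pow_right ?_) ⟨Q, h⟩
  refine (Polynomial.irreducible_X.coprime_iff_not_dvd.2 fun hd => ?_).symm
  rw [Polynomial.X_dvd_iff, hP] at hd
  exact one_ne_zero hd

/-- By the generation property `1/P` is a combination of zeta integrals. Multiplying by a common
denominator `D` shows that `D/P` is a Laurent polynomial. -/
theorem IsRankinSelbergPolynomial.dvd {V₁ V₂ : Submodule ℂ (LocalGL v → ℂ)} {P D : ℂ[X]}
    (hP : IsRankinSelbergPolynomial V₁ V₂ P)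
    (hD : ∀ (Φ : v.adicCompletion F × v.adicCompletion F → ℂ), IsSchwartzBruhat Φ →
      ∀ W₁ ∈ V₁, ∀ W₂ ∈ V₂, IsLaurent v fun s => D.eval ((residueCard v : ℂ) ^ (-s)) *
        zetaIntegral (principalVector Φ s) W₁ W₂) : P ∣ D := by
  obtain ⟨hP0, -, n, Φ, W₁, W₂, m, Q, hΦ, hW₁, hW₂, h⟩ := hP
  obtain ⟨k, R, hR⟩ := IsLaurent.sum Finset.univ fun i _ =>
    (IsLaurent.laurentIn (v := v) (m i) (Q i)).mul (hD (Φ i) (hΦ i) _ (hW₁ i) _ (hW₂ i))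
  refine dvd_of_X_pow_mul_eq (Q := R) (m := k) hP0 (eq_of_eventually_eval_eq v ?_)
  filter_upwards [h, hR] with s hs hs'
  have h1 : laurentIn v k R s * P.eval ((residueCard v : ℂ) ^ (-s)) =
      D.eval ((residueCard v : ℂ) ^ (-s)) := by
    refine Eq.trans ?_ ((congrArg (D.eval ((residueCard v : ℂ) ^ (-s)) * ·) hs).trans (mul_one _))
    rw [← hs', Finset.sum_mul, Finset.mul_sum]
    exact Finset.sum_congr rfl fun i _ => by ring
  rw [eval_mul, eval_mul, eval_pow, eval_X, ← h1, laurentIn_eq, zpow_neg, zpow_natCast]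
  have := residueCard_cpow_ne_zero (v := v) (-s)
  field_simp

/-- After multiplication by `D` the zeta integrals become Laurent polynomials, and the ideal of
`ℂ[X]` spanned by their polynomial multiples by powers of `X` is principal, say with generator `A`.
A non-zero constant zeta integral forces `A ∣ D`, and `D / A` is the polynomial sought, up to a
scalar. -/
theorem exists_isRankinSelbergPolynomial {V₁ V₂ : Submodule ℂ (LocalGL v → ℂ)} {D : ℂ[X]}
    (hD0 : D.coeff 0 = 1)
    (hD : ∀ (Φ : v.adicCompletion F × v.adicCompletion F → ℂ), IsSchwartzBruhat Φ →
      ∀ W₁ ∈ V₁, ∀ W₂ ∈ V₂, IsLaurent v fun s => D.eval ((residueCard v : ℂ) ^ (-s)) *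
        zetaIntegral (principalVector Φ s) W₁ W₂)
    (h1 : ∃ (Φ : v.adicCompletion F × v.adicCompletion F → ℂ), IsSchwartzBruhat Φ ∧
      ∃ W₁ ∈ V₁, ∃ W₂ ∈ V₂, ∃ c : ℂ, c ≠ 0 ∧
        ∀ᶠ s in farRight, zetaIntegral (principalVector Φ s) W₁ W₂ = c) :
    ∃ P, IsRankinSelbergPolynomial V₁ V₂ P := by
  let gens : Set ℂ[X] := {A | ∃ (Φ : v.adicCompletion F × v.adicCompletion F → ℂ),
    IsSchwartzBruhat Φ ∧ ∃ W₁ ∈ V₁, ∃ W₂ ∈ V₂, ∃ m : ℕ, ∀ᶠ s in farRight,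
      A.eval ((residueCard v : ℂ) ^ (-s)) = ((residueCard v : ℂ) ^ (-s)) ^ m *
        (D.eval ((residueCard v : ℂ) ^ (-s)) * zetaIntegral (principalVector Φ s) W₁ W₂)}
  obtain ⟨A, hA⟩ := (IsPrincipalIdealRing.principal (Ideal.span gens)).principal
  have hAdvd : ∀ B ∈ gens, A ∣ B := fun B hB =>
    Ideal.mem_span_singleton.1 (hA.le (Ideal.subset_span hB))
  obtain ⟨Φ, hΦ, W₁, hW₁, W₂, hW₂, c, hc, hcs⟩ := h1
  have hAD : A ∣ D := by
    have h2 : A ∣ C c * D := hAdvd _ ⟨Φ, hΦ, W₁, hW₁, W₂, hW₂, 0, by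
      filter_upwards [hcs] with s hs
      rw [hs, eval_mul, eval_C]
      ring⟩
    have hu : IsUnit (C c : ℂ[X]) := Polynomial.isUnit_C.2 hc.isUnit
    exact (hu.dvd_mul_left).1 h2
  obtain ⟨P, hP⟩ := hAD
  have hAP : A.coeff 0 * P.coeff 0 = 1 := by rw [← mul_coeff_zero, ← hP, hD0]
  have ha : A.coeff 0 ≠ 0 := left_ne_zero_of_mul_eq_one hAP
  have hPe : ∀ x : ℂ, D.eval x = A.eval x * P.eval x := fun x => by rw [hP, eval_mul]
  -- As `A(0) P(0) = D(0) = 1`, the scalar `A(0)` normalises the constant term to `1`.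
  refine ⟨C (A.coeff 0) * P, by simpa using hAP, fun Φ hΦ W₁ hW₁ W₂ hW₂ => ?_, ?_⟩
  · obtain ⟨m, Q, hQ⟩ := hD Φ hΦ W₁ hW₁ W₂ hW₂
    obtain ⟨R, hR⟩ := hAdvd Q ⟨Φ, hΦ, W₁, hW₁, W₂, hW₂, m, by
      filter_upwards [hQ] with s hs
      have := residueCard_cpow_ne_zero (v := v) (-s)
      rw [hs, laurentIn_eq, zpow_neg, zpow_natCast]
      field_simp⟩
    refine ⟨m, C (A.coeff 0) * R, ?_⟩
    have hA0 : ∀ᶠ s in farRight, A.eval ((residueCard v : ℂ) ^ (-s)) ≠ 0 := by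
      have := eventually_eval_ne_zero (v := v) (P := C (P.coeff 0) * A) (by simpa [mul_comm] using hAP)
      filter_upwards [this] with s hs h0
      exact hs (by rw [eval_mul, h0, mul_zero])
    filter_upwards [hQ, hA0] with s hs h0
    apply mul_left_cancel₀ h0
    rw [laurentIn_eq, hR, eval_mul, hPe] at hs
    rw [laurentIn_eq, eval_mul, eval_mul, eval_C]
    linear_combination A.coeff 0 * hs
  · have hmem : A ∈ Ideal.span gens := by
      rw [hA]
      exact Ideal.mem_span_singleton_self A
    obtain ⟨n, f, g, hfg⟩ := Submodule.mem_span_set'.1 hmem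
    choose Φ hΦ W₁ hW₁ W₂ hW₂ m hm using fun i => (g i).2
    refine ⟨n, Φ, W₁, W₂, fun _ => 0, fun i => C (A.coeff 0)⁻¹ * f i * X ^ m i, hΦ, hW₁, hW₂, ?_⟩
    have hA0 : ∀ᶠ s in farRight, A.eval ((residueCard v : ℂ) ^ (-s)) ≠ 0 := by
      have := eventually_eval_ne_zero (v := v) (P := C (P.coeff 0) * A) (by simpa [mul_comm] using hAP)
      filter_upwards [this] with s hs h0
      exact hs (by rw [eval_mul, h0, mul_zero])
    filter_upwards [eventually_all.2 hm, hA0] with s hs h0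
    apply mul_left_cancel₀ h0
    rw [Finset.mul_sum, mul_one]
    conv_rhs => rw [← hfg, Polynomial.eval_finsetSum]
    refine Finset.sum_congr rfl fun i _ => ?_
    rw [smul_eq_mul, eval_mul (p := f i), hs i, hPe, laurentIn_eq]
    simp only [eval_mul, eval_C, eval_pow, eval_X, Nat.cast_zero, neg_zero, zpow_zero, one_mul]
    field_simp

theorem exists_rankinSelbergL_eq {V₁ V₂ : Submodule ℂ (LocalGL v → ℂ)}
    (h : ∃ P, IsRankinSelbergPolynomial V₁ V₂ P) : ∃ P, IsRankinSelbergPolynomial V₁ V₂ P ∧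
      rankinSelbergL V₁ V₂ = fun s => (P.eval ((residueCard v : ℂ) ^ (-s)))⁻¹ := by
  refine ⟨h.choose, h.choose_spec, funext fun s => ?_⟩
  rw [rankinSelbergL, dif_pos h]

/-! ### Sums over residues -/

/-- `S` is a system of representatives of `𝔬_v / 𝔭_v^j`. -/
def IsResidueSystem (S : Finset (v.adicCompletion F)) (j : ℕ) : Prop :=
  S.card = residueCard v ^ j ∧ (∀ s ∈ S, s ∈ ball v 0) ∧
    (∀ x ∈ ball v 0, ∃ s ∈ S, x - s ∈ ball v j) ∧
    ∀ s ∈ S, ∀ t ∈ S, s - t ∈ ball v j → s = t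

theorem IsResidueSystem.sum_eq {S : Finset (v.adicCompletion F)} {j : ℕ}
    (hS : IsResidueSystem S j) {M : Type*} [AddCommMonoid M] {f : v.adicCompletion F → M}
    (hf : ∀ x ∈ ball v 0, ∀ z ∈ ball v j, f (x + z) = f x) {ι : Type*} {t : Finset ι}
    (g : ι → v.adicCompletion F) (hcard : t.card = residueCard v ^ j)
    (hg : ∀ i ∈ t, g i ∈ ball v 0)
    (hinj : ∀ i ∈ t, ∀ k ∈ t, g i - g k ∈ ball v j → i = k) :
    ∑ i ∈ t, f (g i) = ∑ s ∈ S, f s := by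
  obtain ⟨hSc, hS0, hcov, -⟩ := hS
  choose! e he he' using hcov
  have hi : ∀ i (_ : i ∈ t), e (g i) ∈ S := fun i hi => he _ (hg _ hi)
  have hinj' : ∀ i (_ : i ∈ t) k (_ : k ∈ t), e (g i) = e (g k) → i = k := by
    intro i hi k hk h
    refine hinj i hi k hk ?_
    have h1 := he' _ (hg _ hi)
    have h2 := he' _ (hg _ hk)
    rw [← h] at h2
    have := sub_mem h1 h2
    rwa [sub_sub_sub_cancel_right] at this
  refine Finset.sum_bij (fun i _ => e (g i)) hi (fun i hi k hk => hinj' i hi k hk) ?_ ?_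
  · intro b hb
    obtain ⟨a, ha, hab⟩ := Finset.surj_on_of_inj_on_of_card_le (fun i _ => e (g i)) hi
      (fun i k hi hk => hinj' i hi k hk) (hSc.trans hcard.symm).le b hb
    exact ⟨a, ha, hab.symm⟩
  · intro i hi'
    have h1 := he' _ (hg _ hi')
    have := hf (e (g i)) (hS0 _ (hi i hi')) _ h1
    rw [add_sub_cancel] at this
    exact this

theorem IsResidueSystem.sum_comp {S : Finset (v.adicCompletion F)} {j : ℕ}
    (hS : IsResidueSystem S j) {M : Type*} [AddCommMonoid M] {f : v.adicCompletion F → M}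
    (hf : ∀ x ∈ ball v 0, ∀ z ∈ ball v j, f (x + z) = f x) (g : v.adicCompletion F → v.adicCompletion F)
    (hg : ∀ x ∈ ball v 0, g x ∈ ball v 0)
    (hinj : ∀ x ∈ ball v 0, ∀ y ∈ ball v 0, g x - g y ∈ ball v j → x - y ∈ ball v j) :
    ∑ s ∈ S, f (g s) = ∑ s ∈ S, f s :=
  hS.sum_eq hf g hS.1 (fun s hs => hg s (hS.2.1 s hs)) fun s hs t ht h =>
    hS.2.2.2 s hs t ht (hinj s (hS.2.1 s hs) t (hS.2.1 t ht) h)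

/-- Translating the summation variable by a point where the character is not `1` multiplies the sum
by a number different from `1`. -/
theorem IsResidueSystem.sum_addChar {S : Finset (v.adicCompletion F)} (hS : IsResidueSystem S 1)
    {ψ : AddChar (v.adicCompletion F) Circle} (hψ : HasConductor ψ 0)
    {c : v.adicCompletion F} (hc : Valued.v c = WithZero.exp (1 : ℤ)) :
    ∑ s ∈ S, (ψ (c * s) : ℂ) = 0 := by
  obtain ⟨x₀, hx₀, hne⟩ := hψ.exists_ne_one
  have hc0 : c ≠ 0 := fun h => by
    rw [h, map_zero] at hc
    exact WithZero.exp_ne_zero hc.symm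
  have hcb : c ∈ ball v (-1) := by rw [mem_ball, hc, neg_neg]
  have hx : c⁻¹ * x₀ ∈ ball v 0 := by
    have : c⁻¹ ∈ ball v 1 := by rw [mem_ball, map_inv₀, hc, ← WithZero.exp_neg]
    simpa using mul_mem_ball this hx₀
  have h := hS.sum_comp (f := fun s => (ψ (c * s) : ℂ)) (fun x _ z hz => by
    have : c * z ∈ ball v 0 := by simpa using mul_mem_ball hcb hz
    rw [mul_add, AddChar.map_add_eq_mul, hψ.eq_one this, mul_one]) (fun s => s + c⁻¹ * x₀)
    (fun s hs => add_mem hs hx) (fun x _ y _ h => by rwa [add_sub_add_right_eq_sub] at h)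
  have h1 : ∀ s, (ψ (c * (s + c⁻¹ * x₀)) : ℂ) = ψ x₀ * ψ (c * s) := by
    intro s
    rw [mul_add, mul_inv_cancel_left₀ hc0, AddChar.map_add_eq_mul, Circle.coe_mul, mul_comm]
  simp only [h1, ← Finset.mul_sum] at h
  by_contra h0
  apply hne
  exact Circle.ext (by simpa using mul_right_cancel₀ h0 (h.trans (one_mul _).symm))

/-! ### Zeta integrals of level test functions -/

open Classical in
variable (v) in
/-- The function `𝟏_{𝔭_v^r}(x₁) 𝟏_{𝔬_v^×}(x₂)`. -/
def levelTest (r : ℕ) (x : v.adicCompletion F × v.adicCompletion F) : ℂ :=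
  if x.1 ∈ ball v r ∧ Valued.v x.2 = 1 then 1 else 0

theorem isClopen_ball (n : ℤ) : IsClopen (ball v n : Set (v.adicCompletion F)) :=
  ⟨(ball v n).isClosed_of_isOpen (isOpen_ball n), isOpen_ball n⟩

theorem isSchwartzBruhat_levelTest (r : ℕ) : IsSchwartzBruhat (levelTest v r) := by
  have hsphere : {x : v.adicCompletion F | Valued.v x = 1} =
      (ball v 0 : Set (v.adicCompletion F)) ∩ (ball v 1 : Set (v.adicCompletion F))ᶜ := by
    ext x
    constructor
    · intro (hx : Valued.v x = 1)
      refine ⟨mem_ball_zero.2 hx.le, fun h => ?_⟩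
      have := mem_ball_one.1 h
      rw [hx] at this
      exact lt_irrefl _ this
    · exact fun hx => (val_eq_one_or_mem hx.1).resolve_right hx.2
  have hclopen : IsClopen {x : v.adicCompletion F × v.adicCompletion F |
      x.1 ∈ ball v r ∧ Valued.v x.2 = 1} := by
    have h1 : IsClopen {x : v.adicCompletion F | Valued.v x = 1} := by
      rw [hsphere]
      exact (isClopen_ball 0).inter (isClopen_ball 1).compl
    exact ((isClopen_ball (v := v) r).preimage continuous_fst).inter (h1.preimage continuous_snd)
  refine ⟨(IsLocallyConstant.iff_eventually_eq _).2 fun x => ?_, ?_⟩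
  · by_cases hx : x.1 ∈ ball v r ∧ Valued.v x.2 = 1
    · filter_upwards [hclopen.isOpen.mem_nhds hx] with y hy
      rw [levelTest, levelTest, if_pos hx, if_pos hy]
    · filter_upwards [hclopen.compl.isOpen.mem_nhds hx] with y hy
      exact (if_neg hy).trans (if_neg hx).symm
  · have hc : IsCompact (v.adicCompletionIntegers F : Set (v.adicCompletion F)) :=
      isCompact_iff_compactSpace.2 (compactSpace_integers v)
    refine HasCompactSupport.intro (hc.prod hc) fun x hx => if_neg fun h => hx ⟨?_, ?_⟩
    · exact mem_ball_zero.1 (ball_mono (by omega) h.1)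
    · exact h.2.le

/-- Right translation by `diag(ϖ^(-r), 1)` multiplies the first coordinate in `Φ` by `ϖ^(-r)`, which
turns `𝔬` into `𝔭^r`; the determinant contributes `q^(rs)`. -/
theorem testVector_eq {ϖ : (v.adicCompletion F)ˣ}
    (hϖ : Valued.v (ϖ : v.adicCompletion F) = WithZero.exp (-1 : ℤ)) (r : ℕ) (s : ℂ) :
    testVector ϖ r s = fun g => laurentIn v r 1 s * principalVector (levelTest v r) s g := by
  funext g
  have hn : ‖(((ϖ ^ r)⁻¹ : (v.adicCompletion F)ˣ) : v.adicCompletion F)‖ =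
      (residueCard v : ℝ) ^ r := by
    have := norm_zpow_mul hϖ (-(r : ℤ)) (u := 1) (by simp)
    simpa using this
  have h1 : ((g * diagOne (ϖ ^ r)⁻¹ : LocalGL v) : Matrix (Fin 2) (Fin 2) (v.adicCompletion F)).det =
      (((ϖ ^ r)⁻¹ : (v.adicCompletion F)ˣ) : v.adicCompletion F) *
        (g : Matrix (Fin 2) (Fin 2) (v.adicCompletion F)).det := by
    rw [Units.val_mul, Matrix.det_mul, coe_diagOne, mul_comm]
    simp
  have h2 : (g * diagOne (ϖ ^ r)⁻¹ : LocalGL v) 1 0 =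
      g 1 0 * (((ϖ ^ r)⁻¹ : (v.adicCompletion F)ˣ) : v.adicCompletion F) := by
    rw [Units.val_mul, coe_diagOne, Matrix.mul_apply, Fin.sum_univ_two]
    simp
  have h3 : (g * diagOne (ϖ ^ r)⁻¹ : LocalGL v) 1 1 = g 1 1 := by
    rw [Units.val_mul, coe_diagOne, Matrix.mul_apply, Fin.sum_univ_two]
    simp
  unfold testVector rightTranslate principalVector
  rw [h1, norm_mul, Complex.ofReal_mul, Complex.mul_cpow_ofReal_nonneg (norm_nonneg _)
    (norm_nonneg _), h2, h3, hn, laurentIn, eval_one, mul_one, mul_assoc]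
  congr 1
  · rw [Complex.cpow_nat_mul' (by simp [Real.pi_pos]) (by simp [Real.pi_pos.le]),
      Complex.ofReal_pow, Complex.ofReal_natCast]
  · congr 2
    funext t
    congr 1
    unfold testFunction levelTest
    congr 1
    rw [← mul_assoc, mul_comm _ (((ϖ ^ r)⁻¹ : (v.adicCompletion F)ˣ) : v.adicCompletion F),
      ← mem_ball_zero]
    have := zpow_mul_mem_ball hϖ (r : ℤ) (-r) (x := (t : v.adicCompletion F) * g 1 0)
    rw [neg_add_cancel, zpow_neg, zpow_natCast] at this
    rw [this]

/-- The condition on the second coordinate makes `t · k 1 1` a unit, so a non-zero integrand forces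
`k 1 0 ∈ 𝔭^r`. Conversely, as `r ≥ 1`, this membership makes `k 1 1` a unit, and `t` runs over the
units, of volume one. -/
theorem principalVector_levelTest {r : ℕ} (hr : 1 ≤ r) (s : ℂ) (k : IntegralGL v) :
    ((k 1 0 : v.adicCompletion F) ∈ ball v r →
      principalVector (levelTest v r) s (integralIncl v k) = 1) ∧
    ((k 1 0 : v.adicCompletion F) ∉ ball v r →
      principalVector (levelTest v r) s (integralIncl v k) = 0) := by
  rw [principalVector_integral, integralUnits_eq]
  constructor
  · intro hk
    have hk1 : Valued.v (k 1 1 : v.adicCompletion F) = 1 :=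
      val_entry_one_one (Or.inl (ball_mono (by omega) hk))
    have h : ∀ t : (v.adicCompletion F)ˣ, levelTest v r ((t : v.adicCompletion F) * k 1 0,
        (t : v.adicCompletion F) * k 1 1) * ((‖(t : v.adicCompletion F)‖ : ℝ) : ℂ) ^ (2 * s) =
        (unitSet v).indicator (fun _ => (1 : ℂ)) t := by
      intro t
      by_cases ht : t ∈ unitSet v
      · rw [Set.indicator_of_mem ht, levelTest, if_pos ⟨(unit_mul_mem_ball ht).2 hk, by
          rw [map_mul, hk1, mul_one]; exact ht⟩, norm_eq_one ht]
        simp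
      · rw [Set.indicator_of_notMem ht, levelTest, if_neg, zero_mul]
        rintro ⟨-, h⟩
        rw [map_mul, hk1, mul_one] at h
        exact ht h
    simp only [h]
    rw [integral_indicator measurableSet_unitSet, setIntegral_const, measureReal_def,
      haarUnits_unitSet]
    simp
  · intro hk
    refine (integral_congr_ae (g := fun _ => 0) (Eventually.of_forall fun t => ?_)).trans
      (integral_zero _ _)
    refine mul_eq_zero_of_left (if_neg ?_) _
    rintro ⟨h1, h2⟩
    simp only at h1 h2
    have h3 : (k 1 0 : v.adicCompletion F) = (k 1 1 : v.adicCompletion F) *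
        (((t : v.adicCompletion F) * k 1 1)⁻¹ * ((t : v.adicCompletion F) * k 1 0)) := by
      have : (k 1 1 : v.adicCompletion F) ≠ 0 := fun h => by simp [h] at h2
      have := t.ne_zero
      field_simp
    apply hk
    rw [h3, ← zero_add (r : ℤ)]
    exact mul_mem_ball (coe_mem_ball _) ((unit_mul_mem_ball (by rw [map_inv₀, h2, inv_one])).2 h1)

/-- In the factorisation of `eq_mul_lower` the lower unipotent and the unit diagonal part of `k` act
trivially; only the phase of the upper unipotent part survives. -/
theorem IsWhittakerFunction.diagOne_mul_integral {ψ : AddChar (v.adicCompletion F) Circle}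
    {W : LocalGL v → ℂ} (hW : IsWhittakerFunction ψ W) {r : ℕ} (hr : 1 ≤ r)
    (hl : ∀ x ∈ ball v r, rightTranslate (lower x) W = W)
    (hu : ∀ (y u : (v.adicCompletion F)ˣ), Valued.v (u : v.adicCompletion F) = 1 →
      W (diagOne (y * u)) = W (diagOne y)) (y : (v.adicCompletion F)ˣ) (k : IntegralGL v)
    (hk : (k 1 0 : v.adicCompletion F) ∈ ball v r) :
    W (diagOne y * integralIncl v k) =
      (ψ ((y : v.adicCompletion F) * ((k 0 1 : v.adicCompletion F) / (k 1 1 : v.adicCompletion F))) : ℂ) *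
        W (diagOne y) := by
  have hk1 : Valued.v (k 1 1 : v.adicCompletion F) = 1 :=
    val_entry_one_one (Or.inl (ball_mono (by omega) hk))
  have hk0 : (k 1 1 : v.adicCompletion F) ≠ 0 := fun h => by simp [h] at hk1
  rw [hW.diagOne_mul_eq_lower y (integralIncl v k) (Units.mk0 _ hk0) rfl]
  congr 1
  have h1 : (integralIncl v k 1 0 / ((Units.mk0 _ hk0 : (v.adicCompletion F)ˣ) :
      v.adicCompletion F)) ∈ ball v r := by
    rw [div_eq_inv_mul]
    exact (unit_mul_mem_ball (by rw [map_inv₀, Units.val_mk0, hk1, inv_one])).2 hk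
  refine (congrFun (hl _ h1) _).trans (hu y _ ?_)
  rw [Units.val_mul, map_mul, val_det_integralIncl, one_mul, Units.val_inv_eq_inv_val, map_inv₀,
    Units.val_pow_eq_pow_val, map_pow, Units.val_mk0, hk1, one_pow, inv_one]

/-- On the congruence subgroup both Whittaker functions acquire the same phase, which cancels
against its conjugate, and off it the test vector vanishes. The integrand is therefore constant in
`k` on the subgroup. -/
theorem zetaIntegral_levelTest {ψ : AddChar (v.adicCompletion F) Circle} {W₁ W₂ : LocalGL v → ℂ}
    (hW₁ : IsWhittakerFunction ψ W₁) (hW₂ : IsWhittakerFunction ψ W₂) {r : ℕ} (hr : 1 ≤ r)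
    (hl₁ : ∀ x ∈ ball v r, rightTranslate (lower x) W₁ = W₁)
    (hl₂ : ∀ x ∈ ball v r, rightTranslate (lower x) W₂ = W₂)
    (hu₁ : ∀ (y u : (v.adicCompletion F)ˣ), Valued.v (u : v.adicCompletion F) = 1 →
      W₁ (diagOne (y * u)) = W₁ (diagOne y))
    (hu₂ : ∀ (y u : (v.adicCompletion F)ˣ), Valued.v (u : v.adicCompletion F) = 1 →
      W₂ (diagOne (y * u)) = W₂ (diagOne y)) (s : ℂ) :
    zetaIntegral (principalVector (levelTest v r) s) W₁ W₂ =
      levelVolume v r * torusIntegral W₁ W₂ s := by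
  unfold zetaIntegral torusIntegral
  rw [integralUnits_eq, integralUnits_eq, ← integral_const_mul]
  congr 1
  funext y
  have hy : ((‖(y : v.adicCompletion F)‖ : ℝ) : ℂ) ≠ 0 := by simp
  rw [integralCompact_level r _ (W₁ (diagOne y) * starRingEnd ℂ (W₂ (diagOne y)) *
    ((‖(y : v.adicCompletion F)‖ : ℝ) : ℂ) ^ s), Complex.cpow_sub _ _ hy, Complex.cpow_one]
  · ring
  · intro k hk
    rw [hW₁.diagOne_mul_integral hr hl₁ hu₁ y k hk, hW₂.diagOne_mul_integral hr hl₂ hu₂ y k hk,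
      principalVector_diagOne_mul, (principalVector_levelTest hr s k).1 hk, (starRingEnd ℂ).map_mul]
    set z : Circle := ψ ((y : v.adicCompletion F) *
      ((k 0 1 : v.adicCompletion F) / (k 1 1 : v.adicCompletion F)))
    have hz : (z : ℂ) * starRingEnd ℂ (z : ℂ) = 1 := by
      rw [Complex.mul_conj, Circle.normSq_coe, Complex.ofReal_one]
    linear_combination (W₁ (diagOne y) * starRingEnd ℂ (W₂ (diagOne y)) *
      ((‖(y : v.adicCompletion F)‖ : ℝ) : ℂ) ^ s) * hz
  · intro k hk
    rw [principalVector_diagOne_mul, (principalVector_levelTest hr s k).2 hk, mul_zero, mul_zero]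

/-! ### Existence of the Rankin–Selberg factor -/

theorem val_unit_mul {y u : (v.adicCompletion F)ˣ} (hu : Valued.v (u : v.adicCompletion F) = 1) :
    Valued.v ((y * u : (v.adicCompletion F)ˣ) : v.adicCompletion F) =
      Valued.v (y : v.adicCompletion F) := by
  rw [Units.val_mul, map_mul, hu, mul_one]

/-- Averaging over the unipotents with entry in `ϖ⁻¹𝔬 / 𝔬` multiplies the value at `y ∈ 𝔬` by a
character sum, equal to `1` on `𝔭` and to `0` on units. Subtracting this average from `W` leaves the
restriction to the units. -/
theorem exists_torus_indicator {ϖ : (v.adicCompletion F)ˣ}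
    (hϖ : Valued.v (ϖ : v.adicCompletion F) = WithZero.exp (-1 : ℤ))
    {ψ : AddChar (v.adicCompletion F) Circle} (hψ : HasConductor ψ 0)
    {V : Submodule ℂ (LocalGL v → ℂ)} (hV : IsUnitaryGeneric ψ V) {W : LocalGL v → ℂ} (hW : W ∈ V)
    (hn : ∀ x ∈ ball v 0, rightTranslate (upper x) W = W)
    (hu : ∀ (y u : (v.adicCompletion F)ˣ), Valued.v (u : v.adicCompletion F) = 1 →
      W (diagOne (y * u)) = W (diagOne y)) (h1 : W 1 = 1) :
    ∃ W' ∈ V, ∀ y : (v.adicCompletion F)ˣ,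
      W' (diagOne y) = (unitSet v).indicator (fun _ => (1 : ℂ)) y := by
  obtain ⟨S, hS⟩ := exists_residues (v := v) 1
  have hS' : IsResidueSystem S 1 := hS
  have hq := residueCard_ne_zero (v := v)
  refine ⟨W - (residueCard v : ℂ)⁻¹ • ∑ s ∈ S,
    rightTranslate (upper (((ϖ⁻¹ : (v.adicCompletion F)ˣ) : v.adicCompletion F) * s)) W,
    sub_mem hW (V.smul_mem _ (V.sum_mem fun s _ => hV.stable W hW _)), fun y => ?_⟩
  have hWw := hV.isWhittakerFunction hW
  have e : ∀ s : v.adicCompletion F,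
      rightTranslate (upper (((ϖ⁻¹ : (v.adicCompletion F)ˣ) : v.adicCompletion F) * s)) W
        (diagOne y) = (ψ (((y * ϖ⁻¹ : (v.adicCompletion F)ˣ) : v.adicCompletion F) * s) : ℂ) *
          W (diagOne y) := by
    intro s
    have := hWw.diagOne_upper_mul y (((ϖ⁻¹ : (v.adicCompletion F)ˣ) : v.adicCompletion F) * s) 1
    rw [mul_one, mul_one, ← mul_assoc, ← Units.val_mul] at this
    exact this
  rw [Pi.sub_apply, Pi.smul_apply, Finset.sum_apply, Finset.sum_congr rfl fun s _ => e s,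
    ← Finset.sum_mul, smul_eq_mul]
  have hϖ' : Valued.v ((ϖ⁻¹ : (v.adicCompletion F)ˣ) : v.adicCompletion F) =
      WithZero.exp (1 : ℤ) := by
    have := val_zpow hϖ (-1)
    rwa [zpow_neg_one, neg_neg] at this
  by_cases hy0 : (y : v.adicCompletion F) ∈ ball v 0
  · rcases val_eq_one_or_mem hy0 with hy | hy
    · rw [Set.indicator_of_mem (mem_unitSet.2 hy), hS'.sum_addChar hψ (by rw [mul_comm, val_unit_mul hy, hϖ']), zero_mul,
        mul_zero, sub_zero, ← one_mul y, hu 1 y hy, diagOne_one, h1]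
    · have hne : Valued.v (y : v.adicCompletion F) ≠ 1 := (mem_ball_one.1 hy).ne
      have h2 : ∀ s ∈ S, (ψ (((y * ϖ⁻¹ : (v.adicCompletion F)ˣ) : v.adicCompletion F) * s) : ℂ) =
          1 := by
        intro s hs
        have hb : ((ϖ⁻¹ : (v.adicCompletion F)ˣ) : v.adicCompletion F) ∈ ball v (-1) := by
          rw [mem_ball, hϖ', neg_neg]
        have := mul_mem_ball (mul_mem_ball hy hb) (hS'.2.1 s hs)
        rw [hψ.eq_one (by simpa using this), Circle.coe_one]
      rw [Set.indicator_of_notMem (mt mem_unitSet.1 hne), Finset.sum_congr rfl h2, Finset.sum_const, hS'.1, pow_one, nsmul_eq_mul,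
        mul_one, inv_mul_cancel_left₀ hq, sub_self]
  · have hne : Valued.v (y : v.adicCompletion F) ≠ 1 := fun h => hy0 (mem_ball_zero.2 h.le)
    rw [Set.indicator_of_notMem (mt mem_unitSet.1 hne), hWw.eq_zero_of_notMem hψ hn (by simpa using hy0), mul_zero, mul_zero, sub_zero]

/-- At a level deep enough for the lower unipotents to fix both vectors, the torus integral is the
volume of the units, independently of `s`. This non-zero constant is what makes the Rankin–Selberg
polynomial exist. -/
theorem exists_zetaIntegral_const {ϖ : (v.adicCompletion F)ˣ}
    (hϖ : Valued.v (ϖ : v.adicCompletion F) = WithZero.exp (-1 : ℤ))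
    {ψ : AddChar (v.adicCompletion F) Circle} {V₁ V₂ : Submodule ℂ (LocalGL v → ℂ)}
    (hV₁ : IsUnitaryGeneric ψ V₁) (hV₂ : IsUnitaryGeneric ψ V₂)
    (h₁ : ∃ W ∈ V₁, ∀ y : (v.adicCompletion F)ˣ, W (diagOne y) =
      (unitSet v).indicator (fun _ => (1 : ℂ)) y)
    (h₂ : ∃ W ∈ V₂, ∀ y : (v.adicCompletion F)ˣ, W (diagOne y) =
      (unitSet v).indicator (fun _ => (1 : ℂ)) y) :
    ∃ (Φ : v.adicCompletion F × v.adicCompletion F → ℂ), IsSchwartzBruhat Φ ∧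
      ∃ W₁ ∈ V₁, ∃ W₂ ∈ V₂, ∃ c : ℂ, c ≠ 0 ∧
        ∀ᶠ s in farRight, zetaIntegral (principalVector Φ s) W₁ W₂ = c := by
  obtain ⟨W₁, hW₁, e₁⟩ := h₁
  obtain ⟨W₂, hW₂, e₂⟩ := h₂
  obtain ⟨m₁, hm₁, -, hl₁, -⟩ := hV₁.exists_level hW₁
  obtain ⟨m₂, hm₂, -, hl₂, -⟩ := hV₂.exists_level hW₂
  have hmem : ∀ y u : (v.adicCompletion F)ˣ, Valued.v (u : v.adicCompletion F) = 1 →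
      (unitSet v).indicator (fun _ => (1 : ℂ)) (y * u) =
        (unitSet v).indicator (fun _ => (1 : ℂ)) y := by
    intro y u hu
    have : y * u ∈ unitSet v ↔ y ∈ unitSet v := by rw [mem_unitSet, mem_unitSet, val_unit_mul hu]
    by_cases hy : y ∈ unitSet v
    · rw [Set.indicator_of_mem hy, Set.indicator_of_mem (this.2 hy)]
    · rw [Set.indicator_of_notMem hy, Set.indicator_of_notMem (mt this.1 hy)]
  obtain ⟨k, hk⟩ : ∃ k, m₁ + m₂ = k + 1 := ⟨m₁ + m₂ - 1, by omega⟩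
  refine ⟨levelTest v (k + 1), isSchwartzBruhat_levelTest _, W₁, hW₁, W₂, hW₂,
    levelVolume v (k + 1), ?_, Eventually.of_forall fun s => ?_⟩
  · intro h
    have := one_le_levelVolume hϖ k
    rw [Complex.ofReal_eq_zero.1 h, mul_zero] at this
    exact absurd this (by norm_num)
  · rw [zetaIntegral_levelTest (hV₁.isWhittakerFunction hW₁) (hV₂.isWhittakerFunction hW₂)
      (by omega) (fun x hx => hl₁ x (ball_mono (by omega) hx))
      (fun x hx => hl₂ x (ball_mono (by omega) hx)) (fun y u hu => by rw [e₁, e₁, hmem y u hu])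
      (fun y u hu => by rw [e₂, e₂, hmem y u hu]), torusIntegral, integralUnits_eq]
    have h : ∀ y : (v.adicCompletion F)ˣ, W₁ (diagOne y) * starRingEnd ℂ (W₂ (diagOne y)) *
        ((‖(y : v.adicCompletion F)‖ : ℝ) : ℂ) ^ (s - 1) =
        (unitSet v).indicator (fun _ => (1 : ℂ)) y := by
      intro y
      rw [e₁, e₂]
      by_cases hy : y ∈ unitSet v
      · rw [Set.indicator_of_mem hy, norm_eq_one hy]
        simp
      · rw [Set.indicator_of_notMem hy, zero_mul, zero_mul]
    simp only [h]
    rw [integral_indicator measurableSet_unitSet, setIntegral_const, measureReal_def,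
      haarUnits_unitSet]
    simp

/-- Conjugate linearity requires convergence of the integrals concerned, which is available for `Re
s` large. -/
theorem zetaIntegral_add_smul {ϖ : (v.adicCompletion F)ˣ}
    (hϖ : Valued.v (ϖ : v.adicCompletion F) = WithZero.exp (-1 : ℤ))
    {ψ₁ ψ₂ : AddChar (v.adicCompletion F) Circle} {V₁ V₂ : Submodule ℂ (LocalGL v → ℂ)}
    (hV₁ : IsUnitaryGeneric ψ₁ V₁) (hV₂ : IsUnitaryGeneric ψ₂ V₂)
    (hm₁ : ∀ W ∈ V₁, HasMellin ϖ fun y => W (diagOne y))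
    (hm₂ : ∀ W ∈ V₂, HasMellin ϖ fun y => W (diagOne y)) (l : List ℂ)
    (hl : ∀ W₁ ∈ V₁, ∀ W₂ ∈ V₂, ∃ N, ∀ n ≥ N, recOp l (shellSeq ϖ W₁ W₂) n = 0)
    {Φ : v.adicCompletion F × v.adicCompletion F → ℂ} (hΦ : IsSchwartzBruhat Φ)
    {W₁ W₂ W₂' : LocalGL v → ℂ} (hW₁ : W₁ ∈ V₁) (hW₂ : W₂ ∈ V₂) (hW₂' : W₂' ∈ V₂) (c : ℂ) :
    ∀ᶠ s in farRight, zetaIntegral (principalVector Φ s) W₁ (c • W₂ + W₂') =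
      starRingEnd ℂ c * zetaIntegral (principalVector Φ s) W₁ W₂ +
        zetaIntegral (principalVector Φ s) W₁ W₂' := by
  obtain ⟨U₁, hU₁, h₁⟩ := hV₁.exists_isOpen_integral hW₁
  obtain ⟨U₂, hU₂, h₂⟩ := hV₂.exists_isOpen_integral hW₂
  obtain ⟨U₄, hU₄, h₄⟩ := hV₂.exists_isOpen_integral hW₂'
  obtain ⟨U₃, hU₃, h₃⟩ := hΦ.exists_isOpen
  obtain ⟨n, k, -, havg⟩ := exists_average (U₁ ⊓ U₂ ⊓ U₃ ⊓ U₄)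
    (((hU₁.inter hU₂).inter hU₃).inter hU₄)
  have key := fun i => (isLaurent_torusIntegral hϖ
    (hm₁ _ (hV₁.stable W₁ hW₁ (integralIncl v (k i))))
    (hm₂ _ (hV₂.stable W₂ hW₂ (integralIncl v (k i)))) l
    (hl _ (hV₁.stable W₁ hW₁ _) _ (hV₂.stable W₂ hW₂ _))).1
  have key' := fun i => (isLaurent_torusIntegral hϖ
    (hm₁ _ (hV₁.stable W₁ hW₁ (integralIncl v (k i))))
    (hm₂ _ (hV₂.stable W₂' hW₂' (integralIncl v (k i)))) l
    (hl _ (hV₁.stable W₁ hW₁ _) _ (hV₂.stable W₂' hW₂' _))).1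
  filter_upwards [eventually_all.2 key, eventually_all.2 key'] with s hs hs'
  have i₁ : ∀ u ∈ U₁ ⊓ U₂ ⊓ U₃ ⊓ U₄, rightTranslate (integralIncl v u) W₁ = W₁ :=
    fun u hu => h₁ u hu.1.1.1
  have i₂ : ∀ u ∈ U₁ ⊓ U₂ ⊓ U₃ ⊓ U₄, rightTranslate (integralIncl v u) W₂ = W₂ :=
    fun u hu => h₂ u hu.1.1.2
  have i₄ : ∀ u ∈ U₁ ⊓ U₂ ⊓ U₃ ⊓ U₄, rightTranslate (integralIncl v u) W₂' = W₂' :=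
    fun u hu => h₄ u hu.2
  have i₃ : ∀ u ∈ U₁ ⊓ U₂ ⊓ U₃ ⊓ U₄, ∀ x, Φ (rowAct x u) = Φ x := fun u hu => h₃ u hu.1.2
  rw [zetaIntegral_eq_sum havg i₁ i₂ i₃, zetaIntegral_eq_sum havg i₁ i₄ i₃,
    zetaIntegral_eq_sum havg i₁ (fun u hu => by
      rw [rightTranslate_add, rightTranslate_smul, i₂ u hu, i₄ u hu]) i₃, integralUnits_eq,
    integralUnits_eq, integralUnits_eq, ← integral_const_mul, ← integral_add
      ((integrable_finsetSum _ fun i _ => (hs i).const_mul _).const_mul _)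
      (integrable_finsetSum _ fun i _ => (hs' i).const_mul _)]
  congr 1
  funext y
  rw [Finset.mul_sum, ← Finset.sum_add_distrib]
  refine Finset.sum_congr rfl fun i _ => ?_
  rw [rightTranslate_add, rightTranslate_smul, Pi.add_apply, Pi.smul_apply, smul_eq_mul,
    map_add, map_mul]
  ring

theorem zetaIntegral_const_mul (c : ℂ) (f W W' : LocalGL v → ℂ) :
    zetaIntegral (fun g => c * f g) W W' = c * zetaIntegral f W W' := by
  unfold zetaIntegral
  rw [integralUnits_eq, integralUnits_eq, ← integral_const_mul]
  congr 1
  funext y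
  rw [integralCompact_eq, integralCompact_eq, ← mul_div_assoc, ← integral_const_mul]
  congr 2
  funext k
  ring

/-! ### Orthonormal bases -/

section

variable {ψ : AddChar (v.adicCompletion F) Circle} {V : Submodule ℂ (LocalGL v → ℂ)}
  {B : Set (LocalGL v → ℂ)}

/-- Every function in the model is a finite combination of basis vectors, so square integrability on
the torus need only be checked for these. -/
theorem IsOrthonormalBasis.memLp (hV : IsUnitaryGeneric ψ V) (hB : IsOrthonormalBasis V B)
    {W : LocalGL v → ℂ} (hW : W ∈ V) : MemLp (fun y => W (diagOne y)) 2 (haarUnits v) := by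
  have hBV : ∀ b ∈ B, b ∈ V := fun b hb => hB.span_eq ▸ Submodule.subset_span hb
  rw [← hB.span_eq] at hW
  induction hW using Submodule.span_induction with
  | mem b hb =>
    have hm : AEStronglyMeasurable (fun y => b (diagOne y)) (haarUnits v) :=
      (continuous_torus hV (hBV b hb)).aestronglyMeasurable
    rw [memLp_two_iff_integrable_sq_norm hm]
    have h1 := hB.orthonormal b hb b hb
    rw [if_pos rfl, whittakerInner] at h1
    -- The integral of a non-integrable function is `0` by convention, which would contradict `⟨b,
    -- b⟩ = 1`.
    have h2 : Integrable (fun y => b (diagOne y) * starRingEnd ℂ (b (diagOne y))) (haarUnits v) := by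
      by_contra h
      rw [integralUnits_eq, integral_undef h, mul_zero] at h1
      exact zero_ne_one h1
    refine h2.norm.congr (Eventually.of_forall fun y => ?_)
    simp only [norm_mul, RCLike.norm_conj, sq]
  | zero => exact MemLp.zero'
  | add W W' _ _ h h' => exact h.add h'
  | smul c W _ h => exact h.const_smul c

theorem IsOrthonormalBasis.integrable_mul (hV : IsUnitaryGeneric ψ V)
    (hB : IsOrthonormalBasis V B) {W W' : LocalGL v → ℂ} (hW : W ∈ V) (hW' : W' ∈ V) :
    Integrable (fun y => W (diagOne y) * starRingEnd ℂ (W' (diagOne y))) (haarUnits v) :=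
  (hB.memLp hV hW).integrable_mul (hB.memLp hV hW').star

open Classical in
theorem IsOrthonormalBasis.exists_sum_eq (hV : IsUnitaryGeneric ψ V)
    (hB : IsOrthonormalBasis V B) {W : LocalGL v → ℂ} (hW : W ∈ V) :
    ∃ (t : Finset (LocalGL v → ℂ)) (c : (LocalGL v → ℂ) → ℂ), ↑t ⊆ B ∧ W = ∑ b ∈ t, c b • b ∧
      whittakerInner V W W = ((∑ b ∈ t, ‖c b‖ ^ 2 : ℝ) : ℂ) := by
  have hBV : ∀ b ∈ B, b ∈ V := fun b hb => hB.span_eq ▸ Submodule.subset_span hb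
  have hW' := hW
  rw [← hB.span_eq, Submodule.mem_span_set] at hW'
  obtain ⟨c, hc, rfl⟩ := hW'
  refine ⟨c.support, c, hc, rfl, ?_⟩
  have h1 : ∀ y : (v.adicCompletion F)ˣ, (c.sum fun b r => r • b) (diagOne y) *
      starRingEnd ℂ ((c.sum fun b r => r • b) (diagOne y)) =
      ∑ b ∈ c.support, ∑ b' ∈ c.support, (c b * starRingEnd ℂ (c b')) *
        (b (diagOne y) * starRingEnd ℂ (b' (diagOne y))) := by
    intro y
    rw [Finsupp.sum, Finset.sum_apply, map_sum, Finset.sum_mul_sum]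
    refine Finset.sum_congr rfl fun b _ => Finset.sum_congr rfl fun b' _ => ?_
    simp only [Pi.smul_apply, smul_eq_mul, map_mul]
    ring
  have hint : ∀ b ∈ c.support, ∀ b' ∈ c.support, Integrable (fun y =>
      (c b * starRingEnd ℂ (c b')) * (b (diagOne y) * starRingEnd ℂ (b' (diagOne y))))
      (haarUnits v) := fun b hb b' hb' =>
    (hB.integrable_mul hV (hBV b (hc hb)) (hBV b' (hc hb'))).const_mul _
  rw [whittakerInner, integralUnits_eq]
  simp only [h1]
  rw [integral_finsetSum _ fun b hb => integrable_finsetSum _ fun b' hb' => hint b hb b' hb',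
    Finset.mul_sum, Complex.ofReal_sum]
  refine Finset.sum_congr rfl fun b hb => ?_
  rw [integral_finsetSum _ fun b' hb' => hint b hb b' hb', Finset.mul_sum]
  have h2 : ∀ b' ∈ c.support, (eulerFactor v 2 : ℂ) / rankinSelbergL V V 1 *
      ∫ y, (c b * starRingEnd ℂ (c b')) * (b (diagOne y) * starRingEnd ℂ (b' (diagOne y)))
        ∂(haarUnits v) = c b * starRingEnd ℂ (c b') * if b = b' then 1 else 0 := by
    intro b' hb'
    rw [← hB.orthonormal b (hc hb) b' (hc hb'), whittakerInner, integralUnits_eq,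
      integral_const_mul]
    ring
  rw [Finset.sum_congr rfl h2]
  simp only [mul_ite, mul_one, mul_zero, Finset.sum_ite_eq, if_pos hb]
  rw [Complex.mul_conj, Complex.normSq_eq_norm_sq]

/-- Injectivity of restriction to the torus: the norm is an integral over the torus and, by
orthonormality, also the sum of the squared coefficients. -/
theorem IsOrthonormalBasis.eq_zero (hV : IsUnitaryGeneric ψ V) (hB : IsOrthonormalBasis V B)
    {W : LocalGL v → ℂ} (hW : W ∈ V) (h : ∀ y, W (diagOne y) = 0) : W = 0 := by
  obtain ⟨t, c, -, rfl, h1⟩ := hB.exists_sum_eq hV hW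
  rw [whittakerInner, integralUnits_eq] at h1
  simp only [h, zero_mul, integral_zero, mul_zero] at h1
  have h2 := (Finset.sum_eq_zero_iff_of_nonneg fun b _ => sq_nonneg ‖c b‖).1
    (Complex.ofReal_eq_zero.1 h1.symm)
  refine Finset.sum_eq_zero fun b hb => ?_
  have := h2 b hb
  rw [sq_eq_zero_iff, norm_eq_zero] at this
  rw [this, zero_smul]

/-- The normalised zeta integral is conjugate linear in `W` far to the right, hence after
continuation. Expanding `W` in finitely many basis vectors, Cauchy–Schwarz gives the bound with the
partial sum over these vectors, which is at most the whole weight. Thus a single well-chosen vector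
suffices. -/
theorem IsOrthonormalBasis.sq_norm_le_localWeight {ϖ : (v.adicCompletion F)ˣ}
    (hϖ : Valued.v (ϖ : v.adicCompletion F) = WithZero.exp (-1 : ℤ))
    {ψ₀ : AddChar (v.adicCompletion F) Circle} {V₀ : Submodule ℂ (LocalGL v → ℂ)}
    (hV₀ : IsUnitaryGeneric ψ₀ V₀) (hV : IsUnitaryGeneric ψ V) (hB : IsOrthonormalBasis V B)
    (hm₀ : ∀ W ∈ V₀, HasMellin ϖ fun y => W (diagOne y))
    (hm : ∀ W ∈ V, HasMellin ϖ fun y => W (diagOne y)) (l : List ℂ)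
    (hl : ∀ W₁ ∈ V₀, ∀ W₂ ∈ V, ∃ N, ∀ n ≥ N, recOp l (shellSeq ϖ W₁ W₂) n = 0)
    {P : ℂ[X]} (hP : IsRankinSelbergPolynomial V₀ V P)
    (hPL : rankinSelbergL V₀ V = fun s => (P.eval ((residueCard v : ℂ) ^ (-s)))⁻¹)
    (r : ℕ) {W₀ W : LocalGL v → ℂ} (hW₀ : W₀ ∈ V₀) (hW : W ∈ V) {E : ℂ → ℂ}
    (hE : Differentiable ℂ E)
    (hEW : ∀ᶠ s in farRight, zetaIntegral (testVector ϖ r s) W₀ W *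
      P.eval ((residueCard v : ℂ) ^ (-s)) = E s) :
    ENNReal.ofReal (‖E (1 / 2)‖ ^ 2) ≤
      ENNReal.ofReal ‖whittakerInner V W W‖ * localWeight ϖ r V₀ W₀ V B := by
  have hBV : ∀ b ∈ B, b ∈ V := fun b hb => hB.span_eq ▸ Submodule.subset_span hb
  have hzeta : ∀ (s : ℂ) (W' : LocalGL v → ℂ), zetaIntegral (testVector ϖ r s) W₀ W' =
      laurentIn v r 1 s * zetaIntegral (principalVector (levelTest v r) s) W₀ W' := by
    intro s W'
    rw [testVector_eq hϖ, zetaIntegral_const_mul]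
  have hΛ : ∀ b ∈ V, ∃ Λ : ℂ → ℂ, Differentiable ℂ Λ ∧ ∀ᶠ s in farRight,
      zetaIntegral (testVector ϖ r s) W₀ b * P.eval ((residueCard v : ℂ) ^ (-s)) = Λ s := by
    intro b hb
    obtain ⟨m, Q, hQ⟩ := hP.2.1 _ (isSchwartzBruhat_levelTest r) W₀ hW₀ b hb
    refine ⟨fun s => laurentIn v r 1 s * laurentIn v m Q s,
      (differentiable_laurentIn _ _).mul (differentiable_laurentIn _ _), ?_⟩
    filter_upwards [hQ] with s hs
    rw [hzeta, ← hs, mul_assoc]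
  choose! Λ hΛd hΛ using hΛ
  obtain ⟨t, c, htB, hsum, hinner⟩ := hB.exists_sum_eq hV hW
  have hlin : ∀ t : Finset (LocalGL v → ℂ), (↑t ⊆ B) → ∀ᶠ s in farRight,
      zetaIntegral (testVector ϖ r s) W₀ (∑ b ∈ t, c b • b) =
        ∑ b ∈ t, starRingEnd ℂ (c b) * zetaIntegral (testVector ϖ r s) W₀ b := by
    classical
    intro t
    induction t using Finset.induction_on with
    | empty =>
      intro _
      refine Eventually.of_forall fun s => ?_
      simp [zetaIntegral, integralUnits_eq, integralCompact_eq]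
    | insert b t hb ih =>
      intro ht
      rw [Finset.coe_insert, Set.insert_subset_iff] at ht
      filter_upwards [ih ht.2, zetaIntegral_add_smul hϖ hV₀ hV hm₀ hm l hl
        (isSchwartzBruhat_levelTest r) hW₀ (hBV b ht.1)
        (V.sum_mem fun b' hb' => V.smul_mem (c b') (hBV b' (ht.2 hb'))) (c b)] with s h1 h2
      rw [Finset.sum_insert hb, Finset.sum_insert hb, ← h1, hzeta, h2, hzeta, hzeta]
      ring
  have hEeq : E = fun s => ∑ b ∈ t, starRingEnd ℂ (c b) * Λ b s := by
    refine eq_of_eventually_eq hE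
      (Differentiable.fun_sum fun b hb => (hΛd b (hBV b (htB hb))).const_mul _) ?_
    have h3 : ∀ᶠ s in farRight, ∀ b ∈ t, zetaIntegral (testVector ϖ r s) W₀ b *
        P.eval ((residueCard v : ℂ) ^ (-s)) = Λ b s :=
      (Filter.eventually_all_finset t).2 fun b hb => hΛ b (hBV b (htB hb))
    filter_upwards [hEW, hlin t htB, h3] with s h1 h2 h3
    rw [← h1, hsum, h2, Finset.sum_mul]
    refine Finset.sum_congr rfl fun b hb => ?_
    rw [← h3 b hb, mul_assoc]
  have hentire : ∀ b ∈ B, entireQuotient (fun s => zetaIntegral (testVector ϖ r s) W₀ b)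
      (rankinSelbergL V₀ V) = Λ b := by
    intro b hb
    rw [hPL]
    exact entireQuotient_eq hP.1 (hΛd b (hBV b hb)) (hΛ b (hBV b hb))
  have hcs : ‖E (1 / 2)‖ ^ 2 ≤ (∑ b ∈ t, ‖c b‖ ^ 2) * ∑ b ∈ t, ‖Λ b (1 / 2)‖ ^ 2 := by
    refine le_trans ?_ (Finset.sum_mul_sq_le_sq_mul_sq t (fun b => ‖c b‖) fun b => ‖Λ b (1 / 2)‖)
    rw [hEeq]
    refine pow_le_pow_left₀ (norm_nonneg _) ((norm_sum_le _ _).trans (le_of_eq ?_)) 2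
    refine Finset.sum_congr rfl fun b _ => ?_
    rw [norm_mul, RCLike.norm_conj]
  rw [hinner, Complex.norm_of_nonneg (Finset.sum_nonneg fun b _ => sq_nonneg _)]
  refine (ENNReal.ofReal_le_ofReal hcs).trans ?_
  rw [ENNReal.ofReal_mul (Finset.sum_nonneg fun b _ => sq_nonneg _)]
  refine mul_le_mul_right ?_ _
  rw [ENNReal.ofReal_sum_of_nonneg fun b _ => sq_nonneg _, localWeight,
    ← Finset.sum_coe_sort t]
  have hinj : Function.Injective fun b : t => (⟨b, htB b.2⟩ : B) := fun a b h =>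
    Subtype.ext (Subtype.mk.inj h)
  calc _ = ∑ b : t, ‖entireQuotient (fun s => zetaIntegral (testVector ϖ r s) W₀
        ((⟨b, htB b.2⟩ : B) : LocalGL v → ℂ)) (rankinSelbergL V₀ V) (1 / 2)‖ₑ ^ 2 := by
        refine Finset.sum_congr rfl fun b _ => ?_
        rw [hentire _ (htB b.2), ENNReal.ofReal_pow (norm_nonneg _), ofReal_norm]
    _ = ∑' b : t, _ := (tsum_fintype _).symm
    _ ≤ _ := ENNReal.tsum_comp_le_tsum_of_injective hinj fun W : B =>
        ‖entireQuotient (fun s => zetaIntegral (testVector ϖ r s) W₀ W)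
          (rankinSelbergL V₀ V) (1 / 2)‖ₑ ^ 2

end

/-! ### Normalised zeta integrals of newvectors -/

theorem IsInvariantLevel.mono {r r' : ℕ} (h : r ≤ r') {W : LocalGL v → ℂ}
    (hW : IsInvariantLevel r W) : IsInvariantLevel r' W := fun k hk =>
  hW k (hk.trans (WithZero.exp_le_exp.2 (by omega)))

theorem IsInvariantLevel.upper {r : ℕ} {W : LocalGL v → ℂ} (hW : IsInvariantLevel r W)
    {x : v.adicCompletion F} (hx : x ∈ ball v 0) : rightTranslate (upper x) W = W := by
  obtain ⟨k, hk⟩ := exists_integral_upper hx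
  rw [← hk]
  refine hW k ?_
  rw [← integralIncl_apply, hk, coe_upper]
  simp

theorem IsInvariantLevel.lower {r : ℕ} {W : LocalGL v → ℂ} (hW : IsInvariantLevel r W)
    {x : v.adicCompletion F} (hx : x ∈ ball v r) : rightTranslate (lower x) W = W := by
  obtain ⟨k, hk⟩ := exists_integral_lower (ball_mono (by omega) hx)
  rw [← hk]
  refine hW k ?_
  rw [← integralIncl_apply, hk, coe_lower]
  simpa using mem_ball.1 hx

theorem IsInvariantLevel.diagOne {r : ℕ} {W : LocalGL v → ℂ} (hW : IsInvariantLevel r W)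
    {u : (v.adicCompletion F)ˣ} (hu : Valued.v (u : v.adicCompletion F) = 1) :
    rightTranslate (diagOne u) W = W := by
  obtain ⟨k, hk⟩ := exists_integral_diagOne hu
  rw [← hk]
  refine hW k ?_
  rw [← integralIncl_apply, hk, coe_diagOne]
  simp

theorem IsInvariantLevel.torus {r : ℕ} {W : LocalGL v → ℂ} (hW : IsInvariantLevel r W)
    (y u : (v.adicCompletion F)ˣ) (hu : Valued.v (u : v.adicCompletion F) = 1) :
    W (SpectralWeight.diagOne (y * u)) = W (SpectralWeight.diagOne y) := by
  rw [diagOne_mul]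
  exact congrFun (hW.diagOne hu) _

theorem IsInvariantLevel.torus_eq_zero {ψ : AddChar (v.adicCompletion F) Circle}
    (hψ : HasConductor ψ 0) {r : ℕ} {W : LocalGL v → ℂ} (hW : IsInvariantLevel r W)
    (hWw : IsWhittakerFunction ψ W) {y : (v.adicCompletion F)ˣ}
    (hy : (y : v.adicCompletion F) ∉ ball v 0) : W (SpectralWeight.diagOne y) = 0 :=
  hWw.eq_zero_of_notMem hψ (m := 0) (fun _ hx => hW.upper hx) (by simpa using hy)

section

variable {ϖ : (v.adicCompletion F)ˣ}

theorem zpow_mul_notMem_ball (hϖ : Valued.v (ϖ : v.adicCompletion F) = WithZero.exp (-1 : ℤ))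
    {n : ℤ} {u : (v.adicCompletion F)ˣ} (hu : Valued.v (u : v.adicCompletion F) = 1) (hn : n < 0) :
    ((ϖ ^ n * u : (v.adicCompletion F)ˣ) : v.adicCompletion F) ∉ ball v 0 := by
  rw [mem_ball, val_unit_mul hu, val_zpow hϖ, WithZero.exp_le_exp]
  omega

theorem mellin_mul_eq (hϖ : Valued.v (ϖ : v.adicCompletion F) = WithZero.exp (-1 : ℤ))
    {φ : (v.adicCompletion F)ˣ → ℂ} (hφ : HasMellin ϖ φ)
    (h0 : ∀ y : (v.adicCompletion F)ˣ, (y : v.adicCompletion F) ∉ ball v 0 → φ y = 0) (l : List ℂ)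
    {N : ℂ[X]} (hN : (eulerPoly l : PowerSeries ℂ) *
      PowerSeries.mk (fun n => unitIntegral v fun u => φ (ϖ ^ n * u)) = N) :
    ∃ R : ℝ, 1 ≤ R ∧ ∀ z : ℂ, ‖(residueCard v : ℂ) ^ (-z)‖ * R < 1 →
      (eulerPoly l).eval ((residueCard v : ℂ) ^ (-z)) *
        (integralUnits v fun y => φ y * ((‖(y : v.adicCompletion F)‖ : ℝ) : ℂ) ^ z) =
        N.eval ((residueCard v : ℂ) ^ (-z)) := by
  obtain ⟨hc, A, D, R, hD, hR, h0', hb⟩ := hφ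
  refine ⟨R, hR, fun z hz => ?_⟩
  obtain ⟨-, h2, h3⟩ := integralUnits_mul_cpow hϖ hc 0
    (fun n u hu hn => h0 _ (zpow_mul_notMem_ball hϖ hu (by simpa using hn))) (C := D * R ^ A)
    (by linarith)
    (fun n u hu => by
      have := hb (n + A) u hu
      rw [Nat.cast_add, add_sub_cancel_right, pow_add] at this
      rw [Nat.cast_zero, sub_zero]
      linarith) hz
  simp only [Nat.cast_zero, sub_zero, zpow_natCast, pow_zero, one_mul] at h2 h3
  rw [h3, eval_mul_tsum_eq hN h2]

theorem torusIntegral_mul_eq (hϖ : Valued.v (ϖ : v.adicCompletion F) = WithZero.exp (-1 : ℤ))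
    {W₁ W₂ : LocalGL v → ℂ}
    (hm₁ : HasMellin ϖ fun y => W₁ (diagOne y)) (hm₂ : HasMellin ϖ fun y => W₂ (diagOne y))
    (h0 : ∀ y : (v.adicCompletion F)ˣ, (y : v.adicCompletion F) ∉ ball v 0 → W₁ (diagOne y) = 0)
    (l : List ℂ) {N : ℂ[X]} (hN : (eulerPoly l : PowerSeries ℂ) *
      PowerSeries.mk (shellSeq ϖ W₁ W₂) = N) :
    ∀ᶠ s in farRight, (eulerPoly (l.map fun γ => γ * residueCard v)).eval
      ((residueCard v : ℂ) ^ (-s)) * torusIntegral W₁ W₂ s =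
        (N.comp (C (residueCard v : ℂ) * X)).eval ((residueCard v : ℂ) ^ (-s)) := by
  obtain ⟨R, hR, h⟩ := mellin_mul_eq hϖ (hm₁.mul hm₂.conj)
    (fun y hy => by rw [h0 y hy, zero_mul]) l hN
  have hR0 : 0 < R := by linarith
  have hq := residueCard_pos (v := v)
  filter_upwards [eventually_farRight_of_norm_lt (v := v) (ε := (residueCard v * R)⁻¹)
    (by positivity)] with s hs
  have h2 := h (s - 1) (by
    rw [cpow_sub_one_eq, norm_mul, Complex.norm_natCast]
    calc _ = ‖(residueCard v : ℂ) ^ (-s)‖ * (residueCard v * R) := by ring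
      _ < (residueCard v * R)⁻¹ * (residueCard v * R) := by gcongr
      _ = 1 := inv_mul_cancel₀ (by positivity))
  rw [eval_eulerPoly_map_mul, ← cpow_sub_one_eq, torusIntegral, h2, eval_comp, eval_mul, eval_C,
    eval_X, cpow_sub_one_eq]

theorem eulerPoly_quad : eulerPoly [1, -1] = 1 - X ^ 2 := by
  simp
  ring

/-- One explicit zeta integral, `N(qX) / M` up to the volume, pins down `P` up to factors `1 ± X`:
its integrality bounds `P` from below and the common denominator `(1 - X²) M` bounds it from above.
The quotient `G` is also the normalised zeta integral, up to the volume, so the exact Rankin–Selberg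
factor is not needed. -/
theorem exists_dvd_sq (hϖ : Valued.v (ϖ : v.adicCompletion F) = WithZero.exp (-1 : ℤ))
    {ψ : AddChar (v.adicCompletion F) Circle} (hψ : HasConductor ψ 0)
    {V₁ V₂ : Submodule ℂ (LocalGL v → ℂ)} (hV₁ : IsUnitaryGeneric ψ V₁)
    (hV₂ : IsUnitaryGeneric ψ V₂)
    (hm₁ : ∀ W ∈ V₁, HasMellin ϖ fun y => W (diagOne y))
    (hm₂ : ∀ W ∈ V₂, HasMellin ϖ fun y => W (diagOne y)) {l : List ℂ}
    (hl : ∀ W₁ ∈ V₁, ∀ W₂ ∈ V₂, ∃ N, ∀ n ≥ N, recOp l (shellSeq ϖ W₁ W₂) n = 0)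
    {P : ℂ[X]} (hP : IsRankinSelbergPolynomial V₁ V₂ P) {r : ℕ} (hr : 1 ≤ r)
    {W₁ W₂ : LocalGL v → ℂ} (hW₁ : W₁ ∈ V₁) (hW₂ : W₂ ∈ V₂) (hr₁ : IsInvariantLevel r W₁)
    (hr₂ : IsInvariantLevel r W₂) {N : ℂ[X]} (hN0 : N.coeff 0 = 1)
    (hN : (eulerPoly l : PowerSeries ℂ) * PowerSeries.mk (shellSeq ϖ W₁ W₂) = N)
    (hNd : N.comp (C (residueCard v : ℂ) * X) ∣ 1 - X ^ 2) :
    ∃ G : ℂ[X], G ∣ eulerPoly [1, -1, 1, -1] ∧ G.coeff 0 = 1 ∧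
      P * N.comp (C (residueCard v : ℂ) * X) =
        eulerPoly (l.map fun γ => γ * residueCard v) * G ∧
      ∀ᶠ s in farRight, zetaIntegral (principalVector (levelTest v r) s) W₁ W₂ *
        P.eval ((residueCard v : ℂ) ^ (-s)) =
          levelVolume v r * G.eval ((residueCard v : ℂ) ^ (-s)) := by
  set Nq := N.comp (C (residueCard v : ℂ) * X) with hNq
  set M := eulerPoly (l.map fun γ => γ * (residueCard v : ℂ)) with hM
  have hM0 : M.coeff 0 = 1 := eulerPoly_coeff_zero _
  have hNq0 : Nq.coeff 0 = 1 := by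
    rw [hNq, coeff_zero_eq_eval_zero, eval_comp]
    simpa [← coeff_zero_eq_eval_zero] using hN0
  have hz := zetaIntegral_levelTest (hV₁.isWhittakerFunction hW₁) (hV₂.isWhittakerFunction hW₂)
    hr (fun x hx => hr₁.lower hx) (fun x hx => hr₂.lower hx) hr₁.torus hr₂.torus
  have ht := torusIntegral_mul_eq hϖ (hm₁ _ hW₁) (hm₂ _ hW₂)
    (fun y hy => hr₁.torus_eq_zero hψ (hV₁.isWhittakerFunction hW₁) hy) l hN
  have hv0 : (levelVolume v r : ℂ) ≠ 0 := by
    intro h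
    obtain ⟨k, rfl⟩ : ∃ k, r = k + 1 := ⟨r - 1, by omega⟩
    have := one_le_levelVolume hϖ k
    rw [Complex.ofReal_eq_zero.1 h, mul_zero] at this
    exact absurd this (by norm_num)
  obtain ⟨m, Q, hQ⟩ := hP.2.1 _ (isSchwartzBruhat_levelTest r) W₁ hW₁ W₂ hW₂
  -- The lower bound: `P · N(qX) / M` is a Laurent polynomial, and `M(0) = 1`.
  have hMdvd : M ∣ P * Nq := by
    refine dvd_of_X_pow_mul_eq (m := m) (Q := C (levelVolume v r : ℂ)⁻¹ * Q) hM0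
      (eq_of_eventually_eval_eq v ?_)
    filter_upwards [hQ, ht] with s h1 h2
    rw [hz s] at h1
    rw [← hM] at h2
    have hX := residueCard_cpow_ne_zero (v := v) (-s)
    rw [laurentIn_eq, zpow_neg, zpow_natCast] at h1
    have h3 : eval ((residueCard v : ℂ) ^ (-s)) Q = ((residueCard v : ℂ) ^ (-s)) ^ m *
        (levelVolume v r * torusIntegral W₁ W₂ s * eval ((residueCard v : ℂ) ^ (-s)) P) := by
      rw [h1]
      field_simp
    simp only [eval_mul, eval_pow, eval_X, eval_C]
    rw [← h2, h3]
    field_simp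
  obtain ⟨G, hG⟩ := hMdvd
  -- The upper bound `P ∣ (1 - X²) M`. With `N(qX) ∣ 1 - X²` the two combine to `(1 - X²)² = G S T`
  -- after cancelling `M`.
  have hPd := hP.dvd (fun Φ hΦ W hW W' hW' =>
    isLaurent_zetaIntegral hϖ hV₁ hV₂ hm₁ hm₂ l hl hΦ hW hW')
  obtain ⟨S, hS⟩ := hPd
  obtain ⟨T, hT⟩ := hNd
  refine ⟨G, ⟨S * T, ?_⟩, ?_, hG, ?_⟩
  · have hS' : (1 - X ^ 2) * M = P * S := by
      rw [← hS, hM, ← eulerPoly_quad, ← eulerPoly_append]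
      rfl
    have h4 : eulerPoly [1, -1, 1, -1] = (1 - X ^ 2) * (1 - X ^ 2) := by
      rw [← eulerPoly_quad, ← eulerPoly_append]
      rfl
    apply mul_left_cancel₀ (eulerPoly_ne_zero (l.map fun γ => γ * (residueCard v : ℂ)))
    rw [← hM, h4]
    linear_combination (1 - X ^ 2) * hS' + P * S * hT + S * T * hG
  · have := congrArg (fun p => coeff p 0) hG
    simpa [mul_coeff_zero, hM0, hNq0, hP.1] using this.symm
  · filter_upwards [ht, eventually_eval_ne_zero (v := v) hM0] with s h1 h2
    apply mul_left_cancel₀ h2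
    have h3 := congrArg (eval ((residueCard v : ℂ) ^ (-s))) hG
    rw [eval_mul, eval_mul, ← h1] at h3
    rw [hz s]
    linear_combination (levelVolume v r : ℂ) * h3

end

/-! ### The local lower bound -/

section

variable {ϖ : (v.adicCompletion F)ˣ}

theorem hasSum_sq_norm (hϖ : Valued.v (ϖ : v.adicCompletion F) = WithZero.exp (-1 : ℤ))
    {W : LocalGL v → ℂ}
    (hu : ∀ (y u : (v.adicCompletion F)ˣ), Valued.v (u : v.adicCompletion F) = 1 →
      W (diagOne (y * u)) = W (diagOne y))
    (h0 : ∀ y : (v.adicCompletion F)ˣ, (y : v.adicCompletion F) ∉ ball v 0 → W (diagOne y) = 0)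
    (hint : Integrable (fun y => W (diagOne y) * starRingEnd ℂ (W (diagOne y))) (haarUnits v)) :
    HasSum (fun n : ℕ => W (diagOne (ϖ ^ n)) * starRingEnd ℂ (W (diagOne (ϖ ^ n))))
      (integralUnits v fun y => W (diagOne y) * starRingEnd ℂ (W (diagOne y))) := by
  have h1 := hasSum_unitIntegral hϖ hint
  have h2 : ∀ n : ℤ, (unitIntegral v fun u => W (diagOne (ϖ ^ n * u)) *
      starRingEnd ℂ (W (diagOne (ϖ ^ n * u)))) =
      W (diagOne (ϖ ^ n)) * starRingEnd ℂ (W (diagOne (ϖ ^ n))) := by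
    intro n
    rw [unitIntegral_congr (H' := fun _ => W (diagOne (ϖ ^ n)) *
      starRingEnd ℂ (W (diagOne (ϖ ^ n)))) fun u hu' => by rw [hu _ _ hu'], unitIntegral_const]
  simp only [h2] at h1
  have h3 := (Nat.cast_injective (R := ℤ)).hasSum_iff (a := integralUnits v fun y =>
    W (diagOne y) * starRingEnd ℂ (W (diagOne y))) (f := fun n : ℤ => W (diagOne (ϖ ^ n)) *
      starRingEnd ℂ (W (diagOne (ϖ ^ n)))) (fun n hn => by
    have hn' : n < 0 := by
      by_contra h
      exact hn ⟨n.toNat, Int.toNat_of_nonneg (not_lt.1 h)⟩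
    have := h0 (ϖ ^ n) (by simpa using zpow_mul_notMem_ball hϖ (u := 1) (by simp) hn')
    rw [this, zero_mul])
  have := h3.2 h1
  simpa [Function.comp_def] using this

theorem shellSeq_eq {W₁ W₂ : LocalGL v → ℂ}
    (hu₁ : ∀ (y u : (v.adicCompletion F)ˣ), Valued.v (u : v.adicCompletion F) = 1 →
      W₁ (diagOne (y * u)) = W₁ (diagOne y))
    (hu₂ : ∀ (y u : (v.adicCompletion F)ˣ), Valued.v (u : v.adicCompletion F) = 1 →
      W₂ (diagOne (y * u)) = W₂ (diagOne y)) (n : ℕ) :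
    shellSeq ϖ W₁ W₂ n = W₁ (diagOne (ϖ ^ n)) * starRingEnd ℂ (W₂ (diagOne (ϖ ^ n))) := by
  rw [shellSeq, unitIntegral_congr (H' := fun _ => W₁ (diagOne (ϖ ^ n)) *
    starRingEnd ℂ (W₂ (diagOne (ϖ ^ n)))) fun u hu => by rw [hu₁ _ _ hu, hu₂ _ _ hu],
    unitIntegral_const]

/-- The data from which the local lower bound is deduced: a recurrence for the Rankin–Selberg
series of `V₁` and `V₂`, and vectors of level `r` for which the series is explicit. -/
structure HasSeries (ϖ : (v.adicCompletion F)ˣ) (V₁ V₂ : Submodule ℂ (LocalGL v → ℂ))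
    (W₁ W₂ : LocalGL v → ℂ) (l : List ℂ) (N : ℂ[X]) : Prop where
  recOp_eq : ∀ W₁ ∈ V₁, ∀ W₂ ∈ V₂, ∃ N, ∀ n ≥ N, recOp l (shellSeq ϖ W₁ W₂) n = 0
  coeff_zero : N.coeff 0 = 1
  mul_eq : (eulerPoly l : PowerSeries ℂ) * PowerSeries.mk (shellSeq ϖ W₁ W₂) = N
  dvd : N.comp (C (residueCard v : ℂ) * X) ∣ 1 - X ^ 2

/-- The case of `π × π̃` at `s = 1`: the quantity equals `G(q⁻¹)`, a product of at most four factors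
`1 ± q⁻¹`. No bound on the Satake parameters enters, because the integral is assumed to converge at
`s = 1` itself. -/
theorem norm_eval_mul_integral_le (hϖ : Valued.v (ϖ : v.adicCompletion F) = WithZero.exp (-1 : ℤ))
    {ψ : AddChar (v.adicCompletion F) Circle} (hψ : HasConductor ψ 0)
    {V : Submodule ℂ (LocalGL v → ℂ)} (hV : IsUnitaryGeneric ψ V)
    (hm : ∀ W ∈ V, HasMellin ϖ fun y => W (diagOne y)) {P : ℂ[X]}
    (hP : IsRankinSelbergPolynomial V V P) {r : ℕ}
    (hr : 1 ≤ r) {W : LocalGL v → ℂ} (hW : W ∈ V) (hrW : IsInvariantLevel r W)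
    (hint : Integrable (fun y => W (diagOne y) * starRingEnd ℂ (W (diagOne y))) (haarUnits v))
    {l : List ℂ} {N : ℂ[X]} (hs : HasSeries ϖ V V W W l N) :
    ‖P.eval (residueCard v : ℂ)⁻¹ *
      integralUnits v fun y => W (diagOne y) * starRingEnd ℂ (W (diagOne y))‖ ≤
        (1 + (residueCard v : ℝ)⁻¹) ^ 4 := by
  have hq0 := residueCard_ne_zero (v := v)
  have hq1 : (1 : ℝ) < residueCard v := by exact_mod_cast one_lt_residueCard
  have hqp := residueCard_pos (v := v)
  obtain ⟨G, hGd, hG0, hG, -⟩ := exists_dvd_sq hϖ hψ hV hV hm hm hs.recOp_eq hP hr hW hW hrW hrW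
    hs.coeff_zero hs.mul_eq hs.dvd
  have hsum := hasSum_sq_norm hϖ hrW.torus
    (fun y hy => hrW.torus_eq_zero hψ (hV.isWhittakerFunction hW) hy) hint
  set I := integralUnits v fun y => W (diagOne y) * starRingEnd ℂ (W (diagOne y))
  -- The point `s = 1` is `q · q^(-s) = 1`, where absolute convergence comes from square
  -- integrability.
  have h1 : (eulerPoly l).eval 1 * I = N.eval 1 := by
    have := eval_mul_tsum_eq (x := 1) hs.mul_eq (by
      simp only [shellSeq_eq hrW.torus hrW.torus, one_pow, mul_one]
      exact hsum.summable.norm)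
    simpa only [shellSeq_eq hrW.torus hrW.torus, one_pow, mul_one, hsum.tsum_eq] using this
  have h2 := congrArg (eval (residueCard v : ℂ)⁻¹) hG
  rw [eval_mul, eval_mul, eval_eulerPoly_map_mul, eval_comp, eval_mul, eval_C, eval_X,
    mul_inv_cancel₀ hq0] at h2
  obtain ⟨T, hT⟩ := hs.dvd
  -- `N(1)` divides `1 - q^(-2) ≠ 0`, so `M(q⁻¹)` can be cancelled.
  have hN1 : N.eval 1 ≠ 0 := by
    intro h
    have := congrArg (eval (residueCard v : ℂ)⁻¹) hT
    rw [eval_mul, eval_comp, eval_mul, eval_C, eval_X, mul_inv_cancel₀ hq0, h, zero_mul] at this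
    simp only [eval_sub, eval_one, eval_pow, eval_X, sub_eq_zero] at this
    have h3 := congrArg norm this
    rw [norm_one, norm_pow, norm_inv, Complex.norm_natCast] at h3
    have h4 : ((residueCard v : ℝ)⁻¹) ^ 2 < 1 :=
      pow_lt_one₀ (by positivity) (inv_lt_one_of_one_lt₀ hq1) two_ne_zero
    linarith
  have hM1 : (eulerPoly l).eval 1 ≠ 0 := fun h => hN1 (by rw [← h1, h, zero_mul])
  have h3 : P.eval (residueCard v : ℂ)⁻¹ * I = G.eval (residueCard v : ℂ)⁻¹ := by
    apply mul_left_cancel₀ hM1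
    rw [← h2, ← h1]
    ring
  rw [h3]
  obtain ⟨l', hl', rfl⟩ := exists_sublist_of_dvd_eulerPoly _ G hGd hG0
  refine norm_eval_eulerPoly_le (by simp) [1, -1, 1, -1] (fun γ hγ => ?_) hl'
  have hγ' : ‖γ‖ = 1 := by
    simp only [List.mem_cons, List.not_mem_nil, or_false] at hγ
    rcases hγ with rfl | rfl | rfl | rfl <;> simp
  refine (norm_sub_le _ _).trans (le_of_eq ?_)
  rw [norm_one, norm_mul, hγ', one_mul, norm_inv, Complex.norm_natCast]

/-- Here only the upper bound for `P` by divisibility is used: each factor at `q⁻¹` is `1 ± q⁻¹` or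
`1 - γ`, and all of these are assumed to be bounded by `1 + q⁻¹`. The two extra factors account for
the `+ 2`. -/
theorem norm_eval_le_of_forall (hϖ : Valued.v (ϖ : v.adicCompletion F) = WithZero.exp (-1 : ℤ))
    {ψ : AddChar (v.adicCompletion F) Circle} {V : Submodule ℂ (LocalGL v → ℂ)}
    (hV : IsUnitaryGeneric ψ V) (hm : ∀ W ∈ V, HasMellin ϖ fun y => W (diagOne y)) {P : ℂ[X]}
    (hP : IsRankinSelbergPolynomial V V P) {l : List ℂ}
    (hl : ∀ W₁ ∈ V, ∀ W₂ ∈ V, ∃ N, ∀ n ≥ N, recOp l (shellSeq ϖ W₁ W₂) n = 0)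
    (hγ : ∀ γ ∈ l, ‖1 - γ‖ ≤ 1 + (residueCard v : ℝ)⁻¹) :
    ‖P.eval (residueCard v : ℂ)⁻¹‖ ≤ (1 + (residueCard v : ℝ)⁻¹) ^ (l.length + 2) := by
  have hPd := hP.dvd (fun Φ hΦ W hW W' hW' =>
    isLaurent_zetaIntegral hϖ hV hV hm hm l hl hΦ hW hW')
  obtain ⟨l', hl', rfl⟩ := exists_sublist_of_dvd_eulerPoly _ P hPd hP.1
  refine (norm_eval_eulerPoly_le (B := 1 + (residueCard v : ℝ)⁻¹) (by simp) _ ?_ hl').trans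
    (by simp)
  have h1 : ∀ γ : ℂ, ‖γ‖ = 1 →
      ‖1 - γ * (residueCard v : ℂ)⁻¹‖ ≤ 1 + (residueCard v : ℝ)⁻¹ := by
    intro γ hγ'
    refine (norm_sub_le _ _).trans (le_of_eq ?_)
    rw [norm_one, norm_mul, hγ', one_mul, norm_inv, Complex.norm_natCast]
  intro γ hγ'
  simp only [List.mem_cons, List.mem_map] at hγ'
  rcases hγ' with rfl | rfl | ⟨δ, hδ, rfl⟩
  · exact h1 _ (by simp)
  · exact h1 _ (by simp)
  · rw [mul_inv_cancel_right₀ residueCard_ne_zero]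
    exact hγ δ hδ

theorem eulerFactor_one : eulerFactor v 1 = (1 - (residueCard v : ℝ)⁻¹)⁻¹ := by
  rw [eulerFactor, Real.rpow_neg_one]

theorem eulerFactor_two : eulerFactor v 2 = (1 - (residueCard v : ℝ)⁻¹ ^ 2)⁻¹ := by
  rw [eulerFactor, Real.rpow_neg residueCard_pos.le, inv_pow]
  norm_num

/-- Here `x = q^(-1/2)`. The exponent is `18 = 2 + 2 + 8 + 6`: two from `ζ(2)⁻²`, two from the
square of `A · vol ≥ (1 + q⁻¹)⁻¹`, eight from `g²`, and six from the bound `(1 + q⁻¹)^6` for the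
norm. The factor `ζ(1)³` is only used through `ζ(1) ≥ 1`. -/
theorem local_numeric {q A g vol x : ℝ} (hx0 : 0 ≤ x) (hx1 : x < 1) (hx : x ^ 2 = q⁻¹)
    (hA : 0 < A) (hvol : 1 ≤ (A + A * q⁻¹) * vol) (hg : (1 - x) ^ 4 ≤ g) :
    (1 - x) ^ 18 ≤ (A * ((1 - q⁻¹)⁻¹ ^ 3 / (1 - q⁻¹ ^ 2)⁻¹)) *
      (A * vol ^ 2 * g ^ 2 / ((1 - q⁻¹ ^ 2)⁻¹ * (1 + q⁻¹) ^ 6)) := by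
  rw [← hx] at hvol ⊢
  have hx2 : x ^ 2 ≤ x := by nlinarith
  have hx4 : (x ^ 2) ^ 2 ≤ x := by nlinarith [sq_nonneg x]
  have h0 : 0 < 1 - x := by linarith
  have h1 : 1 - x ≤ (1 + x ^ 2)⁻¹ := by
    rw [← one_div, le_div_iff₀ (by positivity)]
    nlinarith
  have h2 : 1 - x ≤ 1 - (x ^ 2) ^ 2 := by linarith
  have h3 : 1 ≤ (1 - x ^ 2)⁻¹ := by
    rw [one_le_inv₀ (by linarith)]
    linarith [sq_nonneg x]
  have h4 : (1 + x ^ 2)⁻¹ ≤ A * vol := by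
    rw [inv_le_iff_one_le_mul₀ (by positivity)]
    linarith
  have h5 : 0 ≤ (1 + x ^ 2)⁻¹ := by positivity
  have e : (A * ((1 - x ^ 2)⁻¹ ^ 3 / (1 - (x ^ 2) ^ 2)⁻¹)) *
      (A * vol ^ 2 * g ^ 2 / ((1 - (x ^ 2) ^ 2)⁻¹ * (1 + x ^ 2) ^ 6)) =
      (1 - x ^ 2)⁻¹ ^ 3 * (1 - (x ^ 2) ^ 2) ^ 2 * (A * vol) ^ 2 * g ^ 2 * ((1 + x ^ 2)⁻¹) ^ 6 := by
    have : (1 - (x ^ 2) ^ 2) ≠ 0 := by linarith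
    field_simp
  rw [e]
  calc (1 - x) ^ 18 = 1 ^ 3 * (1 - x) ^ 2 * (1 - x) ^ 2 * ((1 - x) ^ 4) ^ 2 * (1 - x) ^ 6 := by ring
    _ ≤ _ := by
      have : 1 - x ≤ A * vol := h1.trans h4
      gcongr

/-- Combines the Cauchy–Schwarz bound, the value `q^(rs) · vol · G` of the normalised zeta integral
at `s = 1/2`, and the upper bound for `⟨W, W⟩`. What depends on the representation is the explicit
series and the bound at `s = 1`. -/
theorem local_lower_bound (hϖ : Valued.v (ϖ : v.adicCompletion F) = WithZero.exp (-1 : ℤ))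
    {ψ : AddChar (v.adicCompletion F) Circle} (hψ : HasConductor ψ 0)
    {V₀ V : Submodule ℂ (LocalGL v → ℂ)} {B : Set (LocalGL v → ℂ)} (hV₀ : IsUnitaryGeneric ψ V₀)
    (hV : IsUnitaryGeneric ψ V) (hB : IsOrthonormalBasis V B)
    (hm₀ : ∀ W ∈ V₀, HasMellin ϖ fun y => W (diagOne y))
    (hm : ∀ W ∈ V, HasMellin ϖ fun y => W (diagOne y)) {r : ℕ} (hr : 1 ≤ r)
    {W₀ W : LocalGL v → ℂ} (hW₀ : IsNormalizedSpherical V₀ W₀) (hW : W ∈ V)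
    (hrW : IsInvariantLevel r W) (hW1 : W 1 = 1) {l : List ℂ} {N : ℂ[X]}
    (hs : HasSeries ϖ V₀ V W₀ W l N) (l' : List ℂ)
    (hl' : ∀ W₁ ∈ V, ∀ W₂ ∈ V, ∃ N, ∀ n ≥ N, recOp l' (shellSeq ϖ W₁ W₂) n = 0)
    (hnorm : ∀ P, IsRankinSelbergPolynomial V V P → ‖P.eval (residueCard v : ℂ)⁻¹ *
      integralUnits v fun y => W (diagOne y) * starRingEnd ℂ (W (diagOne y))‖ ≤
        (1 + (residueCard v : ℝ)⁻¹) ^ 6) :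
    ENNReal.ofReal ((1 - (residueCard v : ℝ) ^ (-(1 / 2) : ℝ)) ^ 18) ≤
      ENNReal.ofReal ((residueCard v : ℝ) ^ r * (eulerFactor v 1 ^ 3 / eulerFactor v 2)) *
        localWeight ϖ r V₀ W₀ V B := by
  obtain ⟨hW₀V, hrW₀, hW₀1⟩ := hW₀
  have hrW₀' : IsInvariantLevel r W₀ := hrW₀.mono (Nat.zero_le r)
  have i₀ := exists_torus_indicator hϖ hψ hV₀ hW₀V (fun x hx => hrW₀.upper hx) hrW₀.torus hW₀1
  have i₁ := exists_torus_indicator hϖ hψ hV hW (fun x hx => hrW.upper hx) hrW.torus hW1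
  -- Existence of the polynomial must be proved, since `rankinSelbergL` takes the default value `1`
  -- otherwise.
  obtain ⟨P, hP, hPL⟩ := exists_rankinSelbergL_eq (exists_isRankinSelbergPolynomial
    (eulerPoly_coeff_zero _) (fun Φ hΦ W hW W' hW' =>
      isLaurent_zetaIntegral hϖ hV₀ hV hm₀ hm l hs.recOp_eq hΦ hW hW')
    (exists_zetaIntegral_const hϖ hV₀ hV i₀ i₁))
  obtain ⟨P', hP', hPL'⟩ := exists_rankinSelbergL_eq (exists_isRankinSelbergPolynomial
    (eulerPoly_coeff_zero _) (fun Φ hΦ W hW W' hW' =>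
      isLaurent_zetaIntegral hϖ hV hV hm hm l' hl' hΦ hW hW')
    (exists_zetaIntegral_const hϖ hV hV i₁ i₁))
  obtain ⟨G, hGd, hG0, -, hG⟩ := exists_dvd_sq hϖ hψ hV₀ hV hm₀ hm hs.recOp_eq hP hr hW₀V hW hrW₀'
    hrW hs.coeff_zero hs.mul_eq hs.dvd
  set E : ℂ → ℂ := fun s => laurentIn v r 1 s *
    (levelVolume v r * G.eval ((residueCard v : ℂ) ^ (-s))) with hE
  have hEd : Differentiable ℂ E := by
    have h1 : E = fun s => laurentIn v r 1 s * (levelVolume v r * laurentIn v 0 G s) := by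
      funext s
      simp [hE, laurentIn_eq]
    rw [h1]
    exact (differentiable_laurentIn r 1).mul ((differentiable_laurentIn 0 G).const_mul _)
  have hq1 : (1 : ℝ) < residueCard v := by exact_mod_cast one_lt_residueCard
  have hqp := residueCard_pos (v := v)
  have hbound := hB.sq_norm_le_localWeight hϖ hV₀ hV hm₀ hm l hs.recOp_eq hP hPL r hW₀V hW hEd (by
    filter_upwards [hG] with s h1
    have hzeta : zetaIntegral (testVector ϖ r s) W₀ W =
        laurentIn v r 1 s * zetaIntegral (principalVector (levelTest v r) s) W₀ W := by
      rw [testVector_eq hϖ, zetaIntegral_const_mul]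
    rw [hzeta, mul_assoc, h1])
  -- At `s = 1` the factor `1 / L` is the value of the polynomial at `q⁻¹`, which is where the
  -- hypothesis on the norm applies.
  have hinner : ‖whittakerInner V W W‖ ≤
      (1 - (residueCard v : ℝ)⁻¹ ^ 2)⁻¹ * (1 + (residueCard v : ℝ)⁻¹) ^ 6 := by
    have h1 := hnorm P' hP'
    have h2 : 0 ≤ (1 - (residueCard v : ℝ)⁻¹ ^ 2)⁻¹ := by
      have : ((residueCard v : ℝ)⁻¹) ^ 2 < 1 :=
        pow_lt_one₀ (by positivity) (inv_lt_one_of_one_lt₀ hq1) two_ne_zero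
      exact inv_nonneg.2 (by linarith)
    rw [whittakerInner, hPL']
    beta_reduce
    rw [Complex.cpow_neg_one, div_inv_eq_mul, mul_assoc, norm_mul,
      Complex.norm_real, eulerFactor_two, Real.norm_of_nonneg h2]
    exact mul_le_mul_of_nonneg_left h1 h2
  set x : ℝ := (residueCard v : ℝ) ^ (-(1 / 2) : ℝ) with hx
  have hx0 : 0 ≤ x := by positivity
  have hx1 : x < 1 := Real.rpow_lt_one_of_one_lt_of_neg hq1 (by norm_num)
  have hx2 : x ^ 2 = (residueCard v : ℝ)⁻¹ := by
    rw [hx, ← Real.rpow_natCast, ← Real.rpow_mul hqp.le, ← Real.rpow_neg_one]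
    norm_num
  have hXn : ‖(residueCard v : ℂ) ^ (-(1 / 2) : ℂ)‖ = x := by
    rw [norm_residueCard_cpow, hx]
    norm_num
  have hGn : (1 - x) ^ 4 ≤ ‖G.eval ((residueCard v : ℂ) ^ (-(1 / 2) : ℂ))‖ := by
    obtain ⟨l', hl', rfl⟩ := exists_sublist_of_dvd_eulerPoly _ G hGd hG0
    refine le_norm_eval_eulerPoly (by linarith) (by linarith) [1, -1, 1, -1] (fun γ hγ => ?_) hl'
    have hγ' : ‖γ‖ = 1 := by
      simp only [List.mem_cons, List.not_mem_nil, or_false] at hγ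
      rcases hγ with rfl | rfl | rfl | rfl <;> simp
    refine le_trans (le_of_eq ?_) (norm_sub_norm_le _ _)
    rw [norm_one, norm_mul, hγ', one_mul, hXn]
  have hEn : ‖E (1 / 2)‖ ^ 2 = (residueCard v : ℝ) ^ r * levelVolume v r ^ 2 *
      ‖G.eval ((residueCard v : ℂ) ^ (-(1 / 2) : ℂ))‖ ^ 2 := by
    have h1 : ‖laurentIn v r 1 (1 / 2)‖ ^ 2 = (residueCard v : ℝ) ^ r := by
      rw [laurentIn, eval_one, mul_one,
        Complex.norm_natCast_cpow_of_pos (zero_lt_one.trans one_lt_residueCard),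
        ← Real.rpow_natCast, ← Real.rpow_mul hqp.le, ← Real.rpow_natCast]
      congr 1
      simp
    simp only [hE]
    rw [norm_mul, norm_mul, mul_pow, mul_pow, h1, Complex.norm_real, Real.norm_eq_abs, sq_abs,
      mul_assoc]
  have hvol : 1 ≤ ((residueCard v : ℝ) ^ r + (residueCard v : ℝ) ^ r * (residueCard v : ℝ)⁻¹) *
      levelVolume v r := by
    obtain ⟨k, rfl⟩ : ∃ k, r = k + 1 := ⟨r - 1, by omega⟩
    have := one_le_levelVolume hϖ k
    rwa [pow_succ, mul_inv_cancel_right₀ hqp.ne', ← pow_succ]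
  have hnum := local_numeric hx0 hx1 hx2 (pow_pos hqp r) hvol hGn
  rw [eulerFactor_one, eulerFactor_two]
  have hIpos : 0 < (1 - (residueCard v : ℝ)⁻¹ ^ 2)⁻¹ * (1 + (residueCard v : ℝ)⁻¹) ^ 6 := by
    have : ((residueCard v : ℝ)⁻¹) ^ 2 < 1 :=
      pow_lt_one₀ (by positivity) (inv_lt_one_of_one_lt₀ hq1) two_ne_zero
    exact mul_pos (inv_pos.2 (by linarith)) (by positivity)
  have hKnn : 0 ≤ (residueCard v : ℝ) ^ r * ((1 - (residueCard v : ℝ)⁻¹)⁻¹ ^ 3 /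
      (1 - (residueCard v : ℝ)⁻¹ ^ 2)⁻¹) := by
    have h1 : (residueCard v : ℝ)⁻¹ < 1 := inv_lt_one_of_one_lt₀ hq1
    have h2 : 0 < (residueCard v : ℝ)⁻¹ := by positivity
    have h3 : 0 ≤ 1 - (residueCard v : ℝ)⁻¹ := by linarith
    have h4 : 0 ≤ 1 - (residueCard v : ℝ)⁻¹ ^ 2 := by nlinarith
    positivity
  refine (ENNReal.ofReal_le_ofReal hnum).trans ?_
  rw [ENNReal.ofReal_mul hKnn, ENNReal.ofReal_div_of_pos hIpos, ← hEn]
  refine mul_le_mul_right (ENNReal.div_le_of_le_mul' (hbound.trans ?_)) _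
  exact mul_le_mul_left (ENNReal.ofReal_le_ofReal hinner) _

end

/-! ### Averages over Hecke congruence subgroups -/

theorem coe_mul_apply (k k' : IntegralGL v) (i j : Fin 2) :
    ((k * k') i j : v.adicCompletion F) = k i 0 * k' 0 j + k i 1 * k' 1 j := by
  rw [Units.val_mul, Matrix.mul_apply, Fin.sum_univ_two]
  rfl

variable (v) in
/-- The Hecke congruence subgroup of level `𝔭_v^r`. -/
def levelSubgroup (r : ℕ) : Subgroup (IntegralGL v) where
  carrier := {k | (k 1 0 : v.adicCompletion F) ∈ ball v r}
  one_mem' := by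
    have h : ((1 : IntegralGL v) 1 0 : v.adicCompletion F) = 0 := by simp
    rw [Set.mem_ofPred_eq, h]
    exact zero_mem _
  mul_mem' := fun {a b} ha hb => by
    rw [Set.mem_ofPred_eq, coe_mul_apply]
    refine add_mem ?_ ?_
    · simpa using mul_mem_ball ha (coe_mem_ball (b 0 0))
    · simpa using mul_mem_ball (coe_mem_ball (a 1 1)) hb
  inv_mem' := fun {a} ha => by
    have h1 := coe_mul_apply a⁻¹ a 1 0
    have h2 := coe_mul_apply a⁻¹ a 1 1
    rw [inv_mul_cancel] at h1 h2
    have e1 : ((1 : IntegralGL v) 1 0 : v.adicCompletion F) = 0 := by simp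
    have e2 : ((1 : IntegralGL v) 1 1 : v.adicCompletion F) = 1 := by simp
    rw [e1] at h1
    rw [e2] at h2
    set x : v.adicCompletion F := (((a⁻¹ : IntegralGL v) 1 0 : v.adicCompletionIntegers F) : v.adicCompletion F)
    set y : v.adicCompletion F := (((a⁻¹ : IntegralGL v) 1 1 : v.adicCompletionIntegers F) : v.adicCompletion F)
    have hdet : Valued.v ((a 0 0 * a 1 1 - a 0 1 * a 1 0 : v.adicCompletion F)) = 1 := by
      have := val_det_integralIncl a
      rw [det_eq] at this
      exact this
    have h3 : (a 0 0 * a 1 1 - a 0 1 * a 1 0 : v.adicCompletion F) * x = -(a 1 0 : v.adicCompletion F) := by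
      linear_combination (-(a 1 1 : v.adicCompletion F)) * h1 + (a 1 0 : v.adicCompletion F) * h2
    exact (unit_mul_mem_ball hdet).1 (by rw [h3]; exact neg_mem ha)

theorem isOpen_levelSubgroup (r : ℕ) : IsOpen (levelSubgroup v r : Set (IntegralGL v)) :=
  isOpen_entry 1 0 r

theorem isInvariantLevel_iff {r : ℕ} {W : LocalGL v → ℂ} : IsInvariantLevel r W ↔
    ∀ k ∈ levelSubgroup v r, rightTranslate (integralIncl v k) W = W := Iff.rfl

open Classical in
/-- The average of `W` over the Hecke congruence subgroup of level `𝔭_v^r`, up to normalisation. -/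
def levelAvg (r : ℕ) (W : LocalGL v → ℂ) (g : LocalGL v) : ℂ :=
  integralCompact v fun k => if k 1 0 ∈ ball v r then W (g * k) else 0

theorem levelAvg_invariant (r : ℕ) (W : LocalGL v → ℂ) : IsInvariantLevel r (levelAvg r W) := by
  classical
  rw [isInvariantLevel_iff]
  intro k hk
  funext g
  refine Eq.trans ?_ (integralCompact_mul_left _ k)
  rw [rightTranslate, levelAvg]
  unfold integralCompact
  congr 1
  funext k'
  have h : (integralIncl v k * integralIncl v k') 1 0 ∈ ball v r ↔
      integralIncl v k' 1 0 ∈ ball v r := by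
    rw [← map_mul]
    exact (levelSubgroup v r).mul_mem_cancel_left hk
  simp only [h, mul_assoc]

section

variable {ψ : AddChar (v.adicCompletion F) Circle} {V : Submodule ℂ (LocalGL v → ℂ)}

/-- One finite combination of translations computes the average of both vectors and of their sum, so
it yields membership in `V` and additivity together. -/
theorem IsUnitaryGeneric.exists_levelAvg_eq (hV : IsUnitaryGeneric ψ V) (r : ℕ)
    {W W' : LocalGL v → ℂ} (hW : W ∈ V) (hW' : W' ∈ V) :
    ∃ (n : ℕ) (k : Fin n → IntegralGL v) (c : Fin n → ℂ),
      levelAvg r W = ∑ i, c i • rightTranslate (integralIncl v (k i)) W ∧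
      levelAvg r W' = ∑ i, c i • rightTranslate (integralIncl v (k i)) W' ∧
      levelAvg r (W + W') = ∑ i, c i • rightTranslate (integralIncl v (k i)) (W + W') := by
  classical
  obtain ⟨U, hU, hUW⟩ := hV.exists_isOpen_integral hW
  obtain ⟨U', hU', hUW'⟩ := hV.exists_isOpen_integral hW'
  obtain ⟨n, k, -, havg⟩ := exists_average (U ⊓ U' ⊓ levelSubgroup v r)
    ((hU.inter hU').inter (isOpen_levelSubgroup r))
  have key : ∀ W₁ : LocalGL v → ℂ, (∀ u ∈ U ⊓ U' ⊓ levelSubgroup v r,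
      rightTranslate (integralIncl v u) W₁ = W₁) → levelAvg r W₁ =
      ∑ i, ((n : ℂ)⁻¹ * if k i ∈ levelSubgroup v r then 1 else 0) •
        rightTranslate (integralIncl v (k i)) W₁ := by
    intro W₁ h₁
    funext g
    rw [levelAvg, havg, Finset.mul_sum, Finset.sum_apply]
    · refine Finset.sum_congr rfl fun i _ => ?_
      rw [Pi.smul_apply, smul_eq_mul, mul_assoc, ite_mul, one_mul, zero_mul]
      rfl
    · intro k₁ u hu
      have h2 : (integralIncl v (k₁ * u)) 1 0 ∈ ball v r ↔ integralIncl v k₁ 1 0 ∈ ball v r :=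
        (levelSubgroup v r).mul_mem_cancel_right hu.2
      have h3 := congrFun (h₁ u hu) (g * integralIncl v k₁)
      rw [rightTranslate, mul_assoc, ← map_mul] at h3
      simp only [h2, h3]
  refine ⟨n, k, _, key W fun u hu => hUW u hu.1.1, key W' fun u hu => hUW' u hu.1.2,
    key _ fun u hu => ?_⟩
  rw [rightTranslate_add, hUW u hu.1.1, hUW' u hu.1.2]

theorem IsUnitaryGeneric.levelAvg_mem (hV : IsUnitaryGeneric ψ V) (r : ℕ) {W : LocalGL v → ℂ}
    (hW : W ∈ V) : levelAvg r W ∈ V := by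
  obtain ⟨n, k, c, h, -⟩ := hV.exists_levelAvg_eq r hW hW
  rw [h]
  exact V.sum_mem fun i _ => V.smul_mem _ (hV.stable W hW _)

theorem IsUnitaryGeneric.levelAvg_add (hV : IsUnitaryGeneric ψ V) (r : ℕ) {W W' : LocalGL v → ℂ}
    (hW : W ∈ V) (hW' : W' ∈ V) : levelAvg r (W + W') = levelAvg r W + levelAvg r W' := by
  obtain ⟨n, k, c, h, h', h''⟩ := hV.exists_levelAvg_eq r hW hW'
  rw [h, h', h'', ← Finset.sum_add_distrib]
  refine Finset.sum_congr rfl fun i _ => ?_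
  rw [rightTranslate_add, smul_add]

theorem levelAvg_smul (r : ℕ) (c : ℂ) (W : LocalGL v → ℂ) :
    levelAvg r (c • W) = c • levelAvg r W := by
  classical
  funext g
  rw [Pi.smul_apply, smul_eq_mul, levelAvg, levelAvg, integralCompact_eq, integralCompact_eq,
    ← integral_const_mul]
  congr 1
  funext k
  rw [mul_ite, mul_zero, Pi.smul_apply, smul_eq_mul]

/-- Averaging a vector already fixed by `𝔭^r`-lower unipotents and unit diagonal matrices changes
only the upper unipotent part, whose phase is trivial at `y ∈ 𝔬`. Vectors of level `𝔭^r` with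
prescribed values on the torus are produced in this way. -/
theorem IsWhittakerFunction.levelAvg_torus {W : LocalGL v → ℂ} (hψ : HasConductor ψ 0)
    (hW : IsWhittakerFunction ψ W) {r : ℕ} (hr : 1 ≤ r)
    (hl : ∀ x ∈ ball v r, rightTranslate (lower x) W = W)
    (hu : ∀ (y u : (v.adicCompletion F)ˣ), Valued.v (u : v.adicCompletion F) = 1 →
      W (diagOne (y * u)) = W (diagOne y)) {y : (v.adicCompletion F)ˣ}
    (hy : (y : v.adicCompletion F) ∈ ball v 0) :
    levelAvg r W (diagOne y) = levelVolume v r * W (diagOne y) := by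
  classical
  rw [levelAvg, integralCompact_level r _ (W (diagOne y))]
  · intro k hk
    have h1 : (integralIncl v k) 1 0 ∈ ball v r := hk
    have hk1 : Valued.v (k 1 1 : v.adicCompletion F) = 1 :=
      val_entry_one_one (Or.inl (ball_mono (by omega) hk))
    rw [if_pos h1, hW.diagOne_mul_integral hr hl hu y k hk, hψ.eq_one, Circle.coe_one, one_mul]
    have h2 : (k 0 1 : v.adicCompletion F) / k 1 1 ∈ ball v 0 := by
      rw [div_eq_inv_mul]
      exact (unit_mul_mem_ball (by rw [map_inv₀, hk1, inv_one])).2 (coe_mem_ball _)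
    simpa using mul_mem_ball hy h2
  · intro k hk
    exact if_neg hk

theorem levelVolume_ne_zero {ϖ : (v.adicCompletion F)ˣ}
    (hϖ : Valued.v (ϖ : v.adicCompletion F) = WithZero.exp (-1 : ℤ)) {r : ℕ} (hr : 1 ≤ r) :
    (levelVolume v r : ℂ) ≠ 0 := by
  intro h
  obtain ⟨k, rfl⟩ : ∃ k, r = k + 1 := ⟨r - 1, by omega⟩
  have := one_le_levelVolume hϖ k
  rw [Complex.ofReal_eq_zero.1 h, mul_zero] at this
  exact absurd this (by norm_num)

theorem IsUnitaryGeneric.rightTranslate_centre (hV : IsUnitaryGeneric ψ V) {W : LocalGL v → ℂ}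
    (hW : W ∈ V) (z : (v.adicCompletion F)ˣ) : rightTranslate (centre z) W = W := by
  funext g
  rw [rightTranslate, centre_comm]
  exact hV.central W hW z g

theorem IsUnitaryGeneric.span_eq (hV : IsUnitaryGeneric ψ V) {W : LocalGL v → ℂ} (hW : W ∈ V)
    (h0 : W ≠ 0) : Submodule.span ℂ (Set.range fun g => rightTranslate g W) = V := by
  have hle : Submodule.span ℂ (Set.range fun g => rightTranslate g W) ≤ V := by
    rw [Submodule.span_le]
    rintro _ ⟨g, rfl⟩
    exact hV.stable W hW g
  refine (hV.irreducible _ hle fun W' hW' g => ?_).resolve_left fun h => h0 ?_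
  · induction hW' using Submodule.span_induction with
    | mem W' h =>
      obtain ⟨g', rfl⟩ := h
      exact Submodule.subset_span ⟨g * g', rightTranslate_mul _ _ _⟩
    | zero => exact zero_mem _
    | add W₁ W₂ _ _ h₁ h₂ => exact add_mem h₁ h₂
    | smul c W₁ _ h => exact Submodule.smul_mem _ c h
  · have : rightTranslate 1 W ∈ Submodule.span ℂ (Set.range fun g => rightTranslate g W) :=
      Submodule.subset_span ⟨1, rfl⟩
    rwa [h, rightTranslate_one, Submodule.mem_bot] at this

end

/-! ### Eigenvectors of operators annihilated by polynomials -/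

/-- Linear factors of the annihilating polynomial are split off one at a time until the vector they
act on is an eigenvector. -/
theorem exists_eigenvector {M : Type*} [AddCommGroup M] [Module ℂ M] (T : Module.End ℂ M) :
    ∀ (n : ℕ) (f : ℂ[X]), f.natDegree = n → f ≠ 0 → ∀ x : M, x ≠ 0 → aeval T f x = 0 →
      ∃ (c : ℂ) (w : M), w ≠ 0 ∧ T w = c • w := by
  intro n
  induction n with
  | zero =>
    intro f hf hf0 x hx h
    rw [Polynomial.natDegree_eq_zero] at hf
    obtain ⟨a, rfl⟩ := hf
    rw [aeval_C, Module.algebraMap_end_apply, smul_eq_zero] at h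
    exact absurd (h.resolve_right hx) fun h => hf0 (by rw [h, C_0])
  | succ n ih =>
    intro f hf hf0 x hx h
    obtain ⟨c, hc⟩ := IsAlgClosed.exists_root f fun h => by
      rw [Polynomial.natDegree_eq_of_degree_eq_some h] at hf
      exact absurd hf (Nat.succ_ne_zero n).symm
    obtain ⟨g, rfl⟩ := Polynomial.dvd_iff_isRoot.2 hc
    have hg0 : g ≠ 0 := right_ne_zero_of_mul hf0
    by_cases hw : aeval T g x = 0
    · refine ih g ?_ hg0 x hx hw
      rw [Polynomial.natDegree_mul (X_sub_C_ne_zero c) hg0, natDegree_X_sub_C] at hf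
      omega
    · refine ⟨c, aeval T g x, hw, ?_⟩
      rw [aeval_mul, Module.End.mul_apply, map_sub, aeval_X, aeval_C, LinearMap.sub_apply,
        Module.algebraMap_end_apply, sub_eq_zero] at h
      exact h

/-- Schur's lemma without finite dimension. If `T x ≠ 0`, then `x = p(T) T x` for some `p`, so `pX -
1` annihilates `x` and `T` has an eigenvector; that eigenvector generates everything. -/
theorem exists_scalar {M : Type*} [AddCommGroup M] [Module ℂ M] (T : Module.End ℂ M)
    (h : ∀ x : M, x ≠ 0 → ∀ y, ∃ p : ℂ[X], aeval T p x = y) : ∃ c : ℂ, ∀ x, T x = c • x := by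
  by_cases h0 : ∀ x : M, x = 0
  · exact ⟨0, fun x => by rw [h0 (T x), h0 (_ • x)]⟩
  · push Not at h0
    obtain ⟨x, hx⟩ := h0
    obtain ⟨c, w, hw, hcw⟩ : ∃ (c : ℂ) (w : M), w ≠ 0 ∧ T w = c • w := by
      by_cases hT : T x = 0
      · exact ⟨0, x, hx, by rw [hT, zero_smul]⟩
      · obtain ⟨p, hp⟩ := h _ hT x
        refine exists_eigenvector T _ (p * X - 1) rfl (fun h => ?_) x hx ?_
        · have := congrArg (eval 0) h
          simp at this
        · rw [map_sub, aeval_mul, aeval_X, LinearMap.sub_apply, Module.End.mul_apply, hp, map_one,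
            Module.End.one_apply, sub_self]
    refine ⟨c, fun y => ?_⟩
    obtain ⟨p, rfl⟩ := h w hw y
    have h1 : T (aeval T p w) = aeval T p (T w) := by
      rw [← Module.End.mul_apply, ← Module.End.mul_apply]
      congr 1
      have := (aeval_mul T (p := X) (q := p)).symm.trans ((congrArg (aeval T) (mul_comm X p)).trans (aeval_mul T))
      rwa [aeval_X] at this
    rw [h1, hcw, map_smul]

/-! ### The Cartan decomposition -/

theorem centre_mul_apply (z : (v.adicCompletion F)ˣ) (g : LocalGL v) (i j : Fin 2) :
    (centre z * g : LocalGL v) i j = (z : v.adicCompletion F) * g i j := by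
  rw [Units.val_mul, coe_centre, Matrix.mul_apply, Fin.sum_univ_two]
  fin_cases i <;> simp

theorem diagOne_mul_apply_zero (y : (v.adicCompletion F)ˣ) (g : LocalGL v) (j : Fin 2) :
    (diagOne y * g : LocalGL v) 0 j = (y : v.adicCompletion F) * g 0 j := by
  rw [Units.val_mul, coe_diagOne, Matrix.mul_apply, Fin.sum_univ_two]
  simp

theorem diagOne_mul_apply_one (y : (v.adicCompletion F)ˣ) (g : LocalGL v) (j : Fin 2) :
    (diagOne y * g : LocalGL v) 1 j = g 1 j := by
  rw [Units.val_mul, coe_diagOne, Matrix.mul_apply, Fin.sum_univ_two]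
  simp

theorem mul_diagOne_apply_zero (y : (v.adicCompletion F)ˣ) (g : LocalGL v) (i : Fin 2) :
    (g * diagOne y : LocalGL v) i 0 = g i 0 * (y : v.adicCompletion F) := by
  rw [Units.val_mul, coe_diagOne, Matrix.mul_apply, Fin.sum_univ_two]
  simp

theorem mul_diagOne_apply_one (y : (v.adicCompletion F)ˣ) (g : LocalGL v) (i : Fin 2) :
    (g * diagOne y : LocalGL v) i 1 = g i 1 := by
  rw [Units.val_mul, coe_diagOne, Matrix.mul_apply, Fin.sum_univ_two]
  simp

theorem upper_mul_apply_zero (x : v.adicCompletion F) (g : LocalGL v) (j : Fin 2) :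
    (upper x * g : LocalGL v) 0 j = g 0 j + x * g 1 j := by
  rw [Units.val_mul, coe_upper, Matrix.mul_apply, Fin.sum_univ_two]
  simp

theorem upper_mul_apply_one (x : v.adicCompletion F) (g : LocalGL v) (j : Fin 2) :
    (upper x * g : LocalGL v) 1 j = g 1 j := by
  rw [Units.val_mul, coe_upper, Matrix.mul_apply, Fin.sum_univ_two]
  simp

theorem weyl_mul_apply (g : LocalGL v) (j : Fin 2) :
    (weyl v * g : LocalGL v) 0 j = g 1 j ∧ (weyl v * g : LocalGL v) 1 j = g 0 j := by
  rw [Units.val_mul, coe_weyl, Matrix.mul_apply, Matrix.mul_apply, Fin.sum_univ_two,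
    Fin.sum_univ_two]
  simp

theorem mul_weyl_apply (g : LocalGL v) (i : Fin 2) :
    (g * weyl v : LocalGL v) i 0 = g i 1 ∧ (g * weyl v : LocalGL v) i 1 = g i 0 := by
  rw [Units.val_mul, coe_weyl, Matrix.mul_apply, Matrix.mul_apply, Fin.sum_univ_two,
    Fin.sum_univ_two]
  simp

theorem weyl_mul_weyl : (weyl v * weyl v : LocalGL v) = 1 := by
  refine LocalGL.ext' (Matrix.ext fun i j => ?_)
  rw [Units.val_mul, coe_weyl, Matrix.mul_apply, Fin.sum_univ_two]
  fin_cases i <;> fin_cases j <;> simp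

theorem det_mul_val (g h : LocalGL v) :
    Valued.v ((Matrix.GeneralLinearGroup.det (g * h) : (v.adicCompletion F)ˣ) : v.adicCompletion F) =
      Valued.v ((Matrix.GeneralLinearGroup.det g : (v.adicCompletion F)ˣ) : v.adicCompletion F) *
      Valued.v ((Matrix.GeneralLinearGroup.det h : (v.adicCompletion F)ˣ) : v.adicCompletion F) := by
  rw [map_mul, Units.val_mul, map_mul]

theorem det_diagOne_val (y : (v.adicCompletion F)ˣ) :
    Valued.v ((Matrix.GeneralLinearGroup.det (diagOne y) : (v.adicCompletion F)ˣ) :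
      v.adicCompletion F) = Valued.v (y : v.adicCompletion F) := by
  rw [det_eq, coe_diagOne]
  simp

theorem det_centre_val (z : (v.adicCompletion F)ˣ) :
    Valued.v ((Matrix.GeneralLinearGroup.det (centre z) : (v.adicCompletion F)ˣ) :
      v.adicCompletion F) = Valued.v (z : v.adicCompletion F) ^ 2 := by
  rw [det_eq, coe_centre]
  simp [sq]

theorem det_upper_val (x : v.adicCompletion F) :
    Valued.v ((Matrix.GeneralLinearGroup.det (upper x : LocalGL v) : (v.adicCompletion F)ˣ) :
      v.adicCompletion F) = 1 := by
  rw [det_eq, coe_upper]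
  simp

theorem det_weyl_val :
    Valued.v ((Matrix.GeneralLinearGroup.det (weyl v) : (v.adicCompletion F)ˣ) :
      v.adicCompletion F) = 1 := by
  rw [det_eq, coe_weyl]
  simp

section

variable {ϖ : (v.adicCompletion F)ˣ}

theorem exists_integral_centre {u : (v.adicCompletion F)ˣ}
    (hu : Valued.v (u : v.adicCompletion F) = 1) : ∃ k : IntegralGL v, integralIncl v k = centre u := by
  refine exists_integralIncl_eq _ (fun i j => ?_) (by rw [det_centre_val, hu, one_pow])
  have : (u : v.adicCompletion F) ∈ ball v 0 := mem_ball_zero.2 hu.le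
  rw [coe_centre]
  fin_cases i <;> fin_cases j <;> simp [this, zero_mem]

/-- When `g 1 1` is a unit, every factor of `eq_mul_lower` except the diagonal one is integral, and
the diagonal one is `ϖ^n` times a unit. The other positions of a unit entry reduce to this one by
Weyl elements on either side. -/
theorem exists_cartan_of_unit (hϖ : Valued.v (ϖ : v.adicCompletion F) = WithZero.exp (-1 : ℤ))
    {g : LocalGL v} (hint : ∀ i j, g i j ∈ ball v 0) (h11 : Valued.v (g 1 1) = 1) {n : ℕ}
    (hdet : Valued.v ((Matrix.GeneralLinearGroup.det g : (v.adicCompletion F)ˣ) :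
      v.adicCompletion F) = WithZero.exp (-(n : ℤ))) :
    ∃ k k' : IntegralGL v, g = integralIncl v k * diagOne (ϖ ^ n) * integralIncl v k' := by
  have h0 : g 1 1 ≠ 0 := fun h => by simp [h] at h11
  set d : (v.adicCompletion F)ˣ := Units.mk0 _ h0 with hd
  have hdv : Valued.v (d : v.adicCompletion F) = 1 := h11
  have hdiv : ∀ x ∈ ball v 0, x / (d : v.adicCompletion F) ∈ ball v 0 := fun x hx => by
    rw [div_eq_inv_mul]
    exact (unit_mul_mem_ball (by rw [map_inv₀, hdv, inv_one])).2 hx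
  obtain ⟨k, hk⟩ := exists_integral_upper (hdiv _ (hint 0 1))
  obtain ⟨k₁, hk₁⟩ := exists_integral_lower (hdiv _ (hint 1 0))
  obtain ⟨k₂, hk₂⟩ := exists_integral_centre hdv
  obtain ⟨k₃, hk₃⟩ := exists_integral_diagOne (u := (ϖ ^ n)⁻¹ *
    (Matrix.GeneralLinearGroup.det g * (d ^ 2)⁻¹)) (by
      rw [Units.val_mul, Units.val_mul, map_mul, map_mul, hdet, Units.val_inv_eq_inv_val,
        Units.val_inv_eq_inv_val, map_inv₀, map_inv₀, Units.val_pow_eq_pow_val d, map_pow, hdv,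
        one_pow, inv_one, mul_one, ← zpow_natCast, val_zpow hϖ]
      exact inv_mul_cancel₀ WithZero.exp_ne_zero)
  refine ⟨k, k₂ * (k₃ * k₁), ?_⟩
  rw [map_mul, map_mul, hk, hk₁, hk₂, hk₃]
  conv_lhs => rw [eq_mul_lower g d rfl]
  have e : (diagOne (Matrix.GeneralLinearGroup.det g * (d ^ 2)⁻¹) : LocalGL v) =
      diagOne (ϖ ^ n) * diagOne ((ϖ ^ n)⁻¹ * (Matrix.GeneralLinearGroup.det g * (d ^ 2)⁻¹)) := by
    rw [← diagOne_mul, mul_inv_cancel_left]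
  rw [e]
  simp only [mul_assoc]
  congr 1
  rw [← mul_assoc, ← mul_assoc, ← centre_comm]
  simp only [mul_assoc]

theorem exists_cartan (hϖ : Valued.v (ϖ : v.adicCompletion F) = WithZero.exp (-1 : ℤ))
    {g : LocalGL v} (hint : ∀ i j, g i j ∈ ball v 0) (hunit : ∃ i j, Valued.v (g i j) = 1) {n : ℕ}
    (hdet : Valued.v ((Matrix.GeneralLinearGroup.det g : (v.adicCompletion F)ˣ) :
      v.adicCompletion F) = WithZero.exp (-(n : ℤ))) :
    ∃ k k' : IntegralGL v, g = integralIncl v k * diagOne (ϖ ^ n) * integralIncl v k' := by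
  obtain ⟨w, hw⟩ := exists_integral_weyl (v := v)
  have hrow : ∀ g : LocalGL v, (∀ i j, g i j ∈ ball v 0) → (∃ i, Valued.v (g i 1) = 1) →
      Valued.v ((Matrix.GeneralLinearGroup.det g : (v.adicCompletion F)ˣ) :
      v.adicCompletion F) = WithZero.exp (-(n : ℤ)) →
      ∃ k k' : IntegralGL v, g = integralIncl v k * diagOne (ϖ ^ n) * integralIncl v k' := by
    rintro g hint ⟨i, hi⟩ hdet
    fin_cases i
    · obtain ⟨k, k', h⟩ := exists_cartan_of_unit hϖ (g := weyl v * g) (fun i j => by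
          fin_cases i
          · simpa [(weyl_mul_apply g j).1] using hint 1 j
          · simpa [(weyl_mul_apply g j).2] using hint 0 j)
        (by rw [(weyl_mul_apply g 1).2]; exact hi) (by rw [det_mul_val, det_weyl_val, one_mul, hdet])
      refine ⟨w * k, k', ?_⟩
      rw [map_mul, mul_assoc, mul_assoc, ← mul_assoc _ (diagOne _), ← h, hw, ← mul_assoc,
        weyl_mul_weyl, one_mul]
    · exact exists_cartan_of_unit hϖ hint hi hdet
  obtain ⟨i, j, hij⟩ := hunit
  fin_cases j
  · obtain ⟨k, k', h⟩ := hrow (g * weyl v) (fun i j => by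
        fin_cases j
        · simpa [(mul_weyl_apply g i).1] using hint i 1
        · simpa [(mul_weyl_apply g i).2] using hint i 0)
      ⟨i, by rw [(mul_weyl_apply g i).2]; exact hij⟩
      (by rw [det_mul_val, det_weyl_val, mul_one, hdet])
    refine ⟨k, k' * w, ?_⟩
    rw [map_mul, ← mul_assoc, ← h, hw, mul_assoc, weyl_mul_weyl, mul_one]
  · exact hrow g hint ⟨i, hij⟩ hdet

/-- Dividing by an entry of largest absolute value makes the matrix integral with a unit entry. -/
theorem exists_centre_mul (g : LocalGL v) : ∃ (z : (v.adicCompletion F)ˣ) (g' : LocalGL v) (n : ℕ),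
    g = centre z * g' ∧ (∀ i j, g' i j ∈ ball v 0) ∧ (∃ i j, Valued.v (g' i j) = 1) ∧
    Valued.v ((Matrix.GeneralLinearGroup.det g' : (v.adicCompletion F)ˣ) :
      v.adicCompletion F) = WithZero.exp (-(n : ℤ)) := by
  obtain ⟨⟨i, j⟩, hmax⟩ := Finite.exists_max fun p : Fin 2 × Fin 2 => Valued.v (g p.1 p.2)
  have h0 : g i j ≠ 0 := by
    intro h
    have hz : ∀ i' j', g i' j' = 0 := fun i' j' => by
      have := hmax (i', j')
      simp only [h, map_zero, nonpos_iff_eq_zero, map_eq_zero] at this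
      exact this
    have := det_eq g
    rw [hz, hz 0 1, zero_mul, zero_mul, sub_zero] at this
    exact Units.ne_zero _ this
  set z := Units.mk0 _ h0
  have hz : Valued.v ((z⁻¹ : (v.adicCompletion F)ˣ) : v.adicCompletion F) * Valued.v (g i j) = 1 := by
    rw [← map_mul, Units.val_inv_eq_inv_val, Units.val_mk0, inv_mul_cancel₀ h0, map_one]
  have hint : ∀ i' j', (centre z⁻¹ * g : LocalGL v) i' j' ∈ ball v 0 := by
    intro i' j'
    rw [centre_mul_apply, mem_ball_zero, map_mul, ← hz]
    exact mul_le_mul_right (hmax (i', j')) _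
  obtain ⟨m, hm⟩ := exists_val_eq_exp (Units.ne_zero (Matrix.GeneralLinearGroup.det (centre z⁻¹ * g)))
  have hle : ((Matrix.GeneralLinearGroup.det (centre z⁻¹ * g) : (v.adicCompletion F)ˣ) :
      v.adicCompletion F) ∈ ball v 0 := by
    rw [det_eq]
    exact sub_mem (by simpa using mul_mem_ball (hint 0 0) (hint 1 1))
      (by simpa using mul_mem_ball (hint 0 1) (hint 1 0))
  rw [mem_ball, hm, WithZero.exp_le_exp] at hle
  refine ⟨z, centre z⁻¹ * g, (-m).toNat, ?_, hint, ⟨i, j, ?_⟩, ?_⟩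
  · rw [← mul_assoc, ← map_mul, mul_inv_cancel, map_one, one_mul]
  · rw [centre_mul_apply, map_mul, hz]
  · rw [hm]
    congr 1
    omega

end

/-! ### The Hecke operator on spherical vectors -/

theorem levelSubgroup_zero (k : IntegralGL v) : k ∈ levelSubgroup v 0 := coe_mem_ball _

theorem IsInvariantLevel.apply_mul {W : LocalGL v → ℂ} (hW : IsInvariantLevel 0 W) (g : LocalGL v)
    (k : IntegralGL v) : W (g * integralIncl v k) = W g :=
  congrFun (isInvariantLevel_iff.1 hW k (levelSubgroup_zero k)) g

theorem levelAvg_zero_apply (W : LocalGL v → ℂ) (g : LocalGL v) :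
    levelAvg 0 W g = integralCompact v fun k => W (g * k) := by
  classical
  rw [levelAvg, integralCompact_eq, integralCompact_eq]
  congr 1
  funext k
  exact if_pos (levelSubgroup_zero k)

theorem levelAvg_zero_eq {W : LocalGL v → ℂ} (hW : IsInvariantLevel 0 W) : levelAvg 0 W = W := by
  funext g
  rw [levelAvg_zero_apply, integralCompact_eq]
  simp only [hW.apply_mul]
  simp

theorem levelAvg_zero_translate (k : IntegralGL v) (W : LocalGL v → ℂ) :
    levelAvg 0 (rightTranslate (integralIncl v k) W) = levelAvg 0 W := by
  funext g
  rw [levelAvg_zero_apply, levelAvg_zero_apply]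
  refine Eq.trans ?_ (integralCompact_mul_right (fun k' => W (g * k')) k)
  simp only [rightTranslate, mul_assoc]

section

variable {ϖ : (v.adicCompletion F)ˣ} {ψ : AddChar (v.adicCompletion F) Circle}
  {V : Submodule ℂ (LocalGL v → ℂ)}

theorem levelAvg_cartan (hϖ : Valued.v (ϖ : v.adicCompletion F) = WithZero.exp (-1 : ℤ))
    {W : LocalGL v → ℂ} (hW : IsInvariantLevel 0 W) {g : LocalGL v}
    (hint : ∀ i j, g i j ∈ ball v 0) (hunit : ∃ i j, Valued.v (g i j) = 1) {n : ℕ}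
    (hdet : Valued.v ((Matrix.GeneralLinearGroup.det g : (v.adicCompletion F)ˣ) :
      v.adicCompletion F) = WithZero.exp (-(n : ℤ))) :
    levelAvg 0 (rightTranslate g W) = levelAvg 0 (rightTranslate (diagOne (ϖ ^ n)) W) := by
  obtain ⟨k, k', rfl⟩ := exists_cartan hϖ hint hunit hdet
  rw [rightTranslate_mul, rightTranslate_mul, levelAvg_zero_translate,
    isInvariantLevel_iff.1 hW k' (levelSubgroup_zero k')]

/-- The space of spherical vectors. -/
def sphericalVectors (V : Submodule ℂ (LocalGL v → ℂ)) : Submodule ℂ (LocalGL v → ℂ) where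
  carrier := {W | W ∈ V ∧ IsInvariantLevel 0 W}
  add_mem' := fun {a b} ha hb => ⟨V.add_mem ha.1 hb.1, fun k hk => by
    rw [rightTranslate_add, ha.2 k hk, hb.2 k hk]⟩
  zero_mem' := ⟨V.zero_mem, fun _ _ => rfl⟩
  smul_mem' := fun c a ha => ⟨V.smul_mem c ha.1, fun k hk => by
    rw [rightTranslate_smul, ha.2 k hk]⟩

/-- The Hecke operator of the double coset of `g` on spherical vectors. -/
def IsUnitaryGeneric.hecke (hV : IsUnitaryGeneric ψ V) (g : LocalGL v) :
    Module.End ℂ (sphericalVectors V) where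
  toFun W := ⟨levelAvg 0 (rightTranslate g W), hV.levelAvg_mem 0 (hV.stable W W.2.1 g),
    levelAvg_invariant 0 _⟩
  map_add' W W' := Subtype.ext (by
    show levelAvg 0 (rightTranslate g ((W : LocalGL v → ℂ) + W')) =
      levelAvg 0 (rightTranslate g W) + levelAvg 0 (rightTranslate g W')
    rw [rightTranslate_add,
      hV.levelAvg_add 0 (hV.stable W W.2.1 g) (hV.stable W' W'.2.1 g)])
  map_smul' c W := Subtype.ext (by
    show levelAvg 0 (rightTranslate g (c • (W : LocalGL v → ℂ))) =
      c • levelAvg 0 (rightTranslate g W)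
    rw [rightTranslate_smul, levelAvg_smul])

theorem IsUnitaryGeneric.coe_hecke (hV : IsUnitaryGeneric ψ V) (g : LocalGL v)
    (W : sphericalVectors V) : (hV.hecke g W : LocalGL v → ℂ) = levelAvg 0 (rightTranslate g W) :=
  rfl

theorem val_entry_zero_one {k : IntegralGL v} (h : (k 1 1 : v.adicCompletion F) ∈ ball v 1) :
    Valued.v (k 0 1 : v.adicCompletion F) = 1 :=
  (val_eq_one_or_mem (coe_mem_ball _)).resolve_right fun h' => not_mem_ball_one_of_det
    (mul_mem_ball_one' (coe_mem_ball (k 0 0)) h) (mul_mem_ball_one h' (coe_mem_ball (k 1 0)))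

theorem inv_mem_ball (hϖ : Valued.v (ϖ : v.adicCompletion F) = WithZero.exp (-1 : ℤ)) :
    ((ϖ⁻¹ : (v.adicCompletion F)ˣ) : v.adicCompletion F) ∈ ball v (-1) := by
  simpa using zpow_mem_ball hϖ (-1)

theorem self_mem_ball (hϖ : Valued.v (ϖ : v.adicCompletion F) = WithZero.exp (-1 : ℤ)) :
    (ϖ : v.adicCompletion F) ∈ ball v 1 := by
  simpa using zpow_mem_ball hϖ 1

theorem pow_mem_ball (hϖ : Valued.v (ϖ : v.adicCompletion F) = WithZero.exp (-1 : ℤ)) (n : ℕ) :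
    ((ϖ ^ n : (v.adicCompletion F)ˣ) : v.adicCompletion F) ∈ ball v n := by
  simpa using zpow_mem_ball hϖ n

theorem val_pow (hϖ : Valued.v (ϖ : v.adicCompletion F) = WithZero.exp (-1 : ℤ)) (n : ℕ) :
    Valued.v ((ϖ ^ n : (v.adicCompletion F)ˣ) : v.adicCompletion F) = WithZero.exp (-(n : ℤ)) := by
  rw [← zpow_natCast, val_zpow hϖ]

/-- Hecke multiplication for averages: the double coset of `diag(ϖ,1) k diag(ϖ^(m+1),1)` depends
only on whether `k 1 1 ∈ 𝔭`. That happens on one of the `q + 1` classes of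
`integralCompact_partition`. -/
theorem IsUnitaryGeneric.hecke_mul_hecke (hV : IsUnitaryGeneric ψ V)
    (hϖ : Valued.v (ϖ : v.adicCompletion F) = WithZero.exp (-1 : ℤ)) (m : ℕ)
    (W : sphericalVectors V) :
    ((residueCard v : ℂ) + 1) • hV.hecke (diagOne ϖ) (hV.hecke (diagOne (ϖ ^ (m + 1))) W) =
      hV.hecke (diagOne (ϖ ^ m)) W + (residueCard v : ℂ) • hV.hecke (diagOne (ϖ ^ (m + 2))) W := by
  have hq1 : (residueCard v : ℂ) + 1 ≠ 0 := by exact_mod_cast Nat.succ_ne_zero (residueCard v)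
  obtain ⟨W, hWV, hW⟩ := W
  have hdW : rightTranslate (diagOne (ϖ ^ (m + 1))) W ∈ V := hV.stable W hWV _
  obtain ⟨U, hU, hUW⟩ := hV.exists_isOpen_integral hdW
  obtain ⟨n, k, -, havg⟩ := exists_average U hU
  obtain ⟨S, hS⟩ := exists_residues (v := v) 1
  refine Subtype.ext ?_
  simp only [Submodule.coe_add, Submodule.coe_smul, IsUnitaryGeneric.coe_hecke]
  have h1 : levelAvg 0 (rightTranslate (diagOne (ϖ ^ (m + 1))) W) = (n : ℂ)⁻¹ • ∑ i,
      rightTranslate (integralIncl v (k i)) (rightTranslate (diagOne (ϖ ^ (m + 1))) W) := by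
    funext g
    rw [levelAvg_zero_apply, havg, Pi.smul_apply, Finset.sum_apply, smul_eq_mul]
    · rfl
    · intro k₁ u hu
      have := congrFun (hUW u hu) (g * integralIncl v k₁)
      rwa [rightTranslate, mul_assoc, ← map_mul] at this
  have h2 : ∀ s : Finset (Fin n), levelAvg 0 (rightTranslate (diagOne ϖ) (∑ i ∈ s,
      rightTranslate (integralIncl v (k i)) (rightTranslate (diagOne (ϖ ^ (m + 1))) W))) =
      ∑ i ∈ s, levelAvg 0 (rightTranslate (diagOne ϖ * integralIncl v (k i) * diagOne (ϖ ^ (m + 1))) W) := by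
    classical
    intro s
    induction s using Finset.induction_on with
    | empty =>
      rw [Finset.sum_empty, Finset.sum_empty]
      have := levelAvg_smul (v := v) 0 0 0
      rw [zero_smul, zero_smul] at this
      exact this
    | insert i s hi ih =>
      rw [Finset.sum_insert hi, Finset.sum_insert hi, rightTranslate_add, hV.levelAvg_add 0
        (hV.stable _ (hV.stable _ hdW _) _)
        (hV.stable _ (V.sum_mem fun i _ => hV.stable _ hdW _) _), ih,
        rightTranslate_mul, rightTranslate_mul]
  rw [h1, rightTranslate_smul, levelAvg_smul, h2]
  funext h
  have h3 := havg (fun g => levelAvg 0 (rightTranslate (diagOne ϖ * g * diagOne (ϖ ^ (m + 1))) W) h)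
    (fun k₁ u hu => by
      have : rightTranslate (diagOne ϖ * integralIncl v (k₁ * u) * diagOne (ϖ ^ (m + 1))) W =
          rightTranslate (diagOne ϖ * integralIncl v k₁ * diagOne (ϖ ^ (m + 1))) W := by
        rw [map_mul]
        simp only [rightTranslate_mul, hUW u hu]
      rw [this])
  simp only [Pi.smul_apply, Pi.add_apply, Finset.sum_apply, smul_eq_mul]
  rw [← h3, integralCompact_partition hS.1 hS.2.1 (by simpa using hS.2.2.1) (by simpa using hS.2.2.2) _
    (levelAvg 0 (rightTranslate (diagOne (ϖ ^ m)) W) h)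
    (fun _ => levelAvg 0 (rightTranslate (diagOne (ϖ ^ (m + 2))) W) h), Finset.sum_const, hS.1,
    pow_one, nsmul_eq_mul, mul_inv_cancel_left₀ hq1]
  -- If `k 1 1 ∈ 𝔭`, the matrix is `ϖ` times an integral matrix with the unit entry `k 0 1` and
  -- determinant of valuation `m`.
  · intro k hk
    set g : LocalGL v := diagOne ϖ * integralIncl v k * diagOne (ϖ ^ (m + 1)) with hg
    have e00 : (centre ϖ⁻¹ * g : LocalGL v) 0 0 = (k 0 0 : v.adicCompletion F) *
        ((ϖ ^ (m + 1) : (v.adicCompletion F)ˣ) : v.adicCompletion F) := by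
      rw [centre_mul_apply, hg, mul_diagOne_apply_zero, diagOne_mul_apply_zero, mul_assoc,
        Units.inv_mul_cancel_left]
      rfl
    have e01 : (centre ϖ⁻¹ * g : LocalGL v) 0 1 = (k 0 1 : v.adicCompletion F) := by
      rw [centre_mul_apply, hg, mul_diagOne_apply_one, diagOne_mul_apply_zero,
        Units.inv_mul_cancel_left]
      rfl
    have e10 : (centre ϖ⁻¹ * g : LocalGL v) 1 0 = (k 1 0 : v.adicCompletion F) *
        ((ϖ ^ m : (v.adicCompletion F)ˣ) : v.adicCompletion F) := by
      rw [centre_mul_apply, hg, mul_diagOne_apply_zero, diagOne_mul_apply_one, mul_left_comm,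
        ← Units.val_mul, pow_succ', inv_mul_cancel_left]
      rfl
    have e11 : (centre ϖ⁻¹ * g : LocalGL v) 1 1 =
        ((ϖ⁻¹ : (v.adicCompletion F)ˣ) : v.adicCompletion F) * (k 1 1 : v.adicCompletion F) := by
      rw [centre_mul_apply, hg, mul_diagOne_apply_one, diagOne_mul_apply_one]
      rfl
    have hc : rightTranslate g W = rightTranslate (centre ϖ⁻¹ * g) W :=
      ((rightTranslate_mul (centre ϖ⁻¹) g W).trans
        (hV.rightTranslate_centre (hV.stable W hWV g) _)).symm
    rw [hc, levelAvg_cartan hϖ hW (n := m)]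
    · intro i j
      fin_cases i <;> fin_cases j
      · exact e00 ▸ by simpa using ball_mono (by positivity) (mul_mem_ball (coe_mem_ball (k 0 0)) (pow_mem_ball hϖ (m + 1)))
      · exact e01 ▸ coe_mem_ball _
      · exact e10 ▸ by simpa using ball_mono (by positivity) (mul_mem_ball (coe_mem_ball (k 1 0)) (pow_mem_ball hϖ m))
      · exact e11 ▸ by simpa using mul_mem_ball (inv_mem_ball hϖ) hk
    · exact ⟨0, 1, by rw [e01]; exact val_entry_zero_one hk⟩
    · rw [det_mul_val, det_centre_val, hg, det_mul_val, det_mul_val, det_diagOne_val,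
        det_diagOne_val, val_det_integralIncl, mul_one, hϖ, val_pow hϖ, Units.val_inv_eq_inv_val,
        map_inv₀, hϖ, ← WithZero.exp_neg, ← WithZero.exp_nsmul, ← WithZero.exp_add, ← WithZero.exp_add]
      congr 1
      push_cast
      ring
  -- If `k 1 1` is a unit, the matrix is already primitive, with determinant of valuation `m + 2`.
  · intro k hk x _ _
    set g : LocalGL v := diagOne ϖ * integralIncl v k * diagOne (ϖ ^ (m + 1)) with hg
    have e00 : g 0 0 = (ϖ : v.adicCompletion F) * (k 0 0 : v.adicCompletion F) *
        ((ϖ ^ (m + 1) : (v.adicCompletion F)ˣ) : v.adicCompletion F) := by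
      rw [hg, mul_diagOne_apply_zero, diagOne_mul_apply_zero]
      rfl
    have e01 : g 0 1 = (ϖ : v.adicCompletion F) * (k 0 1 : v.adicCompletion F) := by
      rw [hg, mul_diagOne_apply_one, diagOne_mul_apply_zero]
      rfl
    have e10 : g 1 0 = (k 1 0 : v.adicCompletion F) *
        ((ϖ ^ (m + 1) : (v.adicCompletion F)ˣ) : v.adicCompletion F) := by
      rw [hg, mul_diagOne_apply_zero, diagOne_mul_apply_one]
      rfl
    have e11 : g 1 1 = (k 1 1 : v.adicCompletion F) := by
      rw [hg, mul_diagOne_apply_one, diagOne_mul_apply_one]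
      rfl
    have hϖ0 := ball_mono (v := v) (m := 0) (n := 1) (by norm_num) (self_mem_ball hϖ)
    have hϖ1 := ball_mono (v := v) (m := 0) (by positivity) (pow_mem_ball hϖ (m + 1))
    rw [levelAvg_cartan hϖ hW (n := m + 2)]
    · intro i j
      fin_cases i <;> fin_cases j
      · exact e00 ▸ by simpa using mul_mem_ball (mul_mem_ball hϖ0 (coe_mem_ball (k 0 0))) hϖ1
      · exact e01 ▸ by simpa using mul_mem_ball hϖ0 (coe_mem_ball (k 0 1))
      · exact e10 ▸ by simpa using mul_mem_ball (coe_mem_ball (k 1 0)) hϖ1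
      · exact e11 ▸ coe_mem_ball _
    · exact ⟨1, 1, by rw [e11]; exact hk⟩
    · rw [hg, det_mul_val, det_mul_val, det_diagOne_val,
        det_diagOne_val, val_det_integralIncl, mul_one, hϖ, val_pow hϖ, ← WithZero.exp_add]
      congr 1
      push_cast
      ring

/-- By irreducibility a non-zero spherical vector has translates spanning `V`. Averaging them gives
all spherical vectors, and by the Cartan decomposition and the Hecke recursion each average is a
polynomial in the single operator `T` applied to the vector. Then `exists_scalar` applies, with no
finiteness assumed in advance. -/
theorem IsUnitaryGeneric.exists_hecke_scalar (hV : IsUnitaryGeneric ψ V)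
    (hϖ : Valued.v (ϖ : v.adicCompletion F) = WithZero.exp (-1 : ℤ)) :
    ∃ c : ℂ, ∀ W : sphericalVectors V, hV.hecke (diagOne ϖ) W = c • W := by
  refine exists_scalar _ fun W hW0 W' => ?_
  set T := hV.hecke (diagOne ϖ)
  have hq : (residueCard v : ℂ) ≠ 0 := residueCard_ne_zero
  let C : Submodule ℂ (sphericalVectors V) := LinearMap.range ((aeval T).toLinearMap.flip W)
  have hC : ∀ x, x ∈ C ↔ ∃ p : ℂ[X], aeval T p W = x := fun x => Iff.rfl
  have hT : ∀ x ∈ C, T x ∈ C := by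
    intro x hx
    obtain ⟨p, rfl⟩ := (hC x).1 hx
    refine (hC _).2 ⟨X * p, ?_⟩
    rw [aeval_mul, aeval_X, Module.End.mul_apply]
  have hA : ∀ n, hV.hecke (diagOne (ϖ ^ n)) W ∈ C ∧ hV.hecke (diagOne (ϖ ^ (n + 1))) W ∈ C := by
    intro n
    induction n with
    | zero =>
      have h0 : hV.hecke (diagOne (ϖ ^ 0)) W = W := Subtype.ext (by
        rw [hV.coe_hecke, pow_zero, diagOne_one, rightTranslate_one, levelAvg_zero_eq W.2.2])
      have hW : W ∈ C := (hC _).2 ⟨1, by rw [map_one, Module.End.one_apply]⟩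
      refine ⟨h0.symm ▸ hW, ?_⟩
      rw [zero_add, pow_one]
      exact hT W hW
    | succ n ih =>
      refine ⟨ih.2, ?_⟩
      have h := hV.hecke_mul_hecke hϖ n W
      have h' : hV.hecke (diagOne (ϖ ^ (n + 2))) W = (residueCard v : ℂ)⁻¹ •
          (((residueCard v : ℂ) + 1) • T (hV.hecke (diagOne (ϖ ^ (n + 1))) W) -
            hV.hecke (diagOne (ϖ ^ n)) W) := by
        rw [h, add_sub_cancel_left, inv_smul_smul₀ hq]
      rw [h']
      exact C.smul_mem _ (sub_mem (C.smul_mem _ (hT _ ih.2)) ih.1)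
  obtain ⟨W, hWV, hW⟩ := W
  obtain ⟨W', hWV', hW'⟩ := W'
  have hne : W ≠ 0 := fun h => hW0 (Subtype.ext h)
  have hspan : ∀ x ∈ Submodule.span ℂ (Set.range fun g => rightTranslate g W),
      ∃ y ∈ C, (y : LocalGL v → ℂ) = levelAvg 0 x := by
    intro x hx
    induction hx using Submodule.span_induction with
    | mem x hx =>
      obtain ⟨g, rfl⟩ := hx
      obtain ⟨z, g', n, rfl, hint, hunit, hdet⟩ := exists_centre_mul g
      refine ⟨_, (hA n).1, ?_⟩
      show _ = levelAvg 0 (rightTranslate (centre z * g') W)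
      rw [hV.coe_hecke, rightTranslate_mul, hV.rightTranslate_centre (hV.stable W hWV g'),
        levelAvg_cartan hϖ hW hint hunit hdet]
    | zero =>
      refine ⟨0, C.zero_mem, ?_⟩
      have := levelAvg_smul (v := v) 0 0 0
      rw [zero_smul, zero_smul] at this
      exact this.symm
    | add x x' hx hx' h h' =>
      obtain ⟨y, hy, e⟩ := h
      obtain ⟨y', hy', e'⟩ := h'
      rw [hV.span_eq hWV hne] at hx hx'
      exact ⟨y + y', C.add_mem hy hy', by rw [hV.levelAvg_add 0 hx hx', Submodule.coe_add, e, e']⟩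
    | smul c x _ h =>
      obtain ⟨y, hy, e⟩ := h
      exact ⟨c • y, C.smul_mem c hy, by rw [levelAvg_smul, Submodule.coe_smul, e]⟩
  obtain ⟨y, hy, e⟩ := hspan W' (by rw [hV.span_eq hWV hne]; exact hWV')
  obtain ⟨p, hp⟩ := (hC y).1 hy
  exact ⟨p, hp.trans (Subtype.ext (e.trans (levelAvg_zero_eq hW')))⟩

end

/-! ### Hecke eigenvalues on the torus -/

section

variable {ϖ : (v.adicCompletion F)ˣ} {ψ : AddChar (v.adicCompletion F) Circle}
  {V : Submodule ℂ (LocalGL v → ℂ)}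

theorem IsInvariantLevel.apply_mul_of_integral {W : LocalGL v → ℂ} (hW : IsInvariantLevel 0 W)
    (h : LocalGL v) {g : LocalGL v} (hint : ∀ i j, g i j ∈ ball v 0)
    (hdet : Valued.v ((Matrix.GeneralLinearGroup.det g : (v.adicCompletion F)ˣ) :
      v.adicCompletion F) = 1) : W (h * g) = W h := by
  obtain ⟨k, rfl⟩ := exists_integralIncl_eq g hint hdet
  exact hW.apply_mul h k

theorem diagOne_inv_mul (y : (v.adicCompletion F)ˣ) (g : LocalGL v) :
    diagOne y⁻¹ * (diagOne y * g) = g := by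
  rw [← mul_assoc, ← diagOne_mul, inv_mul_cancel, diagOne_one, one_mul]

theorem diagOne_mul_inv (y : (v.adicCompletion F)ˣ) (g : LocalGL v) :
    diagOne y * (diagOne y⁻¹ * g) = g := by
  rw [← mul_assoc, ← diagOne_mul, mul_inv_cancel, diagOne_one, one_mul]

theorem centre_mul_inv (z : (v.adicCompletion F)ˣ) (g : LocalGL v) :
    centre z * (centre z⁻¹ * g) = g := by
  rw [← mul_assoc, ← map_mul, mul_inv_cancel, map_one, one_mul]

theorem upper_mul_neg (x : v.adicCompletion F) (g : LocalGL v) :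
    upper x * (upper (-x) * g) = g := by
  rw [← mul_assoc, ← upper_add, add_neg_cancel, upper_zero, one_mul]

/-- Of the `q + 1` cosets in the double coset of `diag(ϖ,1)`, one is represented by `diag(ϖ⁻¹,1)` up
to the centre, and `q` by an integral upper unipotent times `diag(ϖ,1)`; for `y ∈ 𝔬` their phases
`ψ(yx)` are trivial. -/
theorem levelAvg_zero_torus (hψ : HasConductor ψ 0)
    (hϖ : Valued.v (ϖ : v.adicCompletion F) = WithZero.exp (-1 : ℤ)) {W : LocalGL v → ℂ}
    (hW : IsInvariantLevel 0 W) (hWw : IsWhittakerFunction ψ W) {y : (v.adicCompletion F)ˣ}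
    (hy : (y : v.adicCompletion F) ∈ ball v 0) :
    ((residueCard v : ℂ) + 1) * levelAvg 0 (rightTranslate (diagOne ϖ) W)
      (diagOne y) = W (diagOne (y * ϖ⁻¹)) +
        residueCard v * W (diagOne (y * ϖ)) := by
  have hq1 : (residueCard v : ℂ) + 1 ≠ 0 := by exact_mod_cast Nat.succ_ne_zero (residueCard v)
  obtain ⟨S, hS⟩ := exists_residues (v := v) 1
  have hϖ0 := ball_mono (v := v) (m := 0) (n := 1) (by norm_num) (self_mem_ball hϖ)
  rw [levelAvg_zero_apply, integralCompact_partition hS.1 hS.2.1 (by simpa using hS.2.2.1)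
    (by simpa using hS.2.2.2) _ (W (diagOne (y * ϖ⁻¹)))
    (fun _ => W (diagOne (y * ϖ))), Finset.sum_const, hS.1,
    pow_one, nsmul_eq_mul, mul_inv_cancel_left₀ hq1]
  · intro k hk
    obtain ⟨g, hg⟩ : ∃ g, g = diagOne ϖ * (centre ϖ⁻¹ *
      (integralIncl v k * diagOne ϖ)) := ⟨_, rfl⟩
    have e : diagOne y * integralIncl v k * diagOne ϖ =
        centre ϖ * (diagOne (y * ϖ⁻¹) * g) := by
      rw [hg, diagOne_mul, mul_assoc (diagOne y), mul_assoc (diagOne y), diagOne_inv_mul,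
        ← mul_assoc (centre ϖ), ← centre_comm, mul_assoc, centre_mul_inv]
    show W _ = _
    rw [e, hWw.centre_mul]
    refine hW.apply_mul_of_integral _ (fun i j => ?_) ?_
    · have e00 : g 0 0 = (k 0 0 : v.adicCompletion F) * (ϖ : v.adicCompletion F) := by
        rw [hg, diagOne_mul_apply_zero, centre_mul_apply, mul_diagOne_apply_zero,
          Units.mul_inv_cancel_left]
        rfl
      have e01 : g 0 1 = (k 0 1 : v.adicCompletion F) := by
        rw [hg, diagOne_mul_apply_zero, centre_mul_apply, mul_diagOne_apply_one,
          Units.mul_inv_cancel_left]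
        rfl
      have e10 : g 1 0 = (k 1 0 : v.adicCompletion F) := by
        rw [hg, diagOne_mul_apply_one, centre_mul_apply, mul_diagOne_apply_zero, mul_left_comm,
          Units.inv_mul, mul_one]
        rfl
      have e11 : g 1 1 = ((ϖ⁻¹ : (v.adicCompletion F)ˣ) : v.adicCompletion F) *
          (k 1 1 : v.adicCompletion F) := by
        rw [hg, diagOne_mul_apply_one, centre_mul_apply, mul_diagOne_apply_one]
        rfl
      fin_cases i <;> fin_cases j
      · exact e00 ▸ by simpa using mul_mem_ball (coe_mem_ball (k 0 0)) hϖ0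
      · exact e01 ▸ coe_mem_ball _
      · exact e10 ▸ coe_mem_ball _
      · exact e11 ▸ by simpa using mul_mem_ball (inv_mem_ball hϖ) hk
    · rw [hg, det_mul_val, det_mul_val, det_mul_val, det_centre_val, det_diagOne_val,
        val_det_integralIncl, Units.val_inv_eq_inv_val, map_inv₀, hϖ, ← WithZero.exp_neg,
        ← WithZero.exp_nsmul, one_mul, ← WithZero.exp_add, ← WithZero.exp_add]
      simp
  · intro k hk x hx hkx
    obtain ⟨g, hg⟩ : ∃ g, g = diagOne ϖ⁻¹ * (upper (-x) *
      (integralIncl v k * diagOne ϖ)) := ⟨_, rfl⟩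
    have e : diagOne y * integralIncl v k * diagOne ϖ =
        diagOne y * (upper x * (diagOne ϖ * g)) := by
      rw [hg, diagOne_mul_inv, upper_mul_neg, mul_assoc]
    show W _ = _
    rw [e, hWw.diagOne_upper_mul, hψ.eq_one (by simpa using mul_mem_ball hy (hS.2.1 x hx)),
      Circle.coe_one, one_mul, ← mul_assoc, ← diagOne_mul]
    refine hW.apply_mul_of_integral _ (fun i j => ?_) ?_
    · have e00 : g 0 0 = (k 0 0 : v.adicCompletion F) - x * (k 1 0 : v.adicCompletion F) := by
        rw [hg, diagOne_mul_apply_zero, upper_mul_apply_zero, mul_diagOne_apply_zero,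
          mul_diagOne_apply_zero, integralIncl_apply, integralIncl_apply]
        have := ϖ.inv_mul
        linear_combination ((k 0 0 : v.adicCompletion F) - x * (k 1 0 : v.adicCompletion F)) * this
      have e01 : g 0 1 = ((ϖ⁻¹ : (v.adicCompletion F)ˣ) : v.adicCompletion F) *
          (k 0 1 - x * k 1 1 : v.adicCompletion F) := by
        rw [hg, diagOne_mul_apply_zero, upper_mul_apply_zero, mul_diagOne_apply_one,
          mul_diagOne_apply_one, integralIncl_apply, integralIncl_apply]
        ring
      have e10 : g 1 0 = (k 1 0 : v.adicCompletion F) * (ϖ : v.adicCompletion F) := by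
        rw [hg, diagOne_mul_apply_one, upper_mul_apply_one, mul_diagOne_apply_zero]
        rfl
      have e11 : g 1 1 = (k 1 1 : v.adicCompletion F) := by
        rw [hg, diagOne_mul_apply_one, upper_mul_apply_one, mul_diagOne_apply_one]
        rfl
      fin_cases i <;> fin_cases j
      · exact e00 ▸ (ball v 0).sub_mem (coe_mem_ball _)
          (by simpa using mul_mem_ball (hS.2.1 x hx) (coe_mem_ball (k 1 0)))
      · exact e01 ▸ by simpa using mul_mem_ball (inv_mem_ball hϖ) hkx
      · exact e10 ▸ by simpa using mul_mem_ball (coe_mem_ball (k 1 0)) hϖ0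
      · exact e11 ▸ coe_mem_ball _
    · rw [hg, det_mul_val, det_mul_val, det_mul_val, det_upper_val, det_diagOne_val,
        det_diagOne_val, val_det_integralIncl, Units.val_inv_eq_inv_val, map_inv₀, hϖ,
        one_mul, one_mul, ← WithZero.exp_neg, ← WithZero.exp_add]
      simp

/-- Near `0` the restriction of `W` to the torus is invariant under units and satisfies the
recurrence with characteristic roots `α` and `β`. -/
def HasSphericalGerm (ϖ : (v.adicCompletion F)ˣ) (α β : ℂ) (W : LocalGL v → ℂ) : Prop :=
  ∃ N : ℕ, ∀ y : (v.adicCompletion F)ˣ, (y : v.adicCompletion F) ∈ ball v N →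
    W (diagOne (ϖ ^ 2 * y)) - (α + β) * W (diagOne (ϖ * y)) + α * β * W (diagOne y) = 0 ∧
    ∀ u : (v.adicCompletion F)ˣ, Valued.v (u : v.adicCompletion F) = 1 →
      W (diagOne (y * u)) = W (diagOne y)

theorem HasSphericalGerm.add {α β : ℂ} {W W' : LocalGL v → ℂ} (h : HasSphericalGerm ϖ α β W)
    (h' : HasSphericalGerm ϖ α β W') : HasSphericalGerm ϖ α β (W + W') := by
  obtain ⟨N, h⟩ := h
  obtain ⟨N', h'⟩ := h'
  refine ⟨max N N', fun y hy => ?_⟩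
  have h1 := h y (ball_mono (by simp) hy)
  have h2 := h' y (ball_mono (by simp) hy)
  refine ⟨?_, fun u hu => ?_⟩
  · simp only [Pi.add_apply]
    linear_combination h1.1 + h2.1
  · rw [Pi.add_apply, Pi.add_apply, h1.2 u hu, h2.2 u hu]

theorem HasSphericalGerm.smul {α β : ℂ} {W : LocalGL v → ℂ} (h : HasSphericalGerm ϖ α β W)
    (c : ℂ) : HasSphericalGerm ϖ α β (c • W) := by
  obtain ⟨N, h⟩ := h
  refine ⟨N, fun y hy => ⟨?_, fun u hu => ?_⟩⟩
  · simp only [Pi.smul_apply, smul_eq_mul]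
    linear_combination c * (h y hy).1
  · rw [Pi.smul_apply, Pi.smul_apply, (h y hy).2 u hu]

theorem apply_diagOne_upper {W : LocalGL v → ℂ} (hW : IsWhittakerFunction ψ W)
    (x : v.adicCompletion F) (y : (v.adicCompletion F)ˣ) :
    rightTranslate (upper x) W (diagOne y) =
      (ψ ((y : v.adicCompletion F) * x) : ℂ) * W (diagOne y) := by
  rw [rightTranslate, diagOne_mul_upper, hW.upper_mul]

theorem HasConductor.exists_germ_upper (hψ : HasConductor ψ 0) (x : v.adicCompletion F) :
    ∃ N : ℕ, ∀ W : LocalGL v → ℂ, IsWhittakerFunction ψ W → ∀ y : (v.adicCompletion F)ˣ,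
      (y : v.adicCompletion F) ∈ ball v N →
        rightTranslate (upper x) W (diagOne y) = W (diagOne y) := by
  obtain ⟨m, hm⟩ := exists_mem_ball x
  refine ⟨m, fun W hW y hy => ?_⟩
  rw [apply_diagOne_upper hW, hψ.eq_one (by simpa using mul_mem_ball hy hm), Circle.coe_one,
    one_mul]

theorem HasSphericalGerm.translate_upper (hψ : HasConductor ψ 0)
    (hϖ : Valued.v (ϖ : v.adicCompletion F) = WithZero.exp (-1 : ℤ)) {α β : ℂ}
    {W : LocalGL v → ℂ} (hW : IsWhittakerFunction ψ W) (h : HasSphericalGerm ϖ α β W)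
    (x : v.adicCompletion F) : HasSphericalGerm ϖ α β (rightTranslate (upper x) W) := by
  obtain ⟨N, h⟩ := h
  obtain ⟨M, hM⟩ := hψ.exists_germ_upper x
  have hϖ0 := ball_mono (v := v) (m := 0) (n := 1) (by norm_num) (self_mem_ball hϖ)
  have hϖ2 := ball_mono (v := v) (m := 0) (by positivity) (pow_mem_ball hϖ 2)
  refine ⟨max N M, fun y hy => ?_⟩
  have hyM : (y : v.adicCompletion F) ∈ ball v M := ball_mono (by simp) hy
  have h1 := h y (ball_mono (by simp) hy)
  refine ⟨?_, fun u hu => ?_⟩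
  · rw [hM W hW _ hyM, hM W hW (ϖ * y) (by simpa using mul_mem_ball hϖ0 hyM),
      hM W hW (ϖ ^ 2 * y) (by simpa using mul_mem_ball hϖ2 hyM), h1.1]
  · rw [hM W hW _ hyM, hM W hW _ (by rw [mem_ball, val_unit_mul hu]; exact hyM), h1.2 u hu]

theorem HasSphericalGerm.translate_diagOne {α β : ℂ}
    {W : LocalGL v → ℂ} (h : HasSphericalGerm ϖ α β W)
    (t : (v.adicCompletion F)ˣ) : HasSphericalGerm ϖ α β (rightTranslate (diagOne t) W) := by
  obtain ⟨N, h⟩ := h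
  obtain ⟨M, hM⟩ := exists_mem_ball (t : v.adicCompletion F)
  refine ⟨N + M, fun y hy => ?_⟩
  have hyt : ((y * t : (v.adicCompletion F)ˣ) : v.adicCompletion F) ∈ ball v N := by
    simpa using mul_mem_ball hy hM
  have h1 := h (y * t) hyt
  simp only [rightTranslate, ← diagOne_mul]
  refine ⟨?_, fun u hu => ?_⟩
  · rw [mul_assoc, mul_assoc, h1.1]
  · rw [mul_right_comm, h1.2 u hu]

/-- The translates of a vector of level `𝔭_v`. -/
theorem IsUnitaryGeneric.translate_eq (hV : IsUnitaryGeneric ψ V) {W : LocalGL v → ℂ}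
    (hW : W ∈ V) (h1 : IsInvariantLevel 1 W) (g : LocalGL v) :
    ∃ (x : v.adicCompletion F) (t : (v.adicCompletion F)ˣ),
      rightTranslate g W = rightTranslate (upper x) (rightTranslate (diagOne t) W) ∨
      rightTranslate g W =
        rightTranslate (upper x) (rightTranslate (diagOne t) (rightTranslate (weyl v) W)) := by
  by_cases hd : g 1 1 ≠ 0 ∧ g 1 0 / g 1 1 ∈ ball v 1
  · refine ⟨g 0 1 / g 1 1, Matrix.GeneralLinearGroup.det g * ((Units.mk0 _ hd.1) ^ 2)⁻¹,
      Or.inl ?_⟩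
    conv_lhs => rw [eq_mul_lower g (Units.mk0 _ hd.1) rfl]
    rw [rightTranslate_mul, rightTranslate_mul, hV.rightTranslate_centre (hV.stable W hW _),
      rightTranslate_mul]
    exact congrArg (fun x => rightTranslate (upper _) (rightTranslate (diagOne _) x))
      (h1.lower hd.2)
  · have hc : g 1 0 ≠ 0 := by
      intro h0
      have h2 : g 1 1 = 0 := by
        by_contra h2
        exact hd ⟨h2, by rw [h0, zero_div]; exact (ball v 1).zero_mem⟩
      have h3 := det_eq g
      rw [h0, h2, mul_zero, mul_zero, sub_zero] at h3
      exact Units.ne_zero _ h3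
    refine ⟨g 0 0 / g 1 0, -(Matrix.GeneralLinearGroup.det g) * ((Units.mk0 _ hc) ^ 2)⁻¹,
      Or.inr ?_⟩
    conv_lhs => rw [eq_mul_weyl g (Units.mk0 _ hc) rfl]
    rw [rightTranslate_mul, rightTranslate_mul, hV.rightTranslate_centre (hV.stable W hW _),
      rightTranslate_mul, rightTranslate_mul, h1.upper]
    · rfl
    -- The excluded case says `g 1 1 = 0` or `g 1 0 / g 1 1 ∉ 𝔭`; either way `g 1 1 / g 1 0` is
    -- integral and the last unipotent fixes `W`.
    rw [Units.val_mk0]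
    by_cases h2 : g 1 1 = 0
    · rw [h2, zero_div]
      exact (ball v 0).zero_mem
    · have h3 : g 1 0 / g 1 1 ∉ ball v 1 := fun h => hd ⟨h2, h⟩
      rw [mem_ball_one, not_lt, map_div₀, one_le_div₀ (by simpa [zero_lt_iff] using h2)] at h3
      rw [mem_ball_zero, map_div₀]
      exact div_le_one_of_le₀ h3 zero_le

/-- The model is spanned by translates of `W`, and for `W` of level `𝔭` each is an upper triangular
translate of `W` or of `wW`. Upper unipotents do not change germs at `0` and diagonal matrices shift
them, so two germs control all of `V`. -/
theorem IsUnitaryGeneric.hasSphericalGerm (hV : IsUnitaryGeneric ψ V) (hψ : HasConductor ψ 0)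
    (hϖ : Valued.v (ϖ : v.adicCompletion F) = WithZero.exp (-1 : ℤ)) {α β : ℂ}
    {W : LocalGL v → ℂ} (hW : W ∈ V) (hW0 : W ≠ 0) (h1 : IsInvariantLevel 1 W)
    (hg : HasSphericalGerm ϖ α β W) (hgw : HasSphericalGerm ϖ α β (rightTranslate (weyl v) W)) :
    ∀ W' ∈ V, HasSphericalGerm ϖ α β W' := by
  intro W' hW'
  rw [← hV.span_eq hW hW0] at hW'
  induction hW' using Submodule.span_induction with
  | mem x hx =>
    obtain ⟨g, rfl⟩ := hx
    obtain ⟨x, t, h | h⟩ := hV.translate_eq hW h1 g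
    · dsimp only
      rw [h]
      exact (hg.translate_diagOne t).translate_upper hψ hϖ
        ((hV.isWhittakerFunction hW).translate _) x
    · dsimp only
      rw [h]
      exact (hgw.translate_diagOne t).translate_upper hψ hϖ
        (((hV.isWhittakerFunction hW).translate _).translate _) x
  | zero => exact ⟨0, fun y _ => ⟨by simp, fun _ _ => rfl⟩⟩
  | add x y _ _ hx hy => exact hx.add hy
  | smul c x _ hx => exact hx.smul c

end

/-! ### Representations with a vector of level `𝔭_v` -/

section

variable {ϖ : (v.adicCompletion F)ˣ} {ψ : AddChar (v.adicCompletion F) Circle}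
  {V : Submodule ℂ (LocalGL v → ℂ)}

/-- The vector `W` is a normalised newvector of level at most one, and `α`, `β` are the Satake
parameters divided by the square root of the residue cardinality. -/
structure IsSatake (ϖ : (v.adicCompletion F)ˣ) (V : Submodule ℂ (LocalGL v → ℂ))
    (W : LocalGL v → ℂ) (α β : ℂ) : Prop where
  mem : W ∈ V
  level : IsInvariantLevel 1 W
  apply_one : W 1 = 1
  apply_self : W (diagOne ϖ) = α + β
  recurrence : ∀ n : ℕ, W (diagOne (ϖ ^ (n + 2))) - (α + β) * W (diagOne (ϖ ^ (n + 1))) +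
    α * β * W (diagOne (ϖ ^ n)) = 0
  germ : ∀ W' ∈ V, HasSphericalGerm ϖ α β W'
  mul_eq : α * β = 0 ∨ α * β = (residueCard v : ℂ)⁻¹

theorem IsSatake.hasExponents {W : LocalGL v → ℂ} {α β : ℂ} (h : IsSatake ϖ V W α β) :
    HasExponents ϖ V α β := fun W' hW' => by
  obtain ⟨N, hN⟩ := h.germ W' hW'
  exact ⟨N, fun y hy => (hN y hy).1⟩

theorem HasExponents.recOp_shellSeq
    (hϖ : Valued.v (ϖ : v.adicCompletion F) = WithZero.exp (-1 : ℤ))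
    {ψ₁ ψ₂ : AddChar (v.adicCompletion F) Circle}
    {V₁ V₂ : Submodule ℂ (LocalGL v → ℂ)} (hV₁ : IsUnitaryGeneric ψ₁ V₁)
    (hV₂ : IsUnitaryGeneric ψ₂ V₂) {α β γ δ : ℂ} (h₁ : HasExponents ϖ V₁ α β)
    (h₂ : HasExponents ϖ V₂ γ δ) {W₁ W₂ : LocalGL v → ℂ} (hW₁ : W₁ ∈ V₁) (hW₂ : W₂ ∈ V₂) :
    ∃ N, ∀ n ≥ N, recOp (productList α β (starRingEnd ℂ γ) (starRingEnd ℂ δ))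
      (shellSeq ϖ W₁ W₂) n = 0 := by
  obtain ⟨N₁, hN₁⟩ := h₁.recurrence hϖ hW₁
  obtain ⟨N₂, hN₂⟩ := h₂.recurrence hϖ hW₂
  refine ⟨max N₁ N₂, fun n hn => ?_⟩
  have hc : ∀ {ψ' : AddChar (v.adicCompletion F) Circle} {V' : Submodule ℂ (LocalGL v → ℂ)},
      IsUnitaryGeneric ψ' V' → ∀ {W' : LocalGL v → ℂ}, W' ∈ V' → ∀ m : ℕ,
      Continuous fun u : (v.adicCompletion F)ˣ => W' (diagOne (ϖ ^ m * u)) := fun h W' hW' m =>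
    (continuous_torus h hW').comp (continuous_const_mul _)
  have := recOp_unitIntegral (productList α β (starRingEnd ℂ γ) (starRingEnd ℂ δ))
    (fun m u => W₁ (diagOne (ϖ ^ m * u)) * starRingEnd ℂ (W₂ (diagOne (ϖ ^ m * u))))
    (fun m => (hc hV₁ hW₁ m).mul (Complex.continuous_conj.comp (hc hV₂ hW₂ m))) n
  refine this.trans ?_
  refine (unitIntegral_congr fun u hu => ?_).trans (unitIntegral_const 0)
  refine recOp_productList (a := fun m => W₁ (diagOne (ϖ ^ m * u)))
    (b := fun m => starRingEnd ℂ (W₂ (diagOne (ϖ ^ m * u)))) (fun m hm => ?_) (fun m hm => ?_)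
  · have := hN₁ m (by exact_mod_cast (le_max_left N₁ N₂).trans (hn.trans hm)) u hu
    exact_mod_cast this
  · have := hN₂ m (by exact_mod_cast (le_max_right N₁ N₂).trans (hn.trans hm)) u hu
    have := congrArg (starRingEnd ℂ) this
    rw [map_add, map_sub, map_mul, map_mul, map_mul, map_add, map_zero] at this
    exact_mod_cast this

/-- The numerator of the Rankin–Selberg identity, evaluated at `qX`, is `1 - X²` when both products
of parameters are `q⁻¹`, and `1` when one of them vanishes. In either case it divides `1 - X²`. -/
theorem IsSatake.hasSeries (hϖ : Valued.v (ϖ : v.adicCompletion F) = WithZero.exp (-1 : ℤ))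
    {ψ₁ ψ₂ : AddChar (v.adicCompletion F) Circle}
    {V₁ V₂ : Submodule ℂ (LocalGL v → ℂ)} (hV₁ : IsUnitaryGeneric ψ₁ V₁)
    (hV₂ : IsUnitaryGeneric ψ₂ V₂) {W₁ W₂ : LocalGL v → ℂ} {α β γ δ : ℂ}
    (h₁ : IsSatake ϖ V₁ W₁ α β) (h₂ : IsSatake ϖ V₂ W₂ γ δ) :
    HasSeries ϖ V₁ V₂ W₁ W₂ (productList α β (starRingEnd ℂ γ) (starRingEnd ℂ δ))
      (1 - C (α * β * starRingEnd ℂ γ * starRingEnd ℂ δ) * X ^ 2) where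
  recOp_eq _ h _ h' := h₁.hasExponents.recOp_shellSeq hϖ hV₁ hV₂ h₂.hasExponents h h'
  coeff_zero := by simp
  mul_eq := by
    have e : shellSeq ϖ W₁ W₂ = fun m => W₁ (diagOne (ϖ ^ m)) *
        starRingEnd ℂ (W₂ (diagOne (ϖ ^ m))) := by
      funext m
      refine (unitIntegral_congr fun u hu => ?_).trans (unitIntegral_const _)
      rw [h₁.level.torus _ _ hu, h₂.level.torus _ _ hu]
    rw [e]
    refine eulerPoly_productList_mul (a := fun m => W₁ (diagOne (ϖ ^ m)))
      (b := fun m => starRingEnd ℂ (W₂ (diagOne (ϖ ^ m)))) h₁.recurrence (fun m => ?_) ?_ ?_ ?_ ?_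
    · have := congrArg (starRingEnd ℂ) (h₂.recurrence m)
      rwa [map_add, map_sub, map_mul, map_mul, map_mul, map_add, map_zero] at this
    · rw [pow_zero, diagOne_one, h₁.apply_one]
    · rw [pow_one, h₁.apply_self]
    · rw [pow_zero, diagOne_one, h₂.apply_one, map_one]
    · rw [pow_one, h₂.apply_self, map_add]
  dvd := by
    have hq : (residueCard v : ℂ) ≠ 0 := residueCard_ne_zero
    have e : (1 - C (α * β * starRingEnd ℂ γ * starRingEnd ℂ δ) * X ^ 2 : ℂ[X]).comp
        (C (residueCard v : ℂ) * X) = 1 - C (α * β * starRingEnd ℂ (γ * δ) *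
          (residueCard v : ℂ) ^ 2) * X ^ 2 := by
      simp only [sub_comp, mul_comp, C_comp, pow_comp, X_comp, one_comp, map_mul, map_pow]
      ring
    rw [e]
    rcases h₁.mul_eq with h | h
    · simp [h]
    · rcases h₂.mul_eq with h' | h'
      · simp [h']
      · rw [h, h', map_inv₀, Complex.conj_natCast]
        have : (residueCard v : ℂ)⁻¹ * (residueCard v : ℂ)⁻¹ * (residueCard v : ℂ) ^ 2 = 1 := by
          field_simp
        rw [this, map_one, one_mul]

/-- Complex numbers with given sum and product. -/
theorem exists_add_mul (s p : ℂ) : ∃ α β : ℂ, α + β = s ∧ α * β = p := by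
  obtain ⟨d, hd⟩ := IsAlgClosed.exists_pow_nat_eq (s ^ 2 - 4 * p) zero_lt_two
  exact ⟨(s + d) / 2, (s - d) / 2, by ring, by linear_combination -hd / 4⟩

/-- If `c` is the Hecke eigenvalue, the formula on the torus is a recurrence with sum of roots `(q +
1)c / q` and product of roots `q⁻¹`. The Weyl element fixes `W`, so the germ of `W` alone controls
the model. -/
theorem IsUnitaryGeneric.exists_satake (hV : IsUnitaryGeneric ψ V) (hψ : HasConductor ψ 0)
    (hϖ : Valued.v (ϖ : v.adicCompletion F) = WithZero.exp (-1 : ℤ))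
    {W : LocalGL v → ℂ} (hW : W ∈ V) (h0 : IsInvariantLevel 0 W)
    (hnz : (∀ y, W (diagOne y) = 0) → W = 0) (hW0 : W ≠ 0) :
    W 1 ≠ 0 ∧ ∃ α β : ℂ, IsSatake ϖ V ((W 1)⁻¹ • W) α β := by
  have hq : (residueCard v : ℂ) ≠ 0 := residueCard_ne_zero
  have hWw := hV.isWhittakerFunction hW
  obtain ⟨c, hc⟩ := hV.exists_hecke_scalar hϖ
  have hc' : levelAvg 0 (rightTranslate (diagOne ϖ) W) = c • W :=
    congrArg Subtype.val (hc ⟨W, hW, h0⟩)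
  have hrec : ∀ y : (v.adicCompletion F)ˣ, (y : v.adicCompletion F) ∈ ball v 0 →
      W (diagOne (y * ϖ)) = ((residueCard v : ℂ) + 1) * c * (residueCard v : ℂ)⁻¹ *
        W (diagOne y) - (residueCard v : ℂ)⁻¹ * W (diagOne (y * ϖ⁻¹)) := by
    intro y hy
    have h := levelAvg_zero_torus hψ hϖ h0 hWw hy
    rw [hc', Pi.smul_apply, smul_eq_mul] at h
    field_simp
    linear_combination -h
  obtain ⟨α, β, hs, hp⟩ := exists_add_mul (((residueCard v : ℂ) + 1) * c * (residueCard v : ℂ)⁻¹)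
    (residueCard v : ℂ)⁻¹
  rw [← hs, ← hp] at hrec
  -- The recurrence at `y = 1` has no third term, because `W` vanishes at `ϖ⁻¹ ∉ 𝔬`.
  have h1 : W (diagOne ϖ) = (α + β) * W 1 := by
    have h := hrec 1 (by simpa using one_mem_ball)
    rw [one_mul, one_mul, diagOne_one, h0.torus_eq_zero hψ hWw (y := ϖ⁻¹), mul_zero, sub_zero] at h
    · exact h
    · simpa using zpow_mul_notMem_ball hϖ (n := -1) (u := 1) (by simp) (by norm_num)
  have h2 : ∀ y : (v.adicCompletion F)ˣ, (y : v.adicCompletion F) ∈ ball v 0 →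
      W (diagOne (ϖ ^ 2 * y)) - (α + β) * W (diagOne (ϖ * y)) + α * β * W (diagOne y) = 0 := by
    intro y hy
    have hϖ0 := ball_mono (v := v) (m := 0) (n := 1) (by norm_num) (self_mem_ball hϖ)
    have h := hrec (ϖ * y) (by simpa using mul_mem_ball hϖ0 hy)
    rw [mul_right_comm, ← pow_two, mul_comm ϖ y, mul_inv_cancel_right, mul_comm y] at h
    linear_combination h
  have h3 : ∀ n : ℕ, W (diagOne (ϖ ^ (n + 2))) - (α + β) * W (diagOne (ϖ ^ (n + 1))) +
      α * β * W (diagOne (ϖ ^ n)) = 0 := by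
    intro n
    have := h2 (ϖ ^ n) (ball_mono (by positivity) (pow_mem_ball hϖ n))
    rwa [← pow_add, ← pow_succ', add_comm 2 n] at this
  -- If `W 1 = 0`, the recurrence makes `W` vanish on the whole torus.
  have hW1 : W 1 ≠ 0 := by
    intro h
    refine hW0 (hnz fun y => ?_)
    by_cases hy : (y : v.adicCompletion F) ∈ ball v 0
    · have h4 : ∀ n : ℕ, W (diagOne (ϖ ^ n)) = 0 ∧ W (diagOne (ϖ ^ (n + 1))) = 0 := by
        intro n
        induction n with
        | zero => exact ⟨by rw [pow_zero, diagOne_one, h], by rw [zero_add, pow_one, h1, h, mul_zero]⟩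
        | succ n ih =>
          refine ⟨ih.2, ?_⟩
          have := h3 n
          rw [ih.1, ih.2] at this
          simpa using this
      obtain ⟨n, u, hu, rfl⟩ := exists_zpow_mul_unit hϖ y
      rw [h0.torus _ _ hu]
      obtain ⟨n, rfl⟩ | hn := (le_or_gt 0 n).imp_left Int.eq_ofNat_of_zero_le
      · exact_mod_cast (h4 n).1
      · exact absurd hy (zpow_mul_notMem_ball hϖ hu hn)
    · exact h0.torus_eq_zero hψ hWw hy
  refine ⟨hW1, α, β, V.smul_mem _ hW, ?_, ?_, ?_, fun n => ?_, ?_, Or.inr hp⟩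
  · intro k hk
    rw [rightTranslate_smul, h0.mono zero_le_one k hk]
  · rw [Pi.smul_apply, smul_eq_mul, inv_mul_cancel₀ hW1]
  · rw [Pi.smul_apply, smul_eq_mul, h1]
    field_simp
  · simp only [Pi.smul_apply, smul_eq_mul]
    linear_combination (W 1)⁻¹ * h3 n
  · have hg : HasSphericalGerm ϖ α β W :=
      ⟨0, fun y hy => ⟨h2 y hy, fun u hu => h0.torus _ _ hu⟩⟩
    refine hV.hasSphericalGerm hψ hϖ hW hW0 (h0.mono zero_le_one) hg ?_
    obtain ⟨k, hk⟩ := exists_integral_weyl (v := v)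
    rw [← hk, isInvariantLevel_iff.1 h0 k (levelSubgroup_zero k)]
    exact hg


/-! ### Level `𝔭_v` without spherical vectors: the Atkin–Lehner involution. -/

/-- The Atkin–Lehner element `(0 1; ϖ 0)`. -/
def atkinLehner (ϖ : (v.adicCompletion F)ˣ) : LocalGL v := weyl v * diagOne ϖ

theorem atkinLehner_mul_self (ϖ : (v.adicCompletion F)ˣ) :
    (atkinLehner ϖ : LocalGL v) * atkinLehner ϖ = centre ϖ := by
  refine LocalGL.ext' ?_
  rw [coe_centre, Units.val_mul, atkinLehner, Units.val_mul, coe_weyl, coe_diagOne]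
  simp

theorem diagOne_mul_atkinLehner (ϖ y : (v.adicCompletion F)ˣ) :
    diagOne y * (atkinLehner ϖ : LocalGL v) = centre ϖ * (diagOne (y * ϖ⁻¹) * weyl v) := by
  refine LocalGL.ext' ?_
  rw [atkinLehner, Units.val_mul, Units.val_mul, Units.val_mul, Units.val_mul, coe_centre, coe_weyl,
    coe_diagOne, coe_diagOne, coe_diagOne]
  simp [mul_left_comm (ϖ : v.adicCompletion F)]

theorem IsInvariantLevel.translate_of_integral {r : ℕ} {W : LocalGL v → ℂ}
    (hW : IsInvariantLevel r W) {g : LocalGL v} (hint : ∀ i j, g i j ∈ ball v 0)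
    (h10 : g 1 0 ∈ ball v r)
    (hdet : Valued.v ((Matrix.GeneralLinearGroup.det g : (v.adicCompletion F)ˣ) :
      v.adicCompletion F) = 1) : rightTranslate g W = W := by
  obtain ⟨k, rfl⟩ := exists_integralIncl_eq g hint hdet
  exact hW k h10

/-- The element normalises the congruence subgroup of level `𝔭`: conjugation exchanges the diagonal
entries and sends the entries `b`, `c` off the diagonal to `ϖb` and `ϖ⁻¹c` in exchanged places. -/
theorem isInvariantLevel_atkinLehner
    (hϖ : Valued.v (ϖ : v.adicCompletion F) = WithZero.exp (-1 : ℤ)) {W : LocalGL v → ℂ}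
    (hW : IsInvariantLevel 1 W) : IsInvariantLevel 1 (rightTranslate (atkinLehner ϖ) W) := by
  intro k hk
  obtain ⟨g, hg⟩ : ∃ g : LocalGL v, g = diagOne ϖ⁻¹ * (weyl v * (integralIncl v k *
      (weyl v * diagOne ϖ))) := ⟨_, rfl⟩
  have hkg : integralIncl v k * atkinLehner ϖ = atkinLehner ϖ * g := by
    rw [hg, atkinLehner, mul_assoc (weyl v), diagOne_mul_inv, ← mul_assoc (weyl v),
      weyl_mul_weyl, one_mul]
  rw [← rightTranslate_mul, hkg, rightTranslate_mul]
  congr 1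
  have e00 : g 0 0 = (k 1 1 : v.adicCompletion F) := by
    rw [hg, diagOne_mul_apply_zero, (weyl_mul_apply _ _).1, ← mul_assoc, mul_diagOne_apply_zero,
      (mul_weyl_apply _ _).1, integralIncl_apply, mul_left_comm, Units.inv_mul, mul_one]
  have e01 : g 0 1 = ((ϖ⁻¹ : (v.adicCompletion F)ˣ) : v.adicCompletion F) *
      (k 1 0 : v.adicCompletion F) := by
    rw [hg, diagOne_mul_apply_zero, (weyl_mul_apply _ _).1, ← mul_assoc, mul_diagOne_apply_one,
      (mul_weyl_apply _ _).2, integralIncl_apply]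
  have e10 : g 1 0 = (k 0 1 : v.adicCompletion F) * (ϖ : v.adicCompletion F) := by
    rw [hg, diagOne_mul_apply_one, (weyl_mul_apply _ _).2, ← mul_assoc, mul_diagOne_apply_zero,
      (mul_weyl_apply _ _).1, integralIncl_apply]
  have e11 : g 1 1 = (k 0 0 : v.adicCompletion F) := by
    rw [hg, diagOne_mul_apply_one, (weyl_mul_apply _ _).2, ← mul_assoc, mul_diagOne_apply_one,
      (mul_weyl_apply _ _).2, integralIncl_apply]
  have h10 : g 1 0 ∈ ball v 1 := e10 ▸ by
    simpa using mul_mem_ball (coe_mem_ball (k 0 1)) (self_mem_ball hϖ)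
  refine hW.translate_of_integral (fun i j => ?_) h10 ?_
  · fin_cases i <;> fin_cases j
    · exact e00 ▸ coe_mem_ball _
    · exact e01 ▸ by simpa using mul_mem_ball (inv_mem_ball hϖ) hk
    · exact ball_mono (by norm_num) h10
    · exact e11 ▸ coe_mem_ball _
  · rw [hg, det_mul_val, det_mul_val, det_mul_val, det_mul_val, det_weyl_val, det_diagOne_val,
      det_diagOne_val, val_det_integralIncl, Units.val_inv_eq_inv_val, map_inv₀, hϖ,
      one_mul, one_mul, one_mul, ← WithZero.exp_neg, ← WithZero.exp_add]
    simp

/-- The average over the compact group is a sum over the `q + 1` points of the projective line. One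
point contributes `W` itself and each of the other `q` contributes the Weyl translate, with phase
`ψ(yx) = 1` for `y ∈ 𝔬`. -/
theorem torus_add_mul_weyl {W : LocalGL v → ℂ} (hψ : HasConductor ψ 0)
    (hW : IsInvariantLevel 1 W) (hWw : IsWhittakerFunction ψ W) (hz : levelAvg 0 W = 0)
    {y : (v.adicCompletion F)ˣ} (hy : (y : v.adicCompletion F) ∈ ball v 0) :
    W (diagOne y) + residueCard v * W (diagOne y * weyl v) = 0 := by
  have hq1 : (residueCard v : ℂ) + 1 ≠ 0 := by exact_mod_cast Nat.succ_ne_zero (residueCard v)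
  obtain ⟨S, hS⟩ := exists_residues (v := v) 1
  obtain ⟨w, hw⟩ := exists_integral_weyl (v := v)
  have h := congrFun hz (diagOne y)
  rw [← levelAvg_zero_translate w, hw, levelAvg_zero_apply, integralCompact_partition hS.1 hS.2.1
    (by simpa using hS.2.2.1)
    (by simpa using hS.2.2.2) _ (W (diagOne y))
    (fun _ => W (diagOne y * weyl v)), Finset.sum_const, hS.1,
    pow_one, nsmul_eq_mul, Pi.zero_apply] at h
  · simpa [hq1] using h
  · intro k hk
    rw [rightTranslate, mul_assoc]
    refine congrFun (hW.translate_of_integral (fun i j => ?_) ?_ ?_) _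
    · fin_cases j
      · exact (mul_weyl_apply (integralIncl v k) i).1 ▸ coe_mem_ball (k i 1)
      · exact (mul_weyl_apply (integralIncl v k) i).2 ▸ coe_mem_ball (k i 0)
    · rw [(mul_weyl_apply _ _).1]
      exact hk
    · rw [det_mul_val, det_weyl_val, val_det_integralIncl, one_mul]
  · intro k hk x hx hkx
    obtain ⟨g, hg⟩ : ∃ g, g = weyl v * (upper (-x) * (integralIncl v k * weyl v)) := ⟨_, rfl⟩
    have e : diagOne y * integralIncl v k * weyl v =
        diagOne y * (upper x * (weyl v * g)) := by
      rw [hg, ← mul_assoc (weyl v), weyl_mul_weyl, one_mul, upper_mul_neg, mul_assoc]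
    rw [rightTranslate, e, hWw.diagOne_upper_mul,
      hψ.eq_one (by simpa using mul_mem_ball hy (hS.2.1 x hx)), Circle.coe_one, one_mul, ← mul_assoc]
    have e0 : ∀ j, g 0 j = (integralIncl v k * weyl v : LocalGL v) 1 j := fun j => by
      rw [hg, (weyl_mul_apply _ _).1, upper_mul_apply_one]
    have e10 : g 1 0 = (k 0 1 - x * k 1 1 : v.adicCompletion F) := by
      rw [hg, (weyl_mul_apply _ _).2, upper_mul_apply_zero, (mul_weyl_apply _ _).1,
        (mul_weyl_apply _ _).1, integralIncl_apply, integralIncl_apply]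
      ring
    have e11 : g 1 1 = (k 0 0 - x * k 1 0 : v.adicCompletion F) := by
      rw [hg, (weyl_mul_apply _ _).2, upper_mul_apply_zero, (mul_weyl_apply _ _).2,
        (mul_weyl_apply _ _).2, integralIncl_apply, integralIncl_apply]
      ring
    have h10 : g 1 0 ∈ ball v 1 := e10 ▸ hkx
    refine congrFun (hW.translate_of_integral (fun i j => ?_) h10 ?_) _
    · fin_cases i <;> fin_cases j
      · exact (e0 0).trans (mul_weyl_apply (integralIncl v k) 1).1 ▸ coe_mem_ball (k 1 1)
      · exact (e0 1).trans (mul_weyl_apply (integralIncl v k) 1).2 ▸ coe_mem_ball (k 1 0)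
      · exact ball_mono (by norm_num) h10
      · exact e11 ▸ (ball v 0).sub_mem (coe_mem_ball _)
          (by simpa using mul_mem_ball (hS.2.1 x hx) (coe_mem_ball (k 1 0)))
    · rw [hg, det_mul_val, det_mul_val, det_mul_val, det_weyl_val, det_upper_val,
        val_det_integralIncl, one_mul, one_mul, one_mul]

/-- In the absence of spherical vectors the average of `W` vanishes, which relates `W` to its Weyl
translate; the Atkin–Lehner eigenvalue `ε` relates the latter to the shift by `ϖ`. Together `W(ϖy) =
-ε q⁻¹ W(y)` on `𝔬`, so the parameters are `-ε q⁻¹` and `0`. -/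
theorem IsUnitaryGeneric.exists_satake_of_level_one (hV : IsUnitaryGeneric ψ V)
    (hψ : HasConductor ψ 0)
    (hϖ : Valued.v (ϖ : v.adicCompletion F) = WithZero.exp (-1 : ℤ))
    (hno : ∀ W ∈ V, IsInvariantLevel 0 W → W = 0)
    (hnz : ∀ W ∈ V, (∀ y, W (diagOne y) = 0) → W = 0)
    {W : LocalGL v → ℂ} (hW : W ∈ V) (hW0 : W ≠ 0) (h1 : IsInvariantLevel 1 W) :
    ∃ W' α β, IsSatake ϖ V W' α β := by
  have hq : (residueCard v : ℂ) ≠ 0 := residueCard_ne_zero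
  -- The Atkin–Lehner operator `A` is an involution, since its square is central. So `W + A W` is an
  -- eigenvector, and if it vanishes then `W` is one with eigenvalue `-1`.
  obtain ⟨W', hW', hW0', h1', ε, hε, hAL⟩ : ∃ W' ∈ V, W' ≠ 0 ∧ IsInvariantLevel 1 W' ∧
      ∃ ε : ℂ, ε * ε = 1 ∧ rightTranslate (atkinLehner ϖ) W' = ε • W' := by
    have hAA : rightTranslate (atkinLehner ϖ) (rightTranslate (atkinLehner ϖ) W) = W := by
      rw [← rightTranslate_mul, atkinLehner_mul_self, hV.rightTranslate_centre hW]
    by_cases h : W + rightTranslate (atkinLehner ϖ) W = 0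
    · refine ⟨W, hW, hW0, h1, -1, by norm_num, ?_⟩
      rw [neg_one_smul]
      exact (neg_eq_of_add_eq_zero_right h).symm
    · refine ⟨_, V.add_mem hW (hV.stable W hW _), h, fun k hk => ?_, 1, by norm_num, ?_⟩
      · rw [rightTranslate_add, h1 k hk, isInvariantLevel_atkinLehner hϖ h1 k hk]
      · rw [rightTranslate_add, hAA, one_smul, add_comm]
  have hWw := hV.isWhittakerFunction hW'
  have hz : levelAvg 0 W' = 0 := hno _ (hV.levelAvg_mem 0 hW') (levelAvg_invariant 0 W')
  have hw : ∀ y : (v.adicCompletion F)ˣ, W' (diagOne y * weyl v) = ε * W' (diagOne (ϖ * y)) := by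
    intro y
    have h := congrFun hAL (diagOne (y * ϖ))
    rw [rightTranslate, diagOne_mul_atkinLehner, hWw.centre_mul, mul_inv_cancel_right,
      Pi.smul_apply, smul_eq_mul, mul_comm y] at h
    exact h
  have hr : ∀ y : (v.adicCompletion F)ˣ, (y : v.adicCompletion F) ∈ ball v 0 →
      W' (diagOne (ϖ * y)) = -ε * (residueCard v : ℂ)⁻¹ * W' (diagOne y) := by
    intro y hy
    have h := torus_add_mul_weyl hψ h1' hWw hz hy
    rw [hw] at h
    field_simp
    linear_combination ε * h - (residueCard v) * W' (diagOne (ϖ * y)) * hε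
  obtain ⟨α, hα⟩ : ∃ α, α = -ε * (residueCard v : ℂ)⁻¹ := ⟨_, rfl⟩
  rw [← hα] at hr
  have hϖ0 := ball_mono (v := v) (m := 0) (n := 1) (by norm_num) (self_mem_ball hϖ)
  have h2 : ∀ y : (v.adicCompletion F)ˣ, (y : v.adicCompletion F) ∈ ball v 0 →
      W' (diagOne (ϖ ^ 2 * y)) - (α + 0) * W' (diagOne (ϖ * y)) + α * 0 * W' (diagOne y) = 0 := by
    intro y hy
    rw [pow_two, mul_assoc, hr (ϖ * y) (by simpa using mul_mem_ball hϖ0 hy)]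
    ring
  have h4 : ∀ n : ℕ, W' (diagOne (ϖ ^ n)) = α ^ n * W' 1 := by
    intro n
    induction n with
    | zero => rw [pow_zero, diagOne_one, pow_zero, one_mul]
    | succ n ih =>
      rw [pow_succ', hr (ϖ ^ n) (ball_mono (by positivity) (pow_mem_ball hϖ n)), ih]
      ring
  have hW1 : W' 1 ≠ 0 := by
    intro h
    refine hW0' (hnz W' hW' fun y => ?_)
    by_cases hy : (y : v.adicCompletion F) ∈ ball v 0
    · obtain ⟨n, u, hu, rfl⟩ := exists_zpow_mul_unit hϖ y
      rw [h1'.torus _ _ hu]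
      obtain ⟨n, rfl⟩ | hn := (le_or_gt 0 n).imp_left Int.eq_ofNat_of_zero_le
      · rw [zpow_natCast, h4, h, mul_zero]
      · exact absurd hy (zpow_mul_notMem_ball hϖ hu hn)
    · exact h1'.torus_eq_zero hψ hWw hy
  have hg : HasSphericalGerm ϖ α 0 W' :=
    ⟨0, fun y hy => ⟨h2 y hy, fun u hu => h1'.torus _ _ hu⟩⟩
  have hgw : HasSphericalGerm ϖ α 0 (rightTranslate (weyl v) W') := by
    obtain ⟨N, hN⟩ := (hg.translate_diagOne ϖ).smul ε
    have e : ∀ y, rightTranslate (weyl v) W' (diagOne y) =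
        (ε • rightTranslate (diagOne ϖ) W') (diagOne y) := fun y => by
      rw [Pi.smul_apply, rightTranslate, rightTranslate, hw, ← diagOne_mul, mul_comm y, smul_eq_mul]
    exact ⟨N, fun y hy => by simpa only [e] using hN y hy⟩
  refine ⟨(W' 1)⁻¹ • W', α, 0, V.smul_mem _ hW', fun k hk => ?_, ?_, ?_, fun n => ?_,
    hV.hasSphericalGerm hψ hϖ hW' hW0' h1' hg hgw, Or.inl (mul_zero _)⟩
  · rw [rightTranslate_smul, h1' k hk]
  · rw [Pi.smul_apply, smul_eq_mul, inv_mul_cancel₀ hW1]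
  · have := h4 1
    rw [pow_one, pow_one] at this
    rw [Pi.smul_apply, smul_eq_mul, this]
    field_simp
    ring
  · simp only [Pi.smul_apply, smul_eq_mul, h4]
    ring

end

/-! ### Representations without vectors of level `𝔭_v` -/

section

variable {ϖ : (v.adicCompletion F)ˣ} {ψ : AddChar (v.adicCompletion F) Circle}
  {V : Submodule ℂ (LocalGL v → ℂ)}

theorem exists_unit_of_val_eq_one {s : v.adicCompletion F} (h : Valued.v s = 1) :
    ∃ u : (v.adicCompletion F)ˣ, (u : v.adicCompletion F) = s :=
  ⟨Units.mk0 s fun h0 => by simp [h0] at h, rfl⟩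

open Classical in
/-- The translate of `W` by the unit `s`, and zero if `s` is not a unit. -/
def unitTranslate (W : LocalGL v → ℂ) (s : v.adicCompletion F) : LocalGL v → ℂ :=
  if h : Valued.v s = 1 then rightTranslate (diagOne (exists_unit_of_val_eq_one h).choose) W else 0

theorem unitTranslate_eq (W : LocalGL v → ℂ) {u : (v.adicCompletion F)ˣ}
    (h : Valued.v (u : v.adicCompletion F) = 1) :
    unitTranslate W (u : v.adicCompletion F) = rightTranslate (diagOne u) W := by
  rw [unitTranslate, dif_pos h]
  congr 2
  exact Units.ext (exists_unit_of_val_eq_one h).choose_spec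

theorem unitTranslate_of_ne (W : LocalGL v → ℂ) {s : v.adicCompletion F} (h : Valued.v s ≠ 1) :
    unitTranslate W s = 0 := dif_neg h

theorem unitTranslate_induction (W : LocalGL v → ℂ) {p : (LocalGL v → ℂ) → Prop} (h0 : p 0)
    (h1 : ∀ u : (v.adicCompletion F)ˣ, Valued.v (u : v.adicCompletion F) = 1 →
      p (rightTranslate (diagOne u) W)) (s : v.adicCompletion F) : p (unitTranslate W s) := by
  by_cases h : Valued.v s = 1
  · obtain ⟨u, rfl⟩ := exists_unit_of_val_eq_one h
    rw [unitTranslate_eq W h]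
    exact h1 u h
  · rw [unitTranslate_of_ne W h]
    exact h0

/-- Translates of `W` by units depend only on the unit modulo `𝔭^m`, so this sum is a trace over the
finite group of unit classes, which multiplication by `u` permutes. -/
theorem diagOne_sum_unitTranslate {m : ℕ} (hm : 1 ≤ m) {S : Finset (v.adicCompletion F)}
    (hS : IsResidueSystem S m) {W : LocalGL v → ℂ}
    (hW : ∀ u : (v.adicCompletion F)ˣ, (u : v.adicCompletion F) - 1 ∈ ball v m →
        rightTranslate (diagOne u) W = W) {u : (v.adicCompletion F)ˣ}
    (hu : Valued.v (u : v.adicCompletion F) = 1) :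
    rightTranslate (diagOne u) (∑ s ∈ S, unitTranslate W s) = ∑ s ∈ S, unitTranslate W s := by
  have h1 := hS.sum_comp (f := unitTranslate W) (fun x hx z hz => ?_)
    (fun s => (u : v.adicCompletion F) * s) (fun x hx => (unit_mul_mem_ball hu).2 hx)
    (fun x hx y hy h => by rwa [← mul_sub, unit_mul_mem_ball hu] at h)
  · refine Eq.trans ?_ h1
    rw [rightTranslate_sum]
    refine Finset.sum_congr rfl fun s _ => ?_
    by_cases h : Valued.v s = 1
    · obtain ⟨t, rfl⟩ := exists_unit_of_val_eq_one h
      rw [unitTranslate_eq W h, ← Units.val_mul, unitTranslate_eq W (by rw [Units.val_mul, map_mul, hu, h, one_mul]),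
        ← rightTranslate_mul, ← diagOne_mul]
    · rw [unitTranslate_of_ne W h, unitTranslate_of_ne W (by rwa [map_mul, hu, one_mul])]
      rfl
  · by_cases h : Valued.v x = 1
    · have h' : Valued.v (x + z) = 1 := val_add_eq_one h (ball_mono (by exact_mod_cast hm) hz)
      obtain ⟨t, ht⟩ := exists_unit_of_val_eq_one h
      obtain ⟨t', ht'⟩ := exists_unit_of_val_eq_one h'
      rw [← ht', ← ht, unitTranslate_eq W (by rwa [ht']), unitTranslate_eq W (by rwa [ht]),
        ← mul_inv_cancel_left t t', diagOne_mul, rightTranslate_mul, hW]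
      have h2 : ((t⁻¹ * t' : (v.adicCompletion F)ˣ) : v.adicCompletion F) - 1 =
          ((t⁻¹ : (v.adicCompletion F)ˣ) : v.adicCompletion F) * z := by
        rw [Units.val_mul, ht', ← ht, mul_add, Units.inv_mul, add_sub_cancel_left]
      rw [h2, unit_mul_mem_ball]
      · exact hz
      · rw [Units.val_inv_eq_inv_val, map_inv₀, ht, h, inv_one]
    · rw [unitTranslate_of_ne W h, unitTranslate_of_ne W]
      intro h'
      refine h ?_
      have := val_add_eq_one h' ((ball v 1).neg_mem (ball_mono (by exact_mod_cast hm) hz))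
      rwa [add_neg_cancel_right] at this

theorem rightTranslate_lower_diagOne {W : LocalGL v → ℂ} {n : ℤ}
    (hW : ∀ x ∈ ball v n, rightTranslate (lower x) W = W) (y : (v.adicCompletion F)ˣ)
    {x : v.adicCompletion F} (hx : x * (y : v.adicCompletion F) ∈ ball v n) :
    rightTranslate (lower x) (rightTranslate (diagOne y) W) = rightTranslate (diagOne y) W := by
  rw [← rightTranslate_mul, lower_mul_diagOne, rightTranslate_mul, hW _ hx]

/-- Averaging over units and translating by `diag(ϖ^n,1)` with `n` large gives a vector fixed by
`𝔭`-lower unipotents; its average at level `𝔭` has the same values on `𝔬` up to a non-zero constant.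
Vectors of level `𝔭` being zero, these values vanish. Thus in this case the unramified part of every
germ is zero. -/
theorem IsUnitaryGeneric.unitIntegral_eq_zero (hV : IsUnitaryGeneric ψ V) (hψ : HasConductor ψ 0)
    (hϖ : Valued.v (ϖ : v.adicCompletion F) = WithZero.exp (-1 : ℤ))
    (hno : ∀ W ∈ V, IsInvariantLevel 1 W → W = 0) {W : LocalGL v → ℂ} (hW : W ∈ V) :
    ∃ N : ℕ, ∀ n ≥ N, (unitIntegral v fun u => W (diagOne (ϖ ^ n * u))) = 0 := by
  obtain ⟨m, hm, -, hl, hd⟩ := hV.exists_level hW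
  obtain ⟨S, hS⟩ : ∃ S, IsResidueSystem (v := v) S m := exists_residues m
  refine ⟨m, fun n hn => ?_⟩
  obtain ⟨WT, hWT⟩ : ∃ WT, WT = ∑ s ∈ S, unitTranslate W s := ⟨_, rfl⟩
  have hWTV : WT ∈ V := hWT ▸ V.sum_mem fun s _ =>
    unitTranslate_induction W (p := fun x => x ∈ V) V.zero_mem (fun u _ => hV.stable W hW _) s
  have hWTu : ∀ u : (v.adicCompletion F)ˣ, Valued.v (u : v.adicCompletion F) = 1 →
      rightTranslate (diagOne u) WT = WT := fun u hu => by
    rw [hWT, diagOne_sum_unitTranslate hm hS hd hu]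
  have hWTl : ∀ x ∈ ball v m, rightTranslate (lower x) WT = WT := by
    intro x hx
    rw [hWT, rightTranslate_sum]
    refine Finset.sum_congr rfl fun s _ => ?_
    refine unitTranslate_induction W (p := fun X => rightTranslate (lower x) X = X) rfl
      (fun u hu => rightTranslate_lower_diagOne hl u ?_) s
    rwa [mul_comm, unit_mul_mem_ball hu]
  -- Lower unipotents with entry in `𝔭` act on the translate as entries in `𝔭^(n+1) ⊆ 𝔭^m` act on
  -- `WT`, that is, trivially.
  have hX : levelAvg 1 (rightTranslate (diagOne (ϖ ^ n)) WT) = 0 :=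
    hno _ (hV.levelAvg_mem 1 (hV.stable WT hWTV _)) (levelAvg_invariant 1 _)
  have hX1 : WT (diagOne (ϖ ^ n)) = 0 := by
    have h := ((hV.isWhittakerFunction hWTV).translate (diagOne (ϖ ^ n))).levelAvg_torus hψ le_rfl
      (fun x hx => rightTranslate_lower_diagOne hWTl _ ?_) (fun y u hu => ?_) (y := 1) ?_
    · rw [hX, Pi.zero_apply, diagOne_one, rightTranslate, one_mul] at h
      exact (mul_eq_zero.1 h.symm).resolve_left (levelVolume_ne_zero hϖ le_rfl)
    · refine ball_mono ?_ (mul_mem_ball hx (pow_mem_ball hϖ n))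
      push_cast
      omega
    · rw [rightTranslate, rightTranslate, ← diagOne_mul, ← diagOne_mul, mul_right_comm]
      have := congrFun (hWTu u hu) (diagOne (y * ϖ ^ n))
      rwa [rightTranslate, ← diagOne_mul] at this
    · simpa using one_mem_ball
  have hint : ∀ s, (unitIntegral v fun u => unitTranslate W s (diagOne (ϖ ^ n * u))) =
      if Valued.v s = 1 then unitIntegral v fun u => W (diagOne (ϖ ^ n * u)) else 0 := by
    intro s
    split_ifs with h
    · obtain ⟨t, rfl⟩ := exists_unit_of_val_eq_one h
      rw [unitTranslate_eq W h]
      refine Eq.trans ?_ (unitIntegral_mul_left h _)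
      congr 1
      funext u
      rw [rightTranslate, ← diagOne_mul, mul_assoc, mul_comm u]
    · rw [unitTranslate_of_ne W h]
      exact unitIntegral_const 0
  have hsum : (unitIntegral v fun u => WT (diagOne (ϖ ^ n * u))) =
      ∑ s ∈ S, unitIntegral v fun u => unitTranslate W s (diagOne (ϖ ^ n * u)) := by
    rw [hWT]
    simp only [Finset.sum_apply]
    refine integral_finsetSum _ fun s _ => integrableOn_unitSet ?_
    refine unitTranslate_induction W (p := fun X => Continuous fun u : (v.adicCompletion F)ˣ =>
      X (diagOne (ϖ ^ n * u))) continuous_const (fun u hu => ?_) s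
    exact (continuous_torus hV (hV.stable W hW (diagOne u))).comp (continuous_const_mul _)
  have hz : (unitIntegral v fun u => WT (diagOne (ϖ ^ n * u))) = 0 := by
    refine (unitIntegral_congr fun u hu => ?_).trans (unitIntegral_const 0)
    have := congrFun (hWTu u hu) (diagOne (ϖ ^ n))
    rwa [rightTranslate, ← diagOne_mul, hX1] at this
  rw [hz] at hsum
  simp only [hint] at hsum
  rw [← Finset.sum_filter, Finset.sum_const, nsmul_eq_mul] at hsum
  refine (mul_eq_zero.1 hsum.symm).resolve_left ?_
  -- The sum is the number of unit classes times the integral of `W`, and the class of `1` shows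
  -- that this number is not zero.
  obtain ⟨s, hs, hs1⟩ := hS.2.2.1 1 one_mem_ball
  have : s ∈ S.filter fun s => Valued.v s = 1 := by
    refine Finset.mem_filter.2 ⟨hs, ?_⟩
    have := val_add_eq_one (x := 1) (map_one _)
      ((ball v 1).neg_mem (ball_mono (by exact_mod_cast hm) hs1))
    rwa [neg_sub, add_sub_cancel] at this
  exact_mod_cast (Finset.card_pos.2 ⟨s, this⟩).ne'

/-- On the torus a vector of level `𝔭^r` is unit-invariant, supported in `𝔬`, and zero near `0`
because its averages over units are. Moving the last non-zero shell to the units by `diag(ϖ^n,1)`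
and averaging again at level `𝔭^r` leaves that shell alone: deeper shells are zero, and values
outside `𝔬` vanish for any vector of level `𝔭^r`. -/
theorem IsUnitaryGeneric.exists_newvector (hV : IsUnitaryGeneric ψ V) (hψ : HasConductor ψ 0)
    (hϖ : Valued.v (ϖ : v.adicCompletion F) = WithZero.exp (-1 : ℤ))
    (hno : ∀ W ∈ V, IsInvariantLevel 1 W → W = 0)
    (hnz : ∀ W ∈ V, (∀ y, W (diagOne y) = 0) → W = 0) {r : ℕ} (hr : 1 ≤ r)
    (hW : ∃ W ∈ V, W ≠ 0 ∧ IsInvariantLevel r W) :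
    ∃ W ∈ V, IsInvariantLevel r W ∧
      ∀ y : (v.adicCompletion F)ˣ, W (diagOne y) = (unitSet v).indicator (fun _ => (1 : ℂ)) y := by
  obtain ⟨W, hW, hW0, hrW⟩ := hW
  have hWw := hV.isWhittakerFunction hW
  obtain ⟨N, hN⟩ := hV.unitIntegral_eq_zero hψ hϖ hno hW
  have hN' : ∀ n ≥ N, W (diagOne (ϖ ^ n)) = 0 := fun n hn => by
    rw [← hN n hn, ← unitIntegral_const (v := v) (W (diagOne (ϖ ^ n)))]
    exact unitIntegral_congr fun u hu => (hrW.torus _ _ hu).symm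
  have hex : ∃ n : ℕ, W (diagOne (ϖ ^ n)) ≠ 0 := by
    by_contra! h
    refine hW0 (hnz W hW fun y => ?_)
    by_cases hy : (y : v.adicCompletion F) ∈ ball v 0
    · obtain ⟨n, u, hu, rfl⟩ := exists_zpow_mul_unit hϖ y
      rw [hrW.torus _ _ hu]
      obtain ⟨n, rfl⟩ | hn := (le_or_gt 0 n).imp_left Int.eq_ofNat_of_zero_le
      · exact_mod_cast h n
      · exact absurd hy (zpow_mul_notMem_ball hϖ hu hn)
    · exact hrW.torus_eq_zero hψ hWw hy
  classical
  obtain ⟨n, hn, hmax⟩ : ∃ n : ℕ, W (diagOne (ϖ ^ n)) ≠ 0 ∧ ∀ k > n, W (diagOne (ϖ ^ k)) = 0 := by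
    refine ⟨Nat.findGreatest (fun n => W (diagOne (ϖ ^ n)) ≠ 0) N, ?_, fun k hk => ?_⟩
    · obtain ⟨n, hn⟩ := hex
      exact Nat.findGreatest_spec (P := fun n => W (diagOne (ϖ ^ n)) ≠ 0)
        (le_of_lt (lt_of_not_ge fun h => hn (hN' n h))) hn
    · by_contra h
      exact Nat.findGreatest_is_greatest hk (le_of_lt (lt_of_not_ge fun h' => h (hN' k h'))) h
  have hv := levelVolume_ne_zero (v := v) hϖ hr
  have hXV := hV.levelAvg_mem r (hV.stable W hW (diagOne (ϖ ^ n)))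
  have hinv := levelAvg_invariant r (rightTranslate (diagOne (ϖ ^ n)) W)
  refine ⟨((levelVolume v r : ℂ) * W (diagOne (ϖ ^ n)))⁻¹ •
    levelAvg r (rightTranslate (diagOne (ϖ ^ n)) W), V.smul_mem _ hXV, fun k hk => ?_, fun y => ?_⟩
  · rw [rightTranslate_smul, hinv k hk]
  rw [Pi.smul_apply, smul_eq_mul]
  by_cases hy : (y : v.adicCompletion F) ∈ ball v 0
  · rw [(hWw.translate (diagOne (ϖ ^ n))).levelAvg_torus hψ hr
      (fun x hx => rightTranslate_lower_diagOne (fun z hz => hrW.lower hz) _ ?_)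
      (fun y u hu => ?_) hy]
    · rw [rightTranslate, ← diagOne_mul]
      obtain ⟨k, u, hu, rfl⟩ := exists_zpow_mul_unit hϖ y
      rw [mul_right_comm, hrW.torus _ _ hu]
      obtain ⟨k, rfl⟩ | hk := (le_or_gt 0 k).imp_left Int.eq_ofNat_of_zero_le
      · rw [zpow_natCast, ← pow_add]
        rcases k.eq_zero_or_pos with rfl | hk
        · rw [Set.indicator_of_mem, zero_add, inv_mul_cancel₀ (mul_ne_zero hv hn)]
          simpa [mem_unitSet] using hu
        · rw [Set.indicator_of_notMem, hmax (k + n) (by omega), mul_zero, mul_zero]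
          rw [mem_unitSet, val_unit_mul hu, val_pow hϖ]
          simp
          omega
      · exact absurd hy (zpow_mul_notMem_ball hϖ hu hk)
    · exact ball_mono (by omega) (mul_mem_ball hx (pow_mem_ball hϖ n))
    · rw [rightTranslate, rightTranslate, ← diagOne_mul, ← diagOne_mul, mul_right_comm,
        hrW.torus _ _ hu]
  · rw [hinv.torus_eq_zero hψ (hV.isWhittakerFunction hXV) hy, mul_zero, Set.indicator_of_notMem]
    intro h
    exact hy (mem_ball_zero.2 (mem_unitSet.1 h).le)

/-- Near `0` the first function is constant on shells, so only the average of the second over units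
matters. -/
theorem HasSphericalGerm.shellSeq_eq_zero
    (hϖ : Valued.v (ϖ : v.adicCompletion F) = WithZero.exp (-1 : ℤ)) {α β : ℂ}
    {W₁ W₂ : LocalGL v → ℂ} (h₁ : HasSphericalGerm ϖ α β W₁)
    (h₂ : ∃ N : ℕ, ∀ n ≥ N, (unitIntegral v fun u => W₂ (diagOne (ϖ ^ n * u))) = 0) :
    ∃ N, ∀ n ≥ N, shellSeq ϖ W₁ W₂ n = 0 := by
  obtain ⟨N₁, h₁⟩ := h₁
  obtain ⟨N₂, h₂⟩ := h₂
  refine ⟨max N₁ N₂, fun n hn => ?_⟩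
  have hn' : ((ϖ ^ n : (v.adicCompletion F)ˣ) : v.adicCompletion F) ∈ ball v N₁ :=
    ball_mono (by exact_mod_cast (le_max_left _ _).trans hn) (pow_mem_ball hϖ n)
  have e : shellSeq ϖ W₁ W₂ n = unitIntegral v fun u => W₁ (diagOne (ϖ ^ n)) *
      starRingEnd ℂ (W₂ (diagOne (ϖ ^ n * u))) :=
    unitIntegral_congr fun u hu => by rw [(h₁ _ hn').2 u hu]
  rw [e, unitIntegral, integral_const_mul, integral_conj]
  have h := h₂ n ((le_max_right _ _).trans hn)
  rw [unitIntegral] at h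
  rw [h, map_zero, mul_zero]

end

/-! ### Equivariant functionals on the Jacquet module -/

/-- A finitely generated module over a finitely generated commutative algebra of operators has a
one-dimensional quotient. -/
theorem exists_simultaneous_eigenfunctional {X : Type*} [AddCommGroup X] [Module ℂ X] [Nontrivial X]
    {D : Set (Module.End ℂ X)} (hD : D.Finite) (hcomm : ∀ a ∈ D, ∀ b ∈ D, a * b = b * a)
    {G : Set X} (hG : G.Finite) (hspan : ∀ x : X, x ∈ Submodule.span (Algebra.adjoin ℂ D) G) :
    ∃ Λ : X →ₗ[ℂ] ℂ, Λ ≠ 0 ∧ ∀ a ∈ Algebra.adjoin ℂ D, ∃ c : ℂ, ∀ x, Λ (a x) = c * Λ x := by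
  have hmc := Algebra.isMulCommutative_adjoin ℂ hcomm
  let : CommRing (Algebra.adjoin ℂ D) :=
    { (Algebra.adjoin ℂ D).toRing with mul_comm := hmc.is_comm.comm }
  have hft : Algebra.FiniteType ℂ (Algebra.adjoin ℂ D) :=
    (Subalgebra.fg_iff_finiteType _).1 (Subalgebra.fg_def.2 ⟨D, hD, rfl⟩)
  have hfin : Module.Finite (Algebra.adjoin ℂ D) X :=
    ⟨Submodule.fg_def.2 ⟨G, hG, eq_top_iff.2 fun x _ => hspan x⟩⟩
  -- A non-zero finitely generated module has a maximal proper submodule, with simple quotient the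
  -- algebra modulo a maximal ideal.
  obtain ⟨N, hN, -⟩ := (eq_top_or_exists_le_coatom (⊥ : Submodule (Algebra.adjoin ℂ D) X)).resolve_left
    bot_ne_top
  have hs : IsSimpleModule (Algebra.adjoin ℂ D) (X ⧸ N) := isSimpleModule_iff_isCoatom.2 hN
  obtain ⟨I, hI, ⟨e⟩⟩ := isSimpleModule_iff_quot_maximal.1 hs
  let := Ideal.Quotient.field I
  have hft' : Algebra.FiniteType ℂ (Algebra.adjoin ℂ D ⧸ I) := inferInstance
  -- By the Nullstellensatz the residue field is finite over `ℂ`, hence equal to it, and the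
  -- quotient map becomes a scalar-valued functional.
  have hfin' : Module.Finite ℂ (Algebra.adjoin ℂ D ⧸ I) := finite_of_finite_type_of_isJacobsonRing _ _
  have hb : Function.Bijective (algebraMap ℂ (Algebra.adjoin ℂ D ⧸ I)) :=
    IsAlgClosed.algebraMap_bijective_of_isIntegral
  let f : ℂ ≃+* (Algebra.adjoin ℂ D ⧸ I) := RingEquiv.ofBijective (algebraMap ℂ _) hb
  let p : X →ₗ[Algebra.adjoin ℂ D] (Algebra.adjoin ℂ D ⧸ I) := e.toLinearMap ∘ₗ N.mkQ
  have hp : Function.Surjective p := e.surjective.comp (Submodule.mkQ_surjective N)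
  have hpa : ∀ (a : Algebra.adjoin ℂ D) x, p (a • x) = Ideal.Quotient.mk I a * p x := fun a x => by
    rw [map_smul]
    rfl
  have hf : ∀ c : ℂ, Ideal.Quotient.mk I (algebraMap ℂ _ c) = f c := fun c => rfl
  refine ⟨{ toFun := fun x => f.symm (p x), map_add' := fun x y => by rw [map_add, map_add],
            map_smul' := fun c x => ?_ }, fun h => ?_, fun a ha => ?_⟩
  · have : c • x = (algebraMap ℂ (Algebra.adjoin ℂ D) c) • x := rfl
    rw [this, hpa, map_mul, hf, f.symm_apply_apply]
    rfl
  · obtain ⟨x, hx⟩ := hp 1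
    have := LinearMap.congr_fun h x
    simp [hx] at this
  · exact ⟨f.symm (Ideal.Quotient.mk I ⟨a, ha⟩), fun x => by
      show f.symm (p ((⟨a, ha⟩ : Algebra.adjoin ℂ D) • x)) = _
      rw [hpa, map_mul]
      rfl⟩

section

variable {ϖ : (v.adicCompletion F)ˣ} {ψ : AddChar (v.adicCompletion F) Circle}
  {V : Submodule ℂ (LocalGL v → ℂ)}

theorem exists_iwasawa (g : LocalGL v) : ∃ (x : v.adicCompletion F) (z t : (v.adicCompletion F)ˣ)
    (k : IntegralGL v), g = upper x * (centre z * (diagOne t * integralIncl v k)) := by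
  by_cases hd : g 1 1 ≠ 0 ∧ g 1 0 / g 1 1 ∈ ball v 0
  · obtain ⟨k, hk⟩ := exists_integral_lower hd.2
    refine ⟨g 0 1 / g 1 1, Units.mk0 _ hd.1,
      Matrix.GeneralLinearGroup.det g * ((Units.mk0 _ hd.1) ^ 2)⁻¹, k,
      (eq_mul_lower g (Units.mk0 _ hd.1) rfl).trans ?_⟩
    rw [hk]
    rfl
  · have hc : g 1 0 ≠ 0 := by
      intro h0
      have h2 : g 1 1 = 0 := by
        by_contra h2
        exact hd ⟨h2, by rw [h0, zero_div]; exact (ball v 0).zero_mem⟩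
      have h3 := det_eq g
      rw [h0, h2, mul_zero, mul_zero, sub_zero] at h3
      exact Units.ne_zero _ h3
    have h0 : g 1 1 / g 1 0 ∈ ball v 0 := by
      by_cases h2 : g 1 1 = 0
      · rw [h2, zero_div]
        exact (ball v 0).zero_mem
      · have h3 : g 1 0 / g 1 1 ∉ ball v 0 := fun h => hd ⟨h2, h⟩
        rw [mem_ball_zero, not_le, map_div₀, one_lt_div₀ (by simpa [zero_lt_iff] using h2)] at h3
        rw [mem_ball_zero, map_div₀]
        exact div_le_one_of_le₀ h3.le zero_le
    obtain ⟨k, hk⟩ := exists_integral_upper h0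
    obtain ⟨w, hw⟩ := exists_integral_weyl (v := v)
    refine ⟨g 0 0 / g 1 0, Units.mk0 _ hc,
      -(Matrix.GeneralLinearGroup.det g) * ((Units.mk0 _ hc) ^ 2)⁻¹, w * k,
      (eq_mul_weyl g (Units.mk0 _ hc) rfl).trans ?_⟩
    rw [map_mul, hw, hk]
    rfl

variable (v) in
/-- The functions whose restriction to the torus vanishes near zero. -/
def zeroGerm : Submodule ℂ (LocalGL v → ℂ) where
  carrier := {W | ∃ N : ℕ, ∀ y : (v.adicCompletion F)ˣ, (y : v.adicCompletion F) ∈ ball v N →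
    W (diagOne y) = 0}
  add_mem' := by
    rintro W W' ⟨N, h⟩ ⟨N', h'⟩
    exact ⟨max N N', fun y hy => by
      rw [Pi.add_apply, h y (ball_mono (by simp) hy), h' y (ball_mono (by simp) hy), add_zero]⟩
  zero_mem' := ⟨0, fun _ _ => rfl⟩
  smul_mem' := by
    rintro c W ⟨N, h⟩
    exact ⟨N, fun y hy => by rw [Pi.smul_apply, h y hy, smul_zero]⟩

theorem translate_diagOne_mem_zeroGerm {W : LocalGL v → ℂ} (hW : W ∈ zeroGerm v)
    (t : (v.adicCompletion F)ˣ) : rightTranslate (diagOne t) W ∈ zeroGerm v := by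
  obtain ⟨N, h⟩ := hW
  obtain ⟨M, hM⟩ := exists_mem_ball (t : v.adicCompletion F)
  refine ⟨N + M, fun y hy => ?_⟩
  rw [rightTranslate, ← diagOne_mul]
  exact h _ (by simpa using mul_mem_ball hy hM)

theorem translate_upper_sub_mem_zeroGerm (hψ : HasConductor ψ 0) {W : LocalGL v → ℂ}
    (hW : IsWhittakerFunction ψ W) (x : v.adicCompletion F) :
    rightTranslate (upper x) W - W ∈ zeroGerm v := by
  obtain ⟨M, hM⟩ := hψ.exists_germ_upper x
  exact ⟨M, fun y hy => by rw [Pi.sub_apply, hM W hW y hy, sub_self]⟩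

/-- Right translation on the Whittaker model. -/
def IsUnitaryGeneric.translate (hV : IsUnitaryGeneric ψ V) (g : LocalGL v) : Module.End ℂ V where
  toFun W := ⟨rightTranslate g W, hV.stable W W.2 g⟩
  map_add' _ _ := rfl
  map_smul' _ _ := rfl

/-- The torus action on the Jacquet module. -/
def IsUnitaryGeneric.jacquet (hV : IsUnitaryGeneric ψ V) (t : (v.adicCompletion F)ˣ) :
    Module.End ℂ (V ⧸ (zeroGerm v).comap V.subtype) :=
  Submodule.mapQ _ _ (hV.translate (diagOne t)) fun _ h => translate_diagOne_mem_zeroGerm h t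

theorem IsUnitaryGeneric.jacquet_mk (hV : IsUnitaryGeneric ψ V) (t : (v.adicCompletion F)ˣ)
    (W : V) : hV.jacquet t (Submodule.Quotient.mk W) =
      Submodule.Quotient.mk (hV.translate (diagOne t) W) := rfl

theorem IsUnitaryGeneric.jacquet_mul (hV : IsUnitaryGeneric ψ V) (s t : (v.adicCompletion F)ˣ) :
    hV.jacquet (s * t) = hV.jacquet s * hV.jacquet t := by
  refine LinearMap.ext fun x => ?_
  obtain ⟨W, rfl⟩ := Submodule.Quotient.mk_surjective _ x
  rw [Module.End.mul_apply, hV.jacquet_mk, hV.jacquet_mk, hV.jacquet_mk]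
  congr 1
  exact Subtype.ext (by
    show rightTranslate _ _ = rightTranslate _ (rightTranslate _ _)
    rw [diagOne_mul, rightTranslate_mul])

theorem IsUnitaryGeneric.jacquet_one (hV : IsUnitaryGeneric ψ V) : hV.jacquet 1 = 1 := by
  refine LinearMap.ext fun x => ?_
  obtain ⟨W, rfl⟩ := Submodule.Quotient.mk_surjective _ x
  rw [hV.jacquet_mk]
  congr 1
  exact Subtype.ext (by
    show rightTranslate _ _ = _
    rw [diagOne_one, rightTranslate_one])

theorem IsUnitaryGeneric.finite_orbit (hV : IsUnitaryGeneric ψ V) {W : LocalGL v → ℂ}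
    (hW : W ∈ V) : (Set.range fun k : IntegralGL v => rightTranslate (integralIncl v k) W).Finite := by
  obtain ⟨U, hU, h⟩ := hV.exists_isOpen_integral hW
  have := U.quotient_finite_of_isOpen hU
  refine (Set.finite_range fun x : IntegralGL v ⧸ U =>
    rightTranslate (integralIncl v x.out) W).subset ?_
  rintro _ ⟨k, rfl⟩
  refine ⟨(k : IntegralGL v ⧸ U), ?_⟩
  obtain ⟨u, hu⟩ := QuotientGroup.mk_out_eq_mul U k
  dsimp only
  rw [hu, map_mul, rightTranslate_mul, h u u.2]

theorem IsUnitaryGeneric.exists_level_orbit (hV : IsUnitaryGeneric ψ V) {W : LocalGL v → ℂ}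
    (hW : W ∈ V) : ∃ m : ℕ, 1 ≤ m ∧ ∀ (k : IntegralGL v) (u : (v.adicCompletion F)ˣ),
      (u : v.adicCompletion F) - 1 ∈ ball v m →
        rightTranslate (diagOne u) (rightTranslate (integralIncl v k) W) =
          rightTranslate (integralIncl v k) W := by
  have h : ∀ W' ∈ Set.range fun k : IntegralGL v => rightTranslate (integralIncl v k) W,
      ∃ m : ℕ, ∀ u : (v.adicCompletion F)ˣ, (u : v.adicCompletion F) - 1 ∈ ball v m →
        rightTranslate (diagOne u) W' = W' := by
    rintro _ ⟨k, rfl⟩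
    obtain ⟨m, -, -, -, h⟩ := hV.exists_level (hV.stable W hW (integralIncl v k))
    exact ⟨m, h⟩
  choose! m hm using h
  obtain ⟨M, hM⟩ := ((hV.finite_orbit hW).image m).bddAbove
  refine ⟨M + 1, by omega, fun k u hu => hm _ ⟨k, rfl⟩ u (ball_mono ?_ hu)⟩
  have := hM ⟨_, ⟨k, rfl⟩, rfl⟩
  exact_mod_cast this.trans (Nat.le_succ M)

/-- Modulo functions with zero germ, the Iwasawa decomposition shows that the model is generated
over the torus by the finite orbit of one vector under the compact group. The torus acts through a
finitely generated commutative algebra, so `exists_simultaneous_eigenfunctional` gives a quotient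
character. -/
theorem IsUnitaryGeneric.exists_functional (hV : IsUnitaryGeneric ψ V) (hψ : HasConductor ψ 0)
    (hϖ : Valued.v (ϖ : v.adicCompletion F) = WithZero.exp (-1 : ℤ))
    (hne : ∃ W ∈ V, W ∉ zeroGerm v) :
    ∃ Λ : V →ₗ[ℂ] ℂ, Λ ≠ 0 ∧ (∀ W : V, (W : LocalGL v → ℂ) ∈ zeroGerm v → Λ W = 0) ∧
      ∀ t : (v.adicCompletion F)ˣ, ∃ c : ℂ, ∀ W : V, Λ (hV.translate (diagOne t) W) = c * Λ W := by
  obtain ⟨W, hW, hWz⟩ := hne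
  have hW0 : W ≠ 0 := fun h => hWz (h ▸ (zeroGerm v).zero_mem)
  obtain ⟨m, hm, hlev⟩ := hV.exists_level_orbit hW
  obtain ⟨S, hS⟩ : ∃ S, IsResidueSystem (v := v) S m := exists_residues m
  have hnt : Nontrivial (V ⧸ (zeroGerm v).comap V.subtype) :=
    Submodule.Quotient.nontrivial_iff.2 fun h =>
      hWz ((Submodule.mem_comap (x := (⟨W, hW⟩ : V))).1 (h ▸ Submodule.mem_top))
  let kW : IntegralGL v → V := fun k => ⟨rightTranslate (integralIncl v k) W, hV.stable W hW _⟩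
  have htr : ∀ g, ∃ t k, (Submodule.Quotient.mk ⟨rightTranslate g W, hV.stable W hW g⟩ :
      V ⧸ (zeroGerm v).comap V.subtype) = hV.jacquet t (Submodule.Quotient.mk (kW k)) := by
    intro g
    obtain ⟨x, z, t, k, rfl⟩ := exists_iwasawa g
    refine ⟨t, k, (Submodule.Quotient.eq _).2 ?_⟩
    have h := translate_upper_sub_mem_zeroGerm hψ
      (hV.isWhittakerFunction (hV.stable _ (kW k).2 (diagOne t))) x
    have e : rightTranslate (upper x * (centre z * (diagOne t * integralIncl v k))) W =
        rightTranslate (upper x) (rightTranslate (diagOne t) (kW k)) := by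
      rw [rightTranslate_mul, rightTranslate_mul, rightTranslate_mul,
        hV.rightTranslate_centre (hV.stable _ (kW k).2 _)]
    rw [← e] at h
    exact h
  have hall : ∀ x : V ⧸ (zeroGerm v).comap V.subtype,
      x ∈ Submodule.span ℂ {x | ∃ t k, x = hV.jacquet t (Submodule.Quotient.mk (kW k))} := by
    intro x
    obtain ⟨⟨X, hX⟩, rfl⟩ := Submodule.Quotient.mk_surjective _ x
    have hX' := hX
    rw [← hV.span_eq hW hW0] at hX'
    induction hX' using Submodule.span_induction with
    | mem X h =>
      obtain ⟨g, rfl⟩ := h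
      obtain ⟨t, k, h⟩ := htr g
      exact Submodule.subset_span ⟨t, k, h⟩
    | zero => exact Submodule.zero_mem _
    | add X Y hX₁ hY₁ h h' =>
      rw [hV.span_eq hW hW0] at hX₁ hY₁
      exact Submodule.add_mem _ (h hX₁) (h' hY₁)
    | smul c X hX₁ h =>
      rw [hV.span_eq hW hW0] at hX₁
      exact Submodule.smul_mem _ c (h hX₁)
  -- Such units fix every vector of the finite orbit, and commute with the torus, so they act
  -- trivially on the whole quotient.
  have hunit : ∀ u : (v.adicCompletion F)ˣ, (u : v.adicCompletion F) - 1 ∈ ball v m →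
      hV.jacquet u = 1 := by
    intro u hu
    refine LinearMap.ext_on (s := {x | ∃ t k, x = hV.jacquet t (Submodule.Quotient.mk (kW k))})
      (eq_top_iff.2 fun x _ => hall x) ?_
    rintro _ ⟨t, k, rfl⟩
    rw [← Module.End.mul_apply, ← hV.jacquet_mul, mul_comm, hV.jacquet_mul, Module.End.mul_apply,
      Module.End.one_apply, hV.jacquet_mk u]
    congr 2
    exact Subtype.ext (hlev k u hu)
  -- The operators of `ϖ`, `ϖ⁻¹` and finitely many unit classes generate the action of the torus;
  -- `ϖ⁻¹` is included because the generated algebra need not contain inverses.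
  let D : Set (Module.End ℂ (V ⧸ (zeroGerm v).comap V.subtype)) :=
    {hV.jacquet ϖ, hV.jacquet ϖ⁻¹} ∪ (hV.jacquet '' {u | (u : v.adicCompletion F) ∈ S})
  have hDfin : D.Finite := (Set.toFinite _).union
    ((S.finite_toSet.preimage Units.val_injective.injOn).image _)
  have hDj : ∀ a ∈ D, ∃ t, a = hV.jacquet t := by
    rintro a ((rfl | rfl) | ⟨u, -, rfl⟩) <;> exact ⟨_, rfl⟩
  have hpow : ∀ (n : ℕ) (t : (v.adicCompletion F)ˣ), hV.jacquet t ∈ Algebra.adjoin ℂ D →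
      hV.jacquet (t ^ n) ∈ Algebra.adjoin ℂ D := by
    intro n t ht
    induction n with
    | zero => rw [pow_zero, hV.jacquet_one]; exact one_mem _
    | succ n ih => rw [pow_succ, hV.jacquet_mul]; exact mul_mem ih ht
  have hmem : ∀ t, hV.jacquet t ∈ Algebra.adjoin ℂ D := by
    intro t
    obtain ⟨n, u, hu, rfl⟩ := exists_zpow_mul_unit hϖ t
    rw [hV.jacquet_mul]
    refine mul_mem ?_ ?_
    · obtain ⟨n, rfl | rfl⟩ := n.eq_nat_or_neg
      · rw [zpow_natCast]
        exact hpow n ϖ (Algebra.subset_adjoin (Or.inl (Or.inl rfl)))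
      · rw [zpow_neg, zpow_natCast, ← inv_pow]
        exact hpow n _ (Algebra.subset_adjoin (Or.inl (Or.inr rfl)))
    · obtain ⟨s, hs, hus⟩ := hS.2.2.1 u (mem_ball_zero.2 hu.le)
      have hs1 : Valued.v s = 1 := by
        have := val_add_eq_one hu ((ball v 1).neg_mem (ball_mono (by exact_mod_cast hm) hus))
        rwa [neg_sub, add_sub_cancel] at this
      obtain ⟨s, rfl⟩ := exists_unit_of_val_eq_one hs1
      have h1 : hV.jacquet (s⁻¹ * u) = 1 := by
        refine hunit _ ?_
        have e : ((s⁻¹ * u : (v.adicCompletion F)ˣ) : v.adicCompletion F) - 1 =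
            ((s⁻¹ : (v.adicCompletion F)ˣ) : v.adicCompletion F) * (u - s) := by
          rw [Units.val_mul, mul_sub, Units.inv_mul]
        rw [e, unit_mul_mem_ball]
        · exact hus
        · rw [Units.val_inv_eq_inv_val, map_inv₀, hs1, inv_one]
      rw [← mul_inv_cancel_left s u, hV.jacquet_mul, h1, mul_one]
      exact Algebra.subset_adjoin (Or.inr ⟨s, hs, rfl⟩)
  let G : Set (V ⧸ (zeroGerm v).comap V.subtype) := Set.range fun k => Submodule.Quotient.mk (kW k)
  have hGfin : G.Finite := by
    have : (Set.range kW).Finite := by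
      refine Set.Finite.of_finite_image (f := Subtype.val) ((hV.finite_orbit hW).subset ?_)
        Subtype.val_injective.injOn
      rintro _ ⟨_, ⟨k, rfl⟩, rfl⟩
      exact ⟨k, rfl⟩
    refine (this.image Submodule.Quotient.mk).subset ?_
    rintro _ ⟨k, rfl⟩
    exact ⟨kW k, ⟨k, rfl⟩, rfl⟩
  have hG : ∀ x, x ∈ Submodule.span (Algebra.adjoin ℂ D) G := by
    intro x
    induction hall x using Submodule.span_induction with
    | mem y hy =>
      obtain ⟨t, k, rfl⟩ := hy
      exact Submodule.smul_mem _ (⟨_, hmem t⟩ : Algebra.adjoin ℂ D) (Submodule.subset_span ⟨k, rfl⟩)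
    | zero => exact Submodule.zero_mem _
    | add _ _ _ _ h h' => exact Submodule.add_mem _ h h'
    | smul c _ _ h => exact Submodule.smul_mem _ (algebraMap ℂ (Algebra.adjoin ℂ D) c) h
  obtain ⟨Λ, hΛ, hΛD⟩ := exists_simultaneous_eigenfunctional hDfin (fun a ha b hb => by
      obtain ⟨s, rfl⟩ := hDj a ha
      obtain ⟨t, rfl⟩ := hDj b hb
      rw [← hV.jacquet_mul, ← hV.jacquet_mul, mul_comm]) hGfin hG
  refine ⟨Λ ∘ₗ Submodule.mkQ _, fun h => hΛ ?_, fun X hX => ?_, fun t => ?_⟩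
  · refine LinearMap.ext fun x => ?_
    obtain ⟨X, rfl⟩ := Submodule.Quotient.mk_surjective _ x
    exact LinearMap.congr_fun h X
  · rw [LinearMap.comp_apply, Submodule.mkQ_apply,
      (Submodule.Quotient.mk_eq_zero ((zeroGerm v).comap V.subtype) (x := X)).2 hX, map_zero]
  · obtain ⟨c, hc⟩ := hΛD _ (hmem t)
    exact ⟨c, fun X => hc (Submodule.Quotient.mk X)⟩

end

/-! ### Exponents of the Jacquet module -/

section

variable {ϖ : (v.adicCompletion F)ˣ} {ψ : AddChar (v.adicCompletion F) Circle}
  {V : Submodule ℂ (LocalGL v → ℂ)}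

/-- A finite form of the change of variables `x ↦ ϖx`, for functions supported in `𝔭`. It compares
two systems of representatives modulo `𝔭^(j+1)`: `t + ϖs`, where only the class `t ∈ 𝔭` contributes,
and `s + ϖ^j t`, where `t` has no effect and gives the factor `q`. -/
theorem IsResidueSystem.sum_uniformizer_mul
    (hϖ : Valued.v (ϖ : v.adicCompletion F) = WithZero.exp (-1 : ℤ))
    {S : Finset (v.adicCompletion F)} {j : ℕ} (hS : IsResidueSystem S j)
    {f : v.adicCompletion F → ℂ} (hf : ∀ x ∈ ball v 0, ∀ z ∈ ball v j, f (x + z) = f x)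
    (hf0 : ∀ x ∈ ball v 0, x ∉ ball v 1 → f x = 0) :
    ∑ s ∈ S, f ((ϖ : v.adicCompletion F) * s) = residueCard v * ∑ s ∈ S, f s := by
  obtain ⟨T, hT⟩ : ∃ T, IsResidueSystem (v := v) T 1 := exists_residues 1
  obtain ⟨R, hR⟩ : ∃ R, IsResidueSystem (v := v) R (j + 1) := exists_residues (j + 1)
  have hϖ0 := ball_mono (v := v) (m := 0) (n := 1) (by norm_num) (self_mem_ball hϖ)
  have hdiv1 : ∀ x : v.adicCompletion F, ∀ n : ℤ, (ϖ : v.adicCompletion F) * x ∈ ball v (1 + n) →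
      x ∈ ball v n := fun x n h => (zpow_mul_mem_ball hϖ n 1).1 (by simpa using h)
  have hdivj : ∀ x : v.adicCompletion F, ((ϖ ^ j : (v.adicCompletion F)ˣ) : v.adicCompletion F) * x ∈
      ball v (j + 1) → x ∈ ball v 1 := fun x h => (zpow_mul_mem_ball hϖ 1 j).1 (by simpa using h)
  have hfR : ∀ x ∈ ball v 0, ∀ z ∈ ball v (j + 1 : ℕ), f (x + z) = f x := fun x hx z hz =>
    hf x hx z (ball_mono (by push_cast; omega) hz)
  have hcard : (T ×ˢ S).card = residueCard v ^ (j + 1) := by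
    rw [Finset.card_product, hT.1, hS.1]
    ring
  have h1 : ∑ p ∈ T ×ˢ S, f (p.1 + (ϖ : v.adicCompletion F) * p.2) = ∑ r ∈ R, f r := by
    refine hR.sum_eq hfR (fun p : v.adicCompletion F × v.adicCompletion F =>
      p.1 + (ϖ : v.adicCompletion F) * p.2) hcard (fun p hp => ?_) (fun p hp p' hp' h => ?_)
    · rw [Finset.mem_product] at hp
      exact (ball v 0).add_mem (hT.2.1 _ hp.1) (by simpa using mul_mem_ball hϖ0 (hS.2.1 _ hp.2))
    · rw [Finset.mem_product] at hp hp'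
      have hT' : p.1 = p'.1 := by
        refine hT.2.2.2 _ hp.1 _ hp'.1 ?_
        have h2 : (ϖ : v.adicCompletion F) * (p.2 - p'.2) ∈ ball v 1 := by
          simpa using mul_mem_ball (self_mem_ball hϖ)
            ((ball v 0).sub_mem (hS.2.1 _ hp.2) (hS.2.1 _ hp'.2))
        have e : p.1 - p'.1 = p.1 + (ϖ : v.adicCompletion F) * p.2 -
            (p'.1 + (ϖ : v.adicCompletion F) * p'.2) - (ϖ : v.adicCompletion F) * (p.2 - p'.2) := by
          ring
        rw [Nat.cast_one, e]
        exact (ball v 1).sub_mem (ball_mono (by push_cast; omega) h) h2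
      refine Prod.ext hT' (hS.2.2.2 _ hp.2 _ hp'.2 (hdiv1 _ _ ?_))
      rw [hT', add_sub_add_left_eq_sub, ← mul_sub] at h
      convert h using 2
      push_cast
      ring
  have h2 : ∑ p ∈ T ×ˢ S, f (p.2 + ((ϖ ^ j : (v.adicCompletion F)ˣ) : v.adicCompletion F) * p.1) =
      ∑ r ∈ R, f r := by
    refine hR.sum_eq hfR (fun p : v.adicCompletion F × v.adicCompletion F =>
      p.2 + ((ϖ ^ j : (v.adicCompletion F)ˣ) : v.adicCompletion F) * p.1) hcard
      (fun p hp => ?_) (fun p hp p' hp' h => ?_)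
    · rw [Finset.mem_product] at hp
      exact (ball v 0).add_mem (hS.2.1 _ hp.2)
        (ball_mono (by positivity) (mul_mem_ball (pow_mem_ball hϖ j) (hT.2.1 _ hp.1)))
    · rw [Finset.mem_product] at hp hp'
      have hS' : p.2 = p'.2 := by
        refine hS.2.2.2 _ hp.2 _ hp'.2 ?_
        have h2 : ((ϖ ^ j : (v.adicCompletion F)ˣ) : v.adicCompletion F) * (p.1 - p'.1) ∈
            ball v j := by
          simpa using mul_mem_ball (pow_mem_ball hϖ j)
            ((ball v 0).sub_mem (hT.2.1 _ hp.1) (hT.2.1 _ hp'.1))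
        have e : p.2 - p'.2 = p.2 + ((ϖ ^ j : (v.adicCompletion F)ˣ) : v.adicCompletion F) * p.1 -
            (p'.2 + ((ϖ ^ j : (v.adicCompletion F)ˣ) : v.adicCompletion F) * p'.1) -
            ((ϖ ^ j : (v.adicCompletion F)ˣ) : v.adicCompletion F) * (p.1 - p'.1) := by
          ring
        rw [e]
        exact (ball v j).sub_mem (ball_mono (by push_cast; omega) h) h2
      refine Prod.ext (hT.2.2.2 _ hp.1 _ hp'.1 (hdivj _ ?_)) hS'
      rw [hS', add_sub_add_left_eq_sub, ← mul_sub] at h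
      exact_mod_cast h
  have h3 : ∑ t ∈ T, ∑ s ∈ S, f (s + ((ϖ ^ j : (v.adicCompletion F)ˣ) : v.adicCompletion F) * t) =
      residueCard v * ∑ s ∈ S, f s := by
    rw [← pow_one (residueCard v), Nat.cast_pow, ← Nat.cast_pow, ← hT.1, ← nsmul_eq_mul,
      ← Finset.sum_const]
    refine Finset.sum_congr rfl fun t ht => Finset.sum_congr rfl fun s hs => hf s (hS.2.1 s hs) _ ?_
    simpa using mul_mem_ball (pow_mem_ball hϖ j) (hT.2.1 t ht)
  obtain ⟨t₀, ht₀, ht₀'⟩ := hT.2.2.1 0 (ball v 0).zero_mem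
  rw [zero_sub] at ht₀'
  have ht₀1 : t₀ ∈ ball v 1 := by simpa using (ball v 1).neg_mem ht₀'
  rw [← h3]
  refine Eq.trans ?_ (h1.trans (h2.symm.trans (Finset.sum_product _ _ _)))
  refine Eq.trans ?_ (Finset.sum_product _ _ _).symm
  refine Eq.trans ?_ (Finset.sum_eq_single t₀ ?_ ?_).symm
  · have ht₂ : ((ϖ⁻¹ : (v.adicCompletion F)ˣ) : v.adicCompletion F) * t₀ ∈ ball v 0 := by
      simpa using mul_mem_ball (inv_mem_ball hϖ) ht₀1
    have := hS.sum_comp (f := fun x => f ((ϖ : v.adicCompletion F) * x)) (fun x hx z hz => ?_)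
      (fun s => ((ϖ⁻¹ : (v.adicCompletion F)ˣ) : v.adicCompletion F) * t₀ + s)
      (fun x hx => (ball v 0).add_mem ht₂ hx) (fun x _ y _ h => by rwa [add_sub_add_left_eq_sub] at h)
    · rw [← this]
      refine Finset.sum_congr rfl fun s _ => ?_
      dsimp only
      rw [mul_add, Units.mul_inv_cancel_left]
    · rw [mul_add]
      exact hf _ (by simpa using mul_mem_ball hϖ0 hx) _ (by simpa using mul_mem_ball hϖ0 hz)
  · intro t ht hne
    refine Finset.sum_eq_zero fun s hs => hf0 _ ((ball v 0).add_mem (hT.2.1 t ht)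
      (by simpa using mul_mem_ball hϖ0 (hS.2.1 s hs))) fun h => hne ?_
    refine hT.2.2.2 t ht t₀ ht₀ ?_
    have h4 : (ϖ : v.adicCompletion F) * s ∈ ball v 1 := by
      simpa using mul_mem_ball (self_mem_ball hϖ) (hS.2.1 s hs)
    have := (ball v 1).sub_mem ((ball v 1).sub_mem h h4) ht₀1
    rwa [add_sub_cancel_right] at this
  · exact fun h => absurd ht₀ h

theorem IsUnitaryGeneric.translate_mul (hV : IsUnitaryGeneric ψ V) (g h : LocalGL v) :
    hV.translate (g * h) = hV.translate g * hV.translate h :=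
  LinearMap.ext fun _ => Subtype.ext (rightTranslate_mul g h _)

theorem IsUnitaryGeneric.translate_mul_apply (hV : IsUnitaryGeneric ψ V) (g h : LocalGL v) (W : V) :
    hV.translate (g * h) W = hV.translate g (hV.translate h W) := by
  rw [hV.translate_mul, Module.End.mul_apply]

theorem IsUnitaryGeneric.translate_one (hV : IsUnitaryGeneric ψ V) : hV.translate 1 = 1 :=
  LinearMap.ext fun _ => Subtype.ext (rightTranslate_one _)

theorem IsUnitaryGeneric.coe_translate (hV : IsUnitaryGeneric ψ V) (g : LocalGL v) (W : V) :
    (hV.translate g W : LocalGL v → ℂ) = rightTranslate g W := rfl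

theorem IsUnitaryGeneric.translate_eq_self (hV : IsUnitaryGeneric ψ V) {g : LocalGL v} {W : V}
    (h : rightTranslate g (W : LocalGL v → ℂ) = W) : hV.translate g W = W := Subtype.ext h

section Functional

variable {hV : IsUnitaryGeneric ψ V} {Λ : V →ₗ[ℂ] ℂ}

theorem functional_upper (hψ : HasConductor ψ 0)
    (hΛz : ∀ W : V, (W : LocalGL v → ℂ) ∈ zeroGerm v → Λ W = 0) (x : v.adicCompletion F) (W : V) :
    Λ (hV.translate (upper x) W) = Λ W := by
  rw [← sub_eq_zero, ← map_sub]
  exact hΛz _ (translate_upper_sub_mem_zeroGerm hψ (hV.isWhittakerFunction W.2) x)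

theorem functional_borel (hψ : HasConductor ψ 0)
    (hΛz : ∀ W : V, (W : LocalGL v → ℂ) ∈ zeroGerm v → Λ W = 0)
    (hΛt : ∀ t : (v.adicCompletion F)ˣ, ∃ c : ℂ, ∀ W : V,
      Λ (hV.translate (diagOne t) W) = c * Λ W) (x : v.adicCompletion F)
    (z t : (v.adicCompletion F)ˣ) : ∃ c : ℂ, ∀ (g : LocalGL v) (W : V),
      Λ (hV.translate (upper x * (centre z * (diagOne t * g))) W) = c * Λ (hV.translate g W) := by
  obtain ⟨c, hc⟩ := hΛt t
  refine ⟨c, fun g W => ?_⟩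
  rw [hV.translate_mul_apply, functional_upper hψ hΛz, hV.translate_mul_apply,
    hV.translate_eq_self (hV.rightTranslate_centre (Subtype.prop _) z), hV.translate_mul_apply, hc]

/-- The vectors all of whose translates are killed by `Λ` form a subrepresentation, proper because
`Λ ≠ 0`. This is the injectivity of the map to a principal series given by Frobenius reciprocity. -/
theorem eq_zero_of_functional (hΛ : Λ ≠ 0) {X : V} (h : ∀ g, Λ (hV.translate g X) = 0) : X = 0 := by
  let K : Submodule ℂ V :=
    { carrier := {Y | ∀ g, Λ (hV.translate g Y) = 0}
      add_mem' := fun {a b} ha hb g => by rw [map_add, map_add, ha g, hb g, add_zero]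
      zero_mem' := fun g => by rw [map_zero, map_zero]
      smul_mem' := fun c a ha g => by rw [map_smul, map_smul, ha g, smul_zero] }
  rcases hV.irreducible (K.map V.subtype) (Submodule.map_subtype_le _ _) (by
    rintro _ ⟨Y, hY, rfl⟩ g
    refine ⟨hV.translate g Y, fun g' => ?_, rfl⟩
    rw [← hV.translate_mul_apply]
    exact hY _) with h0 | h0
  · have : (X : LocalGL v → ℂ) ∈ K.map V.subtype := ⟨X, h, rfl⟩
    rw [h0] at this
    exact Subtype.ext this
  · refine absurd (LinearMap.ext fun Y => ?_) hΛ
    have : (Y : LocalGL v → ℂ) ∈ K.map V.subtype := by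
      rw [h0]
      exact Y.2
    obtain ⟨Y', hY', e⟩ := this
    obtain rfl : Y' = Y := Subtype.ext e
    have := hY' 1
    rwa [hV.translate_one, Module.End.one_apply] at this

/-- Seen in the principal series, a vector killed by `Λ` vanishes at the identity. For large `x` the
matrix `w · upper x` is, up to the Borel subgroup, lower unipotent with small entry `x⁻¹`, so the
function vanishes there as well: it is locally constant with bounded support on the big cell. -/
theorem functional_big_cell (hψ : HasConductor ψ 0)
    (hΛz : ∀ W : V, (W : LocalGL v → ℂ) ∈ zeroGerm v → Λ W = 0)
    (hΛt : ∀ t : (v.adicCompletion F)ˣ, ∃ c : ℂ, ∀ W : V,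
      Λ (hV.translate (diagOne t) W) = c * Λ W) {W : V} (hW : Λ W = 0) :
    ∃ M m : ℕ, (∀ x ∉ ball v (-M), Λ (hV.translate (weyl v * upper x) W) = 0) ∧
      ∀ x, ∀ z ∈ ball v m, Λ (hV.translate (weyl v * upper (x + z)) W) =
        Λ (hV.translate (weyl v * upper x) W) := by
  obtain ⟨m, -, hup, hlo, -⟩ := hV.exists_level W.2
  refine ⟨m, m, fun x hx => ?_, fun x z hz => ?_⟩
  · have hx0 : x ≠ 0 := fun h => hx (h ▸ (ball v _).zero_mem)
    have e11 : (weyl v * upper x : LocalGL v) 1 1 = x := by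
      rw [(weyl_mul_apply _ _).2]
      rfl
    have e10 : (weyl v * upper x : LocalGL v) 1 0 = 1 := by
      rw [(weyl_mul_apply _ _).2]
      rfl
    rw [eq_mul_lower (weyl v * upper x) (Units.mk0 x hx0) e11.symm, e10]
    obtain ⟨c, hc⟩ := functional_borel (hV := hV) hψ hΛz hΛt
      ((weyl v * upper x : LocalGL v) 0 1 / (Units.mk0 x hx0 : (v.adicCompletion F)ˣ))
      (Units.mk0 x hx0) (Matrix.GeneralLinearGroup.det (weyl v * upper x : LocalGL v) * ((Units.mk0 x hx0) ^ 2)⁻¹)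
    rw [hc, hV.translate_eq_self (hlo _ ?_), hW, mul_zero]
    rw [Units.val_mk0, mem_ball, map_div₀, map_one]
    rw [mem_ball, not_le, neg_neg] at hx
    rw [one_div, WithZero.exp_neg]
    exact inv_anti₀ (WithZero.exp_pos) hx.le
  · rw [upper_add, ← mul_assoc, hV.translate_mul_apply, hV.translate_eq_self (hup z hz)]

theorem weyl_mul_diagOne (t : (v.adicCompletion F)ˣ) :
    (weyl v * diagOne t : LocalGL v) = centre t * (diagOne t⁻¹ * weyl v) := by
  have := diagOne_mul_atkinLehner t 1
  rwa [diagOne_one, one_mul, one_mul] at this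

end Functional

/-- Write `E` for the translation by `diag(ϖ,1)` and `α` for its eigenvalue on `Λ`. Then `W₁ = (E -
α)W` lies in the kernel of `Λ` and is described by a function `φ` of bounded support on the big
cell. On such functions integration over the cell has eigenvalue `β = α⁻¹q⁻¹` under `E`, so `W₂ = (E
- β)W₁` has integral zero. A sum of unipotent translates of `W₂` over a large ball therefore
vanishes in the principal series, hence is zero; but near `0` on the torus each of these translates
agrees with `W₂`. -/
theorem IsUnitaryGeneric.exists_exponents (hV : IsUnitaryGeneric ψ V) (hψ : HasConductor ψ 0)
    (hϖ : Valued.v (ϖ : v.adicCompletion F) = WithZero.exp (-1 : ℤ)) {Λ : V →ₗ[ℂ] ℂ} (hΛ : Λ ≠ 0)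
    (hΛz : ∀ W : V, (W : LocalGL v → ℂ) ∈ zeroGerm v → Λ W = 0)
    (hΛt : ∀ t : (v.adicCompletion F)ˣ, ∃ c : ℂ, ∀ W : V,
      Λ (hV.translate (diagOne t) W) = c * Λ W) :
    ∃ α β : ℂ, α * β = (residueCard v : ℂ)⁻¹ ∧
      (∀ W : V, Λ (hV.translate (diagOne ϖ) W) = α * Λ W) ∧
      ∀ W : V, ((hV.translate (diagOne ϖ) (hV.translate (diagOne ϖ) W - α • W) -
        β • (hV.translate (diagOne ϖ) W - α • W) : V) : LocalGL v → ℂ) ∈ zeroGerm v := by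
  have hq : (residueCard v : ℂ) ≠ 0 := residueCard_ne_zero
  obtain ⟨α, hα⟩ := hΛt ϖ
  obtain ⟨α', hα'⟩ := hΛt ϖ⁻¹
  have hαα' : α * α' = 1 := by
    obtain ⟨W, hW⟩ : ∃ W, Λ W ≠ 0 := by
      by_contra! h
      exact hΛ (LinearMap.ext h)
    have h := hα (hV.translate (diagOne ϖ⁻¹) W)
    rw [hα', ← hV.translate_mul_apply, ← diagOne_mul, mul_inv_cancel, diagOne_one,
      hV.translate_one, Module.End.one_apply, ← mul_assoc] at h
    exact mul_right_cancel₀ hW (h.symm.trans (one_mul _).symm)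
  refine ⟨α, α' * (residueCard v : ℂ)⁻¹, by rw [← mul_assoc, hαα', one_mul], hα, fun W => ?_⟩
  obtain ⟨β, hβ⟩ : ∃ β, β = α' * (residueCard v : ℂ)⁻¹ := ⟨_, rfl⟩
  rw [← hβ]
  have hW₁ : Λ (hV.translate (diagOne ϖ) W - α • W) = 0 := by
    rw [map_sub, map_smul, hα, smul_eq_mul, sub_self]
  obtain ⟨W₁, e₁⟩ : ∃ W₁, W₁ = hV.translate (diagOne ϖ) W - α • W := ⟨_, rfl⟩
  rw [← e₁] at hW₁ ⊢
  obtain ⟨W₂, e₂⟩ : ∃ W₂, W₂ = hV.translate (diagOne ϖ) W₁ - β • W₁ := ⟨_, rfl⟩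
  rw [← e₂]
  obtain ⟨M, m, hM, hm⟩ := functional_big_cell (hV := hV) hψ hΛz hΛt hW₁
  obtain ⟨φ, hφ⟩ : ∃ φ : v.adicCompletion F → ℂ, φ = fun x => Λ (hV.translate (weyl v * upper x) W₁) :=
    ⟨_, rfl⟩
  have hM' : ∀ x ∉ ball v (-M), φ x = 0 := fun x hx => by rw [hφ]; exact hM x hx
  have hm' : ∀ x, ∀ z ∈ ball v m, φ (x + z) = φ x := fun x z hz => by rw [hφ]; exact hm x z hz
  -- Moving `diag(ϖ,1)` to the left past `w` inverts it up to the centre and rescales `x` by `ϖ⁻¹`;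
  -- this is where `α' = α⁻¹` appears.
  have hW₂φ : ∀ x, Λ (hV.translate (weyl v * upper x) W₂) =
      α' * φ (((ϖ⁻¹ : (v.adicCompletion F)ˣ) : v.adicCompletion F) * x) - β * φ x := by
    intro x
    have e : (weyl v * upper x * diagOne ϖ : LocalGL v) = centre ϖ * (diagOne ϖ⁻¹ * (weyl v *
        upper (((ϖ⁻¹ : (v.adicCompletion F)ˣ) : v.adicCompletion F) * x))) := by
      have h := diagOne_mul_upper ϖ (((ϖ⁻¹ : (v.adicCompletion F)ˣ) : v.adicCompletion F) * x)
      rw [Units.mul_inv_cancel_left] at h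
      rw [mul_assoc, ← h, ← mul_assoc, weyl_mul_diagOne, mul_assoc, mul_assoc]
    rw [e₂, map_sub, map_sub, map_smul, map_smul, ← hV.translate_mul_apply, e, hφ,
      hV.translate_mul_apply (centre ϖ),
      hV.translate_eq_self (hV.rightTranslate_centre (Subtype.prop _) _),
      hV.translate_mul_apply (diagOne ϖ⁻¹), hα', smul_eq_mul]
  have hW₂0 : Λ W₂ = 0 := by
    rw [e₂, map_sub, map_smul, hα, hW₁, smul_zero, mul_zero, sub_zero]
  obtain ⟨a, ha⟩ : ∃ a : (v.adicCompletion F)ˣ, a = ϖ ^ (-((M : ℤ) + 1)) := ⟨_, rfl⟩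
  have hab : ∀ (n : ℤ) (x : v.adicCompletion F), (a : v.adicCompletion F) * x ∈
      ball v (-((M : ℤ) + 1) + n) ↔ x ∈ ball v n := fun n x => ha ▸ zpow_mul_mem_ball hϖ n _
  have hinvb : ∀ (n : ℤ) (x : v.adicCompletion F), x ∈ ball v n →
      ((ϖ⁻¹ : (v.adicCompletion F)ˣ) : v.adicCompletion F) * x ∈ ball v (n - 1) := fun n x hx => by
    have := mul_mem_ball (inv_mem_ball hϖ) hx
    rwa [neg_add_eq_sub] at this
  have hinvb' : ∀ (n : ℤ) (x : v.adicCompletion F),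
      ((ϖ⁻¹ : (v.adicCompletion F)ˣ) : v.adicCompletion F) * x ∈ ball v (n - 1) → x ∈ ball v n :=
    fun n x hx => by
      have := mul_mem_ball (self_mem_ball hϖ) hx
      rwa [Units.mul_inv_cancel_left, add_sub_cancel] at this
  -- As `a 𝔭^(M+m+2) = 𝔭^(m+1)`, both `φ(as)` and `φ(ϖ⁻¹as)` depend only on `s` modulo `𝔭^(M+m+2)`.
  obtain ⟨S, hS⟩ : ∃ S, IsResidueSystem (v := v) S (M + m + 2) := exists_residues (M + m + 2)
  -- The sum of `φ(as)` is `q` times that of `φ(ϖ⁻¹as)`, and `α' - βq = 0`.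
  have hsum0 : ∑ s ∈ S, Λ (hV.translate (weyl v * upper ((a : v.adicCompletion F) * s)) W₂) = 0 := by
    have h1 := hS.sum_uniformizer_mul hϖ (f := fun s =>
      φ (((ϖ⁻¹ : (v.adicCompletion F)ˣ) : v.adicCompletion F) * ((a : v.adicCompletion F) * s)))
      (fun x hx z hz => ?_) (fun x hx hx1 => ?_)
    · simp only [hW₂φ, Finset.sum_sub_distrib, ← Finset.mul_sum]
      simp only [mul_left_comm (a : v.adicCompletion F), Units.inv_mul_cancel_left] at h1
      rw [h1, hβ]
      field_simp
      ring
    · rw [mul_add, mul_add]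
      refine hm' _ _ (ball_mono ?_ (hinvb _ _ ((hab _ _).2 hz)))
      push_cast
      omega
    · refine hM' _ fun h => hx1 (ball_mono (n := 2) (by norm_num) ((hab _ _).1 (hinvb' _ _ ?_)))
      convert h using 2
      ring
  -- For `x` in the ball `a𝔬` the shift permutes the residue classes; otherwise `x + as` stays
  -- outside the support.
  have hsum : ∀ x, ∑ s ∈ S, Λ (hV.translate (weyl v * upper (x + (a : v.adicCompletion F) * s)) W₂) = 0 := by
    intro x
    by_cases hx : x ∈ ball v (-((M : ℤ) + 1))
    · have hx' : ((a⁻¹ : (v.adicCompletion F)ˣ) : v.adicCompletion F) * x ∈ ball v 0 := by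
        rw [← hab, Units.mul_inv_cancel_left, add_zero]
        exact hx
      have h1 := hS.sum_comp (f := fun s => Λ (hV.translate (weyl v * upper ((a : v.adicCompletion F) * s)) W₂))
        (fun y _ z hz => ?_)
        (fun s => ((a⁻¹ : (v.adicCompletion F)ˣ) : v.adicCompletion F) * x + s)
        (fun y hy => (ball v 0).add_mem hx' hy) (fun y _ y' _ h => by rwa [add_sub_add_left_eq_sub] at h)
      · rw [← hsum0, ← h1]
        refine Finset.sum_congr rfl fun s _ => ?_
        rw [mul_add, Units.mul_inv_cancel_left]
      · rw [hW₂φ, hW₂φ, mul_add, mul_add, hm', hm']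
        · refine ball_mono ?_ ((hab _ _).2 hz)
          push_cast
          omega
        · refine ball_mono ?_ (hinvb _ _ ((hab _ _).2 hz))
          push_cast
          omega
    · refine Finset.sum_eq_zero fun s hs => ?_
      have hxs : x + (a : v.adicCompletion F) * s ∉ ball v (-((M : ℤ) + 1)) := fun h => hx (by
        have h2 := (hab 0 s).2 (hS.2.1 s hs)
        rw [add_zero] at h2
        have := (ball v _).sub_mem h h2
        rwa [add_sub_cancel_right] at this)
      rw [hW₂φ, hM', hM', mul_zero, mul_zero, sub_zero]
      · exact fun h => hxs (ball_mono (by omega) h)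
      · refine fun h => hxs (ball_mono (n := -M + 1) (by omega) (hinvb' _ _ ?_))
        rwa [add_sub_cancel_right]
  have hX : (∑ s ∈ S, hV.translate (upper ((a : v.adicCompletion F) * s)) W₂) = 0 := by
    refine eq_zero_of_functional (hV := hV) hΛ fun g => ?_
    by_cases hc : g 1 0 = 0
    · have hd : g 1 1 ≠ 0 := by
        intro h2
        have h3 := det_eq g
        rw [hc, h2, mul_zero, mul_zero, sub_zero] at h3
        exact Units.ne_zero _ h3
      obtain ⟨c, hc'⟩ := functional_borel (hV := hV) hψ hΛz hΛt
        (g 0 1 / (Units.mk0 _ hd : (v.adicCompletion F)ˣ)) (Units.mk0 _ hd)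
        (Matrix.GeneralLinearGroup.det g * ((Units.mk0 _ hd) ^ 2)⁻¹)
      rw [eq_mul_lower g (Units.mk0 _ hd) rfl, hc', hc, zero_div, lower_zero, hV.translate_one,
        Module.End.one_apply, map_sum, Finset.sum_eq_zero, mul_zero]
      exact fun s _ => (functional_upper hψ hΛz _ _).trans hW₂0
    · obtain ⟨c, hc'⟩ := functional_borel (hV := hV) hψ hΛz hΛt
        (g 0 0 / (Units.mk0 _ hc : (v.adicCompletion F)ˣ)) (Units.mk0 _ hc)
        (-(Matrix.GeneralLinearGroup.det g) * ((Units.mk0 _ hc) ^ 2)⁻¹)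
      have h := hsum (g 1 1 / (Units.mk0 _ hc : (v.adicCompletion F)ˣ))
      rw [eq_mul_weyl g (Units.mk0 _ hc) rfl, hc', map_sum, map_sum]
      refine mul_eq_zero_of_right c (Eq.trans (Finset.sum_congr rfl fun s _ => ?_) h)
      rw [← hV.translate_mul_apply, mul_assoc, ← upper_add]
  -- For `y ∈ 𝔭^(M+1)` one has `y a s ∈ 𝔬`, so every translate in the sum has the value of `W₂` at
  -- `y`, and the sum is `q^(M+m+2)` times that value.
  refine ⟨M + 1, fun y hy => ?_⟩
  have h := congrFun (congrArg Subtype.val hX) (diagOne y)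
  have h' : ∀ s ∈ S, (hV.translate (upper ((a : v.adicCompletion F) * s)) W₂ : LocalGL v → ℂ)
      (diagOne y) = (W₂ : LocalGL v → ℂ) (diagOne y) := fun s hs => by
    have h2 := mul_mem_ball hy ((hab 0 s).2 (hS.2.1 s hs))
    rw [hV.coe_translate, apply_diagOne_upper (hV.isWhittakerFunction W₂.2), hψ.eq_one,
      Circle.coe_one, one_mul]
    refine ball_mono ?_ h2
    push_cast
    omega
  rw [Submodule.coe_sum, Finset.sum_apply, Finset.sum_congr rfl h', Finset.sum_const,
    hS.1, nsmul_eq_mul] at h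
  exact (mul_eq_zero.1 h).resolve_left (by exact_mod_cast pow_ne_zero _ (Nat.cast_ne_zero.1 hq))

end

/-! ### The local lower bound -/

section

variable {ϖ : (v.adicCompletion F)ˣ} {ψ : AddChar (v.adicCompletion F) Circle}
  {V : Submodule ℂ (LocalGL v → ℂ)} {B : Set (LocalGL v → ℂ)}

/-- With an eigenvalue of absolute value at least `1`, the integrals of `|X|²` over successive
shells do not decrease towards `0`, while square integrability makes them summable; so they all
vanish near `0`. -/
theorem IsOrthonormalBasis.mem_zeroGerm (hV : IsUnitaryGeneric ψ V) (hB : IsOrthonormalBasis V B)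
    (hϖ : Valued.v (ϖ : v.adicCompletion F) = WithZero.exp (-1 : ℤ)) {X : LocalGL v → ℂ}
    (hX : X ∈ V) {γ : ℂ} (hγ : 1 ≤ ‖γ‖)
    (h : rightTranslate (diagOne ϖ) X - γ • X ∈ zeroGerm v) : X ∈ zeroGerm v := by
  obtain ⟨N, hN⟩ := h
  have hN' : ∀ y : (v.adicCompletion F)ˣ, (y : v.adicCompletion F) ∈ ball v N →
      X (diagOne (ϖ * y)) = γ * X (diagOne y) := fun y hy => by
    have := hN y hy
    rwa [Pi.sub_apply, rightTranslate, ← diagOne_mul, mul_comm y, Pi.smul_apply, smul_eq_mul,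
      sub_eq_zero] at this
  have hmem : ∀ (n : ℕ) (u : (v.adicCompletion F)ˣ), N ≤ n → Valued.v (u : v.adicCompletion F) = 1 →
      ((ϖ ^ n * u : (v.adicCompletion F)ˣ) : v.adicCompletion F) ∈ ball v N := fun n u hn hu => by
    rw [mem_ball, val_unit_mul hu]
    exact ball_mono (by exact_mod_cast hn) (pow_mem_ball hϖ n)
  have hpow : ∀ (k n : ℕ) (u : (v.adicCompletion F)ˣ), N ≤ n →
      Valued.v (u : v.adicCompletion F) = 1 →
      X (diagOne (ϖ ^ (n + k) * u)) = γ ^ k * X (diagOne (ϖ ^ n * u)) := by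
    intro k n u hn hu
    induction k with
    | zero => rw [add_zero, pow_zero, one_mul]
    | succ k ih =>
      rw [← add_assoc, pow_succ', mul_assoc, hN' _ (hmem _ u (by omega) hu), ih]
      ring
  have hcont : ∀ n : ℕ, Continuous fun u : (v.adicCompletion F)ˣ => X (diagOne (ϖ ^ n * u)) :=
    fun n => (continuous_torus hV hX).comp (continuous_const_mul _)
  obtain ⟨a, ha⟩ : ∃ a : ℕ → ℝ, a = fun n =>
      ∫ u in unitSet v, ‖X (diagOne (ϖ ^ n * u))‖ ^ 2 ∂(haarUnits v) := ⟨_, rfl⟩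
  have hsum := (hasSum_unitIntegral hϖ (hB.integrable_mul hV hX hX)).summable
  have hsum' : Summable fun n : ℕ => (a n : ℂ) := by
    refine (hsum.comp_injective Nat.cast_injective).congr fun n => ?_
    rw [Function.comp_apply, ha, ← integral_complex_ofReal, unitIntegral]
    congr 1
    funext u
    rw [zpow_natCast, Complex.mul_conj, Complex.normSq_eq_norm_sq]
  have hlim : Tendsto a atTop (nhds 0) := (Complex.summable_ofReal.1 hsum').tendsto_atTop_zero
  have ha0 : ∀ n, 0 ≤ a n := fun n => by
    rw [ha]
    exact integral_nonneg fun u => sq_nonneg _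
  have hle : ∀ n ≥ N, ∀ k, a n ≤ a (n + k) := by
    intro n hn k
    rw [ha]
    refine setIntegral_mono_on ?_ ?_ measurableSet_unitSet fun u hu => ?_
    · exact ((hcont n).norm.pow 2).continuousOn.integrableOn_compact isCompact_unitSet
    · exact ((hcont (n + k)).norm.pow 2).continuousOn.integrableOn_compact isCompact_unitSet
    · rw [hpow k n u hn hu, norm_mul, norm_pow, mul_pow]
      exact le_mul_of_one_le_left (sq_nonneg _) (one_le_pow₀ (one_le_pow₀ hγ))
  have hz : ∀ n ≥ N, a n = 0 := fun n hn => le_antisymm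
    (ge_of_tendsto' (hlim.comp (tendsto_add_atTop_nat n)) fun k => by
      rw [Function.comp_apply, add_comm]
      exact hle n hn k) (ha0 n)
  refine ⟨N, fun y hy => ?_⟩
  obtain ⟨n, u, hu, rfl⟩ := exists_zpow_mul_unit hϖ y
  have hn : (N : ℤ) ≤ n := by
    rw [mem_ball, val_unit_mul hu, val_zpow hϖ, WithZero.exp_le_exp] at hy
    omega
  obtain ⟨n, rfl⟩ := Int.eq_ofNat_of_zero_le ((Int.natCast_nonneg N).trans hn)
  have h1 := hz n (by exact_mod_cast hn)
  rw [ha] at h1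
  have h2 := (setIntegral_eq_zero_iff_of_nonneg_ae (ae_of_all _ fun u => sq_nonneg _)
    (((hcont n).norm.pow 2).continuousOn.integrableOn_compact isCompact_unitSet)).1 h1
  -- Continuity upgrades vanishing almost everywhere on the open set of units to vanishing at each
  -- unit.
  have h3 := Measure.eqOn_open_of_ae_eq h2 isOpen_unitSet ((hcont n).norm.pow 2).continuousOn
    continuousOn_const (mem_unitSet.2 hu)
  simpa using h3

theorem HasExponents.of_zeroGerm {α β : ℂ}
    (h : ∀ W ∈ V, rightTranslate (diagOne ϖ) (rightTranslate (diagOne ϖ) W) -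
      (α + β) • rightTranslate (diagOne ϖ) W + (α * β) • W ∈ zeroGerm v) :
    HasExponents ϖ V α β := by
  intro W hW
  obtain ⟨N, hN⟩ := h W hW
  refine ⟨N, fun y hy => ?_⟩
  have := hN y hy
  simp only [Pi.add_apply, Pi.sub_apply, Pi.smul_apply, smul_eq_mul, rightTranslate,
    ← diagOne_mul] at this
  rwa [mul_assoc, ← pow_two, mul_comm y, mul_comm y] at this

/-- For the two squares `|α|²`, `|β|²` the difference from `1` lies in `[0, 1]`; the two mixed
products have absolute value `|αβ| ≤ c`. -/
theorem norm_one_sub_productList_le {α β : ℂ} {c : ℝ} (hα : ‖α‖ ≤ 1) (hβ : ‖β‖ ≤ 1)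
    (hc : ‖α * β‖ ≤ c) (γ : ℂ) (hγ : γ ∈ productList α β (starRingEnd ℂ α) (starRingEnd ℂ β)) :
    ‖1 - γ‖ ≤ 1 + c := by
  have hc0 : 0 ≤ c := (norm_nonneg _).trans hc
  have hsq : ∀ z : ℂ, ‖z‖ ≤ 1 → ‖1 - z * starRingEnd ℂ z‖ ≤ 1 + c := by
    intro z hz
    rw [Complex.mul_conj, Complex.normSq_eq_norm_sq, ← Complex.ofReal_one, ← Complex.ofReal_sub,
      Complex.norm_real, Real.norm_eq_abs, abs_le]
    constructor <;> nlinarith [norm_nonneg z]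
  have hmix : ∀ z : ℂ, ‖z‖ ≤ c → ‖1 - z‖ ≤ 1 + c := fun z hz =>
    (norm_sub_le _ _).trans (by rw [norm_one]; linarith)
  simp only [productList, List.mem_cons, List.not_mem_nil, or_false] at hγ
  rcases hγ with rfl | rfl | rfl | rfl
  · exact hsq α hα
  · exact hmix _ (by rwa [norm_mul, RCLike.norm_conj, ← norm_mul])
  · exact hmix _ (by rwa [norm_mul, RCLike.norm_conj, ← norm_mul, mul_comm])
  · exact hsq β hβ

/-- If all germs vanish the exponents `0`, `0` serve. Otherwise the Jacquet module supplies
exponents with product `q⁻¹`, and square integrability either bounds them by `1` or allows the large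
one to be replaced by `0`. -/
theorem IsOrthonormalBasis.exists_exponents (hV : IsUnitaryGeneric ψ V) (hB : IsOrthonormalBasis V B)
    (hψ : HasConductor ψ 0) (hϖ : Valued.v (ϖ : v.adicCompletion F) = WithZero.exp (-1 : ℤ)) :
    ∃ α β : ℂ, HasExponents ϖ V α β ∧
      ∀ γ ∈ productList α β (starRingEnd ℂ α) (starRingEnd ℂ β),
        ‖1 - γ‖ ≤ 1 + (residueCard v : ℝ)⁻¹ := by
  have hq1 : (1 : ℝ) < residueCard v := by exact_mod_cast one_lt_residueCard
  have hq0 : 0 ≤ (residueCard v : ℝ)⁻¹ := by positivity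
  by_cases hne : ∃ W ∈ V, W ∉ zeroGerm v
  · obtain ⟨Λ, hΛ, hΛz, hΛt⟩ := hV.exists_functional hψ hϖ hne
    obtain ⟨α, β, hαβ, hα, hz⟩ := hV.exists_exponents hψ hϖ hΛ hΛz hΛt
    have hnorm : ‖α * β‖ = (residueCard v : ℝ)⁻¹ := by
      rw [hαβ, norm_inv, Complex.norm_natCast]
    have hz₁ : ∀ W ∈ V, rightTranslate (diagOne ϖ) (rightTranslate (diagOne ϖ) W - α • W) -
        β • (rightTranslate (diagOne ϖ) W - α • W) ∈ zeroGerm v := fun W hW => hz ⟨W, hW⟩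
    have hz₂ : ∀ W ∈ V, rightTranslate (diagOne ϖ) (rightTranslate (diagOne ϖ) W - β • W) -
        α • (rightTranslate (diagOne ϖ) W - β • W) ∈ zeroGerm v := fun W hW => by
      convert hz₁ W hW using 1
      funext g
      simp only [rightTranslate, Pi.sub_apply, Pi.smul_apply, smul_eq_mul]
      ring
    -- If `|α| ≥ 1`, then `(E - β)W` has zero germ for every `W`, so `(α - β) Λ W = 0` and `α = β`;
    -- this contradicts `|αβ| = q⁻¹ < 1`.
    have hα1 : ‖α‖ < 1 := by
      by_contra! h
      obtain ⟨W, hW⟩ : ∃ W, Λ W ≠ 0 := by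
        by_contra! h
        exact hΛ (LinearMap.ext h)
      have h1 := hΛz (hV.translate (diagOne ϖ) W - β • W)
        (hB.mem_zeroGerm hV hϖ (Subtype.prop _) h (hz₂ W W.2))
      rw [map_sub, map_smul, hα, smul_eq_mul, ← sub_mul] at h1
      have h2 := sub_eq_zero.1 ((mul_eq_zero.1 h1).resolve_right hW)
      rw [← h2, norm_mul] at hnorm
      have := inv_lt_one_of_one_lt₀ hq1
      nlinarith
    by_cases hβ1 : ‖β‖ ≤ 1
    · refine ⟨α, β, .of_zeroGerm fun W hW => ?_,
        norm_one_sub_productList_le hα1.le hβ1 hnorm.le⟩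
      convert hz₁ W hW using 1
      funext g
      simp only [rightTranslate, Pi.sub_apply, Pi.add_apply, Pi.smul_apply, smul_eq_mul]
      ring
    -- If `|β| > 1`, then `(E - α)W` already has zero germ, so `α` alone suffices and `0` fills the
    -- second place.
    · refine ⟨α, 0, .of_zeroGerm fun W hW => ?_,
        norm_one_sub_productList_le hα1.le (by simp) (by simp)⟩
      have h1 := hB.mem_zeroGerm hV hϖ (V.sub_mem (hV.stable W hW _) (V.smul_mem α hW))
        (not_le.1 hβ1).le (hz₁ W hW)
      convert translate_diagOne_mem_zeroGerm h1 ϖ using 1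
      funext g
      simp only [rightTranslate, Pi.sub_apply, Pi.add_apply, Pi.smul_apply, smul_eq_mul]
      ring
  · push Not at hne
    refine ⟨0, 0, .of_zeroGerm fun W hW => ?_,
      norm_one_sub_productList_le (by simp) (by simp) (by simp)⟩
    refine Submodule.add_mem _ (Submodule.sub_mem _ (hne _ (hV.stable _ (hV.stable _ hW _) _))
      (Submodule.smul_mem _ _ (hne _ (hV.stable _ hW _)))) (Submodule.smul_mem _ _ (hne W hW))

/-- The division into cases is by the existence of a non-zero vector of level `𝔭`. If there is one,
both representations have Satake data and the series is the Rankin–Selberg identity; if not, the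
vector is the indicator of the units and the exponents of the Jacquet module control the norm. -/
theorem local_lower_bound_of_level (hϖ : Valued.v (ϖ : v.adicCompletion F) = WithZero.exp (-1 : ℤ))
    (hψ : HasConductor ψ 0) {V₀ : Submodule ℂ (LocalGL v → ℂ)} (hV₀ : IsUnitaryGeneric ψ V₀)
    (hV : IsUnitaryGeneric ψ V) (hB : IsOrthonormalBasis V B) {r : ℕ} (hr : 1 ≤ r)
    {W₀ : LocalGL v → ℂ} (hW₀ : IsNormalizedSpherical V₀ W₀)
    (hlev : ∃ W ∈ V, W ≠ 0 ∧ IsInvariantLevel r W) :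
    ENNReal.ofReal ((1 - (residueCard v : ℝ) ^ (-(1 / 2) : ℝ)) ^ 18) ≤
      ENNReal.ofReal ((residueCard v : ℝ) ^ r * (eulerFactor v 1 ^ 3 / eulerFactor v 2)) *
        localWeight ϖ r V₀ W₀ V B := by
  have hq : 1 ≤ 1 + (residueCard v : ℝ)⁻¹ := le_add_of_nonneg_right (by positivity)
  have hnz : ∀ W ∈ V, (∀ y, W (diagOne y) = 0) → W = 0 := fun W hW h => hB.eq_zero hV hW h
  obtain ⟨hW₀V, hW₀l, hW₀1⟩ := hW₀
  have hne₀ : W₀ ≠ 0 := fun h => by simp [h] at hW₀1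
  -- `W₀ 1 = 1`, so `W₀` does not vanish on the torus and the required implication is vacuous.
  obtain ⟨-, α₀, β₀, hs₀⟩ := hV₀.exists_satake hψ hϖ hW₀V hW₀l
    (fun h => absurd (h 1) (by rw [diagOne_one, hW₀1]; exact one_ne_zero)) hne₀
  rw [hW₀1, inv_one, one_smul] at hs₀
  have hm₀ : ∀ W ∈ V₀, HasMellin ϖ fun y => W (diagOne y) := fun W hW =>
    hs₀.hasExponents.hasMellin hψ hϖ hV₀ hW
  by_cases h1 : ∃ W ∈ V, W ≠ 0 ∧ IsInvariantLevel 1 W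
  · obtain ⟨W, α, β, hs⟩ : ∃ W α β, IsSatake ϖ V W α β := by
      obtain ⟨W, hW, hW0, hl⟩ := h1
      by_cases h0 : ∃ W ∈ V, W ≠ 0 ∧ IsInvariantLevel 0 W
      · obtain ⟨W', hW', hW0', hl'⟩ := h0
        obtain ⟨-, α, β, hs⟩ := hV.exists_satake hψ hϖ hW' hl' (hnz W' hW') hW0'
        exact ⟨_, α, β, hs⟩
      · exact hV.exists_satake_of_level_one hψ hϖ
          (fun W' hW' hl' => by_contra fun h => h0 ⟨W', hW', h, hl'⟩) hnz hW hW0 hl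
    have hm : ∀ W ∈ V, HasMellin ϖ fun y => W (diagOne y) := fun W hW =>
      hs.hasExponents.hasMellin hψ hϖ hV hW
    refine local_lower_bound hϖ hψ hV₀ hV hB hm₀ hm hr ⟨hW₀V, hW₀l, hW₀1⟩ hs.mem
      (hs.level.mono hr) hs.apply_one (hs₀.hasSeries hϖ hV₀ hV hs)
      (productList α β (starRingEnd ℂ α) (starRingEnd ℂ β))
      (fun W₁ hW₁ W₂ hW₂ => hs.hasExponents.recOp_shellSeq hϖ hV hV hs.hasExponents hW₁ hW₂)
      fun P hP => ?_
    exact (norm_eval_mul_integral_le hϖ hψ hV hm hP le_rfl hs.mem hs.level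
      (hB.integrable_mul hV hs.mem hs.mem) (hs.hasSeries hϖ hV hV hs)).trans
      (pow_le_pow_right₀ hq (by norm_num))
  · have hno : ∀ W ∈ V, IsInvariantLevel 1 W → W = 0 := fun W hW hl =>
      by_contra fun h => h1 ⟨W, hW, h, hl⟩
    obtain ⟨W, hW, hl, hWt⟩ := hV.exists_newvector hψ hϖ hno hnz hr hlev
    obtain ⟨α, β, hexp, hγ⟩ := hB.exists_exponents hV hψ hϖ
    have hm : ∀ W ∈ V, HasMellin ϖ fun y => W (diagOne y) := fun W hW => hexp.hasMellin hψ hϖ hV hW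
    have hrec : ∀ W₁ ∈ V, ∀ W₂ ∈ V, ∃ N, ∀ n ≥ N, recOp (productList α β (starRingEnd ℂ α)
        (starRingEnd ℂ β)) (shellSeq ϖ W₁ W₂) n = 0 := fun W₁ hW₁ W₂ hW₂ =>
      hexp.recOp_shellSeq hϖ hV hV hexp hW₁ hW₂
    have hone : W 1 = 1 := by
      rw [← diagOne_one, hWt, Set.indicator_of_mem]
      simp [mem_unitSet]
    -- Near `0` functions in `V₀` are constant on shells and those in `V` have mean zero on them, so
    -- the recurrence is empty; the explicit series is the single term `W₀(1) · 1 = 1`.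
    have hs : HasSeries ϖ V₀ V W₀ W [] 1 := by
      refine ⟨fun W₁ hW₁ W₂ hW₂ => (hs₀.germ W₁ hW₁).shellSeq_eq_zero hϖ
        (hV.unitIntegral_eq_zero hψ hϖ hno hW₂), by simp, ?_, by simp⟩
      rw [eulerPoly_nil, Polynomial.coe_one, one_mul]
      ext n
      rw [PowerSeries.coeff_mk, shellSeq_eq hW₀l.torus hl.torus, hWt, PowerSeries.coeff_one]
      split_ifs with hn
      · rw [hn, pow_zero, Set.indicator_of_mem (by simp [mem_unitSet]), diagOne_one, hW₀1, map_one,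
          mul_one]
      · rw [Set.indicator_of_notMem, map_zero, mul_zero]
        rw [mem_unitSet, val_pow hϖ]
        simpa using hn
    refine local_lower_bound hϖ hψ hV₀ hV hB hm₀ hm hr ⟨hW₀V, hW₀l, hW₀1⟩ hW hl hone hs _ hrec
      fun P hP => ?_
    have hint : (integralUnits v fun y => W (diagOne y) * starRingEnd ℂ (W (diagOne y))) = 1 := by
      have e : (fun y => W (diagOne y) * starRingEnd ℂ (W (diagOne y))) =
          (unitSet v).indicator fun _ => (1 : ℂ) := by
        funext y
        rw [hWt]
        by_cases hy : y ∈ unitSet v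
        · rw [Set.indicator_of_mem hy, map_one, mul_one]
        · rw [Set.indicator_of_notMem hy, zero_mul]
      rw [e, integralUnits_eq, integral_indicator measurableSet_unitSet]
      exact unitIntegral_const 1
    rw [hint, mul_one]
    exact norm_eval_le_of_forall hϖ hV hm hP hrec hγ

end

/-! ### Prime divisors of `𝔮` and the passage from local bounds to the product. -/

theorem idealExponent_eq_zero {I : Ideal (𝓞 F)} (h : ¬ v.asIdeal ∣ I) : idealExponent v I = 0 :=
  multiplicity_eq_zero.2 h

theorem one_le_idealExponent {I : Ideal (𝓞 F)} (h : v.asIdeal ∣ I) : 1 ≤ idealExponent v I :=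
  Nat.one_le_iff_ne_zero.2 fun h0 => multiplicity_eq_zero.1 h0 h

theorem not_dvd_of_isCoprime {I J : Ideal (𝓞 F)} (hIJ : IsCoprime I J) (h : v.asIdeal ∣ I) :
    ¬ v.asIdeal ∣ J := fun h' =>
  v.isPrime.ne_top (top_le_iff.1 ((Ideal.isCoprime_iff_sup_eq.1 hIJ).ge.trans
    (sup_le (Ideal.le_of_dvd h) (Ideal.le_of_dvd h'))))

theorem exists_level_of_conductorExponent_le {V : Submodule ℂ (LocalGL v → ℂ)} {r : ℕ}
    (h : conductorExponent V ≤ r) : ∃ W ∈ V, W ≠ 0 ∧ IsInvariantLevel r W := by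
  by_contra hcon
  have hle : ((r + 1 : ℕ) : ℕ∞) ≤ conductorExponent V := by
    refine le_iInf₂ fun n hn => ?_
    obtain ⟨W, hW, hW0, hWn⟩ := hn
    have : r < n := lt_of_not_ge fun hnr => hcon ⟨W, hW, hW0, hWn.mono hnr⟩
    exact_mod_cast this
  have := hle.trans h
  norm_cast at this
  omega

theorem absNorm_eq_prod {𝔮 : Ideal (𝓞 F)} (h𝔮 : 𝔮 ≠ ⊥)
    (hf : {v : HeightOneSpectrum (𝓞 F) | v.asIdeal ∣ 𝔮}.Finite) :
    Ideal.absNorm 𝔮 = ∏ v ∈ hf.toFinset, residueCard v ^ idealExponent v 𝔮 := by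
  conv_lhs => rw [← Ideal.finprod_heightOneSpectrum_pow_multiplicity h𝔮]
  rw [finprod_eq_prod_of_mulSupport_subset_of_finite _ ?_ hf, map_prod]
  · exact Finset.prod_congr rfl fun v _ => map_pow _ _ _
  · intro v hv
    by_contra h
    exact hv (by simp [multiplicity_eq_zero.2 h])

variable (F) in
theorem finite_setOf_residueCard_le (n : ℕ) :
    {v : HeightOneSpectrum (𝓞 F) | residueCard v ≤ n}.Finite :=
  (Ideal.finite_setOfPred_absNorm_le (S := 𝓞 F) n).preimage
    (f := HeightOneSpectrum.asIdeal) fun _ _ _ _ h => HeightOneSpectrum.ext h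

variable (F) in
-- Only finitely many primes have norm below the point from which `h ≥ 1 - ε`. The constant is the
-- product of `h` over all of these, whether or not they lie in `S`; as `h ≤ 1`, the superfluous
-- factors only decrease it, which makes it independent of `S`.
theorem exists_le_prod_of_tendsto_one {h : ℕ → ℝ} (h0 : ∀ q, 1 < q → 0 < h q)
    (h1 : ∀ q, 1 < q → h q ≤ 1) (hlim : Tendsto h atTop (nhds 1)) {ε : ℝ} (hε₀ : 0 < ε)
    (hε₁ : ε < 1) : ∃ c : ℝ, 0 < c ∧ ∀ S : Finset (HeightOneSpectrum (𝓞 F)),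
      c * (1 - ε) ^ S.card ≤ ∏ v ∈ S, h (residueCard v) := by
  obtain ⟨n, hn⟩ := eventually_atTop.1 (hlim.eventually_const_le (show 1 - ε < 1 by linarith))
  obtain ⟨T, hT⟩ : ∃ T, T = (finite_setOf_residueCard_le F n).toFinset := ⟨_, rfl⟩
  have hpos : ∀ v : HeightOneSpectrum (𝓞 F), 0 < h (residueCard v) := fun v =>
    h0 _ one_lt_residueCard
  have hle : ∀ v : HeightOneSpectrum (𝓞 F), h (residueCard v) ≤ 1 := fun v =>
    h1 _ one_lt_residueCard
  refine ⟨∏ v ∈ T, h (residueCard v), Finset.prod_pos fun v _ => hpos v, fun S => ?_⟩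
  classical
  rw [← Finset.prod_sdiff (Finset.inter_subset_left (s₁ := S) (s₂ := T)), mul_comm]
  refine mul_le_mul ?_ ?_ (Finset.prod_nonneg fun v _ => (hpos v).le)
    (Finset.prod_nonneg fun v _ => (hpos v).le)
  · calc (1 - ε) ^ S.card ≤ (1 - ε) ^ (S \ (S ∩ T)).card :=
          pow_le_pow_of_le_one (by linarith) (by linarith) (Finset.card_le_card Finset.sdiff_subset)
      _ = ∏ v ∈ S \ (S ∩ T), (1 - ε) := (Finset.prod_const _).symm
      _ ≤ _ := Finset.prod_le_prod (fun _ _ => by linarith) fun v hv => by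
          refine hn _ ?_
          simp only [Finset.mem_sdiff, Finset.mem_inter, hT, Set.Finite.mem_toFinset,
            Set.mem_ofPred_eq] at hv
          by_contra hlt
          exact hv.2 ⟨hv.1, (not_le.1 hlt).le⟩
  · rw [← Finset.prod_sdiff (Finset.inter_subset_right (s₁ := S) (s₂ := T))]
    exact mul_le_of_le_one_left (Finset.prod_nonneg fun v _ => (hpos v).le)
      (Finset.prod_le_one (fun v _ => (hpos v).le) fun v _ => hle v)

theorem eulerFactor_pos {s : ℝ} (hs : 0 < s) : 0 < eulerFactor v s :=
  inv_pos.2 (sub_pos.2 (Real.rpow_lt_one_of_one_lt_of_neg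
    (by exact_mod_cast one_lt_residueCard (v := v)) (neg_neg_of_pos hs)))

theorem spectralWeight_eq_prod {𝔮 : Ideal (𝓞 F)} (h𝔮 : 𝔮 ≠ ⊥)
    (hf : {v : HeightOneSpectrum (𝓞 F) | v.asIdeal ∣ 𝔮}.Finite)
    (ϖ : ∀ v : HeightOneSpectrum (𝓞 F), (v.adicCompletion F)ˣ)
    (π₀ : ∀ v : HeightOneSpectrum (𝓞 F), Submodule ℂ (LocalGL v → ℂ))
    (W₀ : ∀ v : HeightOneSpectrum (𝓞 F), LocalGL v → ℂ)
    (π : ∀ v : HeightOneSpectrum (𝓞 F), Submodule ℂ (LocalGL v → ℂ))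
    (B : ∀ v : HeightOneSpectrum (𝓞 F), Set (LocalGL v → ℂ)) :
    spectralWeight 𝔮 ϖ π₀ W₀ π B = ∏ v ∈ hf.toFinset,
      ENNReal.ofReal ((residueCard v : ℝ) ^ idealExponent v 𝔮 *
        (eulerFactor v 1 ^ 3 / eulerFactor v 2)) *
        localWeight (ϖ v) (idealExponent v 𝔮) (π₀ v) (W₀ v) (π v) (B v) := by
  have h1 : ∀ v : HeightOneSpectrum (𝓞 F), 0 < eulerFactor v 1 := fun v =>
    eulerFactor_pos one_pos
  have h2 : ∀ v : HeightOneSpectrum (𝓞 F), 0 < eulerFactor v 2 := fun v =>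
    eulerFactor_pos two_pos
  rw [Finset.prod_mul_distrib, ← ENNReal.ofReal_prod_of_nonneg fun v _ => mul_nonneg (by positivity)
    (div_nonneg (pow_nonneg (h1 v).le 3) (h2 v).le), spectralWeight,
    finprod_mem_eq_finite_toFinset_prod _ hf, finprod_mem_eq_finite_toFinset_prod _ hf,
    finprod_mem_eq_finite_toFinset_prod _ hf, absNorm_eq_prod h𝔮 hf, Finset.prod_mul_distrib,
    Finset.prod_div_distrib, Finset.prod_pow, Nat.cast_prod]
  simp only [Nat.cast_pow]

theorem tendsto_one_sub_rpow_pow :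
    Tendsto (fun q : ℕ => (1 - (q : ℝ) ^ (-(1 / 2) : ℝ)) ^ 18) atTop (nhds 1) := by
  have h := (tendsto_rpow_neg_atTop (show (0 : ℝ) < 1 / 2 by norm_num)).comp
    tendsto_natCast_atTop_atTop
  simpa using (h.const_sub 1).pow 18

theorem one_sub_rpow_mem_Ioo {q : ℕ} (hq : 1 < q) :
    0 < (1 - (q : ℝ) ^ (-(1 / 2) : ℝ)) ^ 18 ∧ (1 - (q : ℝ) ^ (-(1 / 2) : ℝ)) ^ 18 ≤ 1 := by
  have h1 : (q : ℝ) ^ (-(1 / 2) : ℝ) < 1 :=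
    Real.rpow_lt_one_of_one_lt_of_neg (by exact_mod_cast hq) (by norm_num)
  have h2 : 0 ≤ (q : ℝ) ^ (-(1 / 2) : ℝ) := by positivity
  exact ⟨pow_pos (by linarith) _, pow_le_one₀ (by linarith) (by linarith)⟩

end SpectralWeight

end

theorem mainTheorem6 {F : Type*} [Field F] [NumberField F] (ε : ℝ) (hε₀ : 0 < ε) (hε₁ : ε < 1) :
    ∃ c : ℝ, 0 < c ∧
      ∀ (ψ : ∀ v : HeightOneSpectrum (𝓞 F), AddChar (v.adicCompletion F) Circle)
        (ϖ : ∀ v : HeightOneSpectrum (𝓞 F), (v.adicCompletion F)ˣ)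
        (π₀ π : ∀ v : HeightOneSpectrum (𝓞 F), Submodule ℂ (SpectralWeight.LocalGL v → ℂ))
        (𝔮 : Ideal (𝓞 F))
        (W₀ : ∀ v : HeightOneSpectrum (𝓞 F), SpectralWeight.LocalGL v → ℂ)
        (B : ∀ v : HeightOneSpectrum (𝓞 F), Set (SpectralWeight.LocalGL v → ℂ)),
        (∀ v, SpectralWeight.HasConductor (ψ v)
          (SpectralWeight.idealExponent v (differentIdeal ℤ (𝓞 F)))) →
        (∀ v, Valued.v (ϖ v : v.adicCompletion F) = WithZero.exp (-1 : ℤ)) →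
        (∀ v, SpectralWeight.IsUnitaryGeneric (ψ v) (π₀ v)) →
        (∀ v, SpectralWeight.conductorExponent (π₀ v) = 0) →
        (∀ v, SpectralWeight.IsUnitaryGeneric (ψ v) (π v)) →
        𝔮 ≠ ⊥ →
        IsCoprime 𝔮 (differentIdeal ℤ (𝓞 F)) →
        (∀ v, SpectralWeight.conductorExponent (π v) ≤ SpectralWeight.idealExponent v 𝔮) →
        (∀ v, v.asIdeal ∣ 𝔮 → SpectralWeight.IsNormalizedSpherical (π₀ v) (W₀ v)) →
        (∀ v, v.asIdeal ∣ 𝔮 → SpectralWeight.IsOrthonormalBasis (π v) (B v)) →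
        ENNReal.ofReal (c * (1 - ε) ^ SpectralWeight.primeOmega 𝔮) ≤
          SpectralWeight.spectralWeight 𝔮 ϖ π₀ W₀ π B := by
  -- The local bound depends on `v` only through its norm, so `c` can be fixed before `ψ`, `π₀`, `π`
  -- and `𝔮`.
  obtain ⟨c, hc, h⟩ := SpectralWeight.exists_le_prod_of_tendsto_one F
    (fun q hq => (SpectralWeight.one_sub_rpow_mem_Ioo hq).1)
    (fun q hq => (SpectralWeight.one_sub_rpow_mem_Ioo hq).2)
    SpectralWeight.tendsto_one_sub_rpow_pow hε₀ hε₁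
  refine ⟨c, hc, ?_⟩
  intro ψ ϖ π₀ π 𝔮 W₀ B hψ hϖ hπ₀ _ hπ h𝔮 hcop hcond hW₀ hB
  have hf := Ideal.finite_factors h𝔮
  rw [SpectralWeight.spectralWeight_eq_prod h𝔮 hf, SpectralWeight.primeOmega,
    Set.ncard_eq_toFinset_card _ hf]
  refine (ENNReal.ofReal_le_ofReal (h hf.toFinset)).trans ?_
  rw [ENNReal.ofReal_prod_of_nonneg fun v _ =>
    (SpectralWeight.one_sub_rpow_mem_Ioo SpectralWeight.one_lt_residueCard).1.le]
  refine Finset.prod_le_prod' fun v hv => ?_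
  have hv : v.asIdeal ∣ 𝔮 := hf.mem_toFinset.1 hv
  have hψv := hψ v
  -- A prime dividing `𝔮` does not divide the different, so `ψ_v` has conductor `𝔬_v`.
  rw [SpectralWeight.idealExponent_eq_zero (SpectralWeight.not_dvd_of_isCoprime hcop hv)] at hψv
  exact SpectralWeight.local_lower_bound_of_level (hϖ v) hψv (hπ₀ v) (hπ v) (hB v hv)
    (SpectralWeight.one_le_idealExponent hv) (hW₀ v hv)
    (SpectralWeight.exists_level_of_conductorExponent_le (hcond v))
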